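/- Let $T>0$, $\mathbb{T}^2=\mathbb{R}^2/(2\pi\mathbb{Z})^2$, and for a vector field $u$ on $\mathbb{T}^2$ let $\hat u_k$, $k=(k_1,k_2)\in\mathbb{Z}^2$, be its Fourier coefficients. Let $H=\{u\in L^2(\mathbb{T}^2;\mathbb{R}^2):\operatorname{div}u=0\}$ with the $L^2$ norm, and for $s,s'\ge 0$ let $\tilde H^{s,s'}$ be the space of $u\in H$ with $\|u\|_{\tilde H^{s,s'}}^2=\sum_k(1+k_1^2)^s(1+k_2^2)^{s'}|\hat u_k|^2<\infty$. Let $H^{-1}$ be the space of $\mathbb{R}^2$-valued distributions on $\mathbb{T}^2$ with $\|u\|^2_{H^{-1}}=\sum_k(1+|k|^2)^{-1}|\hat u_k|^2<\infty$. Put $B(u,v)=P_H(u\cdot\nabla v)$, where $P_H$ is the Leray projection onto divergence-free fields, and $$E=L^\infty([0,T],H)\cap L^2([0,T],\tilde H^{1,0})\cap C([0,T],H^{-1})$$ with the topology of the sum of the three norms. Let $\sigma(t,u)$, $t\in[0,T]$, $u\in H$, be Hilbert–Schmidt operators from $l^2$ to $H^{-1}$, with $(t,u)\mapsto\sigma(t,u)\psi$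 measurable for every $\psi\in l^2$. Write $L_2(l^2,U)$ for the Hilbert–Schmidt operators from $l^2$ to $U$, and suppose that there are nonnegative constants $K_i',K_i,\tilde K_i$ such that, for all $t\in[0,T]$, (A0) $\|\sigma(t,u)\|^2_{L_2(l^2,H^{-1})}\le K_0'+K_1'\|u\|_H^2$ for all $u\in H$; (A1) $\|\sigma(t,u)\|^2_{L_2(l^2,H)}\le K_0+K_1\|u\|_H^2+K_2\|\partial_1u\|_H^2$ for all $u\in H$ with $\partial_1u\in H$ (in particular $\sigma(t,u)$ takes its values in $H$); (A2) $\|\sigma(t,u)\|^2_{L_2(l^2,\tilde H^{0,1})}\le\tilde K_0+\tilde K_1\|u\|^2_{\tilde H^{0,1}}+\tilde K_2(\|\partial_1u\|_H^2+\|\partial_1\partial_2u\|_H^2)$ for all $u\in\tilde H^{0,1}$ with $\partial_1u,\partial_1\partial_2u\in H$ (in particular $\sigma(t,u)$ takes its values in $\tilde H^{0,1}$). All solutions below are in the class $L^\infty([0,T],\tilde H^{0,1})\cap L^2([0,T],\tilde H^{1,1})\cap C([0,T],H^{-1})$, and satisfy their equation integrated in time, at every $t\in[0,T]$, in the sense of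 distributions on $\mathbb{T}^2$. Let $u_0\in\tilde H^{0,2}$ and let $u^0$ be the solution of $$du^0=\partial_1^2u^0\,dt-B(u^0,u^0)\,dt,\qquad u^0(0)=u_0.$$ Then for every $\phi\in L^2([0,T],l^2)$ the skeleton equation $$dX^\phi=\partial_1^2X^\phi\,dt-B(X^\phi,u^0)\,dt-B(u^0,X^\phi)\,dt+\sigma(t,u^0(t))\phi(t)\,dt,\qquad X^\phi(0)=0,$$ has a unique solution $X^\phi$; for every $N<\infty$ the set $$K_N=\Big\{X^\phi:\ \phi\in L^2([0,T],l^2),\ \int_0^T\|\phi(s)\|_{l^2}^2\,ds\le N\Big\}$$ is a compact subset of $E$; and $$I(g)=\inf\Big\{\tfrac12\int_0^T\|\phi(s)\|_{l^2}^2\,ds:\ \phi\in L^2([0,T],l^2),\ g=X^\phi\Big\}\qquad(g\in E,\ \inf\emptyset=+\infty)$$ is a good rate function on $E$: it is lower semicontinuous, not identically $+\infty$, and $\{g\in E:I(g)\le r\}$ is compact for every $r\in(0,\infty)$. -/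

import Mathlib

open MeasureTheory Set
open scoped ENNReal

namespace AnisoNS
noncomputable section

/-- The values of the velocity fields: `ℝ²`. -/
abbrev Plane := EuclideanSpace ℝ (Fin 2)
/-- The values of the Fourier coefficients: `ℂ²`. -/
abbrev CPlane := EuclideanSpace ℂ (Fin 2)

/-- Lebesgue measure on one period `(0, 2π]`. -/
def intervalMeasure : Measure ℝ := volume.restrict (Ioc 0 (2 * Real.pi))

/-- The torus `(ℝ / 2πℤ)²` as a measure space: Lebesgue measure on the fundamental domain
`(0, 2π]²`. -/
def torusMeasure : Measure (ℝ × ℝ) :=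
  volume.restrict (Ioc 0 (2 * Real.pi) ×ˢ Ioc 0 (2 * Real.pi))

/-- `e^{i k·x}`. -/
def character (k : ℤ × ℤ) (x : ℝ × ℝ) : ℂ :=
  Complex.exp (Complex.I * ((k.1 : ℂ) * (x.1 : ℂ) + (k.2 : ℂ) * (x.2 : ℂ)))

/-- The Fourier coefficient `(2π)⁻² ∫ f(x) e^{-i k·x} dx`. -/
def scalarCoeff (f : ℝ × ℝ → ℂ) (k : ℤ × ℤ) : ℂ :=
  (1 / (2 * (Real.pi : ℂ)) ^ 2) * ∫ x, character (-k) x * f x ∂torusMeasure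

instance : IsFiniteMeasure intervalMeasure := by unfold intervalMeasure; infer_instance

theorem torusMeasure_eq : torusMeasure = intervalMeasure.prod intervalMeasure := by
  unfold torusMeasure intervalMeasure
  rw [Measure.prod_restrict]; rfl

instance : IsFiniteMeasure torusMeasure := by rw [torusMeasure_eq]; infer_instance

theorem norm_character (k : ℤ × ℤ) (x : ℝ × ℝ) : ‖character k x‖ = 1 := by
  have : character k x = Complex.exp (((k.1 * x.1 + k.2 * x.2 : ℝ) : ℂ) * Complex.I) := by
    unfold character; congr 1; push_cast; ring
  rw [this, Complex.norm_exp_ofReal_mul_I]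

theorem continuous_character (k : ℤ × ℤ) : Continuous (character k) := by
  unfold character; fun_prop

theorem integrable_character_mul (k : ℤ × ℤ) {f : ℝ × ℝ → ℂ} (hf : Integrable f torusMeasure) :
    Integrable (fun x => character k x * f x) torusMeasure :=
  hf.bdd_mul (c := 1) (continuous_character k).aestronglyMeasurable
    (Filter.Eventually.of_forall fun x => (norm_character k x).le)

theorem ae_zero_of_interval {f : ℝ → ℂ} (hf : MemLp f 2 intervalMeasure)
    (h : ∀ n : ℤ, ∫ x, Complex.exp (-(Complex.I * ((n : ℂ) * (x : ℂ)))) * f x ∂intervalMeasure = 0) :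
    f =ᵐ[intervalMeasure] 0 := by
  have hpi : (0 : ℝ) < 2 * Real.pi := by positivity
  have hs := hasSum_sq_fourierCoeffOn hpi hf
  have h0 : ∀ n, fourierCoeffOn hpi f n = 0 := by
    intro n
    rw [fourierCoeffOn_eq_integral, intervalIntegral.integral_of_le hpi.le]
    have e := h n
    unfold intervalMeasure at e
    rw [smul_eq_zero]; right
    rw [← e]
    congr 1; ext x
    rw [fourier_coe_apply, smul_eq_mul]
    congr 2
    have : (Real.pi : ℂ) ≠ 0 := by exact_mod_cast Real.pi_ne_zero
    push_cast
    field_simp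
    ring
  simp only [h0, norm_zero, ne_eq, OfNat.ofNat_ne_zero, not_false_eq_true, zero_pow] at hs
  have e := hs.unique hasSum_zero
  rw [smul_eq_zero, intervalIntegral.integral_of_le hpi.le] at e
  have e : ∫ x, ‖f x‖ ^ 2 ∂intervalMeasure = 0 := by
    rcases e with e | e
    · exfalso; have := inv_ne_zero (sub_pos.2 hpi).ne'; exact this e
    · exact e
  rw [integral_eq_zero_iff_of_nonneg (fun x => by positivity) hf.integrable_norm_pow'] at e
  filter_upwards [e] with x hx
  simpa using hx

theorem memLp_partial {f : ℝ × ℝ → ℂ} (hf : MemLp f 2 (intervalMeasure.prod intervalMeasure)) (n : ℤ) :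
    MemLp (fun a => ∫ b, Complex.exp (-(Complex.I * ((n : ℂ) * (b : ℂ)))) * f (a, b)
      ∂intervalMeasure) 2 intervalMeasure := by
  have hc : Continuous fun p : ℝ × ℝ => Complex.exp (-(Complex.I * ((n : ℂ) * (p.2 : ℂ)))) := by
    fun_prop
  have hF : AEStronglyMeasurable (fun p : ℝ × ℝ =>
      Complex.exp (-(Complex.I * ((n : ℂ) * (p.2 : ℂ)))) * f p)
      (intervalMeasure.prod intervalMeasure) := hc.aestronglyMeasurable.mul hf.1
  refine ⟨hF.integral_prod_right', ?_⟩
  have hn : ∀ b : ℝ, ‖Complex.exp (-(Complex.I * ((n : ℂ) * (b : ℂ))))‖ₑ = 1 := by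
    intro b
    have : (-(Complex.I * ((n : ℂ) * (b : ℂ)))) = ((-(n * b) : ℝ) : ℂ) * Complex.I := by
      push_cast; ring
    rw [this, ← ofReal_norm, Complex.norm_exp_ofReal_mul_I]; simp
  rw [eLpNorm_lt_top_iff_lintegral_rpow_enorm_lt_top (by norm_num) (by norm_num)]
  have h2 := (eLpNorm_lt_top_iff_lintegral_rpow_enorm_lt_top (p := 2) (by norm_num) (by norm_num)).1 hf.2
  have hmeas : AEMeasurable (fun p : ℝ × ℝ => ‖f p‖ₑ ^ (2 : ℝ≥0∞).toReal)
      (intervalMeasure.prod intervalMeasure) := hf.1.enorm.pow_const _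
  rw [lintegral_prod _ hmeas] at h2
  have hsl := hf.1.prodMk_left
  calc _ ≤ ∫⁻ a, intervalMeasure univ * ∫⁻ b, ‖f (a, b)‖ₑ ^ (2 : ℝ≥0∞).toReal ∂intervalMeasure
          ∂intervalMeasure := by
        refine lintegral_mono_ae ?_
        filter_upwards [hsl] with a ha
        have h3 : ‖∫ b, Complex.exp (-(Complex.I * ((n : ℂ) * (b : ℂ)))) * f (a, b)
            ∂intervalMeasure‖ₑ ≤ ∫⁻ b, ‖f (a, b)‖ₑ * 1 ∂intervalMeasure := by
          refine (enorm_integral_le_lintegral_enorm _).trans (le_of_eq ?_)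
          congr 1; ext b
          rw [enorm_mul, hn, one_mul, mul_one]
        have h4 := ENNReal.lintegral_mul_le_Lp_mul_Lq intervalMeasure
          (p := 2) (q := 2) (by constructor <;> norm_num) ha.enorm
          (aemeasurable_const (b := (1 : ℝ≥0∞)))
        have h5 := ENNReal.rpow_le_rpow (h3.trans h4) (z := 2) (by norm_num)
        rw [ENNReal.mul_rpow_of_nonneg _ _ (by norm_num), ← ENNReal.rpow_mul, ← ENNReal.rpow_mul] at h5
        simp only [ENNReal.toReal_ofNat]
        refine h5.trans (le_of_eq ?_)
        norm_num
        rw [mul_comm]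
    _ = intervalMeasure univ * _ := lintegral_const_mul' _ _ (measure_ne_top _ _)
    _ < ⊤ := ENNReal.mul_lt_top (measure_lt_top _ _) h2

/-- Completeness of the Fourier system; used below to see that the Sobolev norms are norms. -/
theorem ae_zero_of_scalarCoeff {f : ℝ × ℝ → ℂ} (hf : MemLp f 2 torusMeasure)
    (h : ∀ k, scalarCoeff f k = 0) : f =ᵐ[torusMeasure] 0 := by
  rw [torusMeasure_eq] at hf ⊢
  have hz : ∀ n : ℤ, (fun a => ∫ b, Complex.exp (-(Complex.I * ((n : ℂ) * (b : ℂ)))) * f (a, b)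
      ∂intervalMeasure) =ᵐ[intervalMeasure] 0 := by
    intro n
    refine ae_zero_of_interval (memLp_partial hf n) fun m => ?_
    have e := h (m, n)
    unfold scalarCoeff at e
    have hpi : (1 / (2 * (Real.pi : ℂ)) ^ 2) ≠ 0 := by
      have : (Real.pi : ℂ) ≠ 0 := by exact_mod_cast Real.pi_ne_zero
      exact one_div_ne_zero (pow_ne_zero _ (mul_ne_zero two_ne_zero this))
    have e := (mul_eq_zero.1 e).resolve_left hpi
    have hi := integrable_character_mul (-(m, n)) (f := f)
      (by rw [torusMeasure_eq]; exact hf.integrable (by norm_num))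
    rw [torusMeasure_eq] at e hi
    rw [integral_prod _ hi] at e
    rw [← e]
    congr 1; ext a
    rw [← integral_const_mul]
    congr 1; ext b
    rw [← mul_assoc, ← Complex.exp_add]
    unfold character
    congr 2
    simp; ring
  have hz := ae_all_iff.2 hz
  have hsl : ∀ᵐ a ∂intervalMeasure, MemLp (fun b => f (a, b)) 2 intervalMeasure := by
    have h2 := (eLpNorm_lt_top_iff_lintegral_rpow_enorm_lt_top (p := 2) (by norm_num) (by norm_num)).1 hf.2
    have hmeas : AEMeasurable (fun p : ℝ × ℝ => ‖f p‖ₑ ^ (2 : ℝ≥0∞).toReal)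
      (intervalMeasure.prod intervalMeasure) := hf.1.enorm.pow_const _
    rw [lintegral_prod _ hmeas] at h2
    filter_upwards [ae_lt_top' hmeas.lintegral_prod_right' h2.ne, hf.1.prodMk_left] with a h1 h3
    exact ⟨h3, (eLpNorm_lt_top_iff_lintegral_rpow_enorm_lt_top (by norm_num) (by norm_num)).2 h1⟩
  have hfin : ∀ᵐ a ∂intervalMeasure, (fun b => f (a, b)) =ᵐ[intervalMeasure] 0 := by
    filter_upwards [hz, hsl] with a h1 h2
    exact ae_zero_of_interval h2 h1
  obtain ⟨g, hg, hfg⟩ := hf.1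
  have hm : MeasurableSet {p : ℝ × ℝ | g p = 0} := hg.measurable (measurableSet_singleton 0)
  have : ∀ᵐ p ∂(intervalMeasure.prod intervalMeasure), g p = 0 := by
    rw [Measure.ae_prod_iff_ae_ae hm]
    filter_upwards [hfin, Measure.ae_ae_of_ae_prod hfg] with a h1 h2
    filter_upwards [h1, h2] with b h3 h4
    rw [← h4]; exact h3
  filter_upwards [this, hfg] with p h1 h2
  rw [h2, h1]; rfl

/-! ### Fourier coefficients of vector fields, and the space `H` -/

/-- The Fourier coefficients of a vector field, taken componentwise. -/
def fourierVec (f : ℝ × ℝ → Plane) (k : ℤ × ℤ) : CPlane :=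
  WithLp.toLp 2 fun j => scalarCoeff (fun x => ((f x j : ℝ) : ℂ)) k

/-- `L²(𝕋²; ℝ²)`. -/
abbrev L2Torus := Lp Plane 2 torusMeasure

theorem scalarCoeff_congr {f g : ℝ × ℝ → ℂ} (h : f =ᵐ[torusMeasure] g) (k : ℤ × ℤ) :
    scalarCoeff f k = scalarCoeff g k := by
  unfold scalarCoeff
  congr 1
  refine integral_congr_ae ?_
  filter_upwards [h] with x hx
  rw [hx]

theorem memLp_component (u : L2Torus) (j : Fin 2) :
    MemLp (fun x => ((u x j : ℝ) : ℂ)) 2 torusMeasure := by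
  have h1 : MemLp (fun x => u x j) 2 torusMeasure :=
    (EuclideanSpace.proj (𝕜 := ℝ) j : Plane →L[ℝ] ℝ).comp_memLp' (Lp.memLp u)
  exact h1.ofReal

theorem fourierVec_add (u v : L2Torus) (k : ℤ × ℤ) :
    fourierVec (u + v : L2Torus) k = fourierVec u k + fourierVec v k := by
  ext j
  simp only [fourierVec, PiLp.add_apply]
  rw [scalarCoeff_congr (g := fun x => ((u x j : ℝ) : ℂ) + ((v x j : ℝ) : ℂ))]
  · simp only [scalarCoeff, mul_add]
    rw [integral_add, mul_add]
    · exact integrable_character_mul _ ((memLp_component u j).integrable (by norm_num))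
    · exact integrable_character_mul _ ((memLp_component v j).integrable (by norm_num))
  · filter_upwards [Lp.coeFn_add u v] with x hx
    rw [hx]; simp

theorem fourierVec_smul (a : ℝ) (u : L2Torus) (k : ℤ × ℤ) :
    fourierVec (a • u : L2Torus) k = a • fourierVec u k := by
  ext j
  simp only [fourierVec, PiLp.smul_apply]
  rw [scalarCoeff_congr (g := fun x => (a : ℂ) * ((u x j : ℝ) : ℂ))]
  · simp only [scalarCoeff, mul_left_comm _ (a : ℂ)]
    rw [integral_const_mul, Complex.real_smul]
    ring
  · filter_upwards [Lp.coeFn_smul a u] with x hx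
    rw [hx]; simp

/-- The Fourier coefficients as a linear map. -/
def fourierMap : L2Torus →ₗ[ℝ] (ℤ × ℤ → CPlane) where
  toFun u := fourierVec u
  map_add' u v := funext fun k => fourierVec_add u v k
  map_smul' a u := funext fun k => fourierVec_smul a u k

theorem fourierMap_injective : Function.Injective fourierMap := by
  rw [injective_iff_map_eq_zero]
  intro u hu
  have hj : ∀ j, (fun x => ((u x j : ℝ) : ℂ)) =ᵐ[torusMeasure] 0 := fun j =>
    ae_zero_of_scalarCoeff (memLp_component u j) fun k =>
      congrArg (fun c : CPlane => c j) (congrFun hu k)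
  rw [Lp.eq_zero_iff_ae_eq_zero]
  filter_upwards [hj 0, hj 1] with x h0 h1
  ext j
  fin_cases j
  · simpa using h0
  · simpa using h1

/-- The components of a frequency `k ∈ ℤ²`. -/
def freq (k : ℤ × ℤ) : Fin 2 → ℝ := ![(k.1 : ℝ), (k.2 : ℝ)]

/-- The divergence-free fields of `L²(𝕋²; ℝ²)`: `div u = 0` as a distribution, that is,
`k · û_k = 0` for all `k`. -/
def divFree : Submodule ℝ L2Torus where
  carrier := {u | ∀ k, ∑ j, (freq k j : ℂ) * fourierMap u k j = 0}
  add_mem' {u v} hu hv k := by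
    have h1 := hu k
    have h2 := hv k
    simp only [map_add, Pi.add_apply, PiLp.add_apply, mul_add, Finset.sum_add_distrib] at *
    rw [h1, h2, add_zero]
  zero_mem' k := by simp
  smul_mem' a u hu k := by
    have h1 := hu k
    simp only [map_smul, Pi.smul_apply, PiLp.smul_apply, Complex.real_smul,
      mul_left_comm _ (a : ℂ), ← Finset.mul_sum] at *
    rw [h1, mul_zero]

/-- The space `H` of divergence-free fields in `L²(𝕋²; ℝ²)`, with the `L²` norm. -/
abbrev H := ↥divFree

instance : MeasurableSpace H := borel H
instance : BorelSpace H := ⟨rfl⟩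

/-- The Fourier coefficients `û_k ∈ ℂ²` of `u ∈ H`. -/
def coeff (u : H) : ℤ × ℤ → CPlane := fourierMap (u : L2Torus)

/-- `v = ∂_j u` as distributions on the torus, for `u, v ∈ H`. -/
def HasPartial (j : Fin 2) (u v : H) : Prop :=
  ∀ k, coeff v k = (Complex.I * (freq k j : ℂ)) • coeff u k

/-! ### The anisotropic Sobolev spaces and `H⁻¹` -/

/-- Square-summable families of vectors of `ℂ²` indexed by the frequencies. -/
abbrev FreqL2 := lp (fun _ : ℤ × ℤ => CPlane) 2

/-- The square root of the weight `(1 + k₁²)^s (1 + k₂²)^s'`. -/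
def anisoWeight (s s' : ℝ) (k : ℤ × ℤ) : ℝ :=
  (1 + (k.1 : ℝ) ^ 2) ^ (s / 2) * (1 + (k.2 : ℝ) ^ 2) ^ (s' / 2)

theorem anisoWeight_pos (s s' : ℝ) (k : ℤ × ℤ) : 0 < anisoWeight s s' k := by
  unfold anisoWeight; positivity

/-- The fields `u ∈ H` with `∑ (1 + k₁²)^s (1 + k₂²)^s' |û_k|² < ∞`. -/
def anisoSubmodule (s s' : ℝ) : Submodule ℝ H where
  carrier := {u | Memℓp (fun k => anisoWeight s s' k • coeff u k) 2}
  add_mem' {u v} hu hv := by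
    have h := Memℓp.add hu hv
    refine (congrArg (fun f => Memℓp f 2) (funext fun k => ?_)).mp h
    simp [coeff, smul_add]
  zero_mem' := by
    refine (congrArg (fun f => Memℓp f 2) (funext fun k => ?_)).mp
      (zero_memℓp (E := fun _ : ℤ × ℤ => CPlane) (p := 2))
    simp [coeff]
  smul_mem' a u hu := by
    have h := Memℓp.const_smul hu a
    refine (congrArg (fun f => Memℓp f 2) (funext fun k => ?_)).mp h
    simp [coeff, smul_comm a]

/-- The divergence-free anisotropic Sobolev space `H̃^{s,s'}`, for `s, s' ≥ 0`. It is a type of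
its own, because its norm is not the one of `H`. -/
def HT (s s' : ℝ) : Type := ↥(anisoSubmodule s s')

namespace HT

variable {s s' : ℝ}

instance : AddCommGroup (HT s s') := inferInstanceAs (AddCommGroup ↥(anisoSubmodule s s'))
instance : Module ℝ (HT s s') := inferInstanceAs (Module ℝ ↥(anisoSubmodule s s'))

/-- The inclusion of `H̃^{s,s'}` in `H`. -/
def toH : HT s s' →ₗ[ℝ] H := (anisoSubmodule s s').subtype

/-- The weighted Fourier coefficients. -/
def toFreqL2 : HT s s' →ₗ[ℝ] FreqL2 where
  toFun u := ⟨fun k => anisoWeight s s' k • coeff (toH u) k, u.2⟩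
  map_add' u v := by
    ext1; funext k
    simp only [coeff, map_add, Submodule.coe_add, Pi.add_apply, smul_add]
    rfl
  map_smul' a u := by
    ext1; funext k
    simp [coeff, smul_comm a]

theorem toFreqL2_injective : Function.Injective (toFreqL2 : HT s s' →ₗ[ℝ] FreqL2) := by
  rw [injective_iff_map_eq_zero]
  intro u hu
  have h0 : ∀ k, coeff (toH u) k = 0 := fun k => by
    have h : anisoWeight s s' k • coeff (toH u) k = 0 :=
      congrFun (congrArg (fun f : FreqL2 => (f : ℤ × ℤ → CPlane)) hu) k
    exact (smul_eq_zero.1 h).resolve_left (anisoWeight_pos s s' k).ne'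
  have h1 : ((toH u : H) : L2Torus) = 0 :=
    (injective_iff_map_eq_zero _).1 fourierMap_injective _ (funext h0)
  exact Subtype.ext (Subtype.ext h1)

instance : NormedAddCommGroup (HT s s') :=
  NormedAddCommGroup.induced (HT s s') FreqL2 toFreqL2 toFreqL2_injective
instance : NormedSpace ℝ (HT s s') := NormedSpace.induced ℝ (HT s s') FreqL2 toFreqL2

/-- `‖u‖² = ∑ (1 + k₁²)^s (1 + k₂²)^s' |û_k|²`. -/
theorem norm_sq (u : HT s s') : ‖u‖ ^ 2 =
    ∑' k : ℤ × ℤ, (1 + (k.1 : ℝ) ^ 2) ^ s * (1 + (k.2 : ℝ) ^ 2) ^ s' * ‖coeff (toH u) k‖ ^ 2 := by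
  have h := lp.norm_rpow_eq_tsum (p := 2) (by norm_num) (toFreqL2 u)
  simp only [ENNReal.toReal_ofNat, Real.rpow_ofNat] at h
  change ‖toFreqL2 u‖ ^ 2 = _
  rw [h]
  congr 1; funext k
  change ‖anisoWeight s s' k • coeff (toH u) k‖ ^ 2 = _
  rw [norm_smul, Real.norm_of_nonneg (anisoWeight_pos s s' k).le, mul_pow]
  congr 1
  unfold anisoWeight
  have h1 : ∀ a r : ℝ, 0 ≤ a → (a ^ (r / 2)) ^ 2 = a ^ r := fun a r ha => by
    rw [← Real.rpow_natCast, ← Real.rpow_mul ha]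
    congr 1; push_cast; ring
  rw [mul_pow, h1 _ _ (by positivity), h1 _ _ (by positivity)]

end HT

/-- The square root of the weight `(1 + |k|²)^{-1}`. -/
def minusOneWeight (k : ℤ × ℤ) : ℝ := (1 + ((k.1 : ℝ) ^ 2 + (k.2 : ℝ) ^ 2)) ^ (-(1 / 2) : ℝ)

theorem minusOneWeight_pos (k : ℤ × ℤ) : 0 < minusOneWeight k := by
  unfold minusOneWeight; positivity

/-- The families `(c_k)` of vectors of `ℂ²` with `c_{-k}` conjugate to `c_k` and
`∑ (1 + |k|²)^{-1} |c_k|² < ∞`. -/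
def minusOneSubmodule : Submodule ℝ (ℤ × ℤ → CPlane) where
  carrier := {c | (∀ k j, c (-k) j = (starRingEnd ℂ) (c k j)) ∧
    Memℓp (fun k => minusOneWeight k • c k) 2}
  add_mem' {c d} hc hd := by
    refine ⟨fun k j => by simp [hc.1 k j, hd.1 k j], ?_⟩
    have h := Memℓp.add hc.2 hd.2
    refine (congrArg (fun f => Memℓp f 2) (funext fun k => ?_)).mp h
    simp [smul_add]
  zero_mem' := by
    refine ⟨by simp, ?_⟩
    refine (congrArg (fun f => Memℓp f 2) (funext fun k => ?_)).mp
      (zero_memℓp (E := fun _ : ℤ × ℤ => CPlane) (p := 2))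
    simp
  smul_mem' a c hc := by
    refine ⟨fun k j => by simp [hc.1 k j], ?_⟩
    have h := Memℓp.const_smul hc.2 a
    refine (congrArg (fun f => Memℓp f 2) (funext fun k => ?_)).mp h
    simp [smul_comm a]

/-- The Sobolev space `H⁻¹(𝕋²; ℝ²)`: the distributions on the torus, given by their Fourier
coefficients, for which `‖c‖² = ∑ (1 + |k|²)^{-1} |c_k|²` is finite. -/
def HMinusOne : Type := ↥minusOneSubmodule

namespace HMinusOne

instance : AddCommGroup HMinusOne := inferInstanceAs (AddCommGroup ↥minusOneSubmodule)
instance : Module ℝ HMinusOne := inferInstanceAs (Module ℝ ↥minusOneSubmodule)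

/-- The Fourier coefficients of an element of `H⁻¹`. -/
def fourier : HMinusOne →ₗ[ℝ] (ℤ × ℤ → CPlane) := minusOneSubmodule.subtype

/-- The weighted Fourier coefficients. -/
def toFreqL2 : HMinusOne →ₗ[ℝ] FreqL2 where
  toFun c := ⟨fun k => minusOneWeight k • fourier c k, c.2.2⟩
  map_add' c d := by
    ext1; funext k
    simp only [map_add, Pi.add_apply, smul_add]
    rfl
  map_smul' a c := by
    ext1; funext k
    simp [smul_comm a]

theorem toFreqL2_injective : Function.Injective toFreqL2 := by
  rw [injective_iff_map_eq_zero]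
  intro c hc
  refine Subtype.ext (funext fun k => ?_)
  have h : minusOneWeight k • fourier c k = 0 :=
    congrFun (congrArg (fun f : FreqL2 => (f : ℤ × ℤ → CPlane)) hc) k
  exact (smul_eq_zero.1 h).resolve_left (minusOneWeight_pos k).ne'

instance : NormedAddCommGroup HMinusOne :=
  NormedAddCommGroup.induced HMinusOne FreqL2 toFreqL2 toFreqL2_injective
instance : NormedSpace ℝ HMinusOne := NormedSpace.induced ℝ HMinusOne FreqL2 toFreqL2

/-- `‖c‖² = ∑ (1 + |k|²)^{-1} |c_k|²`. -/
theorem norm_sq (c : HMinusOne) : ‖c‖ ^ 2 =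
    ∑' k : ℤ × ℤ, (1 + ((k.1 : ℝ) ^ 2 + (k.2 : ℝ) ^ 2))⁻¹ * ‖fourier c k‖ ^ 2 := by
  have h := lp.norm_rpow_eq_tsum (p := 2) (by norm_num) (toFreqL2 c)
  simp only [ENNReal.toReal_ofNat, Real.rpow_ofNat] at h
  change ‖toFreqL2 c‖ ^ 2 = _
  rw [h]
  congr 1; funext k
  change ‖minusOneWeight k • fourier c k‖ ^ 2 = _
  rw [norm_smul, Real.norm_of_nonneg (minusOneWeight_pos k).le, mul_pow]
  congr 1
  unfold minusOneWeight
  rw [← Real.rpow_natCast, ← Real.rpow_mul (by positivity), ← Real.rpow_neg_one]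
  congr 1
  norm_num

end HMinusOne

/-! ### The path space `L^∞([0,T],H) ∩ L²([0,T],H̃^{1,0}) ∩ C([0,T],H⁻¹)` -/

/-- Lebesgue measure on `[0,T]`. -/
def timeMeasure (T : ℝ) : Measure (Icc (0 : ℝ) T) := Measure.comap Subtype.val volume

/-- An element of the intersection is a triple of representatives, one in each space, that
agree for almost every time. It carries the subspace topology of the product, that is, the
topology of the norm `max (‖·‖_{L^∞(H)}, ‖·‖_{L²(H̃^{1,0})}, ‖·‖_{C(H⁻¹)})`. -/
def pathSet (T : ℝ) : Set (Lp H ∞ (timeMeasure T) × Lp (HT 1 0) 2 (timeMeasure T) ×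
    C(Icc (0 : ℝ) T, HMinusOne)) :=
  {X | ∀ᵐ t ∂timeMeasure T, HT.toH (X.2.1 t) = X.1 t ∧
    HMinusOne.fourier (X.2.2 t) = coeff (X.1 t)}

/-- The space `L^∞([0,T],H) ∩ L²([0,T],H̃^{1,0}) ∩ C([0,T],H⁻¹)`. -/
def PathSpace (T : ℝ) : Type := ↥(pathSet T)

namespace PathSpace

variable {T : ℝ}

instance : MetricSpace (PathSpace T) := inferInstanceAs (MetricSpace ↥(pathSet T))

/-- The path as an almost everywhere defined `H`-valued function. -/
def inH (X : PathSpace T) : Icc (0 : ℝ) T → H := X.1.1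

/-- The path as a continuous `H⁻¹`-valued function, defined at every time. -/
def inHMinusOne (X : PathSpace T) : C(Icc (0 : ℝ) T, HMinusOne) := X.1.2.2

/-- The path belongs to `L^p([0,T], H̃^{s,s'})`. -/
def MemLpHT (p : ℝ≥0∞) (s s' : ℝ) (X : PathSpace T) : Prop :=
  ∃ Y : Icc (0 : ℝ) T → HT s s', MemLp Y p (timeMeasure T) ∧ ∀ᵐ t ∂timeMeasure T, HT.toH (Y t) = X.inH t

end PathSpace

/-! ### The equations -/

/-- The Leray projection at frequency `k`: `z ↦ z - (k·z / |k|²) k`, the identity at `k = 0`. -/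
def leray (k : ℤ × ℤ) (z : CPlane) : CPlane :=
  WithLp.toLp 2 fun j =>
    z j - ((∑ i, (freq k i : ℂ) * z i) / (∑ i, (freq k i : ℂ) ^ 2)) * (freq k j : ℂ)

/-- The Fourier coefficients of `B(u, v) = P_H (u·∇v)`, where, `u` being divergence-free,
`u·∇v = ∑ᵢ ∂ᵢ (uⁱ v)` as a distribution. -/
def convection (u v : H) (k : ℤ × ℤ) : CPlane :=
  leray k (∑ i : Fin 2, (Complex.I * (freq k i : ℂ)) •
    fourierVec (fun x => ((u : L2Torus) x i) • ((v : L2Torus) x)) k)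

/-- The Fourier coefficients of `∂₁² u`. -/
def partialOneSq (u : H) (k : ℤ × ℤ) : CPlane := -((k.1 : ℝ) ^ 2) • coeff u k

/-- `X` belongs to `L^∞([0,T],H̃^{0,1}) ∩ L²([0,T],H̃^{1,1}) ∩ C([0,T],H⁻¹)` and
`X(t) = x₀ + ∫₀ᵗ F(s) ds` for every `t ∈ [0,T]`, as distributions on the torus; `x₀` and `F(s)`
are given by their Fourier coefficients. -/
def IsSolution {T : ℝ} (x₀ : ℤ × ℤ → CPlane) (F : Icc (0 : ℝ) T → ℤ × ℤ → CPlane)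
    (X : PathSpace T) : Prop :=
  X.MemLpHT ∞ 0 1 ∧ X.MemLpHT 2 1 1 ∧
    ∀ (t : Icc (0 : ℝ) T) (k : ℤ × ℤ),
      HMinusOne.fourier (X.inHMinusOne t) k = x₀ k + ∫ s in Iic t, F s k ∂timeMeasure T

/-- `u` solves `du = ∂₁² u dt - B(u, u) dt`, `u(0) = u₀`. -/
def IsDeterministicSolution {T : ℝ} (u₀ : H) (u : PathSpace T) : Prop :=
  IsSolution (coeff u₀)
    (fun s k => partialOneSq (u.inH s) k - convection (u.inH s) (u.inH s) k) u

/-- The sequence space `l²`. -/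
abbrev SeqL2 := lp (fun _ : ℕ => ℝ) 2

/-- `X` solves the skeleton equation
`dX = ∂₁² X dt - B(X, u) dt - B(u, X) dt + σ(t, u) φ dt`, `X(0) = 0`. -/
def IsSkeletonSolution {T : ℝ} (σ : Icc (0 : ℝ) T → H → SeqL2 →L[ℝ] HMinusOne)
    (u : PathSpace T) (φ : Lp SeqL2 2 (timeMeasure T))
    (X : PathSpace T) : Prop :=
  IsSolution 0
    (fun s k => partialOneSq (X.inH s) k - convection (X.inH s) (u.inH s) k -
      convection (u.inH s) (X.inH s) k + HMinusOne.fourier (σ s (u.inH s) (φ s)) k) X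

/-! ### Assumptions on the diffusion coefficient -/

/-- The square of the Hilbert-Schmidt norm of an operator on `l²`, possibly infinite. -/
def hsNormSq {U : Type*} [NormedAddCommGroup U] [NormedSpace ℝ U] (S : SeqL2 →L[ℝ] U) : ℝ≥0∞ :=
  ∑' i : ℕ, ‖S (lp.single 2 i (1 : ℝ))‖ₑ ^ 2

/-- Joint measurability of `(t, u) ↦ σ(t, u) ψ`. -/
def DiffusionMeasurable {T : ℝ} (σ : Icc (0 : ℝ) T → H → SeqL2 →L[ℝ] HMinusOne) : Prop :=
  ∀ ψ : SeqL2, StronglyMeasurable fun p : Icc (0 : ℝ) T × H => σ p.1 p.2 ψ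

/-- (A0): `‖σ(t,u)‖²_{L₂(l²,H⁻¹)} ≤ K₀' + K₁' ‖u‖²_H`. -/
def A0 {T : ℝ} (σ : Icc (0 : ℝ) T → H → SeqL2 →L[ℝ] HMinusOne) : Prop :=
  ∃ K₀ K₁ : ℝ, 0 ≤ K₀ ∧ 0 ≤ K₁ ∧ ∀ (t : Icc (0 : ℝ) T) (u : H),
    hsNormSq (σ t u) ≤ ENNReal.ofReal (K₀ + K₁ * ‖u‖ ^ 2)

/-- (A1): if `∂₁u ∈ H`, then `σ(t,u)` takes its values in `H`, and
`‖σ(t,u)‖²_{L₂(l²,H)} ≤ K₀ + K₁ ‖u‖²_H + K₂ ‖∂₁u‖²_H`. -/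
def A1 {T : ℝ} (σ : Icc (0 : ℝ) T → H → SeqL2 →L[ℝ] HMinusOne) : Prop :=
  ∃ K₀ K₁ K₂ : ℝ, 0 ≤ K₀ ∧ 0 ≤ K₁ ∧ 0 ≤ K₂ ∧
    ∀ (t : Icc (0 : ℝ) T) (u du : H), HasPartial 0 u du →
      ∃ S : SeqL2 →L[ℝ] H, (∀ ψ, HMinusOne.fourier (σ t u ψ) = coeff (S ψ)) ∧
        hsNormSq S ≤ ENNReal.ofReal (K₀ + K₁ * ‖u‖ ^ 2 + K₂ * ‖du‖ ^ 2)

/-- (A2): if `u ∈ H̃^{0,1}` and `∂₁u, ∂₁∂₂u ∈ H`, then `σ(t,u)` takes its values in `H̃^{0,1}`,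
and `‖σ(t,u)‖²_{L₂(l²,H^{0,1})} ≤ K₀ + K₁ ‖u‖²_{H^{0,1}} + K₂ (‖∂₁u‖²_H + ‖∂₁∂₂u‖²_H)`. -/
def A2 {T : ℝ} (σ : Icc (0 : ℝ) T → H → SeqL2 →L[ℝ] HMinusOne) : Prop :=
  ∃ K₀ K₁ K₂ : ℝ, 0 ≤ K₀ ∧ 0 ≤ K₁ ∧ 0 ≤ K₂ ∧
    ∀ (t : Icc (0 : ℝ) T) (u : HT 0 1) (du ddu : H),
      HasPartial 0 (HT.toH u) du → HasPartial 1 du ddu →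
      ∃ S : SeqL2 →L[ℝ] HT 0 1,
        (∀ ψ, HMinusOne.fourier (σ t (HT.toH u) ψ) = coeff (HT.toH (S ψ))) ∧
        hsNormSq S ≤ ENNReal.ofReal (K₀ + K₁ * ‖u‖ ^ 2 + K₂ * (‖du‖ ^ 2 + ‖ddu‖ ^ 2))

/-! ### The sets `K_N` and the rate function -/

/-- `K_N`: the solutions of the skeleton equation with `∫₀ᵀ ‖φ(s)‖² ds ≤ N`. -/
def skeletonSet {T : ℝ} (σ : Icc (0 : ℝ) T → H → SeqL2 →L[ℝ] HMinusOne)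
    (u : PathSpace T) (N : ℝ) : Set (PathSpace T) :=
  {X | ∃ φ : Lp SeqL2 2 (timeMeasure T),
    ∫ s, ‖φ s‖ ^ 2 ∂timeMeasure T ≤ N ∧ IsSkeletonSolution σ u φ X}

/-- `I(g) = inf {½ ∫₀ᵀ ‖φ(s)‖² ds : g = X^φ}`, with the infimum of the empty set equal to `∞`. -/
def rateFunction {T : ℝ} (σ : Icc (0 : ℝ) T → H → SeqL2 →L[ℝ] HMinusOne)
    (u : PathSpace T) (g : PathSpace T) : ℝ≥0∞ :=
  ⨅ (φ : Lp SeqL2 2 (timeMeasure T)) (_ : IsSkeletonSolution σ u φ g),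
    ENNReal.ofReal (1 / 2 * ∫ s, ‖φ s‖ ^ 2 ∂timeMeasure T)

/-- A good rate function: lower semicontinuous, not identically infinite, and with compact
level sets. -/
def IsGoodRateFunction {E : Type*} [TopologicalSpace E] (I : E → ℝ≥0∞) : Prop :=
  LowerSemicontinuous I ∧ (∃ x, I x ≠ ∞) ∧
    ∀ r : ℝ, 0 < r → IsCompact {x | I x ≤ ENNReal.ofReal r}

end
end AnisoNS

namespace AnisoNS
noncomputable section

set_option linter.unusedSectionVars false

/-! ### Primitives of integrable functions on a linearly ordered space -/

section Primitive

variable {α : Type*} [LinearOrder α] [TopologicalSpace α] [OrderTopology α]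
  [SecondCountableTopology α] [MeasurableSpace α] [BorelSpace α] {μ : Measure α}

/-! Everything is done on Fourier coefficients. The equations dissipate only in the first variable,
so the convection term has to be controlled without any gain of regularity in the second one.
Incompressibility makes this possible. In $u^1\partial_1v$ the factor $u^1$ has a derivative in
$x_1$ to spare and $\partial_1v$ one in $x_2$. In $u^2\partial_2v$ the identity
$\partial_2u^2=-\partial_1u^1$ gives $u^2$ a derivative in $x_2$, while $\partial_2v$ has one in
$x_1$. In both cases two one-dimensional Sobolev embeddings bound the product in $L^2$, and the
trilinear form is at most a constant times the product of the $\tilde H^{1,0}$ norm of $u$, the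
$\tilde H^{1,1}$ norm of $v$ and the $L^2$ norm of the test field (`tsum_convolution_le`,
`advection_le`).

The second ingredient is a weighted energy estimate. Transport by a divergence-free field is
antisymmetric, so testing with $w_k^2\hat Y_k$ leaves only the differences $w_{k+l}-w_l$ of the
weight (`abs_tsum_convection_le`), and Young's inequality absorbs the remaining terms in half of the
dissipation (`energy_estimate`). With $w$ a bounded approximation of $k_2^2$ this shows that the
deterministic solution stays in $L^2([0,T],\tilde H^{1,2})$ (`deterministic_regularity`). Its
squared $\tilde H^{1,2}$ norm is then an integrable growth rate for the equation linearised at it.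
For that equation, weights close to $1+|k_2|$ give bounds in $\tilde H^{0,1}$, and the weight $1$
gives bounds on differences in $H$ (`linearised_estimate`).

By (A2), along the deterministic solution the forcing $\sigma\varphi$ takes values in $\tilde
H^{0,1}$, with norm at most $\sqrt{\kappa(t)}\,\|\varphi(t)\|$ for an integrable $\kappa$
(`exists_forcing`). Galerkin approximations are therefore bounded in $L^\infty(\tilde H^{0,1})\cap
L^2(\tilde H^{1,1})$, and since the equation is linear, a weak limit of them solves it
(`exists_weak_solution`). Uniqueness is the estimate for differences.

For the compactness of $K_N$, balls of $L^2([0,T],l^2)$ are weakly compact, so it suffices that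
$\varphi\mapsto X^\varphi$ is continuous on them from the weak topology to the norm of $E$. When
$\varphi-\psi$ is weakly small, the forcing $h=\sigma(\varphi-\psi)$ need not be small in norm. But
the time primitive $G$ of its truncation $P_nh$ to finitely many frequencies is small, uniformly in
time, and $h-P_nh$ is small in $L^1([0,T],H)$ for large $n$, uniformly on the ball, because the
operators are Hilbert-Schmidt. Subtracting $G$ from $X^\varphi-X^\psi$ leaves a solution of the
linearised equation whose forcing is the drift of $G$ plus $h-P_nh$, and the energy estimate applies
(`linearised_estimate_of_forcing`, `Forcing.isCompact_image`).

Finally, the level sets of $I$ are intersections of sets $K_N$ with $N$ decreasing to twice the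
level, so they are compact (`isGoodRateFunction_iInf`). -/

theorem setIntegral_Iic_restrict {E : Type*} [NormedAddCommGroup E] [NormedSpace ℝ E]
    (f : α → E) {s t : α} (h : s ≤ t) :
    ∫ r in Iic s, f r ∂(μ.restrict (Iic t)) = ∫ r in Iic s, f r ∂μ := by
  rw [Measure.restrict_restrict measurableSet_Iic, inter_eq_left.2 (Iic_subset_Iic.2 h)]

/-- The product rule for primitives. -/
theorem setIntegral_Iic_mul [SFinite μ] [NullSingletonClass μ] {F G : α → ℝ} (hF : Integrable F μ)
    (hG : Integrable G μ) (t : α) :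
    (∫ s in Iic t, F s ∂μ) * (∫ s in Iic t, G s ∂μ) =
      ∫ s in Iic t, (F s * (∫ r in Iic s, G r ∂μ) + (∫ r in Iic s, F r ∂μ) * G s) ∂μ := by
  set ν := μ.restrict (Iic t) with hν
  have hF' : Integrable F ν := hF.restrict
  have hG' : Integrable G ν := hG.restrict
  have hFG : Integrable (fun z : α × α => F z.1 * G z.2) (ν.prod ν) := hF'.mul_prod hG'
  -- Fubini: the product of the two integrals is an integral over a square, which is cut along the
  -- diagonal into two triangles.
  have hm : MeasurableSet {z : α × α | z.2 ≤ z.1} := measurableSet_le measurable_snd measurable_fst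
  have hs : ∀ᵐ s ∂ν, s ∈ Iic t := ae_restrict_mem measurableSet_Iic
  have i1 := hFG.indicator hm
  have i2 := hFG.indicator hm.compl
  have e1 : ∫ z, {z : α × α | z.2 ≤ z.1}.indicator (fun z => F z.1 * G z.2) z ∂(ν.prod ν) =
      ∫ s, F s * (∫ r in Iic s, G r ∂μ) ∂ν := by
    rw [integral_prod _ i1]
    refine integral_congr_ae (hs.mono fun s hs => ?_)
    change ∫ r, _ ∂ν = F s * ∫ r in Iic s, G r ∂μ
    rw [← setIntegral_Iic_restrict G hs, ← integral_const_mul,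
      ← integral_indicator (f := fun r => F s * G r) measurableSet_Iic]
    rfl
  -- The complementary triangle is strict and its sections are `Iio s`; points being null, they may
  -- be replaced by `Iic s`.
  have e2 : ∫ z, {z : α × α | z.2 ≤ z.1}ᶜ.indicator (fun z => F z.1 * G z.2) z ∂(ν.prod ν) =
      ∫ s, (∫ r in Iic s, F r ∂μ) * G s ∂ν := by
    rw [integral_prod_symm _ i2]
    refine integral_congr_ae (hs.mono fun s hs => ?_)
    change ∫ r, _ ∂ν = (∫ r in Iic s, F r ∂μ) * G s
    rw [← setIntegral_Iic_restrict F hs, ← integral_mul_const, setIntegral_congr_set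
      (Iio_ae_eq_Iic (a := s)).symm, ← integral_indicator measurableSet_Iio]
    congr 1; ext r
    simp [indicator]
  have j1 : Integrable (fun s => F s * (∫ r in Iic s, G r ∂μ)) ν := by
    refine (i1.integral_prod_left).congr (hs.mono fun s hs => ?_)
    change ∫ r, _ ∂ν = F s * ∫ r in Iic s, G r ∂μ
    rw [← setIntegral_Iic_restrict G hs, ← integral_const_mul,
      ← integral_indicator (f := fun r => F s * G r) measurableSet_Iic]
    rfl
  have j2 : Integrable (fun s => (∫ r in Iic s, F r ∂μ) * G s) ν := by
    refine (i2.integral_prod_right).congr (hs.mono fun s hs => ?_)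
    change ∫ r, _ ∂ν = (∫ r in Iic s, F r ∂μ) * G s
    rw [← setIntegral_Iic_restrict F hs, ← integral_mul_const, setIntegral_congr_set
      (Iio_ae_eq_Iic (a := s)).symm, ← integral_indicator measurableSet_Iio]
    congr 1; ext r
    simp [indicator]
  rw [integral_add j1 j2, ← e1, ← e2, ← integral_add i1 i2, ← integral_prod_mul]
  congr 1; ext z
  exact (congrFun (indicator_self_add_compl {z : α × α | z.2 ≤ z.1}
    fun z : α × α => F z.1 * G z.2) z).symm

variable {E : Type*} [NormedAddCommGroup E] [NormedSpace ℝ E]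

/-- Dominated convergence: the indicators of `Iic x` converge as $x\to t$ at every point except $t$
itself, which is null. -/
theorem continuous_setIntegral_Iic [NullSingletonClass μ] {F : α → E} (hF : Integrable F μ) :
    Continuous fun t => ∫ s in Iic t, F s ∂μ := by
  rw [continuous_iff_continuousAt]
  intro t
  have : (fun t => ∫ s in Iic t, F s ∂μ) = fun t => ∫ s, (Iic t).indicator F s ∂μ := by
    ext t; rw [integral_indicator measurableSet_Iic]
  rw [this]
  refine continuousAt_of_dominated (bound := fun s => ‖F s‖)
    (Filter.Eventually.of_forall fun x => hF.1.indicator measurableSet_Iic)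
    (Filter.Eventually.of_forall fun x => Filter.Eventually.of_forall fun s =>
      norm_indicator_le_norm_self _ _) hF.norm ?_
  have hne : ∀ᵐ s ∂μ, s ≠ t := by simp [ae_iff]
  filter_upwards [hne] with s hs
  rcases lt_or_gt_of_ne hs with h | h
  · refine (continuousAt_const (y := F s)).congr ?_
    filter_upwards [lt_mem_nhds h] with x hx
    rw [indicator_of_mem (mem_Iic.2 (le_of_lt hx))]
  · refine (continuousAt_const (y := (0 : E))).congr ?_
    filter_upwards [gt_mem_nhds h] with x hx
    rw [indicator_of_notMem (by simpa using hx)]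

/-- The square of a primitive. -/
theorem sq_add_setIntegral_Iic [IsFiniteMeasure μ] [NullSingletonClass μ] {F : α → ℝ} (hF : Integrable F μ)
    (a : ℝ) (t : α) :
    (a + ∫ s in Iic t, F s ∂μ) ^ 2 =
      a ^ 2 + 2 * ∫ s in Iic t, F s * (a + ∫ r in Iic s, F r ∂μ) ∂μ := by
  have h := setIntegral_Iic_mul hF hF t
  have hc : Integrable (fun s => F s * a) (μ.restrict (Iic t)) := hF.restrict.mul_const a
  have hb : ∃ C, ∀ s, ‖∫ r in Iic s, F r ∂μ‖ ≤ C := by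
    refine ⟨∫ r, ‖F r‖ ∂μ, fun s => (norm_integral_le_integral_norm _).trans ?_⟩
    exact setIntegral_le_integral hF.norm (Filter.Eventually.of_forall fun _ => norm_nonneg _)
  obtain ⟨C, hC⟩ := hb
  have hd : Integrable (fun s => F s * ∫ r in Iic s, F r ∂μ) (μ.restrict (Iic t)) :=
    hF.restrict.mul_bdd (c := C) (continuous_setIntegral_Iic hF).aestronglyMeasurable
      (Filter.Eventually.of_forall hC)
  have e : ∫ s in Iic t, F s * (a + ∫ r in Iic s, F r ∂μ) ∂μ =
      (∫ s in Iic t, F s ∂μ) * a + ∫ s in Iic t, F s * ∫ r in Iic s, F r ∂μ ∂μ := by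
    rw [← integral_mul_const, ← integral_add hc hd]
    congr 1; ext s; ring
  have h2 : ∫ s in Iic t, (F s * (∫ r in Iic s, F r ∂μ) + (∫ r in Iic s, F r ∂μ) * F s) ∂μ =
      2 * ∫ s in Iic t, F s * ∫ r in Iic s, F r ∂μ ∂μ := by
    rw [← integral_const_mul]
    congr 1; ext s; ring
  rw [h2] at h
  rw [e]
  nlinarith

/-- The rule $(A^{n+1})'=(n+1)aA^n$ for an antiderivative $A$ of a merely integrable $a$, by
induction from the product rule. It evaluates the iterated integrals in the Gronwall and Picard
arguments below. -/
theorem setIntegral_Iic_mul_pow [IsFiniteMeasure μ] [NullSingletonClass μ] {a : α → ℝ} (ha : Integrable a μ)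
    (n : ℕ) (t : α) :
    Integrable (fun s => a s * (∫ r in Iic s, a r ∂μ) ^ n) μ ∧
    (∫ s in Iic t, a s ∂μ) ^ (n + 1) =
      (n + 1) * ∫ s in Iic t, a s * (∫ r in Iic s, a r ∂μ) ^ n ∂μ := by
  have hb : ∃ C, ∀ s, ‖∫ r in Iic s, a r ∂μ‖ ≤ C := by
    refine ⟨∫ r, ‖a r‖ ∂μ, fun s => (norm_integral_le_integral_norm _).trans ?_⟩
    exact setIntegral_le_integral ha.norm (Filter.Eventually.of_forall fun _ => norm_nonneg _)
  obtain ⟨C, hC⟩ := hb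
  have hint : ∀ n : ℕ, Integrable (fun s => a s * (∫ r in Iic s, a r ∂μ) ^ n) μ := fun n =>
    ha.mul_bdd (c := C ^ n) ((continuous_setIntegral_Iic ha).pow n).aestronglyMeasurable
      (Filter.Eventually.of_forall fun s => by
        rw [norm_pow]; exact pow_le_pow_left₀ (norm_nonneg _) (hC s) n)
  refine ⟨hint n, ?_⟩
  induction n generalizing t with
  | zero => simp
  | succ n ih =>
    have h := setIntegral_Iic_mul (hint n) ha t
    have e : ∫ s in Iic t, (a s * (∫ r in Iic s, a r ∂μ) ^ n * (∫ r in Iic s, a r ∂μ) +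
        (∫ r in Iic s, a r * (∫ q in Iic r, a q ∂μ) ^ n ∂μ) * a s) ∂μ =
        (1 + 1 / ((n : ℝ) + 1)) * ∫ s in Iic t, a s * (∫ r in Iic s, a r ∂μ) ^ (n + 1) ∂μ := by
      rw [← integral_const_mul]
      congr 1; ext s
      have h2 := ih s
      have : (∫ r in Iic s, a r * (∫ q in Iic r, a q ∂μ) ^ n ∂μ) =
          1 / ((n : ℝ) + 1) * (∫ r in Iic s, a r ∂μ) ^ (n + 1) := by
        rw [h2]; field_simp
      rw [this]; ring
    rw [e] at h
    rw [pow_succ, ih t, mul_assoc, h]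
    push_cast
    field_simp

/-- The integral form of Gronwall's inequality, with an integrable coefficient. -/
theorem gronwall_setIntegral_Iic [IsFiniteMeasure μ] [NullSingletonClass μ] {a φ : α → ℝ}
    (ha : Integrable a μ) (ha0 : ∀ s, 0 ≤ a s) (hφ : AEStronglyMeasurable φ μ) {M A : ℝ} (hA : 0 ≤ A)
    (hM : ∀ s, |φ s| ≤ M)
    (h : ∀ t, φ t ≤ A + ∫ s in Iic t, a s * φ s ∂μ) (t : α) :
    φ t ≤ A * Real.exp (∫ s, a s ∂μ) := by
  set p : α → ℝ := fun t => ∫ s in Iic t, a s ∂μ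
  have hp0 : ∀ t, 0 ≤ p t := fun t => setIntegral_nonneg measurableSet_Iic fun s _ => ha0 s
  have hpT : ∀ t, p t ≤ ∫ s, a s ∂μ := fun t =>
    setIntegral_le_integral ha (Filter.Eventually.of_forall ha0)
  have haφ : Integrable (fun s => a s * φ s) μ :=
    ha.mul_bdd (c := M) hφ (Filter.Eventually.of_forall hM)
  -- Iterating the hypothesis $n$ times produces the Taylor polynomial of $Ae^{p}$ and a remainder
  -- $Mp^n/n!$ that tends to zero.
  have step : ∀ n : ℕ, ∀ t, φ t ≤ A * ∑ j ∈ Finset.range n, p t ^ j / j.factorial +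
      M * (p t ^ n / n.factorial) := by
    intro n
    induction n with
    | zero => intro t; simpa using (le_abs_self _).trans (hM t)
    | succ n ih =>
      intro t
      have hint : ∀ j : ℕ, Integrable (fun s => a s * (p s ^ j / j.factorial)) (μ.restrict (Iic t)) := fun j => by
        simpa [mul_div_assoc] using ((setIntegral_Iic_mul_pow ha j t).1.div_const (j.factorial : ℝ)).restrict
      have hval : ∀ j : ℕ, ∫ s in Iic t, a s * (p s ^ j / j.factorial) ∂μ =
          p t ^ (j + 1) / (j + 1).factorial := fun j => by
        have := (setIntegral_Iic_mul_pow ha j t).2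
        change p t ^ (j + 1) = (j + 1) * ∫ s in Iic t, a s * p s ^ j ∂μ at this
        rw [this, Nat.factorial_succ]
        simp only [← mul_div_assoc]
        rw [integral_div]
        push_cast
        have h1 : (j : ℝ) + 1 ≠ 0 := by positivity
        have h2 : (j.factorial : ℝ) ≠ 0 := by positivity
        field_simp
      have hsum : Integrable (fun s => ∑ j ∈ Finset.range n, A * (a s * (p s ^ j / j.factorial)) )
          (μ.restrict (Iic t)) := integrable_finsetSum _ fun j _ => (hint j).const_mul A
      calc φ t ≤ A + ∫ s in Iic t, a s * φ s ∂μ := h t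
        _ ≤ A + ∫ s in Iic t, ((∑ j ∈ Finset.range n, A * (a s * (p s ^ j / j.factorial))) +
              M * (a s * (p s ^ n / n.factorial))) ∂μ := by
            refine add_le_add le_rfl ?_
            · refine integral_mono haφ.restrict (hsum.add ((hint n).const_mul M)) fun s => ?_
              refine (mul_le_mul_of_nonneg_left (ih s) (ha0 s)).trans (le_of_eq ?_)
              rw [mul_add, Finset.mul_sum, Finset.mul_sum]
              congr 1
              · exact Finset.sum_congr rfl fun j _ => by ring
              · ring
        _ = _ := by
            rw [integral_add hsum ((hint n).const_mul M), integral_finsetSum _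
              fun j _ => (hint j).const_mul A, integral_const_mul, hval, Finset.sum_range_succ']
            simp only [integral_const_mul, hval, ← Finset.mul_sum]
            simp; ring
  have hlim : Filter.Tendsto (fun n : ℕ => A * Real.exp (p t) + M * (p t ^ n / n.factorial)) Filter.atTop
      (nhds (A * Real.exp (p t) + M * 0)) :=
    ((FloorSemiring.tendsto_pow_div_factorial_atTop (p t)).const_mul M).const_add _
  have hle : φ t ≤ A * Real.exp (p t) := by
    have := ge_of_tendsto' hlim (b := φ t) fun n => (step n t).trans (by
      gcongr
      exact Real.sum_le_exp_of_nonneg (hp0 t) n)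
    simpa using this
  exact hle.trans (by gcongr; exact hpT t)

/-- Linear differential equations with integrable coefficients have solutions. -/
theorem exists_eq_setIntegral_Iic [CompactSpace α] [IsFiniteMeasure μ] [NullSingletonClass μ] [CompleteSpace E]
    {A : α → E →L[ℝ] E} (hA : Integrable A μ) {f : α → E} (hf : Integrable f μ) :
    ∃ X : C(α, E), ∀ t, X t = ∫ s in Iic t, (A s (X s) + f s) ∂μ := by
  have hint : ∀ X : C(α, E), Integrable (fun s => A s (X s) + f s) μ := fun X => by
    refine Integrable.add (Integrable.mono' (hA.norm.mul_const ‖X‖)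
      (ContinuousLinearMap.apply ℝ E |>.flip.aestronglyMeasurable_comp₂ hA.1 X.continuous.aestronglyMeasurable)
      (Filter.Eventually.of_forall fun s => ?_)) hf
    exact ((A s).le_opNorm _).trans (by gcongr; exact X.norm_coe_le_norm s)
  let Φ : C(α, E) → C(α, E) := fun X => ⟨_, continuous_setIntegral_Iic (hint X)⟩
  have hΦ : ∀ X t, Φ X t = ∫ s in Iic t, (A s (X s) + f s) ∂μ := fun X t => rfl
  set p : α → ℝ := fun t => ∫ s in Iic t, ‖A s‖ ∂μ
  -- The Picard map need not be a contraction on the whole interval, but its iterates have Lipschitz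
  -- constants $p^n/n!$.
  have step : ∀ n : ℕ, ∀ X Y : C(α, E), ∀ t, ‖(Φ^[n] X) t - (Φ^[n] Y) t‖ ≤
      p t ^ n / n.factorial * ‖X - Y‖ := by
    intro n X Y
    induction n with
    | zero => intro t; simpa using (X - Y).norm_coe_le_norm t
    | succ n ih =>
      intro t
      have hp := setIntegral_Iic_mul_pow hA.norm n t
      rw [Function.iterate_succ_apply', Function.iterate_succ_apply', hΦ, hΦ,
        ← integral_sub (hint _).restrict (hint _).restrict]
      have e : ∫ s in Iic t, ‖A s‖ * (p s ^ n / n.factorial * ‖X - Y‖) ∂μ =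
          p t ^ (n + 1) / (n + 1).factorial * ‖X - Y‖ := by
        have := hp.2
        change p t ^ (n + 1) = (n + 1) * ∫ s in Iic t, ‖A s‖ * p s ^ n ∂μ at this
        rw [this, Nat.factorial_succ]
        have : ∀ s, ‖A s‖ * (p s ^ n / n.factorial * ‖X - Y‖) =
          (‖A s‖ * p s ^ n) * (‖X - Y‖ / n.factorial) := fun s => by ring
        simp only [this, integral_mul_const]
        push_cast
        have h1 : (n : ℝ) + 1 ≠ 0 := by positivity
        have h2 : (n.factorial : ℝ) ≠ 0 := by positivity
        field_simp
      rw [← e]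
      refine norm_integral_le_of_norm_le ?_ (Filter.Eventually.of_forall fun s => ?_)
      · refine (hp.1.mul_const (‖X - Y‖ / n.factorial)).restrict.congr
          (Filter.Eventually.of_forall fun s => ?_)
        change ‖A s‖ * p s ^ n * _ = _
        ring
      · have : A s ((Φ^[n] X) s) + f s - (A s ((Φ^[n] Y) s) + f s) =
          A s ((Φ^[n] X) s - (Φ^[n] Y) s) := by rw [map_sub]; abel
        rw [this]
        exact ((A s).le_opNorm _).trans (by gcongr; exact ih s)
  -- Some iterate is a contraction, and its unique fixed point is also fixed by the map itself.
  obtain ⟨n, hn⟩ := ((FloorSemiring.tendsto_pow_div_factorial_atTop (∫ s, ‖A s‖ ∂μ)).eventually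
    (gt_mem_nhds (show (0 : ℝ) < 1 / 2 by norm_num))).exists
  have hc : ContractingWith (1 / 2) (Φ^[n]) := by
    refine ⟨by norm_num [← NNReal.coe_lt_coe], LipschitzWith.of_dist_le_mul fun X Y => ?_⟩
    rw [ContinuousMap.dist_le (by positivity)]
    intro t
    rw [dist_eq_norm, dist_eq_norm]
    refine (step n X Y t).trans ?_
    gcongr
    refine le_trans ?_ (hn.le.trans (by norm_num))
    gcongr
    exact setIntegral_le_integral hA.norm (Filter.Eventually.of_forall fun _ => norm_nonneg _)
  refine ⟨hc.fixedPoint _, fun t => ?_⟩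
  have := hc.isFixedPt_fixedPoint_iterate
  rw [← hΦ, this]

end Primitive

/-! ### Energy identities and energy estimates -/

section Energy

variable {α : Type*} [LinearOrder α] [TopologicalSpace α] [OrderTopology α]
  [SecondCountableTopology α] [MeasurableSpace α] [BorelSpace α] {μ : Measure α}
  [IsFiniteMeasure μ] [NullSingletonClass μ]

/-- In an orthonormal basis this is the sum over the coordinates of the scalar identity
`sq_add_setIntegral_Iic`. -/
theorem norm_sq_add_setIntegral_Iic {E : Type*} [NormedAddCommGroup E] [InnerProductSpace ℝ E]
    [FiniteDimensional ℝ E] {F : α → E} (hF : Integrable F μ) (a : E) (t : α) :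
    ‖a + ∫ s in Iic t, F s ∂μ‖ ^ 2 = ‖a‖ ^ 2 +
      2 * ∫ s in Iic t, inner ℝ (F s) (a + ∫ r in Iic s, F r ∂μ) ∂μ := by
  set b := stdOrthonormalBasis ℝ E
  have hint : ∀ (i) (t : α), inner ℝ (b i) (∫ s in Iic t, F s ∂μ) =
      ∫ s in Iic t, inner ℝ (b i) (F s) ∂μ := fun i t => (integral_inner hF.restrict (b i)).symm
  have hFi : ∀ i, Integrable (fun s => inner ℝ (b i) (F s)) μ := fun i =>
    hF.const_inner (b i)
  have hsq : ∀ x : E, ‖x‖ ^ 2 = ∑ i, inner ℝ (b i) x ^ 2 := fun x => by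
    rw [← real_inner_self_eq_norm_sq, ← b.sum_inner_mul_inner]
    exact Finset.sum_congr rfl fun i _ => by rw [real_inner_comm, sq]
  have hinn : ∀ s, inner ℝ (F s) (a + ∫ r in Iic s, F r ∂μ) = ∑ i, inner ℝ (b i) (F s) *
      (inner ℝ (b i) a + ∫ r in Iic s, inner ℝ (b i) (F r) ∂μ) := fun s => by
    rw [← b.sum_inner_mul_inner]
    refine Finset.sum_congr rfl fun i _ => ?_
    rw [real_inner_comm, inner_add_right, hint]
  have hint2 : ∀ i, Integrable (fun s => inner ℝ (b i) (F s) *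
      (inner ℝ (b i) a + ∫ r in Iic s, inner ℝ (b i) (F r) ∂μ)) (μ.restrict (Iic t)) := fun i => by
    refine ((hFi i).mul_bdd (c := |inner ℝ (b i) a| + ∫ r, |inner ℝ (b i) (F r)| ∂μ)
      (continuous_const.add (continuous_setIntegral_Iic (hFi i))).aestronglyMeasurable
      (Filter.Eventually.of_forall fun s => (norm_add_le _ _).trans ?_)).restrict
    refine add_le_add le_rfl ((norm_integral_le_integral_norm _).trans ?_)
    exact setIntegral_le_integral (hFi i).norm (Filter.Eventually.of_forall fun _ => norm_nonneg _)
  simp only [hinn]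
  rw [hsq, hsq, integral_finsetSum _ fun i _ => hint2 i, Finset.mul_sum, ← Finset.sum_add_distrib]
  refine Finset.sum_congr rfl fun i _ => ?_
  rw [inner_add_right, hint, sq_add_setIntegral_Iic (hFi i)]

/-- Absolute summability over frequencies and time together is the one condition that later
justifies every exchange of sum and integral. -/
theorem integrable_tsum_of_lintegral {ι : Type*} [Countable ι] {f : ι → α → ℝ}
    (hf : ∀ i, AEStronglyMeasurable (f i) μ) (h : ∫⁻ s, ∑' i, ‖f i s‖ₑ ∂μ ≠ ∞) :
    Integrable (fun s => ∑' i, f i s) μ ∧ (∀ᵐ s ∂μ, Summable fun i => f i s) ∧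
      ∀ t, HasSum (fun i => ∫ s in Iic t, f i s ∂μ) (∫ s in Iic t, ∑' i, f i s ∂μ) := by
  have hs : ∀ᵐ s ∂μ, Summable fun i => ‖f i s‖ := by
    filter_upwards [ae_lt_top' (AEMeasurable.tsum fun i => (hf i).enorm) h] with s hs
    have := ENNReal.summable_toReal hs.ne
    simpa using this
  have hm : AEMeasurable (fun s => ∑' i, f i s) μ := by
    exact AEMeasurable.tsum fun i => (hf i).aemeasurable
  refine ⟨⟨hm.aestronglyMeasurable, ?_⟩, hs.mono fun s h => h.of_norm, fun t => ?_⟩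
  · refine lt_of_le_of_lt (lintegral_mono_ae ?_) (lt_top_iff_ne_top.2 h)
    filter_upwards [hs] with s hs
    rw [← ofReal_norm]
    refine (ENNReal.ofReal_le_ofReal (norm_tsum_le_tsum_norm hs)).trans ?_
    rw [ENNReal.ofReal_tsum_of_nonneg (fun _ => norm_nonneg _) hs]
    simp [Real.enorm_eq_ofReal_abs]
  · refine hasSum_integral_of_summable_integral_norm (fun i => ?_) ?_
    · refine ⟨(hf i).restrict, lt_of_le_of_lt ((setLIntegral_le_lintegral _ _).trans
        (lintegral_mono fun s => ?_)) (lt_top_iff_ne_top.2 h)⟩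
      exact ENNReal.le_tsum i
    · have h2 : ∑' i, ∫⁻ s in Iic t, ‖f i s‖ₑ ∂μ ≠ ∞ := by
        rw [← lintegral_tsum fun i => (hf i).enorm.restrict]
        exact ((setLIntegral_le_lintegral _ _).trans_lt (lt_top_iff_ne_top.2 h)).ne
      refine (ENNReal.summable_toReal h2).congr fun i => ?_
      rw [integral_norm_eq_lintegral_enorm (hf i).restrict]

/-- The energy identity for a countable family of equations, with weights `p`. -/
theorem hasSum_energy {ι E : Type*} [Countable ι] [NormedAddCommGroup E] [InnerProductSpace ℝ E]
    [FiniteDimensional ℝ E] {F c : α → ι → E} {x₀ : ι → E} {p : ι → ℝ} (hp : ∀ i, 0 ≤ p i)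
    (hF : ∀ i, Integrable (fun s => F s i) μ)
    (hc : ∀ t i, c t i = x₀ i + ∫ s in Iic t, F s i ∂μ)
    (h0 : Summable fun i => p i * ‖x₀ i‖ ^ 2)
    (h : ∫⁻ s, ∑' i, ENNReal.ofReal (p i) * (‖F s i‖ₑ * ‖c s i‖ₑ) ∂μ ≠ ∞) :
    Integrable (fun s => ∑' i, p i * inner ℝ (F s i) (c s i)) μ ∧
    (∀ᵐ s ∂μ, Summable fun i => p i * inner ℝ (F s i) (c s i)) ∧
    ∀ t, HasSum (fun i => p i * ‖c t i‖ ^ 2) ((∑' i, p i * ‖x₀ i‖ ^ 2) +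
      2 * ∫ s in Iic t, ∑' i, p i * inner ℝ (F s i) (c s i) ∂μ) := by
  have hcc : ∀ i, AEStronglyMeasurable (fun s => c s i) μ := fun i => by
    simp only [hc]
    exact (continuous_const.add (continuous_setIntegral_Iic (hF i))).aestronglyMeasurable
  have key := integrable_tsum_of_lintegral (μ := μ) (f := fun i s => p i * inner ℝ (F s i) (c s i))
    (fun i => ((hF i).1.inner (hcc i)).const_mul (p i)) (by
      refine ((lintegral_mono fun s => ENNReal.tsum_le_tsum fun i => ?_).trans_lt
        (lt_top_iff_ne_top.2 h)).ne
      rw [enorm_mul, Real.enorm_of_nonneg (hp i)]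
      gcongr
      rw [← ofReal_norm, ← ofReal_norm, ← ofReal_norm, ← ENNReal.ofReal_mul (norm_nonneg _)]
      exact ENNReal.ofReal_le_ofReal (norm_inner_le_norm _ _))
  refine ⟨key.1, key.2.1, fun t => ?_⟩
  convert h0.hasSum.add ((key.2.2 t).mul_left 2) using 2 with i
  have e : ∀ s, inner ℝ (F s i) (c s i) = inner ℝ (F s i) (x₀ i + ∫ r in Iic s, F r i ∂μ) :=
    fun s => by rw [hc]
  rw [hc, norm_sq_add_setIntegral_Iic (hF i), integral_const_mul]
  simp only [e]
  ring

end Energy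

/-- The constant in `energy_gronwall`. -/
def energyConst (Γ : ℝ) : ℝ := 1 + (1 + Γ) * (4 * Real.exp (2 * Γ))

section Energy

variable {α : Type*} [LinearOrder α] [TopologicalSpace α] [OrderTopology α]
  [SecondCountableTopology α] [MeasurableSpace α] [BorelSpace α] {μ : Measure α}
  [IsFiniteMeasure μ] [NullSingletonClass μ]

/-- The source $b$ is only integrable in time, so $b\sqrt Q$ cannot be absorbed pointwise. Instead
$\sqrt Q$ is replaced by the root of the supremum $S$ of $Q$. Gronwall's inequality then bounds $S$
by $(Q_0+2\beta\sqrt S)e^{\Gamma}$, and this is solved for $S$. Returning to the inequality with $S$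
known bounds the integral of the dissipation $D$. -/
theorem energy_gronwall {γ Q D b P : α → ℝ} {Q₀ : ℝ} (hγ : Integrable γ μ) (hγ0 : ∀ s, 0 ≤ γ s)
    (hQ : ∀ s, 0 ≤ Q s) (hD : Integrable D μ) (hD0 : ∀ s, 0 ≤ D s) (hb : Integrable b μ)
    (hb0 : ∀ s, 0 ≤ b s) (hP : Integrable P μ) (hQ₀ : 0 ≤ Q₀)
    (hQP : ∀ t, Q t = Q₀ + 2 * ∫ s in Iic t, P s ∂μ)
    (h : ∀ᵐ s ∂μ, 2 * P s ≤ -D s + γ s * Q s + 2 * (b s * √(Q s))) (t : α) :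
    Q t ≤ energyConst (∫ s, γ s ∂μ) * (Q₀ + (∫ s, b s ∂μ) ^ 2) ∧
    ∫ s in Iic t, D s ∂μ ≤ energyConst (∫ s, γ s ∂μ) * (Q₀ + (∫ s, b s ∂μ) ^ 2) := by
  set Γ := ∫ s, γ s ∂μ
  set β := ∫ s, b s ∂μ
  have hΓ : 0 ≤ Γ := integral_nonneg hγ0
  have hβ : 0 ≤ β := integral_nonneg hb0
  have hQc : Continuous Q := by
    have : Q = fun t => Q₀ + 2 * ∫ s in Iic t, P s ∂μ := funext hQP
    rw [this]
    exact continuous_const.add (continuous_const.mul (continuous_setIntegral_Iic hP))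
  have hbd : BddAbove (range Q) := by
    refine ⟨Q₀ + 2 * ∫ s, |P s| ∂μ, ?_⟩
    rintro _ ⟨t, rfl⟩
    rw [hQP]
    gcongr
    refine (le_abs_self _).trans (abs_integral_le_integral_abs.trans ?_)
    exact setIntegral_le_integral hP.abs (Filter.Eventually.of_forall fun _ => abs_nonneg _)
  set S := ⨆ t, Q t
  have hS : ∀ t, Q t ≤ S := fun t => le_ciSup hbd t
  have hS0 : 0 ≤ S := (hQ t).trans (hS t)
  have hγQ : Integrable (fun s => γ s * Q s) μ := hγ.mul_bdd (c := S) hQc.aestronglyMeasurable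
    (Filter.Eventually.of_forall fun s => by rw [Real.norm_of_nonneg (hQ s)]; exact hS s)
  have main : ∀ t, Q t + ∫ s in Iic t, D s ∂μ ≤ (Q₀ + 2 * (β * √S)) + ∫ s in Iic t, γ s * Q s ∂μ := by
    intro t
    have h1 : 2 * ∫ s in Iic t, P s ∂μ ≤ ∫ s in Iic t, (-D s + γ s * Q s + 2 * (b s * √S)) ∂μ := by
      rw [← integral_const_mul]
      refine integral_mono_ae (hP.const_mul 2).restrict
        ((hD.neg.add hγQ).add ((hb.mul_const _).const_mul 2)).restrict
        (ae_restrict_of_ae (h.mono fun s hs => hs.trans ?_))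
      change _ ≤ -D s + γ s * Q s + 2 * (b s * √S)
      gcongr
      · exact hb0 s
      · exact hS s
    have h2 : ∫ s in Iic t, (-D s + γ s * Q s + 2 * (b s * √S)) ∂μ =
        -(∫ s in Iic t, D s ∂μ) + ∫ s in Iic t, γ s * Q s ∂μ + 2 * ((∫ s in Iic t, b s ∂μ) * √S) := by
      rw [integral_add (f := fun s => -D s + γ s * Q s) (hD.neg.add hγQ).restrict
        ((hb.mul_const _).const_mul 2).restrict,
        integral_add (f := fun s => -D s) hD.neg.restrict hγQ.restrict, integral_neg,
        integral_const_mul, integral_mul_const]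
    have h3 : (∫ s in Iic t, b s ∂μ) ≤ β :=
      setIntegral_le_integral hb (Filter.Eventually.of_forall hb0)
    have h4 := mul_le_mul_of_nonneg_right h3 (Real.sqrt_nonneg S)
    rw [h2] at h1
    linarith [hQP t]
  have hexp : 1 ≤ Real.exp Γ := Real.one_le_exp hΓ
  have hQe : ∀ t, Q t ≤ (Q₀ + 2 * (β * √S)) * Real.exp Γ := by
    refine gronwall_setIntegral_Iic hγ hγ0 hQc.aestronglyMeasurable (M := S) (by positivity)
      (fun s => by rw [abs_of_nonneg (hQ s)]; exact hS s) fun t => ?_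
    have : 0 ≤ ∫ s in Iic t, D s ∂μ := setIntegral_nonneg measurableSet_Iic fun s _ => hD0 s
    linarith [main t]
  have : Nonempty α := ⟨t⟩
  have hSe : S ≤ (Q₀ + 2 * (β * √S)) * Real.exp Γ := ciSup_le hQe
  have e2 : Real.exp (2 * Γ) = Real.exp Γ ^ 2 := by rw [← Real.exp_nat_mul]; norm_num
  -- Young's inequality moves $S/2$ to the left; this doubles the remaining terms, whence the factor
  -- $4$.
  have hS4 : S ≤ 4 * Real.exp (2 * Γ) * (Q₀ + β ^ 2) := by
    have h5 : 2 * (β * √S) * Real.exp Γ ≤ S / 2 + 2 * β ^ 2 * Real.exp (2 * Γ) := by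
      have h6 := Real.sq_sqrt hS0
      rw [e2]
      nlinarith [sq_nonneg (√S - 2 * (β * Real.exp Γ))]
    have h7 : Q₀ * Real.exp Γ ≤ Q₀ * Real.exp (2 * Γ) := by
      gcongr; linarith
    nlinarith
  have hSβ : 2 * (β * √S) ≤ S + β ^ 2 := by
    nlinarith [Real.sq_sqrt hS0, sq_nonneg (√S - β)]
  have hγS : ∫ s in Iic t, γ s * Q s ∂μ ≤ Γ * S := by
    calc ∫ s in Iic t, γ s * Q s ∂μ ≤ ∫ s, γ s * Q s ∂μ :=
          setIntegral_le_integral hγQ (Filter.Eventually.of_forall fun s => mul_nonneg (hγ0 s) (hQ s))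
      _ ≤ ∫ s, γ s * S ∂μ := integral_mono hγQ (hγ.mul_const S)
          fun s => mul_le_mul_of_nonneg_left (hS s) (hγ0 s)
      _ = _ := integral_mul_const _ _
  have hE : S ≤ 4 * Real.exp (2 * Γ) * (Q₀ + β ^ 2) := hS4
  have hX : 0 ≤ Q₀ + β ^ 2 := by positivity
  have hE0 : 0 ≤ Real.exp (2 * Γ) := (Real.exp_pos _).le
  unfold energyConst
  have hmul : (1 + Γ) * S ≤ (1 + Γ) * (4 * Real.exp (2 * Γ) * (Q₀ + β ^ 2)) := by gcongr
  constructor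
  · nlinarith [hS t, mul_nonneg hΓ hS0]
  · nlinarith [main t, hQ t]

end Energy

/-! ### Lebesgue measure on the time interval -/

instance (T : ℝ) : IsFiniteMeasure (timeMeasure T) := by
  refine ⟨?_⟩
  unfold timeMeasure
  rw [comap_subtype_coe_apply measurableSet_Icc, image_univ, Subtype.range_coe]
  exact measure_Icc_lt_top

instance (T : ℝ) : NullSingletonClass (timeMeasure T) := by
  refine ⟨fun x => ?_⟩
  unfold timeMeasure
  rw [comap_subtype_coe_apply measurableSet_Icc]
  simp

/-- A relatively open subset may touch only an endpoint, so it is first made to meet the open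
interval; for $T=0$ the statement fails. It is used to pass from almost every time to every time. -/
theorem isOpenPosMeasure_timeMeasure {T : ℝ} (hT : 0 < T) : (timeMeasure T).IsOpenPosMeasure := by
  refine ⟨fun U hU hne => ?_⟩
  obtain ⟨V, hV, rfl⟩ := isOpen_induced_iff.1 hU
  obtain ⟨x, hx⟩ := hne
  have hcl : (x : ℝ) ∈ closure (Ioo 0 T) := by
    rw [closure_Ioo hT.ne]; exact x.2
  obtain ⟨y, hyV, hy⟩ := mem_closure_iff.1 hcl V hV hx
  unfold timeMeasure
  rw [comap_subtype_coe_apply measurableSet_Icc]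
  refine (((hV.inter isOpen_Ioo).measure_pos volume ⟨y, hyV, hy⟩).trans_le
    (measure_mono ?_)).ne'
  rintro z ⟨hz, hz'⟩
  exact ⟨⟨z, Ioo_subset_Icc_self hz'⟩, hz, rfl⟩

/-! ### The Fourier basis of the torus -/

theorem character_mul (k l : ℤ × ℤ) (x : ℝ × ℝ) :
    character k x * character l x = character (k + l) x := by
  unfold character
  rw [← Complex.exp_add]
  congr 1
  push_cast [Prod.fst_add, Prod.snd_add]
  ring

theorem conj_character (k : ℤ × ℤ) (x : ℝ × ℝ) :
    (starRingEnd ℂ) (character k x) = character (-k) x := by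
  unfold character
  rw [← Complex.exp_conj]
  congr 1
  simp
  ring

theorem integral_exp_int (n : ℤ) :
    ∫ x, Complex.exp (Complex.I * ((n : ℂ) * (x : ℂ))) ∂intervalMeasure =
      if n = 0 then 2 * (Real.pi : ℂ) else 0 := by
  have hpi : (0 : ℝ) ≤ 2 * Real.pi := by positivity
  unfold intervalMeasure
  rw [← intervalIntegral.integral_of_le hpi]
  split_ifs with h
  · simp [h]
  · have hn : (Complex.I * n) ≠ 0 := mul_ne_zero Complex.I_ne_zero (by exact_mod_cast h)
    simp only [← mul_assoc]
    rw [integral_exp_mul_complex hn]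
    have : Complex.I * n * ((2 * Real.pi : ℝ) : ℂ) = n * (2 * Real.pi * Complex.I) := by
      push_cast; ring
    rw [this, Complex.exp_int_mul_two_pi_mul_I]
    simp

theorem integral_character (k : ℤ × ℤ) :
    ∫ x, character k x ∂torusMeasure = if k = 0 then (2 * (Real.pi : ℂ)) ^ 2 else 0 := by
  rw [torusMeasure_eq]
  have : ∀ x : ℝ × ℝ, character k x = Complex.exp (Complex.I * ((k.1 : ℂ) * (x.1 : ℂ))) *
      Complex.exp (Complex.I * ((k.2 : ℂ) * (x.2 : ℂ))) := fun x => by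
    unfold character; rw [← Complex.exp_add]; ring_nf
  simp only [this]
  rw [integral_prod_mul (fun x : ℝ => Complex.exp (Complex.I * ((k.1 : ℂ) * (x : ℂ))))
    (fun x : ℝ => Complex.exp (Complex.I * ((k.2 : ℂ) * (x : ℂ)))), integral_exp_int,
    integral_exp_int]
  simp only [Prod.ext_iff, Prod.fst_zero, Prod.snd_zero]
  split_ifs <;> simp_all [sq]

theorem two_pi_ne_zero : (2 * (Real.pi : ℂ)) ≠ 0 :=
  mul_ne_zero two_ne_zero (by exact_mod_cast Real.pi_ne_zero)

theorem conj_two_pi : (starRingEnd ℂ) (2 * (Real.pi : ℂ)) = 2 * Real.pi := by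
  rw [map_mul, Complex.conj_ofReal, map_ofNat]

theorem memLp_character (k : ℤ × ℤ) : MemLp (character k) 2 torusMeasure :=
  MemLp.of_bound (continuous_character k).aestronglyMeasurable 1
    (Filter.Eventually.of_forall fun x => (norm_character k x).le)

/-- The normalized characters in `L²`. -/
def characterLp (k : ℤ × ℤ) : Lp ℂ 2 torusMeasure :=
  (1 / (2 * (Real.pi : ℂ))) • (memLp_character k).toLp

theorem coeFn_characterLp (k : ℤ × ℤ) :
    characterLp k =ᵐ[torusMeasure] fun x => (1 / (2 * (Real.pi : ℂ))) * character k x := by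
  filter_upwards [Lp.coeFn_smul (1 / (2 * (Real.pi : ℂ))) (memLp_character k).toLp,
    (memLp_character k).coeFn_toLp] with x h1 h2
  change ((1 / (2 * (Real.pi : ℂ))) • (memLp_character k).toLp : Lp ℂ 2 torusMeasure) x = _
  rw [h1, Pi.smul_apply, h2, smul_eq_mul]

theorem inner_characterLp (k : ℤ × ℤ) (f : Lp ℂ 2 torusMeasure) :
    inner ℂ (characterLp k) f = 2 * Real.pi * scalarCoeff f k := by
  rw [L2.inner_def]
  have : ∫ x, inner ℂ (characterLp k x) (f x) ∂torusMeasure =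
      ∫ x, (1 / (2 * (Real.pi : ℂ))) * (character (-k) x * f x) ∂torusMeasure := by
    refine integral_congr_ae ?_
    filter_upwards [coeFn_characterLp k] with x hx
    rw [hx, RCLike.inner_apply, map_mul, conj_character, map_div₀, conj_two_pi, map_one]
    ring
  rw [this, integral_const_mul]
  unfold scalarCoeff
  have := two_pi_ne_zero
  field_simp

theorem orthonormal_characterLp : Orthonormal ℂ characterLp := by
  rw [orthonormal_iff_ite]
  intro k l
  rw [inner_characterLp, scalarCoeff_congr (coeFn_characterLp l)]
  unfold scalarCoeff
  have : ∀ x, character (-k) x * (1 / (2 * (Real.pi : ℂ)) * character l x) =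
      1 / (2 * (Real.pi : ℂ)) * character (l - k) x := fun x => by
    rw [mul_left_comm, character_mul]; congr 2; abel
  simp only [this]
  rw [integral_const_mul, integral_character]
  have := two_pi_ne_zero
  simp only [sub_eq_zero, eq_comm (a := l)]
  split_ifs
  · field_simp
  · simp

/-- The Hilbert basis of `L²(𝕋²; ℂ)` formed by the characters. -/
def fourierBasis : HilbertBasis (ℤ × ℤ) ℂ (Lp ℂ 2 torusMeasure) :=
  HilbertBasis.mkOfOrthogonalEqBot orthonormal_characterLp (by
    rw [Submodule.eq_bot_iff]
    intro f hf
    rw [Lp.eq_zero_iff_ae_eq_zero]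
    refine ae_zero_of_scalarCoeff (Lp.memLp f) fun k => ?_
    have := (Submodule.mem_orthogonal _ _).1 hf _ (Submodule.subset_span ⟨k, rfl⟩)
    rw [inner_characterLp] at this
    exact (mul_eq_zero.1 this).resolve_left two_pi_ne_zero)

theorem coe_fourierBasis (k : ℤ × ℤ) : fourierBasis k = characterLp k :=
  congrFun (HilbertBasis.coe_mkOfOrthogonalEqBot _ _) k

theorem inner_fourierBasis (k : ℤ × ℤ) {f : ℝ × ℝ → ℂ} (hf : MemLp f 2 torusMeasure) :
    inner ℂ (fourierBasis k) hf.toLp = 2 * Real.pi * scalarCoeff f k := by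
  rw [coe_fourierBasis, inner_characterLp, scalarCoeff_congr hf.coeFn_toLp]

theorem conj_scalarCoeff (f : ℝ × ℝ → ℂ) (k : ℤ × ℤ) :
    scalarCoeff (fun x => (starRingEnd ℂ) (f x)) k = (starRingEnd ℂ) (scalarCoeff f (-k)) := by
  unfold scalarCoeff
  rw [map_mul, ← integral_conj, map_div₀, map_pow, conj_two_pi, map_one]
  congr 2; ext x
  rw [map_mul, conj_character, neg_neg]

/-- The Fourier coefficients of a product are given by a convolution. -/
theorem hasSum_scalarCoeff_mul {f g : ℝ × ℝ → ℂ} (hf : MemLp f 2 torusMeasure)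
    (hg : MemLp g 2 torusMeasure) (m : ℤ × ℤ) :
    HasSum (fun l => scalarCoeff f (m - l) * scalarCoeff g l)
      (scalarCoeff (fun x => f x * g x) m) := by
  -- The coefficient of $fg$ at $m$ is, up to $(2\pi)^2$, the inner product of $e^{im\cdot x}\bar f$
  -- with $g$; Parseval's identity expands it in the characters.
  have hx : MemLp (fun x => character m x * (starRingEnd ℂ) (f x)) 2 torusMeasure := by
    refine MemLp.of_le hf ((continuous_character m).aestronglyMeasurable.mul
      (RCLike.continuous_conj.comp_aestronglyMeasurable hf.1)) (Filter.Eventually.of_forall fun x => ?_)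
    rw [norm_mul, norm_character, one_mul, RCLike.norm_conj]
  have h := fourierBasis.hasSum_inner_mul_inner hx.toLp hg.toLp
  have h1 : ∀ l, inner ℂ hx.toLp (fourierBasis l) = 2 * Real.pi * scalarCoeff f (m - l) := fun l => by
    rw [← inner_conj_symm, inner_fourierBasis, map_mul, conj_two_pi]
    congr 1
    unfold scalarCoeff
    rw [map_mul, ← integral_conj, map_div₀, map_pow, conj_two_pi, map_one]
    congr 2; ext x
    rw [map_mul, map_mul, conj_character, conj_character, Complex.conj_conj, ← mul_assoc,
      character_mul]
    congr 2; abel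
  have h2 : inner ℂ hx.toLp hg.toLp = (2 * (Real.pi : ℂ)) ^ 2 * scalarCoeff (fun x => f x * g x) m := by
    rw [L2.inner_def]
    unfold scalarCoeff
    rw [← mul_assoc, mul_one_div_cancel (pow_ne_zero _ two_pi_ne_zero), one_mul]
    refine integral_congr_ae ?_
    filter_upwards [hx.coeFn_toLp, hg.coeFn_toLp] with x e1 e2
    rw [e1, e2, RCLike.inner_apply, map_mul, conj_character, Complex.conj_conj]
    ring
  simp only [h1, inner_fourierBasis] at h
  rw [h2] at h
  have h3 := h.mul_left (1 / (2 * (Real.pi : ℂ)) ^ 2)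
  have := two_pi_ne_zero
  rw [← mul_assoc, one_div_mul_cancel (pow_ne_zero _ this), one_mul] at h3
  refine h3.congr_fun fun l => ?_
  field_simp

theorem hasSum_norm_scalarCoeff_sq {f : ℝ × ℝ → ℂ} (hf : MemLp f 2 torusMeasure) :
    HasSum (fun k => (2 * Real.pi) ^ 2 * ‖scalarCoeff f k‖ ^ 2) (∫ x, ‖f x‖ ^ 2 ∂torusMeasure) := by
  have h := fourierBasis.hasSum_inner_mul_inner hf.toLp hf.toLp
  have h1 := (Complex.reCLM.hasSum h)
  have e : ∫ x, ‖f x‖ ^ 2 ∂torusMeasure = Complex.reCLM (inner ℂ hf.toLp hf.toLp) := by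
    rw [L2.inner_def, ← ContinuousLinearMap.integral_comp_comm _ (L2.integrable_inner _ _)]
    refine integral_congr_ae ?_
    filter_upwards [hf.coeFn_toLp] with x hx
    rw [hx, inner_self_eq_norm_sq_to_K]
    change _ = (((‖f x‖ : ℝ) : ℂ) ^ 2).re
    rw [← Complex.ofReal_pow, Complex.ofReal_re]
  rw [e]
  convert h1 using 2 with k
  rw [← inner_conj_symm, inner_fourierBasis, Complex.conj_mul', norm_mul, norm_mul]
  change _ = Complex.re _
  rw [← Complex.ofReal_pow, Complex.ofReal_re]
  simp [abs_of_pos Real.pi_pos, mul_pow]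

/-- The Riesz-Fischer theorem on the torus. -/
theorem exists_scalarCoeff_eq {a : ℤ × ℤ → ℂ} (ha : Memℓp a 2) :
    ∃ f : ℝ × ℝ → ℂ, MemLp f 2 torusMeasure ∧ ∀ k, scalarCoeff f k = a k := by
  have ha' : Memℓp (fun k => (2 * (Real.pi : ℂ)) * a k) 2 := ha.const_smul (2 * (Real.pi : ℂ))
  set f : Lp ℂ 2 torusMeasure := fourierBasis.repr.symm ⟨_, ha'⟩
  refine ⟨f, Lp.memLp f, fun k => ?_⟩
  have h1 : fourierBasis.repr f k = 2 * Real.pi * a k := by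
    rw [LinearIsometryEquiv.apply_symm_apply]
  rw [fourierBasis.repr_apply_apply, coe_fourierBasis, inner_characterLp] at h1
  exact mul_left_cancel₀ two_pi_ne_zero h1

/-! ### Fields and their coefficients -/

theorem coeff_apply (u : H) (k : ℤ × ℤ) (j : Fin 2) :
    coeff u k j = scalarCoeff (fun x => (((u : L2Torus) x j : ℝ) : ℂ)) k := rfl

theorem coeff_add (u v : H) : coeff (u + v) = coeff u + coeff v := by simp [coeff]
theorem coeff_sub (u v : H) : coeff (u - v) = coeff u - coeff v := by simp [coeff]
theorem coeff_smul (a : ℝ) (u : H) : coeff (a • u) = a • coeff u := by simp [coeff]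
theorem coeff_zero : coeff 0 = 0 := by simp [coeff]

theorem coeff_injective : Function.Injective coeff := fun _ _ h =>
  Subtype.ext (fourierMap_injective h)

theorem coeff_neg_apply (u : H) (k : ℤ × ℤ) (j : Fin 2) :
    coeff u (-k) j = (starRingEnd ℂ) (coeff u k j) := by
  have := conj_scalarCoeff (fun x => (((u : L2Torus) x j : ℝ) : ℂ)) (-k)
  rw [neg_neg] at this
  rw [coeff_apply, coeff_apply, ← this]
  simp

theorem coeff_div (u : H) (k : ℤ × ℤ) : ∑ j, (freq k j : ℂ) * coeff u k j = 0 := u.2 k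

theorem hasSum_norm_coeff_sq (u : H) :
    HasSum (fun k => (2 * Real.pi) ^ 2 * ‖coeff u k‖ ^ 2) (‖u‖ ^ 2) := by
  have h := hasSum_sum (s := Finset.univ) fun (j : Fin 2) _ =>
    hasSum_norm_scalarCoeff_sq (memLp_component (u : L2Torus) j)
  have e : ‖u‖ ^ 2 = ∑ j : Fin 2, ∫ x, ‖(((u : L2Torus) x j : ℝ) : ℂ)‖ ^ 2 ∂torusMeasure := by
    rw [← integral_finsetSum _ fun j _ => (memLp_component (u : L2Torus) j).integrable_norm_pow']
    change ‖(u : L2Torus)‖ ^ 2 = _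
    rw [← real_inner_self_eq_norm_sq, L2.inner_def]
    congr 1; ext x
    rw [real_inner_self_eq_norm_sq, EuclideanSpace.norm_sq_eq]
    simp
  rw [e]
  convert h using 2 with k
  rw [← Finset.mul_sum, EuclideanSpace.norm_sq_eq]
  rfl

/-- The field with given coefficients. -/
theorem exists_coeff_eq {c : ℤ × ℤ → CPlane}
    (hc : ∀ k j, c (-k) j = (starRingEnd ℂ) (c k j))
    (hdiv : ∀ k, ∑ j, (freq k j : ℂ) * c k j = 0) (hs : Summable fun k => ‖c k‖ ^ 2) :
    ∃ u : H, coeff u = c := by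
  have hj : ∀ j, ∃ f : ℝ × ℝ → ℂ, MemLp f 2 torusMeasure ∧ ∀ k, scalarCoeff f k = c k j := fun j => by
    refine exists_scalarCoeff_eq (memℓp_gen ?_)
    simp only [ENNReal.toReal_ofNat, Real.rpow_ofNat]
    refine hs.of_nonneg_of_le (fun _ => by positivity) fun k => ?_
    gcongr
    exact PiLp.norm_apply_le (c k) j
  choose f hf hfc using hj
  -- The symmetry of the coefficients says that $f_j$ and its conjugate have the same ones, so $f_j$
  -- is real almost everywhere.
  have hreal : ∀ j, ∀ᵐ x ∂torusMeasure, f j x - (starRingEnd ℂ) (f j x) = 0 := fun j => by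
    have hconj : MemLp (fun x => (starRingEnd ℂ) (f j x)) 2 torusMeasure :=
      (hf j).of_le (RCLike.continuous_conj.comp_aestronglyMeasurable (hf j).1)
        (Filter.Eventually.of_forall fun x => (RCLike.norm_conj _).le)
    refine ae_zero_of_scalarCoeff ((hf j).sub hconj) fun k => ?_
    have h1 := conj_scalarCoeff (f j) k
    rw [hfc, hc, Complex.conj_conj, ← hfc j k] at h1
    unfold scalarCoeff at h1 ⊢
    simp only [mul_sub]
    rw [integral_sub (integrable_character_mul _ ((hf j).integrable (by norm_num)))
      (integrable_character_mul _ (hconj.integrable (by norm_num))), mul_sub, h1, sub_self]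
  have hm : MemLp (fun x => (WithLp.toLp 2 fun j => (f j x).re : Plane)) 2 torusMeasure :=
    MemLp.of_eval_piLp fun j => (hf j).re
  have hco : ∀ k, fourierMap hm.toLp k = c k := fun k => by
    ext j
    rw [← hfc j k]
    refine scalarCoeff_congr ?_ k
    filter_upwards [hm.coeFn_toLp, hreal j] with x h1 h2
    rw [h1]
    change (((f j x).re : ℝ) : ℂ) = f j x
    exact Complex.conj_eq_iff_re.1 (sub_eq_zero.1 h2).symm
  refine ⟨⟨hm.toLp, fun k => ?_⟩, funext hco⟩
  rw [hco]; exact hdiv k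

/-! ### The trilinear estimate -/

theorem tsum_mul_le_sqrt {ι : Type*} [Countable ι] (f g : ι → ℝ≥0∞) :
    ∑' i, f i * g i ≤ (∑' i, f i ^ 2) ^ (1 / 2 : ℝ) * (∑' i, g i ^ 2) ^ (1 / 2 : ℝ) := by
  let _ : MeasurableSpace ι := ⊤
  have h := ENNReal.lintegral_mul_le_Lp_mul_Lq (Measure.count : Measure ι) (p := 2) (q := 2)
    (by constructor <;> norm_num) (f := f) (g := g) (measurable_from_top).aemeasurable
    (measurable_from_top).aemeasurable
  simpa [lintegral_count] using h

/-- `∑ (1 + n²)⁻¹` over the integers. -/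
def japaneseSum : ℝ≥0∞ := ∑' n : ℤ, ENNReal.ofReal (1 + (n : ℝ) ^ 2)⁻¹

theorem japaneseSum_ne_top : japaneseSum ≠ ∞ := by
  have h : Summable fun n : ℤ => (1 + (n : ℝ) ^ 2)⁻¹ := by
    have h2 : Summable fun n : ℤ => 1 / (n : ℝ) ^ 2 :=
      Real.summable_one_div_int_pow.2 (by norm_num)
    refine (h2.add (summable_of_hasFiniteSupport (f := fun n : ℤ => if n = 0 then (1 : ℝ) else 0)
      ((finite_singleton (0 : ℤ)).subset fun n hn => ?_))).of_nonneg_of_le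
      (fun n => by positivity) fun n => ?_
    · by_contra h
      simp only [mem_singleton_iff] at h
      simp [h] at hn
    · by_cases hn : n = 0
      · simp [hn]
      · have : (0 : ℝ) < (n : ℝ) ^ 2 := by positivity
        simp only [hn, if_false, add_zero, one_div]
        gcongr
        linarith
  unfold japaneseSum
  rw [← ENNReal.ofReal_tsum_of_nonneg (fun n => by positivity) h]
  exact ENNReal.ofReal_ne_top

/-- The Fourier form of the embeddings of one derivative in $x_1$ into $L^2_{x_2}L^\infty_{x_1}$ and
of one in $x_2$ into $L^2_{x_1}L^\infty_{x_2}$: the product of two such functions lies in $L^2$. The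
weights $\sqrt{1+k_1^2}$ on $a$ and $\sqrt{1+l_2^2}$ on $b$, together with their inverses, are
inserted before the Cauchy-Schwarz inequality over pairs $(k,l)$. -/
theorem tsum_convolution_le (a b c : ℤ × ℤ → ℝ≥0∞) :
    ∑' k, ∑' l, a k * b l * c (k + l) ≤ japaneseSum *
      ((∑' k : ℤ × ℤ, ENNReal.ofReal (1 + (k.1 : ℝ) ^ 2) * a k ^ 2) *
      (∑' k : ℤ × ℤ, ENNReal.ofReal (1 + (k.2 : ℝ) ^ 2) * b k ^ 2) * ∑' k, c k ^ 2) ^ (1 / 2 : ℝ) := by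
  set ω : ℤ → ℝ≥0∞ := fun n => ENNReal.ofReal √(1 + (n : ℝ) ^ 2) with hω
  set ω' : ℤ → ℝ≥0∞ := fun n => ENNReal.ofReal (√(1 + (n : ℝ) ^ 2))⁻¹ with hω'
  have h1 : ∀ n, ω n * ω' n = 1 := fun n => by
    rw [hω, hω', ← ENNReal.ofReal_mul (Real.sqrt_nonneg _), mul_inv_cancel₀ (by positivity),
      ENNReal.ofReal_one]
  have h2 : ∀ n, ω n ^ 2 = ENNReal.ofReal (1 + (n : ℝ) ^ 2) := fun n => by
    rw [hω, ← ENNReal.ofReal_pow (Real.sqrt_nonneg _), Real.sq_sqrt (by positivity)]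
  have h3 : ∑' n, ω' n ^ 2 = japaneseSum := by
    unfold japaneseSum
    congr 1; ext n
    rw [hω', ← ENNReal.ofReal_pow (by positivity), inv_pow, Real.sq_sqrt (by positivity)]
  -- With $m=k+l$ fixed, $k_1$ and $l_2=m_2-k_2$ range independently over the integers, so the
  -- double sum of inverse weights factorises.
  have hS : ∀ m : ℤ × ℤ, ∑' k : ℤ × ℤ, ω' k.1 ^ 2 * ω' (m.2 - k.2) ^ 2 = japaneseSum ^ 2 := fun m => by
    rw [ENNReal.tsum_prod (f := fun (i j : ℤ) => ω' i ^ 2 * ω' (m.2 - j) ^ 2)]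
    simp only [ENNReal.tsum_mul_left, ENNReal.tsum_mul_right]
    have e := (Equiv.subLeft m.2).tsum_eq (fun j => ω' j ^ 2)
    simp only [Equiv.subLeft_apply] at e
    rw [e, h3, sq]
  calc ∑' k, ∑' l, a k * b l * c (k + l)
      = ∑' z : (ℤ × ℤ) × (ℤ × ℤ), (ω z.1.1 * a z.1 * (ω z.2.2 * b z.2)) *
          (ω' z.1.1 * ω' z.2.2 * c (z.1 + z.2)) := by
        rw [ENNReal.tsum_prod (f := fun (k l : ℤ × ℤ) => (ω k.1 * a k * (ω l.2 * b l)) *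
          (ω' k.1 * ω' l.2 * c (k + l)))]
        congr 1; ext k; congr 1; ext l
        calc a k * b l * c (k + l) = (ω k.1 * ω' k.1) * (ω l.2 * ω' l.2) * (a k * b l * c (k + l)) := by
              rw [h1, h1, one_mul, one_mul]
          _ = _ := by ring
    _ ≤ _ := tsum_mul_le_sqrt _ _
    _ = ((∑' k : ℤ × ℤ, ENNReal.ofReal (1 + (k.1 : ℝ) ^ 2) * a k ^ 2) *
      (∑' k : ℤ × ℤ, ENNReal.ofReal (1 + (k.2 : ℝ) ^ 2) * b k ^ 2)) ^ (1 / 2 : ℝ) *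
        (japaneseSum ^ 2 * ∑' k, c k ^ 2) ^ (1 / 2 : ℝ) := by
        congr 2
        · rw [ENNReal.tsum_prod (f := fun (k l : ℤ × ℤ) => (ω k.1 * a k * (ω l.2 * b l)) ^ 2)]
          simp only [mul_pow, h2, ENNReal.tsum_mul_left, ENNReal.tsum_mul_right]
        · rw [ENNReal.tsum_prod (f := fun (k l : ℤ × ℤ) => (ω' k.1 * ω' l.2 * c (k + l)) ^ 2)]
          calc ∑' k : ℤ × ℤ, ∑' l : ℤ × ℤ, (ω' k.1 * ω' l.2 * c (k + l)) ^ 2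
              = ∑' k : ℤ × ℤ, ∑' m : ℤ × ℤ, (ω' k.1 * ω' (m.2 - k.2) * c m) ^ 2 := by
                congr 1; ext k
                rw [← (Equiv.addLeft k).tsum_eq
                  (fun m : ℤ × ℤ => (ω' k.1 * ω' (m.2 - k.2) * c m) ^ 2)]
                simp
            _ = ∑' m : ℤ × ℤ, ∑' k : ℤ × ℤ, (ω' k.1 * ω' (m.2 - k.2) * c m) ^ 2 := ENNReal.tsum_comm
            _ = _ := by
                simp only [mul_pow, ENNReal.tsum_mul_right, hS, ENNReal.tsum_mul_left]
    _ = _ := by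
        have h4 : (0 : ℝ) ≤ 1 / 2 := by norm_num
        rw [ENNReal.mul_rpow_of_nonneg (japaneseSum ^ 2) _ h4,
          ENNReal.mul_rpow_of_nonneg _ (∑' k, c k ^ 2) h4, ← ENNReal.rpow_natCast japaneseSum,
          ← ENNReal.rpow_mul]
        norm_num
        ring

/-- `∑ (1 + k₁²)^a (1 + k₂²)^b |c_k|²`. -/
def anisoEnergy (a b : ℕ) (c : ℤ × ℤ → CPlane) : ℝ≥0∞ :=
  ∑' k : ℤ × ℤ, ENNReal.ofReal ((1 + (k.1 : ℝ) ^ 2) ^ a * (1 + (k.2 : ℝ) ^ 2) ^ b) * ‖c k‖ₑ ^ 2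

/-- `∑ |u_k · l| |v_l| |z_{k+l}|`. -/
def advection (u v z : ℤ × ℤ → CPlane) : ℝ≥0∞ :=
  ∑' k, ∑' l, ‖∑ j, (freq l j : ℂ) * u k j‖ₑ * ‖v l‖ₑ * ‖z (k + l)‖ₑ

theorem enorm_sq_eq (x : CPlane) : ‖x‖ₑ ^ 2 = ‖x 0‖ₑ ^ 2 + ‖x 1‖ₑ ^ 2 := by
  simp only [← ofReal_norm]
  rw [← ENNReal.ofReal_pow (norm_nonneg _), ← ENNReal.ofReal_pow (norm_nonneg _),
    ← ENNReal.ofReal_pow (norm_nonneg _), ← ENNReal.ofReal_add (by positivity) (by positivity),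
    EuclideanSpace.norm_sq_eq]
  simp

theorem enorm_intCast_sq (n : ℤ) : ‖((n : ℝ) : ℂ)‖ₑ ^ 2 = ENNReal.ofReal ((n : ℝ) ^ 2) := by
  rw [← ofReal_norm, ← ENNReal.ofReal_pow (norm_nonneg _), Complex.norm_real, Real.norm_eq_abs,
    sq_abs]

/-- The two components of $u$ are treated with exchanged roles. For $u^1\partial_1v$ the derivative
in $x_1$ is taken from $u^1$ and the one in $x_2$ from $v$. For $u^2\partial_2v$ it is the other way
round, and the derivative of $u^2$ in $x_2$ comes from the divergence condition. This is why no
regularity of $u$ in the second variable is needed. -/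
theorem advection_le {u v z : ℤ × ℤ → CPlane} (hu : ∀ k, ∑ j, (freq k j : ℂ) * u k j = 0) :
    advection u v z ≤ 2 * japaneseSum *
      (anisoEnergy 1 0 u * anisoEnergy 1 1 v * anisoEnergy 0 0 z) ^ (1 / 2 : ℝ) := by
  have hz : ∑' k, ‖z k‖ₑ ^ 2 = anisoEnergy 0 0 z := by simp [anisoEnergy]
  have hA : ∑' k, ∑' l, ‖u k 0‖ₑ * (‖((l.1 : ℝ) : ℂ)‖ₑ * ‖v l‖ₑ) * ‖z (k + l)‖ₑ ≤ japaneseSum *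
      (anisoEnergy 1 0 u * anisoEnergy 1 1 v * anisoEnergy 0 0 z) ^ (1 / 2 : ℝ) := by
    refine (tsum_convolution_le (fun k => ‖u k 0‖ₑ) (fun l => ‖((l.1 : ℝ) : ℂ)‖ₑ * ‖v l‖ₑ)
      (fun m => ‖z m‖ₑ)).trans ?_
    rw [hz]
    unfold anisoEnergy
    refine mul_le_mul' le_rfl (ENNReal.rpow_le_rpow (mul_le_mul' (mul_le_mul'
      (ENNReal.tsum_le_tsum fun k => ?_) (ENNReal.tsum_le_tsum fun k => ?_)) le_rfl) (by norm_num))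
    · rw [enorm_sq_eq, pow_one, pow_zero, mul_one]
      gcongr
      exact le_self_add
    · rw [mul_pow, enorm_intCast_sq, ← mul_assoc, ← ENNReal.ofReal_mul (by positivity)]
      refine mul_le_mul' (ENNReal.ofReal_le_ofReal ?_) le_rfl
      nlinarith [sq_nonneg (k.2 : ℝ)]
  have hB : ∑' k, ∑' l, ‖u k 1‖ₑ * (‖((l.2 : ℝ) : ℂ)‖ₑ * ‖v l‖ₑ) * ‖z (k + l)‖ₑ ≤ japaneseSum *
      (anisoEnergy 1 0 u * anisoEnergy 1 1 v * anisoEnergy 0 0 z) ^ (1 / 2 : ℝ) := by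
    rw [ENNReal.tsum_comm]
    have : ∀ k l : ℤ × ℤ, ‖u k 1‖ₑ * (‖((l.2 : ℝ) : ℂ)‖ₑ * ‖v l‖ₑ) * ‖z (k + l)‖ₑ =
        (‖((l.2 : ℝ) : ℂ)‖ₑ * ‖v l‖ₑ) * ‖u k 1‖ₑ * ‖z (l + k)‖ₑ := fun k l => by
      rw [add_comm k l]; ring
    simp only [this]
    refine (tsum_convolution_le (fun l => ‖((l.2 : ℝ) : ℂ)‖ₑ * ‖v l‖ₑ) (fun k => ‖u k 1‖ₑ)
      (fun m => ‖z m‖ₑ)).trans ?_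
    rw [hz, mul_comm (anisoEnergy 1 0 u)]
    unfold anisoEnergy
    refine mul_le_mul' le_rfl (ENNReal.rpow_le_rpow (mul_le_mul' (mul_le_mul'
      (ENNReal.tsum_le_tsum fun k => ?_) (ENNReal.tsum_le_tsum fun k => ?_)) le_rfl) (by norm_num))
    · rw [mul_pow, enorm_intCast_sq, ← mul_assoc, ← ENNReal.ofReal_mul (by positivity)]
      refine mul_le_mul' (ENNReal.ofReal_le_ofReal ?_) le_rfl
      nlinarith [sq_nonneg (k.1 : ℝ)]
    · have hd := hu k
      simp only [Fin.sum_univ_two, freq, Matrix.cons_val_zero, Matrix.cons_val_one] at hd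
      -- Incompressibility: $|k_2\hat u^2_k|=|k_1\hat u^1_k|$.
      have h1 : ‖((k.2 : ℝ) : ℂ)‖ₑ ^ 2 * ‖u k 1‖ₑ ^ 2 = ‖((k.1 : ℝ) : ℂ)‖ₑ ^ 2 * ‖u k 0‖ₑ ^ 2 := by
        rw [← mul_pow, ← mul_pow, ← enorm_mul, ← enorm_mul, eq_neg_of_add_eq_zero_right hd, enorm_neg]
      rw [enorm_intCast_sq, enorm_intCast_sq] at h1
      rw [ENNReal.ofReal_add zero_le_one (by positivity), add_mul, h1, pow_one, pow_zero, mul_one,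
        ENNReal.ofReal_add zero_le_one (by positivity), enorm_sq_eq, ENNReal.ofReal_one]
      calc 1 * ‖u k 1‖ₑ ^ 2 + ENNReal.ofReal ((k.1 : ℝ) ^ 2) * ‖u k 0‖ₑ ^ 2 =
          ENNReal.ofReal ((k.1 : ℝ) ^ 2) * ‖u k 0‖ₑ ^ 2 + ‖u k 1‖ₑ ^ 2 := by ring
        _ ≤ (ENNReal.ofReal ((k.1 : ℝ) ^ 2) * ‖u k 0‖ₑ ^ 2 + ‖u k 1‖ₑ ^ 2) +
          (ENNReal.ofReal ((k.1 : ℝ) ^ 2) * ‖u k 1‖ₑ ^ 2 + ‖u k 0‖ₑ ^ 2) := le_self_add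
        _ = _ := by ring
  calc advection u v z ≤ ∑' k, ∑' l, (‖u k 0‖ₑ * (‖((l.1 : ℝ) : ℂ)‖ₑ * ‖v l‖ₑ) * ‖z (k + l)‖ₑ +
        ‖u k 1‖ₑ * (‖((l.2 : ℝ) : ℂ)‖ₑ * ‖v l‖ₑ) * ‖z (k + l)‖ₑ) := by
        unfold advection
        refine ENNReal.tsum_le_tsum fun k => ENNReal.tsum_le_tsum fun l => ?_
        rw [← add_mul]
        gcongr
        rw [Fin.sum_univ_two]
        refine (mul_le_mul_left (enorm_add_le _ _) _).trans (le_of_eq ?_)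
        rw [enorm_mul, enorm_mul]
        simp only [freq, Matrix.cons_val_zero, Matrix.cons_val_one]
        ring
    _ ≤ japaneseSum * (anisoEnergy 1 0 u * anisoEnergy 1 1 v * anisoEnergy 0 0 z) ^ (1 / 2 : ℝ) +
        japaneseSum * (anisoEnergy 1 0 u * anisoEnergy 1 1 v * anisoEnergy 0 0 z) ^ (1 / 2 : ℝ) := by
        simp only [ENNReal.tsum_add]
        exact add_le_add hA hB
    _ = _ := by ring

/-! ### The convection term in Fourier coefficients -/

theorem hasSum_cplane {ι : Type*} {f : ι → CPlane} {a : CPlane}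
    (h : ∀ j, HasSum (fun i => f i j) (a j)) : HasSum f a := by
  have h1 : HasSum (fun i => (EuclideanSpace.equiv (Fin 2) ℂ) (f i)) ((EuclideanSpace.equiv (Fin 2) ℂ) a) :=
    Pi.hasSum.2 h
  have h2 := (EuclideanSpace.equiv (Fin 2) ℂ).symm.hasSum.2 h1
  simpa using h2

theorem enorm_le_tsum_of_hasSum {ι E : Type*} [NormedAddCommGroup E] {f : ι → E} {a : E}
    (h : HasSum f a) : ‖a‖ₑ ≤ ∑' i, ‖f i‖ₑ := by
  rw [← h.tsum_eq]; exact enorm_tsum_le_tsum_enorm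

theorem real_inner_cplane (x y : CPlane) : inner ℝ x y = (inner ℂ x y).re := by
  simp [PiLp.inner_apply, Complex.inner]

theorem leray_apply (k : ℤ × ℤ) (z : CPlane) (j : Fin 2) : leray k z j =
    z j - ((∑ i, (freq k i : ℂ) * z i) / (∑ i, (freq k i : ℂ) ^ 2)) * (freq k j : ℂ) := rfl

/-- The Leray projection as a linear map. -/
def lerayLin (k : ℤ × ℤ) : CPlane →L[ℂ] CPlane := LinearMap.toContinuousLinearMap
  { toFun := leray k
    map_add' := fun x y => by
      ext j
      simp only [leray_apply, PiLp.add_apply, mul_add, Finset.sum_add_distrib]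
      ring
    map_smul' := fun a x => by
      ext j
      simp only [leray_apply, PiLp.smul_apply, smul_eq_mul, mul_left_comm _ a, ← Finset.mul_sum,
        RingHom.id_apply]
      ring }

theorem lerayLin_apply (k : ℤ × ℤ) (z : CPlane) : lerayLin k z = leray k z := rfl

theorem freq_sq_sum_eq_zero {k : ℤ × ℤ} (h : ∑ i, (freq k i : ℂ) ^ 2 = 0) (j : Fin 2) :
    freq k j = 0 := by
  have h1 : (freq k 0) ^ 2 + (freq k 1) ^ 2 = 0 := by
    rw [Fin.sum_univ_two] at h; exact_mod_cast h
  fin_cases j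
  · simp only [Fin.zero_eta]; nlinarith [sq_nonneg (freq k 0), sq_nonneg (freq k 1)]
  · simp only [Fin.mk_one]; nlinarith [sq_nonneg (freq k 0), sq_nonneg (freq k 1)]

theorem leray_div (k : ℤ × ℤ) (z : CPlane) : ∑ j, (freq k j : ℂ) * leray k z j = 0 := by
  by_cases h : ∑ i, (freq k i : ℂ) ^ 2 = 0
  · simp [freq_sq_sum_eq_zero h]
  · simp only [leray_apply, mul_sub, Finset.sum_sub_distrib]
    rw [sub_eq_zero]
    have : ∀ j, (freq k j : ℂ) * ((∑ i, (freq k i : ℂ) * z i) / (∑ i, (freq k i : ℂ) ^ 2) *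
        (freq k j : ℂ)) = ((∑ i, (freq k i : ℂ) * z i) / (∑ i, (freq k i : ℂ) ^ 2)) *
        (freq k j : ℂ) ^ 2 := fun j => by ring
    simp only [this]
    rw [← Finset.mul_sum, div_mul_cancel₀ _ h]

/-- The projection subtracts a multiple of $k$, and $z$ is orthogonal to $k$. So the pressure
disappears from every energy balance. -/
theorem inner_leray {k : ℤ × ℤ} {z : CPlane} (hz : ∑ j, (freq k j : ℂ) * z j = 0) (y : CPlane) :
    inner ℂ (leray k y) z = inner ℂ y z := by
  rw [← inner_conj_symm, ← inner_conj_symm y]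
  congr 1
  simp only [PiLp.inner_apply, RCLike.inner_apply, leray_apply, sub_mul, Finset.sum_sub_distrib]
  have h2 : ∑ j, (freq k j : ℂ) * (starRingEnd ℂ) (z j) = 0 := by
    have := congrArg (starRingEnd ℂ) hz
    simpa using this
  have : ∀ j, (∑ i, (freq k i : ℂ) * y i) / (∑ i, (freq k i : ℂ) ^ 2) * (freq k j : ℂ) *
      (starRingEnd ℂ) (z j) = (∑ i, (freq k i : ℂ) * y i) / (∑ i, (freq k i : ℂ) ^ 2) *
      ((freq k j : ℂ) * (starRingEnd ℂ) (z j)) := fun j => by ring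
  simp only [this]
  rw [← Finset.mul_sum, h2, mul_zero, sub_zero]

theorem norm_leray_le (k : ℤ × ℤ) (z : CPlane) : ‖leray k z‖ ≤ ‖z‖ := by
  have h := inner_leray (leray_div k z) z
  rw [inner_self_eq_norm_sq_to_K] at h
  have h2 : ‖leray k z‖ ^ 2 ≤ ‖z‖ * ‖leray k z‖ := by
    have h3 := norm_inner_le_norm (𝕜 := ℂ) z (leray k z)
    rw [← h] at h3
    simpa using h3
  nlinarith [norm_nonneg (leray k z), norm_nonneg z]

theorem leray_conj {k : ℤ × ℤ} {y z : CPlane} (h : ∀ j, z j = (starRingEnd ℂ) (y j)) (j : Fin 2) :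
    leray (-k) z j = (starRingEnd ℂ) (leray k y j) := by
  have hf : ∀ j, freq (-k) j = - freq k j := fun j => by fin_cases j <;> simp [freq]
  simp only [leray_apply, hf, h, map_sub, map_mul, map_div₀, map_sum, map_pow, Complex.conj_ofReal]
  simp only [Complex.ofReal_neg, neg_mul, neg_sq, Finset.sum_neg_distrib, neg_div, mul_neg, neg_neg]

/-- The symbol `m · û_{m-l} = l · û_{m-l}`. -/
def advSymbol (u : H) (m l : ℤ × ℤ) : ℂ := ∑ i, (freq l i : ℂ) * coeff u (m - l) i

theorem advSymbol_eq (u : H) (m l : ℤ × ℤ) :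
    advSymbol u m l = ∑ i, (freq m i : ℂ) * coeff u (m - l) i := by
  have h := coeff_div u (m - l)
  have hf : ∀ i, (freq (m - l) i : ℂ) = freq m i - freq l i := fun i => by
    fin_cases i <;> simp [freq]
  simp only [hf, sub_mul, Finset.sum_sub_distrib] at h
  exact (sub_eq_zero.1 h).symm

/-- Since $u$ is divergence-free, $l$ may be exchanged with $m$ in the symbol, and since $u$ is
real, $\hat u_{l-m}$ is the conjugate of $\hat u_{m-l}$. With the factor $i$ this Hermitian symmetry
is the antisymmetry of $u\cdot\nabla$. -/
theorem advSymbol_swap (u : H) (m l : ℤ × ℤ) :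
    advSymbol u l m = (starRingEnd ℂ) (advSymbol u m l) := by
  rw [advSymbol_eq u m l, map_sum]
  unfold advSymbol
  refine Finset.sum_congr rfl fun i _ => ?_
  rw [map_mul, Complex.conj_ofReal, ← coeff_neg_apply, neg_sub]

theorem advSymbol_neg (u : H) (m l : ℤ × ℤ) :
    advSymbol u (-m) (-l) = -(starRingEnd ℂ) (advSymbol u m l) := by
  unfold advSymbol
  have hf : ∀ j, (freq (-l) j : ℂ) = - freq l j := fun j => by fin_cases j <;> simp [freq]
  rw [map_sum, ← Finset.sum_neg_distrib]
  refine Finset.sum_congr rfl fun i _ => ?_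
  rw [map_mul, Complex.conj_ofReal, ← coeff_neg_apply, hf, neg_mul, neg_sub_neg, neg_sub]

theorem hasSum_convection_aux (u v : H) (m : ℤ × ℤ) :
    HasSum (fun l => (Complex.I * advSymbol u m l) • coeff v l)
      (∑ i : Fin 2, (Complex.I * (freq m i : ℂ)) •
        fourierVec (fun x => ((u : L2Torus) x i) • ((v : L2Torus) x)) m) := by
  refine hasSum_cplane fun j => ?_
  have h := hasSum_sum (s := Finset.univ) fun (i : Fin 2) _ =>
    (hasSum_scalarCoeff_mul (memLp_component (u : L2Torus) i)
      (memLp_component (v : L2Torus) j) m).mul_left (Complex.I * (freq m i : ℂ))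
  have e : (∑ i : Fin 2, (Complex.I * (freq m i : ℂ)) •
      fourierVec (fun x => ((u : L2Torus) x i) • ((v : L2Torus) x)) m : CPlane) j =
      ∑ i : Fin 2, (Complex.I * (freq m i : ℂ)) * scalarCoeff
        (fun x => (((u : L2Torus) x i : ℝ) : ℂ) * (((v : L2Torus) x j : ℝ) : ℂ)) m := by
    simp [Fin.sum_univ_two, fourierVec]
  rw [e]
  refine h.congr_fun fun l => ?_
  rw [PiLp.smul_apply, smul_eq_mul, advSymbol_eq, Finset.mul_sum, Finset.sum_mul]
  refine Finset.sum_congr rfl fun i _ => ?_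
  rw [coeff_apply, coeff_apply]
  ring

theorem hasSum_convection (u v : H) (m : ℤ × ℤ) :
    HasSum (fun l => leray m ((Complex.I * advSymbol u m l) • coeff v l)) (convection u v m) :=
  (lerayLin m).hasSum (hasSum_convection_aux u v m)

theorem convection_div (u v : H) (m : ℤ × ℤ) : ∑ j, (freq m j : ℂ) * convection u v m j = 0 :=
  leray_div m _

theorem convection_neg_apply (u v : H) (m : ℤ × ℤ) (j : Fin 2) :
    convection u v (-m) j = (starRingEnd ℂ) (convection u v m j) := by
  refine leray_conj (fun j => ?_) j
  have h1 := (PiLp.proj 2 (fun _ : Fin 2 => ℂ) j : CPlane →L[ℂ] ℂ).hasSum (hasSum_convection_aux u v m)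
  have h2 := (PiLp.proj 2 (fun _ : Fin 2 => ℂ) j : CPlane →L[ℂ] ℂ).hasSum (hasSum_convection_aux u v (-m))
  have h3 := (Complex.conjCLE : ℂ →L[ℝ] ℂ).hasSum h1
  have h4 := (Equiv.neg (ℤ × ℤ)).hasSum_iff.2 h2
  refine h4.unique (h3.congr_fun fun l => ?_)
  change Complex.I * advSymbol u (-m) (-l) * coeff v (-l) j =
    (starRingEnd ℂ) (Complex.I * advSymbol u m l * coeff v l j)
  rw [advSymbol_neg, coeff_neg_apply, map_mul, map_mul, Complex.conj_I]
  ring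

theorem convection_add_left (u u' v : H) (m : ℤ × ℤ) :
    convection (u + u') v m = convection u v m + convection u' v m := by
  refine (hasSum_convection (u + u') v m).unique
    (((hasSum_convection u v m).add (hasSum_convection u' v m)).congr_fun fun l => ?_)
  simp only [← lerayLin_apply, ← map_add, ← add_smul, ← mul_add]
  congr 4
  simp [advSymbol, coeff_add, mul_add, Finset.sum_add_distrib]

theorem convection_add_right (u v v' : H) (m : ℤ × ℤ) :
    convection u (v + v') m = convection u v m + convection u v' m := by
  refine (hasSum_convection u (v + v') m).unique
    (((hasSum_convection u v m).add (hasSum_convection u v' m)).congr_fun fun l => ?_)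
  simp only [← lerayLin_apply, ← map_add, ← smul_add, coeff_add, Pi.add_apply]

theorem convection_smul_left (a : ℝ) (u v : H) (m : ℤ × ℤ) :
    convection (a • u) v m = a • convection u v m := by
  refine (hasSum_convection (a • u) v m).unique
    (((hasSum_convection u v m).const_smul a).congr_fun fun l => ?_)
  simp only [← lerayLin_apply]
  rw [← Complex.coe_smul, ← map_smul, smul_smul]
  congr 2
  simp only [advSymbol, coeff_smul, Pi.smul_apply, PiLp.smul_apply, Complex.real_smul, Finset.mul_sum]
  refine Finset.sum_congr rfl fun i _ => by ring

theorem convection_smul_right (a : ℝ) (u v : H) (m : ℤ × ℤ) :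
    convection u (a • v) m = a • convection u v m := by
  refine (hasSum_convection u (a • v) m).unique
    (((hasSum_convection u v m).const_smul a).congr_fun fun l => ?_)
  simp only [← lerayLin_apply]
  rw [← Complex.coe_smul, ← map_smul, smul_smul, coeff_smul, Pi.smul_apply, ← Complex.coe_smul a,
    smul_smul, mul_comm]

theorem enorm_convection_le (u v : H) (m : ℤ × ℤ) :
    ‖convection u v m‖ₑ ≤ ∑' l, ‖advSymbol u m l‖ₑ * ‖coeff v l‖ₑ := by
  refine (enorm_le_tsum_of_hasSum (hasSum_convection u v m)).trans (ENNReal.tsum_le_tsum fun l => ?_)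
  refine (enorm_le_iff_norm_le.2 (norm_leray_le m _)).trans (le_of_eq ?_)
  rw [enorm_smul, enorm_mul, ← ofReal_norm Complex.I, Complex.norm_I, ENNReal.ofReal_one, one_mul]

/-- The substitution $k=m-l$, carried out in `ℝ≥0∞`, where sums may be rearranged freely. -/
theorem tsum_advSymbol (u : H) (v : ℤ × ℤ → CPlane) (g : ℤ × ℤ → ℤ × ℤ → ℝ≥0∞) :
    ∑' m, ∑' l, ‖advSymbol u m l‖ₑ * ‖v l‖ₑ * g m l =
      ∑' k, ∑' l, ‖∑ j, (freq l j : ℂ) * coeff u k j‖ₑ * ‖v l‖ₑ * g (k + l) l := by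
  rw [ENNReal.tsum_comm, ENNReal.tsum_comm (f := fun k l => ‖∑ j, (freq l j : ℂ) * coeff u k j‖ₑ *
    ‖v l‖ₑ * g (k + l) l)]
  congr 1; ext l
  rw [← (Equiv.addRight l).tsum_eq (fun m => ‖advSymbol u m l‖ₑ * ‖v l‖ₑ * g m l)]
  simp [advSymbol]

theorem tsum_convection_le (u v : H) (z : ℤ × ℤ → CPlane) :
    ∑' m, ‖convection u v m‖ₑ * ‖z m‖ₑ ≤ advection (coeff u) (coeff v) z := by
  have := tsum_advSymbol u (coeff v) fun m _ => ‖z m‖ₑ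
  unfold advection
  rw [← this]
  refine ENNReal.tsum_le_tsum fun m => ?_
  rw [ENNReal.tsum_mul_right]
  exact mul_le_mul' (enorm_convection_le u v m) le_rfl

/-- The antisymmetry of the transport term, in the form of a commutator estimate. -/
theorem abs_tsum_convection_le (u X : H) {w : ℤ × ℤ → ℝ} {W : ℝ} (hw : ∀ k, |w k| ≤ W)
    (h : advection (coeff u) (coeff X) (coeff X) ≠ ∞) :
    ENNReal.ofReal |∑' m, w m ^ 2 * inner ℝ (convection u X m) (coeff X m)| ≤
      ∑' k, ∑' l, ‖∑ j, (freq l j : ℂ) * coeff u k j‖ₑ * ‖coeff X l‖ₑ *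
        (ENNReal.ofReal (|w (k + l)| * |w (k + l) - w l|) * ‖coeff X (k + l)‖ₑ) := by
  set τ : (ℤ × ℤ) × (ℤ × ℤ) → ℝ := fun z =>
    inner ℝ ((Complex.I * advSymbol u z.1 z.2) • coeff X z.2) (coeff X z.1) with hτ
  have hτn : ∀ z, ‖τ z‖ₑ ≤ ‖advSymbol u z.1 z.2‖ₑ * ‖coeff X z.2‖ₑ * ‖coeff X z.1‖ₑ := fun z => by
    rw [← ofReal_norm]
    refine (ENNReal.ofReal_le_ofReal (norm_inner_le_norm _ _)).trans (le_of_eq ?_)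
    rw [norm_smul, norm_mul, Complex.norm_I, one_mul, ENNReal.ofReal_mul (by positivity),
      ENNReal.ofReal_mul (by positivity), ofReal_norm, ofReal_norm, ofReal_norm]
  have hτs : Summable τ := by
    refine Summable.of_norm ?_
    have : ∑' z, ‖τ z‖ₑ ≠ ∞ := by
      refine ((ENNReal.tsum_le_tsum hτn).trans_lt ?_).ne
      rw [ENNReal.tsum_prod (f := fun m l => ‖advSymbol u m l‖ₑ * ‖coeff X l‖ₑ * ‖coeff X m‖ₑ),
        tsum_advSymbol u (coeff X) fun m _ => ‖coeff X m‖ₑ]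
      exact lt_top_iff_ne_top.2 h
    simpa using ENNReal.summable_toReal this
  have hanti : ∀ z, τ z.swap = - τ z := fun z => by
    simp only [hτ, Prod.fst_swap, Prod.snd_swap]
    rw [real_inner_cplane, real_inner_cplane, inner_smul_left, inner_smul_left,
      ← inner_conj_symm (coeff X z.1), advSymbol_swap, map_mul, map_mul, Complex.conj_conj,
      Complex.conj_I]
    simp only [Complex.mul_re, Complex.neg_re, Complex.neg_im, Complex.I_re, Complex.I_im,
      Complex.mul_im, Complex.conj_re, Complex.conj_im]
    ring
  -- Because the weight is bounded, all the weighted double series converge absolutely, so the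
  -- splitting and the exchange of indices below are legitimate.
  have hbd : ∀ f : (ℤ × ℤ) × (ℤ × ℤ) → ℝ, (∀ z, |f z| ≤ W ^ 2) → Summable fun z => f z * τ z := by
    intro f hf
    refine Summable.of_norm ((hτs.norm.mul_left (W ^ 2)).of_nonneg_of_le
      (fun _ => norm_nonneg _) fun z => ?_)
    rw [norm_mul]
    exact mul_le_mul_of_nonneg_right (hf z) (norm_nonneg _)
  have hW : 0 ≤ W := (abs_nonneg _).trans (hw 0)
  have hs1 := hbd (fun z => w z.1 * w z.1) fun z => by
    rw [abs_mul, sq]; exact mul_le_mul (hw _) (hw _) (abs_nonneg _) hW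
  have hs2 := hbd (fun z => w z.1 * w z.2) fun z => by
    rw [abs_mul, sq]; exact mul_le_mul (hw _) (hw _) (abs_nonneg _) hW
  -- The factor $w_mw_l$ is symmetric and `τ` antisymmetric. Subtracting this vanishing sum turns
  -- $w_m^2$ into $w_m(w_m-w_l)$.
  have hzero : ∑' z, w z.1 * w z.2 * τ z = 0 := by
    have h1 := (Equiv.prodComm (ℤ × ℤ) (ℤ × ℤ)).tsum_eq fun z => w z.1 * w z.2 * τ z
    simp only [Equiv.prodComm_apply, hanti, Prod.fst_swap, Prod.snd_swap, mul_neg, tsum_neg,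
      mul_comm (w (Prod.snd _))] at h1
    linarith
  have hmain : ∑' m, w m ^ 2 * inner ℝ (convection u X m) (coeff X m) =
      ∑' z : (ℤ × ℤ) × (ℤ × ℤ), (w z.1 * (w z.1 - w z.2)) * τ z := by
    have e1 : ∑' z : (ℤ × ℤ) × (ℤ × ℤ), (w z.1 * (w z.1 - w z.2)) * τ z =
        ∑' z, w z.1 * w z.1 * τ z := by
      have := hs1.tsum_sub hs2
      rw [hzero, sub_zero] at this
      rw [← this]
      congr 1; ext z; ring
    rw [e1, hs1.tsum_prod]
    congr 1; ext m
    have hl : HasSum (fun l => τ (m, l)) (inner ℝ (convection u X m) (coeff X m)) := by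
      have h1 := (hasSum_convection_aux u X m)
      have h2 := (innerSL ℝ (coeff X m)).hasSum h1
      have e2 : inner ℝ (convection u X m) (coeff X m) = innerSL ℝ (coeff X m)
          (∑ i : Fin 2, (Complex.I * (freq m i : ℂ)) •
        fourierVec (fun x => ((u : L2Torus) x i) • ((X : L2Torus) x)) m) := by
        rw [innerSL_apply_apply]
        refine Eq.trans ?_ (real_inner_comm _ _)
        rw [real_inner_cplane, real_inner_cplane]
        unfold convection
        rw [inner_leray (coeff_div X m)]
      rw [e2]
      refine h2.congr_fun fun l => ?_
      rw [innerSL_apply_apply, real_inner_comm]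
    rw [← hl.tsum_eq, ← tsum_mul_left]
    congr 1; ext l
    ring
  rw [hmain, ← Real.enorm_eq_ofReal_abs]
  have hs3 : Summable fun z : (ℤ × ℤ) × (ℤ × ℤ) => (w z.1 * (w z.1 - w z.2)) * τ z := by
    refine (hs1.sub hs2).congr fun z => by ring
  refine (enorm_le_tsum_of_hasSum hs3.hasSum).trans ?_
  have e3 := tsum_advSymbol u (coeff X) fun m l =>
    ENNReal.ofReal (|w m| * |w m - w l|) * ‖coeff X m‖ₑ
  rw [← e3, ← ENNReal.tsum_prod (f := fun m l => ‖advSymbol u m l‖ₑ * ‖coeff X l‖ₑ *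
    (ENNReal.ofReal (|w m| * |w m - w l|) * ‖coeff X m‖ₑ))]
  refine ENNReal.tsum_le_tsum fun z => ?_
  rw [enorm_mul, Real.enorm_eq_ofReal_abs, abs_mul]
  refine (mul_le_mul' le_rfl (hτn z)).trans (le_of_eq ?_)
  ring

/-! ### The space `H` in Fourier coefficients -/

theorem norm_sq_eq_tsum_coeff (u : H) : ‖u‖ ^ 2 = (2 * Real.pi) ^ 2 * ∑' k, ‖coeff u k‖ ^ 2 := by
  rw [← tsum_mul_left, (hasSum_norm_coeff_sq u).tsum_eq]

theorem summable_norm_coeff_sq (u : H) : Summable fun k => ‖coeff u k‖ ^ 2 :=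
  (summable_mul_left_iff (by positivity)).1 (hasSum_norm_coeff_sq u).summable

theorem anisoEnergy_zero_zero_eq (c : ℤ × ℤ → CPlane) : anisoEnergy 0 0 c = ∑' k, ‖c k‖ₑ ^ 2 := by
  simp [anisoEnergy]

theorem anisoEnergy_coeff (u : H) :
    anisoEnergy 0 0 (coeff u) = ENNReal.ofReal (‖u‖ ^ 2 / (2 * Real.pi) ^ 2) := by
  rw [anisoEnergy_zero_zero_eq, norm_sq_eq_tsum_coeff, mul_div_cancel_left₀ _ (by positivity),
    ENNReal.ofReal_tsum_of_nonneg (fun _ => by positivity) (summable_norm_coeff_sq u)]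
  congr 1; ext k
  rw [ENNReal.ofReal_pow (norm_nonneg _), ofReal_norm]

theorem one_le_two_pi : 1 ≤ 2 * Real.pi := by linarith [Real.pi_gt_three]

theorem norm_coeff_le (u : H) (k : ℤ × ℤ) : ‖coeff u k‖ ≤ ‖u‖ := by
  have h := (summable_norm_coeff_sq u).le_tsum k fun _ _ => by positivity
  have h2 := norm_sq_eq_tsum_coeff u
  have h3 : (1 : ℝ) ≤ (2 * Real.pi) ^ 2 := one_le_pow₀ one_le_two_pi
  refine abs_le_of_sq_le_sq' ?_ (norm_nonneg _) |>.2
  nlinarith [sq_nonneg ‖coeff u k‖]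

theorem norm_le_of_coeff_le {u v : H} {M : ℝ} (hM : 0 ≤ M)
    (h : ∀ k, ‖coeff u k‖ ≤ M * ‖coeff v k‖) : ‖u‖ ≤ M * ‖v‖ := by
  refine abs_le_of_sq_le_sq' ?_ (by positivity) |>.2
  rw [mul_pow, norm_sq_eq_tsum_coeff, norm_sq_eq_tsum_coeff, mul_left_comm, ← tsum_mul_left (a := M ^ 2)]
  gcongr with k
  · exact summable_norm_coeff_sq u
  · exact (summable_norm_coeff_sq v).mul_left _
  · rw [← mul_pow]; exact pow_le_pow_left₀ (norm_nonneg _) (h k) 2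

/-- The `k`-th Fourier coefficient as a continuous linear map. -/
def coeffL (k : ℤ × ℤ) : H →L[ℝ] CPlane :=
  LinearMap.mkContinuous
    { toFun := fun u => coeff u k
      map_add' := fun u v => by rw [coeff_add]; rfl
      map_smul' := fun a u => by rw [coeff_smul]; rfl } 1
    fun u => by rw [one_mul]; exact norm_coeff_le u k

theorem coeffL_apply (k : ℤ × ℤ) (u : H) : coeffL k u = coeff u k := rfl

theorem isClosed_divFree : IsClosed (divFree : Set L2Torus) := by
  have hcont : ∀ k, ∀ j, Continuous fun u : L2Torus => fourierMap u k j := by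
    intro k j
    have h : ∀ u : L2Torus, ‖fourierMap u k j‖ ≤ ‖u‖ := fun u => by
      have h1 := (hasSum_norm_scalarCoeff_sq (memLp_component u j))
      have h2 := h1.summable.le_tsum k fun _ _ => by positivity
      rw [h1.tsum_eq] at h2
      have h3 : ∫ x, ‖((u x j : ℝ) : ℂ)‖ ^ 2 ∂torusMeasure ≤ ‖u‖ ^ 2 := by
        rw [← real_inner_self_eq_norm_sq, L2.inner_def]
        refine integral_mono (memLp_component u j).integrable_norm_pow' (L2.integrable_inner _ _)
          fun x => ?_
        change ‖((u x j : ℝ) : ℂ)‖ ^ 2 ≤ inner ℝ (u x) (u x)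
        rw [real_inner_self_eq_norm_sq, Complex.norm_real]
        exact pow_le_pow_left₀ (norm_nonneg _) (PiLp.norm_apply_le (u x) j) 2
      have h4 : (1 : ℝ) ≤ (2 * Real.pi) ^ 2 := one_le_pow₀ one_le_two_pi
      refine abs_le_of_sq_le_sq' ?_ (norm_nonneg _) |>.2
      change ‖scalarCoeff (fun x => ((u x j : ℝ) : ℂ)) k‖ ^ 2 ≤ _
      nlinarith [sq_nonneg ‖scalarCoeff (fun x => ((u x j : ℝ) : ℂ)) k‖]
    let L : L2Torus →ₗ[ℝ] ℂ :=
      { toFun := fun u => fourierMap u k j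
        map_add' := fun u v => by simp
        map_smul' := fun a u => by simp }
    exact (L.mkContinuous 1 fun u => by rw [one_mul]; exact h u).continuous
  have : (divFree : Set L2Torus) = ⋂ k, {u | ∑ j, (freq k j : ℂ) * fourierMap u k j = 0} := by
    ext u
    simp only [mem_iInter, mem_ofPred_eq]
    rfl
  rw [this]
  exact isClosed_iInter fun k => isClosed_eq
    (continuous_finsetSum _ fun j _ => continuous_const.mul (hcont k j)) continuous_const

instance : CompleteSpace H := isClosed_divFree.completeSpace_coe

/-- The square-summable family of coefficients. -/
def coeffFreq : H →ₗ[ℝ] FreqL2 where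
  toFun u := ⟨coeff u, memℓp_gen (by simpa using summable_norm_coeff_sq u)⟩
  map_add' u v := by ext1; exact coeff_add u v
  map_smul' a u := by ext1; exact coeff_smul a u

theorem norm_coeffFreq (u : H) : ‖u‖ = 2 * Real.pi * ‖coeffFreq u‖ := by
  have h := lp.norm_rpow_eq_tsum (p := 2) (by norm_num) (coeffFreq u)
  simp only [ENNReal.toReal_ofNat, Real.rpow_ofNat] at h
  have h2 := norm_sq_eq_tsum_coeff u
  change ‖coeffFreq u‖ ^ 2 = ∑' k, ‖coeff u k‖ ^ 2 at h
  rw [← h, ← mul_pow] at h2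
  exact (pow_left_inj₀ (norm_nonneg _) (by positivity) two_ne_zero).1 h2

theorem isEmbedding_coeffFreq : Topology.IsEmbedding coeffFreq := by
  have h1 : AntilipschitzWith (Real.toNNReal (2 * Real.pi)) coeffFreq :=
    AntilipschitzWith.of_le_mul_dist fun u v => by
      rw [Real.coe_toNNReal _ (by positivity), dist_eq_norm, dist_eq_norm, ← map_sub]
      exact (norm_coeffFreq (u - v)).le
  have h2 : Continuous coeffFreq := by
    refine (coeffFreq.mkContinuous 1 fun u => ?_).continuous
    rw [one_mul, norm_coeffFreq u]
    exact le_mul_of_one_le_left (norm_nonneg _) one_le_two_pi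
  have h3 : UniformContinuous coeffFreq := by
    have : UniformContinuous (coeffFreq.mkContinuous 1 fun u => by
      rw [one_mul, norm_coeffFreq u]
      exact le_mul_of_one_le_left (norm_nonneg _) one_le_two_pi) := ContinuousLinearMap.uniformContinuous _
    exact this
  exact (h1.isUniformEmbedding h3).isEmbedding

/-! ### Truncation to boxes of frequencies and Fourier multipliers -/

/-- The frequencies with both components of absolute value at most `n`. -/
def box (n : ℕ) : Finset (ℤ × ℤ) := Finset.Icc (-(n : ℤ), -(n : ℤ)) ((n : ℤ), (n : ℤ))

theorem mem_box {n : ℕ} {k : ℤ × ℤ} : k ∈ box n ↔ |k.1| ≤ n ∧ |k.2| ≤ n := by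
  simp only [box, Finset.mem_Icc, Prod.le_def, abs_le]
  tauto

theorem neg_mem_box {n : ℕ} {k : ℤ × ℤ} : -k ∈ box n ↔ k ∈ box n := by
  simp [mem_box]

theorem box_mono {m n : ℕ} (h : m ≤ n) : box m ⊆ box n := by
  intro k hk
  rw [mem_box] at *
  have : (m : ℤ) ≤ n := by exact_mod_cast h
  exact ⟨hk.1.trans this, hk.2.trans this⟩

theorem tendsto_box : Filter.Tendsto box Filter.atTop Filter.atTop := by
  refine Filter.tendsto_atTop_finset_of_monotone (fun m n h => box_mono h) fun k => ?_
  refine ⟨max k.1.natAbs k.2.natAbs, mem_box.2 ?_⟩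
  constructor <;> push_cast <;> simp

/-- The family of coefficients is the limit in $\ell^2$ of its truncations to boxes, which are
finite sums of measurable functions, and `coeffFreq` is an embedding. -/
theorem aestronglyMeasurable_of_coeff {α : Type*} [MeasurableSpace α] {μ : Measure α} {X : α → H}
    (h : ∀ k, AEStronglyMeasurable (fun t => coeff (X t) k) μ) : AEStronglyMeasurable X μ := by
  rw [← isEmbedding_coeffFreq.aestronglyMeasurable_comp_iff]
  refine aestronglyMeasurable_of_tendsto_ae Filter.atTop
    (f := fun (n : ℕ) t => ∑ k ∈ box n, (lp.single 2 k (coeff (X t) k) : FreqL2)) (fun n => ?_)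
    (Filter.Eventually.of_forall fun t => ?_)
  · refine Finset.aestronglyMeasurable_fun_sum _ fun k _ => ?_
    have hc : Continuous fun z : CPlane => (lp.single 2 k z : FreqL2) := by
      refine (Isometry.continuous (Isometry.of_dist_eq fun x y => ?_))
      rw [dist_eq_norm, ← lp.single_sub, lp.norm_single (by norm_num), dist_eq_norm]
    exact hc.comp_aestronglyMeasurable (h k)
  · exact (lp.hasSum_single (by norm_num) (coeffFreq (X t))).comp tendsto_box

/-- The Fourier multiplier with an even, bounded, real symbol. -/
structure Symbol where
  /-- the symbol -/
  fn : ℤ × ℤ → ℝ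
  /-- a bound -/
  bound : ℝ
  le_bound : ∀ k, |fn k| ≤ bound
  even : ∀ k, fn (-k) = fn k

namespace Symbol

theorem bound_nonneg (m : Symbol) : 0 ≤ m.bound := (abs_nonneg _).trans (m.le_bound 0)

theorem exists_coeff (m : Symbol) (u : H) : ∃ v : H, coeff v = fun k => m.fn k • coeff u k := by
  refine exists_coeff_eq (fun k j => ?_) (fun k => ?_) ?_
  · simp [m.even, coeff_neg_apply]
  · simp only [PiLp.smul_apply, Complex.real_smul, mul_left_comm _ (m.fn k : ℂ), ← Finset.mul_sum,
      coeff_div, mul_zero]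
  · refine ((summable_norm_coeff_sq u).mul_left (m.bound ^ 2)).of_nonneg_of_le
      (fun _ => by positivity) fun k => ?_
    rw [norm_smul, mul_pow, Real.norm_eq_abs]
    gcongr
    exact m.le_bound k

/-- The multiplier as a map on `H`. -/
def map (m : Symbol) (u : H) : H := (m.exists_coeff u).choose

theorem coeff_map (m : Symbol) (u : H) (k : ℤ × ℤ) : coeff (m.map u) k = m.fn k • coeff u k :=
  congrFun (m.exists_coeff u).choose_spec k

/-- The multiplier as an operator on `H`. -/
def op (m : Symbol) : H →L[ℝ] H :=
  LinearMap.mkContinuous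
    { toFun := m.map
      map_add' := fun u v => coeff_injective (by
        ext1 k
        rw [coeff_add, Pi.add_apply, coeff_map, coeff_map, coeff_map, coeff_add, Pi.add_apply, smul_add])
      map_smul' := fun a u => coeff_injective (by
        ext1 k
        rw [RingHom.id_apply, coeff_smul, Pi.smul_apply, coeff_map, coeff_map, coeff_smul,
          Pi.smul_apply, smul_comm]) } m.bound
    fun u => norm_le_of_coeff_le m.bound_nonneg fun k => by
      change ‖coeff (m.map u) k‖ ≤ _
      rw [coeff_map, norm_smul, Real.norm_eq_abs]
      exact mul_le_mul_of_nonneg_right (m.le_bound k) (norm_nonneg _)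

theorem coeff_op (m : Symbol) (u : H) (k : ℤ × ℤ) : coeff (m.op u) k = m.fn k • coeff u k :=
  coeff_map m u k

theorem norm_op_le (m : Symbol) (u : H) : ‖m.op u‖ ≤ m.bound * ‖u‖ :=
  norm_le_of_coeff_le m.bound_nonneg fun k => by
    rw [coeff_op, norm_smul, Real.norm_eq_abs]
    exact mul_le_mul_of_nonneg_right (m.le_bound k) (norm_nonneg _)

/-- The symbol of the truncation to a box. -/
def trunc (n : ℕ) : Symbol where
  fn k := if k ∈ box n then 1 else 0
  bound := 1
  le_bound k := by split_ifs <;> simp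
  even k := by simp [neg_mem_box]

/-- The symbol `(1 + k₁²)^{-s/2} (1 + k₂²)^{-s'/2}`. -/
def bessel (s s' : ℝ) (hs : 0 ≤ s) (hs' : 0 ≤ s') : Symbol where
  fn k := (anisoWeight s s' k)⁻¹
  bound := 1
  le_bound k := by
    rw [abs_of_nonneg (inv_nonneg.2 (anisoWeight_pos _ _ _).le)]
    refine inv_le_one_of_one_le₀ ?_
    unfold anisoWeight
    exact one_le_mul_of_one_le_of_one_le
      (Real.one_le_rpow (by nlinarith [sq_nonneg (k.1 : ℝ)]) (by positivity))
      (Real.one_le_rpow (by nlinarith [sq_nonneg (k.2 : ℝ)]) (by positivity))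
  even k := by simp [anisoWeight]

end Symbol

theorem coeff_trunc (n : ℕ) (u : H) (k : ℤ × ℤ) :
    coeff ((Symbol.trunc n).op u) k = if k ∈ box n then coeff u k else 0 := by
  rw [Symbol.coeff_op]
  change (if k ∈ box n then (1 : ℝ) else 0) • _ = _
  split_ifs <;> simp

/-! ### Embeddings between the spaces -/

theorem anisoWeight_smul_bessel {s s' : ℝ} (hs : 0 ≤ s) (hs' : 0 ≤ s') (u : H) (k : ℤ × ℤ) :
    anisoWeight s s' k • coeff ((Symbol.bessel s s' hs hs').op u) k = coeff u k := by
  rw [Symbol.coeff_op]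
  change anisoWeight s s' k • (anisoWeight s s' k)⁻¹ • coeff u k = _
  rw [smul_smul, mul_inv_cancel₀ (anisoWeight_pos _ _ _).ne', one_smul]

/-- The isomorphism (up to a constant factor) of `H` with `H̃^{s,s'}`, as a linear map. -/
def toHTLin (s s' : ℝ) (hs : 0 ≤ s) (hs' : 0 ≤ s') : H →ₗ[ℝ] HT s s' :=
  LinearMap.codRestrict (anisoSubmodule s s') (Symbol.bessel s s' hs hs').op.toLinearMap
    fun u => (congrArg (fun f => Memℓp f 2)
      (funext fun k => (anisoWeight_smul_bessel hs hs' u k).symm)).mp (coeffFreq u).2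

theorem norm_toHTLin {s s' : ℝ} (hs : 0 ≤ s) (hs' : 0 ≤ s') (u : H) :
    ‖toHTLin s s' hs hs' u‖ = ‖coeffFreq u‖ := by
  have h : HT.toFreqL2 (toHTLin s s' hs hs' u) = coeffFreq u := by
    ext1; exact funext fun k => anisoWeight_smul_bessel hs hs' u k
  rw [← h]; rfl

/-- The isomorphism (up to a constant factor) of `H` with `H̃^{s,s'}`. -/
def toHT (s s' : ℝ) (hs : 0 ≤ s) (hs' : 0 ≤ s') : H →L[ℝ] HT s s' :=
  (toHTLin s s' hs hs').mkContinuous 1 fun u => by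
    rw [norm_toHTLin, one_mul, norm_coeffFreq u]
    exact le_mul_of_one_le_left (norm_nonneg _) one_le_two_pi

theorem toH_toHT {s s' : ℝ} (hs : 0 ≤ s) (hs' : 0 ≤ s') (u : H) :
    HT.toH (toHT s s' hs hs' u) = (Symbol.bessel s s' hs hs').op u := rfl

theorem ofReal_norm_sq_HT {s s' : ℝ} {a b : ℕ} (ha : s = a) (hb : s' = b) (u : HT s s') :
    anisoEnergy a b (coeff (HT.toH u)) = ENNReal.ofReal (‖u‖ ^ 2) := by
  subst ha hb
  have hs : Summable fun k : ℤ × ℤ => (1 + (k.1 : ℝ) ^ 2) ^ (a : ℝ) * (1 + (k.2 : ℝ) ^ 2) ^ (b : ℝ) *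
      ‖coeff (HT.toH u) k‖ ^ 2 := by
    have h := (lp.memℓp (HT.toFreqL2 u)).summable (by norm_num)
    simp only [ENNReal.toReal_ofNat, Real.rpow_ofNat] at h
    refine h.congr fun k => ?_
    change ‖anisoWeight a b k • coeff (HT.toH u) k‖ ^ 2 = _
    rw [norm_smul, Real.norm_of_nonneg (anisoWeight_pos a b k).le, mul_pow]
    congr 1
    unfold anisoWeight
    have h1 : ∀ a r : ℝ, 0 ≤ a → (a ^ (r / 2)) ^ 2 = a ^ r := fun a r ha => by
      rw [← Real.rpow_natCast, ← Real.rpow_mul ha]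
      congr 1; push_cast; ring
    rw [mul_pow, h1 _ _ (by positivity), h1 _ _ (by positivity)]
  rw [HT.norm_sq, ENNReal.ofReal_tsum_of_nonneg (fun _ => by positivity) hs]
  unfold anisoEnergy
  congr 1; ext k
  rw [Real.rpow_natCast, Real.rpow_natCast, ENNReal.ofReal_mul (by positivity) (q := _ ^ 2),
    ENNReal.ofReal_pow (norm_nonneg _), ofReal_norm]

theorem minusOneWeight_le_one (k : ℤ × ℤ) : minusOneWeight k ≤ 1 := by
  unfold minusOneWeight
  refine Real.rpow_le_one_of_one_le_of_nonpos ?_ (by norm_num)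
  nlinarith [sq_nonneg (k.1 : ℝ), sq_nonneg (k.2 : ℝ)]

/-- The inclusion of `H` in `H⁻¹`. -/
def toHMinusOne : H →ₗ[ℝ] HMinusOne :=
  LinearMap.codRestrict minusOneSubmodule
    { toFun := coeff
      map_add' := coeff_add
      map_smul' := coeff_smul } fun u => by
    refine ⟨fun k j => coeff_neg_apply u k j, memℓp_gen ?_⟩
    simp only [ENNReal.toReal_ofNat, Real.rpow_ofNat]
    refine (summable_norm_coeff_sq u).of_nonneg_of_le (fun _ => by positivity) fun k => ?_
    change ‖minusOneWeight k • coeff u k‖ ^ 2 ≤ _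
    rw [norm_smul, Real.norm_of_nonneg (minusOneWeight_pos k).le]
    refine pow_le_pow_left₀ (mul_nonneg (minusOneWeight_pos k).le (norm_nonneg _)) ?_ 2
    exact mul_le_of_le_one_left (norm_nonneg (coeff u k)) (minusOneWeight_le_one k)

theorem fourier_toHMinusOne (u : H) : HMinusOne.fourier (toHMinusOne u) = coeff u := rfl

theorem summable_HMinusOne (c : HMinusOne) : Summable fun k : ℤ × ℤ =>
    (1 + ((k.1 : ℝ) ^ 2 + (k.2 : ℝ) ^ 2))⁻¹ * ‖HMinusOne.fourier c k‖ ^ 2 := by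
  have h := (lp.memℓp (HMinusOne.toFreqL2 c)).summable (by norm_num)
  simp only [ENNReal.toReal_ofNat, Real.rpow_ofNat] at h
  refine h.congr fun k => ?_
  change ‖minusOneWeight k • HMinusOne.fourier c k‖ ^ 2 = _
  rw [norm_smul, Real.norm_of_nonneg (minusOneWeight_pos k).le, mul_pow]
  congr 1
  unfold minusOneWeight
  rw [← Real.rpow_natCast, ← Real.rpow_mul (by positivity), ← Real.rpow_neg_one]
  congr 1
  norm_num

/-- The Fourier coefficients of an element of `H⁻¹` depend continuously on it. -/
def fourierL (k : ℤ × ℤ) : HMinusOne →L[ℝ] CPlane :=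
  LinearMap.mkContinuous ((LinearMap.proj k).comp HMinusOne.fourier) (minusOneWeight k)⁻¹ fun c => by
    have h := lp.norm_apply_le_norm (p := 2) (by norm_num) (HMinusOne.toFreqL2 c) k
    change ‖minusOneWeight k • HMinusOne.fourier c k‖ ≤ ‖c‖ at h
    rw [norm_smul, Real.norm_of_nonneg (minusOneWeight_pos k).le] at h
    change ‖HMinusOne.fourier c k‖ ≤ _
    rw [inv_mul_eq_div, le_div_iff₀ (minusOneWeight_pos k), mul_comm]
    exact h

/-! ### Continuity of the convection term -/

/-- Writing the symbol as $m\cdot\hat u_{m-l}$ puts the derivative on the output frequency, and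
Cauchy-Schwarz does the rest. Each single coefficient is thus continuous on $H\times H$ without any
derivative, which is enough to pass to the limit in the equation frequency by frequency. -/
theorem norm_convection_le (u v : H) (m : ℤ × ℤ) :
    ‖convection u v m‖ ≤ (|(m.1 : ℝ)| + |(m.2 : ℝ)|) * (‖u‖ * ‖v‖) := by
  have hb : ∀ l, ‖advSymbol u m l‖ₑ * ‖coeff v l‖ₑ ≤
      ENNReal.ofReal (|(m.1 : ℝ)| + |(m.2 : ℝ)|) * (‖coeff u (m - l)‖ₑ * ‖coeff v l‖ₑ) := fun l => by
    rw [← mul_assoc]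
    refine mul_le_mul' ?_ le_rfl
    rw [← ofReal_norm, ← ofReal_norm (coeff u (m - l)), ← ENNReal.ofReal_mul (by positivity)]
    refine ENNReal.ofReal_le_ofReal ?_
    rw [advSymbol_eq, Fin.sum_univ_two, add_mul]
    refine (norm_add_le _ _).trans ?_
    rw [norm_mul, norm_mul, Complex.norm_real, Complex.norm_real]
    exact add_le_add (mul_le_mul_of_nonneg_left (PiLp.norm_apply_le _ _) (norm_nonneg _))
      (mul_le_mul_of_nonneg_left (PiLp.norm_apply_le _ _) (norm_nonneg _))
  have h1 : ‖convection u v m‖ₑ ≤ ENNReal.ofReal ((|(m.1 : ℝ)| + |(m.2 : ℝ)|) * (‖u‖ * ‖v‖)) := by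
    refine (enorm_convection_le u v m).trans ((ENNReal.tsum_le_tsum hb).trans ?_)
    rw [ENNReal.tsum_mul_left, ENNReal.ofReal_mul (by positivity), ENNReal.ofReal_mul (norm_nonneg _)]
    refine mul_le_mul' le_rfl ((tsum_mul_le_sqrt _ _).trans ?_)
    have e := (Equiv.subLeft m).tsum_eq fun l => ‖coeff u l‖ₑ ^ 2
    simp only [Equiv.subLeft_apply] at e
    rw [e, ← anisoEnergy_zero_zero_eq, ← anisoEnergy_zero_zero_eq, anisoEnergy_coeff, anisoEnergy_coeff]
    have h3 : (1 : ℝ) ≤ (2 * Real.pi) ^ 2 := one_le_pow₀ one_le_two_pi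
    have key : ∀ w : H, ENNReal.ofReal (‖w‖ ^ 2 / (2 * Real.pi) ^ 2) ^ (1 / 2 : ℝ) ≤
        ENNReal.ofReal ‖w‖ := fun w => by
      rw [ENNReal.ofReal_rpow_of_nonneg (by positivity) (by norm_num), ← Real.sqrt_eq_rpow]
      refine ENNReal.ofReal_le_ofReal (Real.sqrt_le_iff.2 ⟨norm_nonneg _, div_le_self (by positivity) h3⟩)
    exact mul_le_mul' (key u) (key v)
  rw [← ofReal_norm] at h1
  exact (ENNReal.ofReal_le_ofReal_iff (by positivity)).1 h1

/-- The coefficients of the convection term as continuous bilinear maps. -/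
def convectionL (m : ℤ × ℤ) : H →L[ℝ] H →L[ℝ] CPlane :=
  LinearMap.mkContinuous₂
    (LinearMap.mk₂ ℝ (fun u v => convection u v m) (fun u u' v => convection_add_left u u' v m)
      (fun a u v => convection_smul_left a u v m) (fun u v v' => convection_add_right u v v' m)
      fun a u v => convection_smul_right a u v m) (|(m.1 : ℝ)| + |(m.2 : ℝ)|)
    fun u v => by rw [mul_assoc]; exact norm_convection_le u v m

theorem exists_coeff_trunc_convection (n : ℕ) (u v : H) :
    ∃ x : H, coeff x = fun m => if m ∈ box n then convection u v m else 0 := by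
  refine exists_coeff_eq (fun k j => ?_) (fun k => ?_)
    (summable_of_hasFiniteSupport ((box n).finite_toSet.subset fun k hk => ?_))
  · by_cases hk : k ∈ box n
    · simp only [neg_mem_box, hk, if_true, convection_neg_apply]
    · simp [neg_mem_box, hk]
  · by_cases hk : k ∈ box n
    · simp only [hk, if_true, convection_div]
    · simp [hk]
  · by_contra h
    rw [Finset.mem_coe] at h
    simp [h] at hk

/-- Only finitely many coefficients survive and each is a bounded bilinear map, so the truncated
convection is bounded from $H\times H$ to $H$ and the Galerkin equation is a linear ordinary
differential equation in $H$. -/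
theorem exists_truncConvection (n : ℕ) : ∃ β : H →L[ℝ] H →L[ℝ] H, ∀ u v m,
    coeff (β u v) m = if m ∈ box n then convection u v m else 0 := by
  choose b hb using exists_coeff_trunc_convection n
  have hbm : ∀ u v m, coeff (b u v) m = if m ∈ box n then convection u v m else 0 := fun u v m => by
    rw [hb]
  refine ⟨LinearMap.mkContinuous₂ (LinearMap.mk₂ ℝ b (fun u u' v => ?_) (fun a u v => ?_)
    (fun u v v' => ?_) fun a u v => ?_)
    (2 * Real.pi * ∑ m ∈ box n, (|(m.1 : ℝ)| + |(m.2 : ℝ)|)) fun u v => ?_, hbm⟩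
  · refine coeff_injective (funext fun m => ?_)
    rw [coeff_add, Pi.add_apply, hbm, hbm, hbm]
    split_ifs
    · exact convection_add_left u u' v m
    · simp
  · refine coeff_injective (funext fun m => ?_)
    rw [coeff_smul, Pi.smul_apply, hbm, hbm]
    split_ifs
    · exact convection_smul_left a u v m
    · simp
  · refine coeff_injective (funext fun m => ?_)
    rw [coeff_add, Pi.add_apply, hbm, hbm, hbm]
    split_ifs
    · exact convection_add_right u v v' m
    · simp
  · refine coeff_injective (funext fun m => ?_)
    rw [coeff_smul, Pi.smul_apply, hbm, hbm]
    split_ifs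
    · exact convection_smul_right a u v m
    · simp
  · change ‖b u v‖ ≤ _
    have h1 : ‖b u v‖ ^ 2 = (2 * Real.pi) ^ 2 * ∑ m ∈ box n, ‖convection u v m‖ ^ 2 := by
      rw [norm_sq_eq_tsum_coeff, tsum_eq_sum (s := box n)]
      · congr 1
        exact Finset.sum_congr rfl fun m hm => by rw [hbm, if_pos hm]
      · intro m hm; rw [hbm, if_neg hm]; simp
    have h2 : ∑ m ∈ box n, ‖convection u v m‖ ^ 2 ≤
        (∑ m ∈ box n, (|(m.1 : ℝ)| + |(m.2 : ℝ)|) * (‖u‖ * ‖v‖)) ^ 2 := by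
      refine (Finset.sum_sq_le_sq_sum_of_nonneg fun m _ => norm_nonneg _).trans ?_
      gcongr with m
      exact norm_convection_le u v m
    refine abs_le_of_sq_le_sq' ?_ (by positivity) |>.2
    rw [h1]
    refine (mul_le_mul_of_nonneg_left h2 (by positivity)).trans (le_of_eq ?_)
    rw [← Finset.sum_mul]
    ring

/-! ### Weighted energy estimates for transport equations -/

/-- The family `w_k c_k`. -/
def weighted (w : ℤ × ℤ → ℝ) (c : ℤ × ℤ → CPlane) : ℤ × ℤ → CPlane := fun k => w k • c k

theorem enorm_weighted_sq (w : ℤ × ℤ → ℝ) (c : ℤ × ℤ → CPlane) (k : ℤ × ℤ) :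
    ‖weighted w c k‖ₑ ^ 2 = ENNReal.ofReal (w k ^ 2) * ‖c k‖ₑ ^ 2 := by
  rw [weighted, enorm_smul, mul_pow, Real.enorm_eq_ofReal_abs, ← ENNReal.ofReal_pow (abs_nonneg _),
    sq_abs]

theorem ofReal_norm_sq_cplane (x : CPlane) : ENNReal.ofReal (‖x‖ ^ 2) = ‖x‖ₑ ^ 2 := by
  rw [ENNReal.ofReal_pow (norm_nonneg _), ofReal_norm]

theorem sqrt_mul_le_add (a b : ℝ≥0∞) : (a * b) ^ (1 / 2 : ℝ) ≤ a + b := by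
  calc (a * b) ^ (1 / 2 : ℝ) ≤ ((a + b) * (a + b)) ^ (1 / 2 : ℝ) := by
        gcongr
        · exact le_self_add
        · exact le_add_self
    _ = a + b := by
        rw [ENNReal.mul_rpow_of_nonneg _ _ (by norm_num), ← ENNReal.rpow_add_of_nonneg _ _ (by norm_num)
          (by norm_num)]
        norm_num

theorem aemeasurable_anisoEnergy {α : Type*} [MeasurableSpace α] {μ : Measure α}
    {c : α → ℤ × ℤ → CPlane} (hc : ∀ k, AEStronglyMeasurable (fun t => c t k) μ) (a b : ℕ) :
    AEMeasurable (fun t => anisoEnergy a b (c t)) μ :=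
  AEMeasurable.tsum fun k => ((hc k).enorm.pow_const 2).const_mul _

theorem anisoEnergy_mono {a a' b b' : ℕ} (ha : a ≤ a') (hb : b ≤ b') (c : ℤ × ℤ → CPlane) :
    anisoEnergy a b c ≤ anisoEnergy a' b' c := by
  refine ENNReal.tsum_le_tsum fun k => mul_le_mul' (ENNReal.ofReal_le_ofReal ?_) le_rfl
  gcongr
  · nlinarith [sq_nonneg (k.1 : ℝ)]
  · nlinarith [sq_nonneg (k.2 : ℝ)]

theorem anisoEnergy_weighted_le {w : ℤ × ℤ → ℝ} {W : ℝ} (hw : ∀ k, |w k| ≤ W) (a b : ℕ)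
    (c : ℤ × ℤ → CPlane) : anisoEnergy a b (weighted w c) ≤ ENNReal.ofReal (W ^ 2) * anisoEnergy a b c := by
  unfold anisoEnergy
  rw [← ENNReal.tsum_mul_left]
  refine ENNReal.tsum_le_tsum fun k => ?_
  rw [enorm_weighted_sq, mul_left_comm]
  refine mul_le_mul' (ENNReal.ofReal_le_ofReal ?_) le_rfl
  rw [← sq_abs]
  exact pow_le_pow_left₀ (abs_nonneg _) (hw k) 2

/-- The dissipation `∑ k₁² |c_k|²`. -/
def dissipation (c : ℤ × ℤ → CPlane) : ℝ≥0∞ :=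
  ∑' k : ℤ × ℤ, ENNReal.ofReal ((k.1 : ℝ) ^ 2) * ‖c k‖ₑ ^ 2

theorem anisoEnergy_one_zero (c : ℤ × ℤ → CPlane) :
    anisoEnergy 1 0 c = anisoEnergy 0 0 c + dissipation c := by
  unfold anisoEnergy dissipation
  rw [← ENNReal.tsum_add]
  congr 1; ext k
  rw [pow_one, pow_zero, pow_zero, mul_one, mul_one, ENNReal.ofReal_add zero_le_one
    (by positivity), add_mul]

theorem hasSum_toReal_tsum {ι : Type*} {f : ι → ℝ} (hf : ∀ i, 0 ≤ f i)
    (h : ∑' i, ENNReal.ofReal (f i) ≠ ∞) : HasSum f (∑' i, ENNReal.ofReal (f i)).toReal := by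
  have h1 : Summable f := by
    refine (ENNReal.summable_toReal h).congr fun i => ENNReal.toReal_ofReal (hf i)
  rw [← ENNReal.ofReal_tsum_of_nonneg hf h1, ENNReal.toReal_ofReal (tsum_nonneg hf)]
  exact h1.hasSum

theorem hasSum_anisoEnergy {c : ℤ × ℤ → CPlane} (h : anisoEnergy 0 0 c ≠ ∞) :
    HasSum (fun k => ‖c k‖ ^ 2) (anisoEnergy 0 0 c).toReal := by
  rw [anisoEnergy_zero_zero_eq] at *
  simp only [← ofReal_norm_sq_cplane] at *
  exact hasSum_toReal_tsum (fun _ => by positivity) h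

theorem hasSum_dissipation {c : ℤ × ℤ → CPlane} (h : dissipation c ≠ ∞) :
    HasSum (fun k : ℤ × ℤ => (k.1 : ℝ) ^ 2 * ‖c k‖ ^ 2) (dissipation c).toReal := by
  have e : ∀ k : ℤ × ℤ, ENNReal.ofReal ((k.1 : ℝ) ^ 2) * ‖c k‖ₑ ^ 2 =
      ENNReal.ofReal ((k.1 : ℝ) ^ 2 * ‖c k‖ ^ 2) := fun k => by
    rw [ENNReal.ofReal_mul (by positivity), ofReal_norm_sq_cplane]
  unfold dissipation at *
  simp only [e] at *
  exact hasSum_toReal_tsum (fun _ => by positivity) h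

theorem summable_abs_tsum_le {ι : Type*} {f : ι → ℝ} {g : ι → ℝ≥0∞} (hfg : ∀ i, ‖f i‖ₑ ≤ g i)
    (h : ∑' i, g i ≠ ∞) : Summable f ∧ |∑' i, f i| ≤ (∑' i, g i).toReal := by
  have h1 : ∑' i, ‖f i‖ₑ ≠ ∞ := ((ENNReal.tsum_le_tsum hfg).trans_lt (lt_top_iff_ne_top.2 h)).ne
  have hs : Summable f := Summable.of_norm (by simpa using ENNReal.summable_toReal h1)
  refine ⟨hs, ?_⟩
  have h2 := (enorm_le_tsum_of_hasSum hs.hasSum).trans (ENNReal.tsum_le_tsum hfg)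
  have h3 := ENNReal.toReal_mono h h2
  simpa using h3

/-- The commutator of the transport by `u` with the weight `w`, tested against `w c`. -/
def commutator (w : ℤ × ℤ → ℝ) (u c : ℤ × ℤ → CPlane) : ℝ≥0∞ :=
  ∑' k, ∑' l, ‖∑ j, (freq l j : ℂ) * u k j‖ₑ * ‖c l‖ₑ *
    (ENNReal.ofReal (|w (k + l)| * |w (k + l) - w l|) * ‖c (k + l)‖ₑ)

/-- The constant in `energy_estimate`. -/
def estimateConst (T Γ : ℝ) : ℝ :=
  (1 + (timeMeasure T).real univ) * energyConst (Γ + (timeMeasure T).real univ)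

theorem enorm_mul_inner_le (p : ℝ) (x y : CPlane) :
    ‖p * inner ℝ x y‖ₑ ≤ ENNReal.ofReal |p| * (‖x‖ₑ * ‖y‖ₑ) := by
  rw [enorm_mul, Real.enorm_eq_ofReal_abs]
  refine mul_le_mul' le_rfl ?_
  rw [← ofReal_norm, ← ofReal_norm, ← ofReal_norm, ← ENNReal.ofReal_mul (norm_nonneg _)]
  exact ENNReal.ofReal_le_ofReal (norm_inner_le_norm _ _)

/-- The pointwise in time form of the energy inequality. -/
theorem tsum_inner_le {w : ℤ × ℤ → ℝ} {W : ℝ} (hw : ∀ k, |w k| ≤ W) {U Y : H}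
    {F R : ℤ × ℤ → CPlane}
    (hF : ∀ k, coeff Y k = 0 ∨
      F k = -((k.1 : ℝ) ^ 2) • coeff Y k - convection U Y k - R k)
    (h10 : anisoEnergy 1 0 (coeff Y) ≠ ∞)
    (hadv : advection (coeff U) (coeff Y) (coeff Y) ≠ ∞)
    {B : ℝ} (hB : 0 ≤ B)
    (h : commutator w (coeff U) (coeff Y) +
      ∑' k, ENNReal.ofReal (w k ^ 2) * (‖R k‖ₑ * ‖coeff Y k‖ₑ) ≤ ENNReal.ofReal B) :
    ∑' k, w k ^ 2 * inner ℝ (F k) (coeff Y k) ≤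
      -(dissipation (weighted w (coeff Y))).toReal + B := by
  set c := coeff Y
  have hW2 : ∀ k, |w k ^ 2| ≤ W ^ 2 := fun k => by
    rw [abs_of_nonneg (sq_nonneg _), ← sq_abs]
    exact pow_le_pow_left₀ (abs_nonneg _) (hw k) 2
  have hD : dissipation (weighted w c) ≠ ∞ := by
    have h1 : dissipation (weighted w c) ≤ anisoEnergy 1 0 (weighted w c) := by
      rw [anisoEnergy_one_zero]; exact le_add_self
    exact ((h1.trans (anisoEnergy_weighted_le hw 1 0 c)).trans_lt
      (ENNReal.mul_lt_top ENNReal.ofReal_lt_top (lt_top_iff_ne_top.2 h10))).ne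
  have s1 := hasSum_dissipation hD
  have s2 := summable_abs_tsum_le (f := fun k => w k ^ 2 * inner ℝ (convection U Y k) (c k))
    (g := fun k => ENNReal.ofReal (W ^ 2) * (‖convection U Y k‖ₑ * ‖c k‖ₑ))
    (fun k => (enorm_mul_inner_le _ _ _).trans (mul_le_mul' (ENNReal.ofReal_le_ofReal (hW2 k)) le_rfl))
    (by
      rw [ENNReal.tsum_mul_left]
      exact ENNReal.mul_ne_top ENNReal.ofReal_ne_top
        ((tsum_convection_le U Y c).trans_lt (lt_top_iff_ne_top.2 hadv)).ne)
  have hRw : ∑' k, ENNReal.ofReal (w k ^ 2) * (‖R k‖ₑ * ‖c k‖ₑ) ≠ ∞ :=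
    ((le_add_self.trans h).trans_lt ENNReal.ofReal_lt_top).ne
  have s3 := summable_abs_tsum_le (f := fun k => w k ^ 2 * inner ℝ (R k) (c k))
    (g := fun k => ENNReal.ofReal (w k ^ 2) * (‖R k‖ₑ * ‖c k‖ₑ))
    (fun k => (enorm_mul_inner_le _ _ _).trans (by rw [abs_of_nonneg (sq_nonneg _)])) hRw
  have e : ∀ k, w k ^ 2 * inner ℝ (F k) (c k) = -((k.1 : ℝ) ^ 2 * ‖weighted w c k‖ ^ 2) -
      w k ^ 2 * inner ℝ (convection U Y k) (c k) - w k ^ 2 * inner ℝ (R k) (c k) := fun k => by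
    -- Where $\hat Y_k=0$ the value of `F` is irrelevant. Galerkin approximations need this: they
    -- satisfy the equation only at frequencies inside the box.
    rcases hF k with h0 | h0
    · change c k = 0 at h0
      simp [weighted, h0]
    · rw [h0, inner_sub_left, inner_sub_left, real_inner_smul_left, real_inner_self_eq_norm_sq,
        weighted, norm_smul, mul_pow, Real.norm_eq_abs, sq_abs]
      ring
  have hs := ((s1.neg.sub s2.1.hasSum).sub s3.1.hasSum)
  simp only [e]
  rw [hs.tsum_eq]
  have hc := abs_tsum_convection_le U Y hw hadv
  change _ ≤ commutator w (coeff U) c at hc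
  have hcom : commutator w (coeff U) c ≠ ∞ := ((le_self_add.trans h).trans_lt ENNReal.ofReal_lt_top).ne
  have b1 := (ENNReal.ofReal_le_iff_le_toReal hcom).1 hc
  have b2 := ENNReal.toReal_mono ENNReal.ofReal_ne_top h
  rw [ENNReal.toReal_add hcom hRw, ENNReal.toReal_ofReal hB] at b2
  have b3 := neg_abs_le (∑' k, w k ^ 2 * inner ℝ (convection U Y k) (c k))
  have b4 := neg_abs_le (∑' k, w k ^ 2 * inner ℝ (R k) (c k))
  linarith [s3.2]

/-- The derivative of $\sum w_k^2|c_k|^2$ is minus twice the weighted dissipation, plus the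
commutator of transport with $w$, plus the contribution of the remainder `R`. The hypothesis bounds
the last two by a geometric mean of the weighted energy and its $\tilde H^{1,0}$ version, up to a
source $b$; Young's inequality and `energy_gronwall` conclude. The boundedness of $w$ and the
qualitative regularity of `U` and `Y` only ensure convergence: neither `W` nor `M` enters the bound,
so unbounded weights can be reached in the limit. -/
theorem energy_estimate {T : ℝ} {w : ℤ × ℤ → ℝ} {W : ℝ} (hw : ∀ k, |w k| ≤ W)
    {U Y : Icc (0 : ℝ) T → H} {F R c : Icc (0 : ℝ) T → ℤ × ℤ → CPlane} {x₀ : ℤ × ℤ → CPlane}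
    {Q₀ : ℝ} (hQ₀ : 0 ≤ Q₀)
    (hFint : ∀ k, Integrable (fun s => F s k) (timeMeasure T))
    (hc : ∀ t k, c t k = x₀ k + ∫ s in Iic t, F s k ∂timeMeasure T)
    (hY : ∀ᵐ s ∂timeMeasure T, coeff (Y s) = c s)
    (hF : ∀ᵐ s ∂timeMeasure T, ∀ k, coeff (Y s) k = 0 ∨
      F s k = -((k.1 : ℝ) ^ 2) • coeff (Y s) k - convection (U s) (Y s) k - R s k)
    (hU : ∫⁻ s, anisoEnergy 1 0 (coeff (U s)) ∂timeMeasure T ≠ ∞)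
    (hUm : AEStronglyMeasurable U (timeMeasure T))
    (hY11 : ∫⁻ s, anisoEnergy 1 1 (coeff (Y s)) ∂timeMeasure T ≠ ∞)
    {M : ℝ} (hYb : ∀ᵐ s ∂timeMeasure T, ‖Y s‖ ≤ M)
    (hRm : ∀ k, AEStronglyMeasurable (fun s => R s k) (timeMeasure T))
    (hR : ∫⁻ s, ∑' k, ‖R s k‖ₑ * ‖coeff (Y s) k‖ₑ ∂timeMeasure T ≠ ∞)
    (h0 : anisoEnergy 0 0 (weighted w x₀) ≤ ENNReal.ofReal Q₀)
    {γ b : Icc (0 : ℝ) T → ℝ} (hγ : Integrable γ (timeMeasure T)) (hγ0 : ∀ s, 0 ≤ γ s)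
    (hb : Integrable b (timeMeasure T)) (hb0 : ∀ s, 0 ≤ b s)
    (h : ∀ᵐ s ∂timeMeasure T, commutator w (coeff (U s)) (coeff (Y s)) +
      ∑' k, ENNReal.ofReal (w k ^ 2) * (‖R s k‖ₑ * ‖coeff (Y s) k‖ₑ) ≤ ENNReal.ofReal
        (√(γ s * (anisoEnergy 0 0 (weighted w (coeff (Y s)))).toReal *
          (anisoEnergy 1 0 (weighted w (coeff (Y s)))).toReal) +
          b s * √(anisoEnergy 0 0 (weighted w (coeff (Y s)))).toReal)) :
    (∀ t, anisoEnergy 0 0 (weighted w (c t)) ≤ ENNReal.ofReal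
      (estimateConst T (∫ s, γ s ∂timeMeasure T) * (Q₀ + (∫ s, b s ∂timeMeasure T) ^ 2))) ∧
    ∫⁻ s, anisoEnergy 1 0 (weighted w (coeff (Y s))) ∂timeMeasure T ≤ ENNReal.ofReal
      (estimateConst T (∫ s, γ s ∂timeMeasure T) * (Q₀ + (∫ s, b s ∂timeMeasure T) ^ 2)) := by
  set μ := timeMeasure T
  have hW2 : ∀ k, w k ^ 2 ≤ W ^ 2 := fun k => by
    rw [← sq_abs]; exact pow_le_pow_left₀ (abs_nonneg _) (hw k) 2
  have hcm : ∀ k, AEStronglyMeasurable (fun s => c s k) μ := fun k => by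
    simp only [hc]
    exact (continuous_const.add (continuous_setIntegral_Iic (hFint k))).aestronglyMeasurable
  have hYm : ∀ k, AEStronglyMeasurable (fun s => coeff (Y s) k) μ := fun k =>
    (hcm k).congr (hY.mono fun s hs => by simp only [hs])
  have hUk : ∀ k, AEStronglyMeasurable (fun s => coeff (U s) k) μ := fun k =>
    (coeffL k).continuous.comp_aestronglyMeasurable hUm
  have hwm : ∀ k, AEStronglyMeasurable (fun s => weighted w (coeff (Y s)) k) μ := fun k =>
    (hYm k).const_smul (w k)
  -- finiteness
  have fin11 := ae_lt_top' (aemeasurable_anisoEnergy hYm 1 1) hY11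
  have finU := ae_lt_top' (aemeasurable_anisoEnergy hUk 1 0) hU
  have hadv : ∀ᵐ s ∂μ, advection (coeff (U s)) (coeff (Y s)) (coeff (Y s)) ≤
      2 * japaneseSum * (anisoEnergy 1 0 (coeff (U s)) + anisoEnergy 1 1 (coeff (Y s))) *
        ENNReal.ofReal (M ^ 2 / (2 * Real.pi) ^ 2) ^ (1 / 2 : ℝ) := by
    filter_upwards [hYb] with s hs
    refine (advection_le (coeff_div (U s))).trans ?_
    rw [ENNReal.mul_rpow_of_nonneg _ _ (by norm_num), mul_assoc (2 * japaneseSum)]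
    refine mul_le_mul' le_rfl (mul_le_mul' (sqrt_mul_le_add _ _) (ENNReal.rpow_le_rpow ?_ (by norm_num)))
    rw [anisoEnergy_coeff]
    gcongr
  have hadvI : ∫⁻ s, 2 * japaneseSum * (anisoEnergy 1 0 (coeff (U s)) + anisoEnergy 1 1 (coeff (Y s))) *
        ENNReal.ofReal (M ^ 2 / (2 * Real.pi) ^ 2) ^ (1 / 2 : ℝ) ∂μ ≠ ∞ := by
    have hk : ENNReal.ofReal (M ^ 2 / (2 * Real.pi) ^ 2) ^ (1 / 2 : ℝ) ≠ ∞ :=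
      ENNReal.rpow_ne_top_of_nonneg (by norm_num) ENNReal.ofReal_ne_top
    have hj : 2 * japaneseSum ≠ ∞ := ENNReal.mul_ne_top (by norm_num) japaneseSum_ne_top
    rw [lintegral_mul_const' _ _ hk, lintegral_const_mul' _ _ hj,
      lintegral_add_left' (aemeasurable_anisoEnergy hUk 1 0)]
    exact ENNReal.mul_ne_top (ENNReal.mul_ne_top hj (ENNReal.add_ne_top.2 ⟨hU, hY11⟩)) hk
  have hsum0 : Summable fun k => w k ^ 2 * ‖x₀ k‖ ^ 2 := by
    have := (hasSum_anisoEnergy (h0.trans_lt ENNReal.ofReal_lt_top).ne).summable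
    refine this.congr fun k => ?_
    rw [weighted, norm_smul, mul_pow, Real.norm_eq_abs, sq_abs]
  have hQ0' : ∑' k, w k ^ 2 * ‖x₀ k‖ ^ 2 ≤ Q₀ := by
    have h1 := hasSum_anisoEnergy (h0.trans_lt ENNReal.ofReal_lt_top).ne
    have h2 := ENNReal.toReal_mono ENNReal.ofReal_ne_top h0
    rw [ENNReal.toReal_ofReal hQ₀, ← h1.tsum_eq] at h2
    refine le_trans (le_of_eq ?_) h2
    congr 1; ext k
    rw [weighted, norm_smul, mul_pow, Real.norm_eq_abs, sq_abs]
  -- The absolute convergence that the energy identity requires. The bound depends on `W` and `M`,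
  -- but only its finiteness is used.
  have hFc : ∫⁻ s, ∑' k, ENNReal.ofReal (w k ^ 2) * (‖F s k‖ₑ * ‖c s k‖ₑ) ∂μ ≠ ∞ := by
    have hle : ∀ᵐ s ∂μ, ∑' k, ENNReal.ofReal (w k ^ 2) * (‖F s k‖ₑ * ‖c s k‖ₑ) ≤
        ENNReal.ofReal (W ^ 2) * ((anisoEnergy 1 1 (coeff (Y s)) + 2 * japaneseSum *
          (anisoEnergy 1 0 (coeff (U s)) + anisoEnergy 1 1 (coeff (Y s))) *
          ENNReal.ofReal (M ^ 2 / (2 * Real.pi) ^ 2) ^ (1 / 2 : ℝ)) +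
          ∑' k, ‖R s k‖ₑ * ‖coeff (Y s) k‖ₑ) := by
      filter_upwards [hY, hF, hadv] with s h1 h2 h3
      have h4 : ∀ k, ENNReal.ofReal (w k ^ 2) * (‖F s k‖ₑ * ‖c s k‖ₑ) ≤ ENNReal.ofReal (W ^ 2) *
          ((ENNReal.ofReal ((k.1 : ℝ) ^ 2) * ‖coeff (Y s) k‖ₑ ^ 2 +
            ‖convection (U s) (Y s) k‖ₑ * ‖coeff (Y s) k‖ₑ) + ‖R s k‖ₑ * ‖coeff (Y s) k‖ₑ) := fun k => by
        refine mul_le_mul' (ENNReal.ofReal_le_ofReal (hW2 k)) ?_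
        rw [← h1]
        rcases h2 k with h5 | h5
        · simp [h5]
        · rw [h5]
          have h6 : ‖-((k.1 : ℝ) ^ 2) • coeff (Y s) k - convection (U s) (Y s) k - R s k‖ₑ ≤
              ENNReal.ofReal ((k.1 : ℝ) ^ 2) * ‖coeff (Y s) k‖ₑ + ‖convection (U s) (Y s) k‖ₑ +
                ‖R s k‖ₑ := by
            refine enorm_sub_le.trans (add_le_add (enorm_sub_le.trans
              (add_le_add (le_of_eq ?_) le_rfl)) le_rfl)
            rw [enorm_smul, enorm_neg, Real.enorm_of_nonneg (by positivity)]
          refine (mul_le_mul' h6 le_rfl).trans (le_of_eq ?_)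
          ring
      refine (ENNReal.tsum_le_tsum h4).trans ?_
      rw [ENNReal.tsum_mul_left, ENNReal.tsum_add, ENNReal.tsum_add]
      refine mul_le_mul' le_rfl (add_le_add (add_le_add ?_ ((tsum_convection_le _ _ _).trans h3)) le_rfl)
      refine le_trans ?_ (anisoEnergy_mono le_rfl zero_le_one _)
      rw [anisoEnergy_one_zero]
      exact le_add_self
    refine ((lintegral_mono_ae hle).trans_lt ?_).ne
    have hRY : AEMeasurable (fun s => ∑' k, ‖R s k‖ₑ * ‖coeff (Y s) k‖ₑ) μ :=
      AEMeasurable.tsum fun k => (hRm k).enorm.mul (hYm k).enorm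
    rw [lintegral_const_mul' _ _ ENNReal.ofReal_ne_top, lintegral_add_right' _ hRY,
      lintegral_add_left' (aemeasurable_anisoEnergy hYm 1 1)]
    exact ENNReal.mul_lt_top ENNReal.ofReal_lt_top (lt_top_iff_ne_top.2
      (ENNReal.add_ne_top.2 ⟨ENNReal.add_ne_top.2 ⟨hY11, hadvI⟩, hR⟩))
  obtain ⟨hPint, hPs, hQs⟩ := hasSum_energy (μ := μ) (p := fun k => w k ^ 2) (fun k => sq_nonneg _)
    hFint hc hsum0 hFc
  set P : Icc (0 : ℝ) T → ℝ := fun s => ∑' k, w k ^ 2 * inner ℝ (F s k) (c s k)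
  set Q : Icc (0 : ℝ) T → ℝ := fun t => ∑' k, w k ^ 2 * ‖c t k‖ ^ 2 with hQdef
  have hQP : ∀ t, Q t = (∑' k, w k ^ 2 * ‖x₀ k‖ ^ 2) + 2 * ∫ s in Iic t, P s ∂μ := fun t =>
    (hQs t).tsum_eq
  have hQe : ∀ t, anisoEnergy 0 0 (weighted w (c t)) = ENNReal.ofReal (Q t) := fun t => by
    rw [anisoEnergy_zero_zero_eq, hQdef, ENNReal.ofReal_tsum_of_nonneg (fun _ => by positivity)
      (hQs t).summable]
    congr 1; ext k
    rw [enorm_weighted_sq, ENNReal.ofReal_mul (sq_nonneg _), ofReal_norm_sq_cplane]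
  have hQ0 : ∀ t, 0 ≤ Q t := fun t => tsum_nonneg fun _ => by positivity
  set D : Icc (0 : ℝ) T → ℝ := fun s => (dissipation (weighted w (coeff (Y s)))).toReal
  have hDle : ∀ s, dissipation (weighted w (coeff (Y s))) ≤ ENNReal.ofReal (W ^ 2) *
      anisoEnergy 1 1 (coeff (Y s)) := fun s => by
    refine le_trans ?_ ((anisoEnergy_weighted_le hw 1 0 _).trans
      (mul_le_mul' le_rfl (anisoEnergy_mono le_rfl zero_le_one _)))
    rw [anisoEnergy_one_zero]
    exact le_add_self
  have hDm : AEMeasurable (fun s => dissipation (weighted w (coeff (Y s)))) μ :=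
    AEMeasurable.tsum fun k => ((hwm k).enorm.pow_const 2).const_mul _
  have hDI : ∫⁻ s, dissipation (weighted w (coeff (Y s))) ∂μ ≠ ∞ := by
    refine ((lintegral_mono hDle).trans_lt ?_).ne
    rw [lintegral_const_mul' _ _ ENNReal.ofReal_ne_top]
    exact ENNReal.mul_lt_top ENNReal.ofReal_lt_top (lt_top_iff_ne_top.2 hY11)
  have hDint : Integrable D μ := integrable_toReal_of_lintegral_ne_top hDm hDI
  have hγ1 : Integrable (fun s => γ s + 1) μ := hγ.add (integrable_const 1)
  have hmain : ∀ᵐ s ∂μ, 2 * P s ≤ -D s + (γ s + 1) * Q s + 2 * (b s * √(Q s)) := by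
    filter_upwards [hY, hF, hadv, fin11, finU, h] with s h1 h2 h3 h4 h5 h7
    have h8 : (anisoEnergy 0 0 (weighted w (coeff (Y s)))).toReal = Q s := by
      rw [h1, hQe, ENNReal.toReal_ofReal (hQ0 s)]
    have hDfin : dissipation (weighted w (coeff (Y s))) ≠ ∞ :=
      ((hDle s).trans_lt (ENNReal.mul_lt_top ENNReal.ofReal_lt_top h4)).ne
    have h9 : (anisoEnergy 1 0 (weighted w (coeff (Y s)))).toReal = Q s + D s := by
      rw [anisoEnergy_one_zero, ENNReal.toReal_add _ hDfin, h8]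
      rw [h1, hQe]; exact ENNReal.ofReal_ne_top
    rw [h8, h9] at h7
    have hD0 : 0 ≤ D s := ENNReal.toReal_nonneg
    have h10 := tsum_inner_le hw (F := F s) h2
      ((anisoEnergy_mono le_rfl zero_le_one _).trans_lt h4).ne
      (h3.trans_lt (ENNReal.mul_lt_top (ENNReal.mul_lt_top (ENNReal.mul_lt_top (by norm_num)
        (lt_top_iff_ne_top.2 japaneseSum_ne_top)) (ENNReal.add_lt_top.2 ⟨h5, h4⟩))
        (lt_top_iff_ne_top.2 (ENNReal.rpow_ne_top_of_nonneg (by norm_num) ENNReal.ofReal_ne_top)))).ne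
      (add_nonneg (Real.sqrt_nonneg _) (mul_nonneg (hb0 s) (Real.sqrt_nonneg _))) h7
    have h11 : P s = ∑' k, w k ^ 2 * inner ℝ (F s k) (coeff (Y s) k) := by rw [h1]
    rw [← h11] at h10
    -- This spends one of the two copies of the dissipation and adds $1$ to the growth rate.
    have h12 : 2 * √(γ s * Q s * (Q s + D s)) ≤ γ s * Q s + (Q s + D s) := by
      have hx : 0 ≤ γ s * Q s := mul_nonneg (hγ0 s) (hQ0 s)
      have hy : 0 ≤ Q s + D s := add_nonneg (hQ0 s) hD0
      rw [Real.sqrt_mul hx]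
      nlinarith [sq_nonneg (√(γ s * Q s) - √(Q s + D s)), Real.sq_sqrt hx, Real.sq_sqrt hy]
    change P s ≤ -D s + _ at h10
    linarith
  have hconcl := fun t => energy_gronwall hγ1 (fun s => by linarith [hγ0 s]) hQ0 hDint
    (fun s => ENNReal.toReal_nonneg) hb hb0 hPint (tsum_nonneg fun _ => by positivity) hQP hmain t
  have hΓ : ∫ s, (γ s + 1) ∂μ = ∫ s, γ s ∂μ + μ.real univ := by
    rw [integral_add hγ (integrable_const 1)]; simp
  simp only [hΓ] at hconcl
  set Γ := ∫ s, γ s ∂μ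
  set β := ∫ s, b s ∂μ
  have hΓ0 : 0 ≤ Γ := integral_nonneg hγ0
  have hμ0 : 0 ≤ μ.real univ := measureReal_nonneg
  have hC0 : 0 ≤ energyConst (Γ + μ.real univ) := by unfold energyConst; positivity
  set C := energyConst (Γ + μ.real univ)
  have hle : C * (∑' k, w k ^ 2 * ‖x₀ k‖ ^ 2 + β ^ 2) ≤ C * (Q₀ + β ^ 2) := by gcongr
  have hX : 0 ≤ C * (Q₀ + β ^ 2) := by positivity
  -- The additional term pays for the time integral of the energy itself, which the $\tilde H^{1,0}$
  -- norm contains besides the dissipation.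
  have hest : estimateConst T Γ * (Q₀ + β ^ 2) = C * (Q₀ + β ^ 2) + μ.real univ * (C * (Q₀ + β ^ 2)) := by
    unfold estimateConst; ring
  have hpos : 0 ≤ μ.real univ * (C * (Q₀ + β ^ 2)) := by positivity
  refine ⟨fun t => ?_, ?_⟩
  · rw [hQe]
    refine ENNReal.ofReal_le_ofReal ?_
    rw [hest]
    linarith [(hconcl t).1]
  · have hDu : ∫ s, D s ∂μ ≤ C * (Q₀ + β ^ 2) := by
      -- The last time `T` gives the integral over the whole interval; for negative `T` the interval
      -- is empty.
      by_cases hT : 0 ≤ T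
      · have := (hconcl ⟨T, hT, le_rfl⟩).2.trans hle
        have hu : Iic (⟨T, hT, le_rfl⟩ : Icc (0 : ℝ) T) = univ := by
          ext s; simp [← Subtype.coe_le_coe, s.2.2]
        rwa [hu, Measure.restrict_univ] at this
      · have : IsEmpty (Icc (0 : ℝ) T) := ⟨fun s => hT (s.2.1.trans s.2.2)⟩
        rw [Measure.eq_zero_of_isEmpty μ, integral_zero_measure]; exact hX
    have e1 : ∀ᵐ s ∂μ, anisoEnergy 1 0 (weighted w (coeff (Y s))) ≤
        ENNReal.ofReal (C * (Q₀ + β ^ 2)) + dissipation (weighted w (coeff (Y s))) := by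
      filter_upwards [hY] with s h1
      rw [anisoEnergy_one_zero]
      refine add_le_add ?_ le_rfl
      rw [h1, hQe]
      exact ENNReal.ofReal_le_ofReal ((hconcl s).1.trans hle)
    refine (lintegral_mono_ae e1).trans ?_
    rw [lintegral_add_left measurable_const, lintegral_const, hest, add_comm,
      ENNReal.ofReal_add hX hpos]
    refine add_le_add ?_ ?_
    · have := ofReal_integral_eq_lintegral_ofReal hDint (Filter.Eventually.of_forall fun s => ENNReal.toReal_nonneg)
      have e2 : ∫⁻ s, dissipation (weighted w (coeff (Y s))) ∂μ = ENNReal.ofReal (∫ s, D s ∂μ) := by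
        rw [this]
        refine lintegral_congr_ae ((ae_lt_top' hDm hDI).mono fun s hs => ?_)
        exact (ENNReal.ofReal_toReal hs.ne).symm
      rw [e2]
      exact ENNReal.ofReal_le_ofReal hDu
    · rw [ENNReal.ofReal_mul hμ0, mul_comm]
      refine mul_le_mul' (le_of_eq ?_) le_rfl
      rw [measureReal_def, ENNReal.ofReal_toReal (measure_ne_top _ _)]

/-! ### Estimates for the linearised and for the deterministic equation -/

theorem weighted_one (c : ℤ × ℤ → CPlane) : weighted (fun _ => 1) c = c := by
  funext k; simp [weighted]

theorem weighted_div (w : ℤ × ℤ → ℝ) {u : ℤ × ℤ → CPlane}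
    (hu : ∀ k, ∑ j, (freq k j : ℂ) * u k j = 0) (k : ℤ × ℤ) :
    ∑ j, (freq k j : ℂ) * weighted w u k j = 0 := by
  have := hu k
  simp only [weighted, PiLp.smul_apply, Complex.real_smul, mul_left_comm _ ((w k : ℝ) : ℂ),
    ← Finset.mul_sum] at *
  rw [this, mul_zero]

theorem enorm_sum_weighted (w : ℤ × ℤ → ℝ) (u : ℤ × ℤ → CPlane) (k l : ℤ × ℤ) :
    ‖∑ j, (freq l j : ℂ) * weighted w u k j‖ₑ =
      ENNReal.ofReal |w k| * ‖∑ j, (freq l j : ℂ) * u k j‖ₑ := by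
  simp only [weighted, PiLp.smul_apply, Complex.real_smul, mul_left_comm _ ((w k : ℝ) : ℂ),
    ← Finset.mul_sum]
  rw [enorm_mul]
  congr 1
  rw [← ofReal_norm, Complex.norm_real, Real.norm_eq_abs]

theorem enorm_weighted (w : ℤ × ℤ → ℝ) (c : ℤ × ℤ → CPlane) (k : ℤ × ℤ) :
    ‖weighted w c k‖ₑ = ENNReal.ofReal |w k| * ‖c k‖ₑ := by
  rw [weighted, enorm_smul, Real.enorm_eq_ofReal_abs]

theorem anisoEnergy_weighted_le_weighted {w w' : ℤ × ℤ → ℝ} {c : ℤ × ℤ → CPlane} {a b a' b' : ℕ}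
    {C : ℝ} (hC : 0 ≤ C) (h : ∀ k : ℤ × ℤ, c k = 0 ∨
      w k ^ 2 * ((1 + (k.1 : ℝ) ^ 2) ^ a * (1 + (k.2 : ℝ) ^ 2) ^ b) ≤
        C * (w' k ^ 2 * ((1 + (k.1 : ℝ) ^ 2) ^ a' * (1 + (k.2 : ℝ) ^ 2) ^ b'))) :
    anisoEnergy a b (weighted w c) ≤ ENNReal.ofReal C * anisoEnergy a' b' (weighted w' c) := by
  unfold anisoEnergy
  rw [← ENNReal.tsum_mul_left]
  refine ENNReal.tsum_le_tsum fun k => ?_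
  rw [enorm_weighted_sq, enorm_weighted_sq]
  rcases h k with h0 | h0
  · simp [h0]
  · rw [← mul_assoc, ← mul_assoc, ← mul_assoc, ← ENNReal.ofReal_mul (by positivity),
      ← ENNReal.ofReal_mul hC, ← ENNReal.ofReal_mul (by positivity)]
    refine mul_le_mul' (ENNReal.ofReal_le_ofReal ?_) le_rfl
    linarith

theorem rpow_half_eq {x : ℝ≥0∞} (hx : x ≠ ∞) : x ^ (1 / 2 : ℝ) = ENNReal.ofReal √x.toReal := by
  rw [Real.sqrt_eq_rpow, ← ENNReal.ofReal_rpow_of_nonneg ENNReal.toReal_nonneg (by norm_num),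
    ENNReal.ofReal_toReal hx]

/-- The growth rate of the energy in the equation linearised at `c`. -/
def growthRate (c : ℤ × ℤ → CPlane) : ℝ := 36 * japaneseSum.toReal ^ 2 * (anisoEnergy 1 2 c).toReal

theorem growthRate_nonneg (c : ℤ × ℤ → CPlane) : 0 ≤ growthRate c := by
  unfold growthRate; positivity

/-- Of the two factors $w_{k+l}$, one stays on the test field and the other is distributed over the
two arguments of the convection by submultiplicativity. -/
theorem tsum_weighted_convection_le {w : ℤ × ℤ → ℝ} (h1 : ∀ k, 1 ≤ w k)
    (hmul : ∀ k l, w (k + l) ≤ w k * w l) (u v : H) :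
    ∑' k, ENNReal.ofReal (w k ^ 2) * (‖convection v u k‖ₑ * ‖coeff v k‖ₑ) ≤
      advection (weighted w (coeff v)) (weighted w (coeff u)) (weighted w (coeff v)) := by
  have e : ∀ k, ENNReal.ofReal (w k ^ 2) * (‖convection v u k‖ₑ * ‖coeff v k‖ₑ) =
      ‖convection v u k‖ₑ * ‖weighted (fun k => w k ^ 2) (coeff v) k‖ₑ := fun k => by
    rw [enorm_weighted, abs_of_nonneg (sq_nonneg _)]; ring
  simp only [e]
  refine (tsum_convection_le _ _ _).trans ?_
  unfold advection
  refine ENNReal.tsum_le_tsum fun k => ENNReal.tsum_le_tsum fun l => ?_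
  rw [enorm_sum_weighted, enorm_weighted, enorm_weighted, enorm_weighted,
    abs_of_nonneg (sq_nonneg _), abs_of_nonneg (zero_le_one.trans (h1 _)),
    abs_of_nonneg (zero_le_one.trans (h1 _)), abs_of_nonneg (zero_le_one.trans (h1 _))]
  have : ENNReal.ofReal (w (k + l) ^ 2) ≤ ENNReal.ofReal (w k) * ENNReal.ofReal (w l) *
      ENNReal.ofReal (w (k + l)) := by
    rw [← ENNReal.ofReal_mul (zero_le_one.trans (h1 _)), ← ENNReal.ofReal_mul
      (mul_nonneg (zero_le_one.trans (h1 _)) (zero_le_one.trans (h1 _)))]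
    refine ENNReal.ofReal_le_ofReal ?_
    rw [sq]
    exact mul_le_mul_of_nonneg_right (hmul k l) (zero_le_one.trans (h1 _))
  calc _ = ENNReal.ofReal (w (k + l) ^ 2) * (‖∑ j, (freq l j : ℂ) * coeff v k j‖ₑ * ‖coeff u l‖ₑ *
        ‖coeff v (k + l)‖ₑ) := by ring
    _ ≤ _ := mul_le_mul' this le_rfl
    _ = _ := by ring

/-- The Lipschitz condition replaces the difference of weights by $|k_2|$: the weight costs one
derivative in $x_2$ of the transporting field. -/
theorem commutator_le {w : ℤ × ℤ → ℝ} (hlip : ∀ k l, |w (k + l) - w l| ≤ |(k.2 : ℝ)|)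
    (u c : ℤ × ℤ → CPlane) :
    commutator w u c ≤ advection (weighted (fun k => (k.2 : ℝ)) u) c (weighted w c) := by
  unfold commutator advection
  refine ENNReal.tsum_le_tsum fun k => ENNReal.tsum_le_tsum fun l => ?_
  rw [enorm_sum_weighted, enorm_weighted, ENNReal.ofReal_mul (abs_nonneg _)]
  calc _ = ENNReal.ofReal |w (k + l) - w l| * (‖∑ j, (freq l j : ℂ) * u k j‖ₑ * ‖c l‖ₑ *
        (ENNReal.ofReal |w (k + l)| * ‖c (k + l)‖ₑ)) := by ring
    _ ≤ _ := mul_le_mul' (ENNReal.ofReal_le_ofReal (hlip k l)) le_rfl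
    _ = _ := by ring

/-- Both transport by $u$ and the term $v\cdot\nabla u$ are at most a multiple of $\sqrt{AQP}$, with
$A$ the $\tilde H^{1,2}$ energy of $u$, $Q$ the weighted energy of $v$ and $P$ its $\tilde H^{1,0}$
version. The alternative on the weight covers two uses. A constant weight has no commutator, which
serves for differences of solutions; a weight that dominates $1+|k_2|$ on the support of $\hat v$
lets $P$ control $\tilde H^{1,1}$, which serves for the Galerkin bounds. -/
theorem drift_le {w : ℤ × ℤ → ℝ} (h1 : ∀ k, 1 ≤ w k)
    (hmul : ∀ k l, w (k + l) ≤ w k * w l) (hlip : ∀ k l, |w (k + l) - w l| ≤ |(k.2 : ℝ)|)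
    (hle : ∀ k : ℤ × ℤ, w k ≤ 1 + |(k.2 : ℝ)|) (u v : H)
    (hsupp : (∀ k, w k = 1) ∨ ∀ k, coeff v k ≠ 0 → 1 + |(k.2 : ℝ)| ≤ w k)
    (hu : anisoEnergy 1 2 (coeff u) ≠ ∞) (hv : anisoEnergy 1 0 (weighted w (coeff v)) ≠ ∞) :
    commutator w (coeff u) (coeff v) +
      ∑' k, ENNReal.ofReal (w k ^ 2) * (‖convection v u k‖ₑ * ‖coeff v k‖ₑ) ≤
    ENNReal.ofReal √(growthRate (coeff u) * (anisoEnergy 0 0 (weighted w (coeff v))).toReal *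
      (anisoEnergy 1 0 (weighted w (coeff v))).toReal) := by
  set c := coeff v
  set A := anisoEnergy 1 2 (coeff u)
  set Q := anisoEnergy 0 0 (weighted w c)
  set P := anisoEnergy 1 0 (weighted w c)
  have hQ : Q ≠ ∞ := ((anisoEnergy_mono zero_le le_rfl _).trans_lt (lt_top_iff_ne_top.2 hv)).ne
  have a1 : commutator w (coeff u) c ≤ 2 * japaneseSum * (A * Q * P) ^ (1 / 2 : ℝ) := by
    rcases hsupp with hs | hs
    · have : commutator w (coeff u) c = 0 := by simp [commutator, hs]
      rw [this]; exact zero_le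
    · refine (commutator_le hlip _ _).trans ((advection_le (weighted_div _ (coeff_div u))).trans ?_)
      refine mul_le_mul' le_rfl (ENNReal.rpow_le_rpow ?_ (by norm_num))
      have b1 : anisoEnergy 1 0 (weighted (fun k => (k.2 : ℝ)) (coeff u)) ≤ A := by
        have := anisoEnergy_weighted_le_weighted (w := fun k => (k.2 : ℝ)) (w' := fun _ => 1)
          (c := coeff u) (a := 1) (b := 0) (a' := 1) (b' := 2) zero_le_one (fun k => Or.inr (by
            have : (k.2 : ℝ) ^ 2 ≤ (1 + (k.2 : ℝ) ^ 2) ^ 2 := by nlinarith [sq_nonneg (k.2 : ℝ)]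
            have h2 : 0 ≤ 1 + (k.1 : ℝ) ^ 2 := by positivity
            nlinarith [mul_le_mul_of_nonneg_left this h2]))
        rwa [weighted_one, ENNReal.ofReal_one, one_mul] at this
      have b2 : anisoEnergy 1 1 c ≤ P := by
        have := anisoEnergy_weighted_le_weighted (w := fun _ => 1) (w' := w)
          (c := c) (a := 1) (b := 1) (a' := 1) (b' := 0) zero_le_one (fun k => by
            by_cases h0 : c k = 0
            · exact Or.inl h0
            · right
              have h3 := hs k h0
              have h4 : 1 + (k.2 : ℝ) ^ 2 ≤ w k ^ 2 := by
                have := pow_le_pow_left₀ (by positivity) h3 2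
                nlinarith [abs_nonneg (k.2 : ℝ), sq_abs (k.2 : ℝ)]
              have h2 : 0 ≤ 1 + (k.1 : ℝ) ^ 2 := by positivity
              nlinarith [mul_le_mul_of_nonneg_left h4 h2])
        rwa [weighted_one, ENNReal.ofReal_one, one_mul] at this
      calc _ ≤ A * P * Q := mul_le_mul' (mul_le_mul' b1 b2) le_rfl
        _ = A * Q * P := by ring
  have a2 : ∑' k, ENNReal.ofReal (w k ^ 2) * (‖convection v u k‖ₑ * ‖c k‖ₑ) ≤
      4 * japaneseSum * (A * Q * P) ^ (1 / 2 : ℝ) := by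
    refine (tsum_weighted_convection_le h1 hmul u v).trans
      ((advection_le (weighted_div _ (coeff_div v))).trans ?_)
    have b1 : anisoEnergy 1 1 (weighted w (coeff u)) ≤ 4 * A := by
      have := anisoEnergy_weighted_le_weighted (w := w) (w' := fun _ => 1)
        (c := coeff u) (a := 1) (b := 1) (a' := 1) (b' := 2) (C := 4) (by norm_num) (fun k => Or.inr (by
          have h3 : w k ^ 2 ≤ 4 * (1 + (k.2 : ℝ) ^ 2) := by
            have := pow_le_pow_left₀ (zero_le_one.trans (h1 k)) (hle k) 2
            nlinarith [sq_nonneg (|(k.2 : ℝ)| - 1), sq_abs (k.2 : ℝ)]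
          have h2 : 0 ≤ (1 + (k.1 : ℝ) ^ 2) * (1 + (k.2 : ℝ) ^ 2) := by positivity
          nlinarith [mul_le_mul_of_nonneg_left h3 h2]))
      rwa [weighted_one, ENNReal.ofReal_ofNat] at this
    calc _ ≤ 2 * japaneseSum * (4 * (A * Q * P)) ^ (1 / 2 : ℝ) := by
          refine mul_le_mul' le_rfl (ENNReal.rpow_le_rpow ?_ (by norm_num))
          calc _ ≤ P * (4 * A) * Q := mul_le_mul' (mul_le_mul' le_rfl b1) le_rfl
            _ = _ := by ring
      _ = _ := by
          have : (4 : ℝ≥0∞) ^ (1 / 2 : ℝ) = 2 := by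
            have h4 : (4 : ℝ≥0∞) = 2 ^ (2 : ℝ) := by norm_num
            rw [h4, ← ENNReal.rpow_mul]; norm_num
          rw [ENNReal.mul_rpow_of_nonneg _ _ (by norm_num), this]; ring
  refine (add_le_add a1 a2).trans (le_of_eq ?_)
  have hfin : A * Q * P ≠ ∞ := ENNReal.mul_ne_top (ENNReal.mul_ne_top hu hQ) hv
  -- The commutator contributes $2$ and the other term $4$ times `japaneseSum`; the square of their
  -- sum is the constant in `growthRate`.
  have e : growthRate (coeff u) * Q.toReal * P.toReal = (6 * japaneseSum.toReal) ^ 2 * (A * Q * P).toReal := by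
    rw [ENNReal.toReal_mul, ENNReal.toReal_mul]; unfold growthRate; ring
  rw [e, Real.sqrt_mul (sq_nonneg _), Real.sqrt_sq (by positivity), ENNReal.ofReal_mul (by positivity),
    ← rpow_half_eq hfin, ENNReal.ofReal_mul (by norm_num), ENNReal.ofReal_toReal japaneseSum_ne_top,
    ENNReal.ofReal_ofNat, ← add_mul, ← add_mul]
  norm_num

/-- An application of `energy_estimate` in which the remainder consists of the convection of the
reference field by the solution and of the forcing. The growth rate is supplied by `drift_le`, and
the source $b$ by the forcing. -/
theorem linearised_estimate {T : ℝ} {w : ℤ × ℤ → ℝ} {W : ℝ} (hw : ∀ k, |w k| ≤ W) (h1 : ∀ k, 1 ≤ w k)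
    (hmul : ∀ k l, w (k + l) ≤ w k * w l) (hlip : ∀ k l, |w (k + l) - w l| ≤ |(k.2 : ℝ)|)
    (hle : ∀ k : ℤ × ℤ, w k ≤ 1 + |(k.2 : ℝ)|)
    {U Y : Icc (0 : ℝ) T → H} {F g c : Icc (0 : ℝ) T → ℤ × ℤ → CPlane}
    (hFint : ∀ k, Integrable (fun s => F s k) (timeMeasure T))
    (hc : ∀ t k, c t k = ∫ s in Iic t, F s k ∂timeMeasure T)
    (hY : ∀ᵐ s ∂timeMeasure T, coeff (Y s) = c s)
    (hF : ∀ᵐ s ∂timeMeasure T, ∀ k, coeff (Y s) k = 0 ∨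
      F s k = partialOneSq (Y s) k - convection (Y s) (U s) k - convection (U s) (Y s) k + g s k)
    (hU : ∫⁻ s, anisoEnergy 1 2 (coeff (U s)) ∂timeMeasure T ≠ ∞)
    (hUm : AEStronglyMeasurable U (timeMeasure T))
    (hY11 : ∫⁻ s, anisoEnergy 1 1 (coeff (Y s)) ∂timeMeasure T ≠ ∞)
    {M : ℝ} (hYb : ∀ᵐ s ∂timeMeasure T, ‖Y s‖ ≤ M)
    (hgm : ∀ k, AEStronglyMeasurable (fun s => g s k) (timeMeasure T))
    (hsupp : (∀ k, w k = 1) ∨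
      ∀ᵐ s ∂timeMeasure T, ∀ k, coeff (Y s) k ≠ 0 → 1 + |(k.2 : ℝ)| ≤ w k)
    {b : Icc (0 : ℝ) T → ℝ} (hb : Integrable b (timeMeasure T)) (hb0 : ∀ s, 0 ≤ b s)
    (hg : ∀ᵐ s ∂timeMeasure T,
      ∑' k, ENNReal.ofReal (w k ^ 2) * (‖g s k‖ₑ * ‖coeff (Y s) k‖ₑ) ≤ ENNReal.ofReal
        (b s * √(anisoEnergy 0 0 (weighted w (coeff (Y s)))).toReal)) :
    (∀ t, anisoEnergy 0 0 (weighted w (c t)) ≤ ENNReal.ofReal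
      (estimateConst T (∫ s, growthRate (coeff (U s)) ∂timeMeasure T) *
        (∫ s, b s ∂timeMeasure T) ^ 2)) ∧
    ∫⁻ s, anisoEnergy 1 0 (weighted w (coeff (Y s))) ∂timeMeasure T ≤ ENNReal.ofReal
      (estimateConst T (∫ s, growthRate (coeff (U s)) ∂timeMeasure T) *
        (∫ s, b s ∂timeMeasure T) ^ 2) := by
  set μ := timeMeasure T
  have hcm : ∀ k, AEStronglyMeasurable (fun s => c s k) μ := fun k => by
    simp only [hc]
    exact (continuous_setIntegral_Iic (hFint k)).aestronglyMeasurable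
  have hYk : ∀ k, AEStronglyMeasurable (fun s => coeff (Y s) k) μ := fun k =>
    (hcm k).congr (hY.mono fun s hs => by simp only [hs])
  have hYm : AEStronglyMeasurable Y μ := aestronglyMeasurable_of_coeff hYk
  have hUk : ∀ k, AEStronglyMeasurable (fun s => coeff (U s) k) μ := fun k =>
    (coeffL k).continuous.comp_aestronglyMeasurable hUm
  have hw0 : ∀ k, 0 ≤ w k := fun k => zero_le_one.trans (h1 k)
  have finU := ae_lt_top' (aemeasurable_anisoEnergy hUk 1 2) hU
  have finY := ae_lt_top' (aemeasurable_anisoEnergy hYk 1 1) hY11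
  have hgr : Integrable (fun s => growthRate (coeff (U s))) μ :=
    (integrable_toReal_of_lintegral_ne_top (aemeasurable_anisoEnergy hUk 1 2) hU).const_mul _
  have hW0 : 0 ≤ W := (abs_nonneg _).trans (hw 0)
  have hconv : ∀ k, AEStronglyMeasurable (fun s => convection (Y s) (U s) k) μ := fun k =>
    (convectionL k).aestronglyMeasurable_comp₂ hYm hUm
  have hgY : ∫⁻ s, ∑' k, ‖g s k‖ₑ * ‖coeff (Y s) k‖ₑ ∂μ ≠ ∞ := by
    have h2 : ∀ᵐ s ∂μ, ∑' k, ‖g s k‖ₑ * ‖coeff (Y s) k‖ₑ ≤ ENNReal.ofReal (b s * (W * M)) := by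
      filter_upwards [hg, hYb] with s h3 h4
      have hM : 0 ≤ M := (norm_nonneg _).trans h4
      refine (ENNReal.tsum_le_tsum fun k => ?_).trans (h3.trans (ENNReal.ofReal_le_ofReal
        (mul_le_mul_of_nonneg_left (Real.sqrt_le_iff.2 ⟨by positivity, ?_⟩) (hb0 s))))
      · have : (1 : ℝ≥0∞) ≤ ENNReal.ofReal (w k ^ 2) := by
          rw [ENNReal.one_le_ofReal]; nlinarith [h1 k]
        calc _ = 1 * (‖g s k‖ₑ * ‖coeff (Y s) k‖ₑ) := (one_mul _).symm
          _ ≤ _ := mul_le_mul' this le_rfl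
      · have h5 := anisoEnergy_weighted_le hw 0 0 (coeff (Y s))
        rw [anisoEnergy_coeff, ← ENNReal.ofReal_mul (sq_nonneg _)] at h5
        have h6 := ENNReal.toReal_mono ENNReal.ofReal_ne_top h5
        rw [ENNReal.toReal_ofReal (by positivity)] at h6
        refine h6.trans ?_
        rw [mul_pow W M]
        refine mul_le_mul_of_nonneg_left ?_ (sq_nonneg _)
        refine (div_le_self (sq_nonneg _) (one_le_pow₀ one_le_two_pi)).trans ?_
        gcongr
    refine ((lintegral_mono_ae h2).trans_lt ?_).ne
    have := (hb.mul_const (W * M)).lintegral_lt_top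
    exact this
  have hRY : ∫⁻ s, ∑' k, ‖convection (Y s) (U s) k - g s k‖ₑ * ‖coeff (Y s) k‖ₑ ∂μ ≠ ∞ := by
    have h2 : ∀ᵐ s ∂μ, ∑' k, ‖convection (Y s) (U s) k - g s k‖ₑ * ‖coeff (Y s) k‖ₑ ≤
        2 * japaneseSum * (anisoEnergy 1 1 (coeff (Y s)) + anisoEnergy 1 2 (coeff (U s))) *
          ENNReal.ofReal (M ^ 2 / (2 * Real.pi) ^ 2) ^ (1 / 2 : ℝ) +
        ∑' k, ‖g s k‖ₑ * ‖coeff (Y s) k‖ₑ := by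
      filter_upwards [hYb] with s h4
      have h3 : ∀ k, ‖convection (Y s) (U s) k - g s k‖ₑ * ‖coeff (Y s) k‖ₑ ≤
          ‖convection (Y s) (U s) k‖ₑ * ‖coeff (Y s) k‖ₑ + ‖g s k‖ₑ * ‖coeff (Y s) k‖ₑ := fun k => by
        rw [← add_mul]; exact mul_le_mul' enorm_sub_le le_rfl
      refine (ENNReal.tsum_le_tsum h3).trans ?_
      rw [ENNReal.tsum_add]
      refine add_le_add ((tsum_convection_le _ _ _).trans ((advection_le (coeff_div _)).trans ?_)) le_rfl
      rw [ENNReal.mul_rpow_of_nonneg _ _ (by norm_num), mul_assoc (2 * japaneseSum)]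
      refine mul_le_mul' le_rfl (mul_le_mul' ((ENNReal.rpow_le_rpow (mul_le_mul'
        (anisoEnergy_mono le_rfl zero_le_one _) (anisoEnergy_mono le_rfl (one_le_two : (1 : ℕ) ≤ 2) _))
        (by norm_num)).trans (sqrt_mul_le_add _ _)) (ENNReal.rpow_le_rpow ?_ (by norm_num)))
      rw [anisoEnergy_coeff]
      gcongr
    refine ((lintegral_mono_ae h2).trans_lt ?_).ne
    have hk : ENNReal.ofReal (M ^ 2 / (2 * Real.pi) ^ 2) ^ (1 / 2 : ℝ) ≠ ∞ :=
      ENNReal.rpow_ne_top_of_nonneg (by norm_num) ENNReal.ofReal_ne_top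
    have hj : 2 * japaneseSum ≠ ∞ := ENNReal.mul_ne_top (by norm_num) japaneseSum_ne_top
    have hgm' : AEMeasurable (fun s => ∑' k, ‖g s k‖ₑ * ‖coeff (Y s) k‖ₑ) μ :=
      AEMeasurable.tsum fun k => (hgm k).enorm.mul (hYk k).enorm
    rw [lintegral_add_right' _ hgm', lintegral_mul_const' _ _ hk, lintegral_const_mul' _ _ hj,
      lintegral_add_left' (aemeasurable_anisoEnergy hYk 1 1)]
    exact ENNReal.add_lt_top.2 ⟨ENNReal.mul_lt_top (ENNReal.mul_lt_top (lt_top_iff_ne_top.2 hj)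
      (ENNReal.add_lt_top.2 ⟨lt_top_iff_ne_top.2 hY11, lt_top_iff_ne_top.2 hU⟩))
      (lt_top_iff_ne_top.2 hk), lt_top_iff_ne_top.2 hgY⟩
  have hsupp' : ∀ᵐ s ∂μ, (∀ k, w k = 1) ∨ ∀ k, coeff (Y s) k ≠ 0 → 1 + |(k.2 : ℝ)| ≤ w k := by
    rcases hsupp with h | h
    · exact Filter.Eventually.of_forall fun s => Or.inl h
    · exact h.mono fun s hs => Or.inr hs
  have key := energy_estimate (T := T) (U := U) (Y := Y) (F := F) (c := c) (x₀ := 0) (Q₀ := 0)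
    (R := fun s k => convection (Y s) (U s) k - g s k) (γ := fun s => growthRate (coeff (U s))) (b := b)
    hw le_rfl hFint (fun t k => by rw [hc, Pi.zero_apply, zero_add]) hY
    (hF.mono fun s hs k => (hs k).imp_right fun h => by rw [h]; unfold partialOneSq; abel)
    ((lintegral_mono fun s => anisoEnergy_mono le_rfl zero_le _).trans_lt
      (lt_top_iff_ne_top.2 hU)).ne hUm hY11 hYb (fun k => (hconv k).sub (hgm k)) hRY
    (by simp [anisoEnergy, weighted]) hgr (fun s => growthRate_nonneg _) hb hb0 (by
      filter_upwards [hg, hsupp', finU, finY] with s h2 h3 h4 h5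
      have hv : anisoEnergy 1 0 (weighted w (coeff (Y s))) ≠ ∞ :=
        ((anisoEnergy_weighted_le hw 1 0 _).trans_lt (ENNReal.mul_lt_top ENNReal.ofReal_lt_top
          ((anisoEnergy_mono le_rfl zero_le_one _).trans_lt h5))).ne
      have h6 := drift_le h1 hmul hlip hle (U s) (Y s) h3 h4.ne hv
      rw [ENNReal.ofReal_add (Real.sqrt_nonneg _) (mul_nonneg (hb0 s) (Real.sqrt_nonneg _))]
      refine le_trans ?_ (add_le_add h6 h2)
      rw [add_assoc, ← ENNReal.tsum_add]
      refine add_le_add le_rfl (ENNReal.tsum_le_tsum fun k => ?_)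
      rw [← mul_add, ← add_mul]
      exact mul_le_mul' le_rfl (mul_le_mul' enorm_sub_le le_rfl))
  simpa only [zero_add] using key

/-! ### Regularity of the deterministic solution in the second variable -/

/-- A bounded approximation of `k₂²`. -/
def truncSq (ε : ℝ) (k : ℤ × ℤ) : ℝ := (k.2 : ℝ) ^ 2 / (1 + ε * (k.2 : ℝ) ^ 2)

/-- The discrete Leibniz rule for $y\mapsto y^2$, kept uniform in $\varepsilon$. The cross term
carries $y/(1+\varepsilon y^2)$ instead of $y$, because only with this damping does one more
derivative in $x_2$ remain controlled by the truncated weight. -/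
theorem abs_truncSq_sub_le {ε : ℝ} (hε : 0 < ε) (k l : ℤ × ℤ) :
    |truncSq ε (k + l) - truncSq ε l| ≤
      2 * truncSq ε k + 2 * (|(k.2 : ℝ)| * |(l.2 : ℝ) / (1 + ε * (l.2 : ℝ) ^ 2)|) := by
  unfold truncSq
  have e : ((k + l).2 : ℝ) = k.2 + l.2 := by simp
  rw [e]
  generalize (k.2 : ℝ) = x
  generalize (l.2 : ℝ) = y
  have hx : 0 < 1 + ε * x ^ 2 := by positivity
  have hy : 0 < 1 + ε * y ^ 2 := by positivity
  have hz : 0 < 1 + ε * (x + y) ^ 2 := by positivity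
  have e1 : (x + y) ^ 2 / (1 + ε * (x + y) ^ 2) - y ^ 2 / (1 + ε * y ^ 2) =
      x ^ 2 / ((1 + ε * (x + y) ^ 2) * (1 + ε * y ^ 2)) +
        2 * x * (y / (1 + ε * y ^ 2)) / (1 + ε * (x + y) ^ 2) := by
    field_simp
    ring
  rw [e1]
  refine (abs_add_le _ _).trans (add_le_add ?_ ?_)
  · rw [abs_of_nonneg (by positivity), ← mul_div_assoc, div_le_div_iff₀ (by positivity) hx]
    -- From $x=(x+y)-y$, that is, $x^2\le2(x+y)^2+2y^2$.
    have : 1 + ε * x ^ 2 ≤ 2 * ((1 + ε * (x + y) ^ 2) * (1 + ε * y ^ 2)) := by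
      have h1 : 0 ≤ ε * (x + 2 * y) ^ 2 := by positivity
      have h2 : 0 ≤ ε * (x + y) ^ 2 * (ε * y ^ 2) := by positivity
      nlinarith
    nlinarith [mul_le_mul_of_nonneg_left this (sq_nonneg x)]
  · rw [abs_div, abs_mul, abs_mul, abs_of_pos hz, abs_of_nonneg (zero_le_two : (0 : ℝ) ≤ 2),
      mul_assoc]
    refine div_le_self (by positivity) ?_
    nlinarith [mul_nonneg hε.le (sq_nonneg (x + y))]

theorem abs_truncSq_le {ε : ℝ} (hε : 0 < ε) (k : ℤ × ℤ) : |truncSq ε k| ≤ 1 / ε := by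
  unfold truncSq
  rw [abs_of_nonneg (by positivity), div_le_div_iff₀ (by positivity) hε]
  linarith

theorem commutator_truncSq_le {ε : ℝ} (hε : 0 < ε) (u : ℤ × ℤ → CPlane) :
    commutator (truncSq ε) u u ≤
      2 * advection (weighted (truncSq ε) u) u (weighted (truncSq ε) u) +
      2 * advection (weighted (fun k => (k.2 : ℝ)) u)
        (weighted (fun l => (l.2 : ℝ) / (1 + ε * (l.2 : ℝ) ^ 2)) u) (weighted (truncSq ε) u) := by
  unfold commutator advection
  rw [← ENNReal.tsum_mul_left, ← ENNReal.tsum_mul_left, ← ENNReal.tsum_add]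
  refine ENNReal.tsum_le_tsum fun k => ?_
  rw [← ENNReal.tsum_mul_left, ← ENNReal.tsum_mul_left, ← ENNReal.tsum_add]
  refine ENNReal.tsum_le_tsum fun l => ?_
  rw [enorm_sum_weighted, enorm_sum_weighted, enorm_weighted, enorm_weighted,
    ENNReal.ofReal_mul (abs_nonneg _)]
  have h := ENNReal.ofReal_le_ofReal (abs_truncSq_sub_le hε k l)
  rw [ENNReal.ofReal_add (by unfold truncSq; positivity) (by positivity),
    ENNReal.ofReal_mul (by norm_num), ENNReal.ofReal_mul (by norm_num),
    ENNReal.ofReal_mul (abs_nonneg _), ENNReal.ofReal_ofNat] at h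
  have h2 : truncSq ε k = |truncSq ε k| := (abs_of_nonneg (by unfold truncSq; positivity)).symm
  rw [h2] at h
  calc _ = ENNReal.ofReal |truncSq ε (k + l) - truncSq ε l| *
        (‖∑ j, (freq l j : ℂ) * u k j‖ₑ * ‖u l‖ₑ *
        (ENNReal.ofReal |truncSq ε (k + l)| * ‖u (k + l)‖ₑ)) := by ring
    _ ≤ _ := mul_le_mul' h le_rfl
    _ = _ := by ring

/-- The coefficients involve only the $\tilde H^{1,1}$ energy of $u$, which is integrable in time by
hypothesis on the solution class. The top-order quantities enter in the form that `energy_estimate`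
accepts, with constants independent of $\varepsilon$. -/
theorem deterministic_drift_le {ε : ℝ} (hε : 0 < ε) (u : H)
    (hu : anisoEnergy 1 1 (coeff u) ≠ ∞) (hw : anisoEnergy 1 0 (weighted (truncSq ε) (coeff u)) ≠ ∞) :
    commutator (truncSq ε) (coeff u) (coeff u) ≤ ENNReal.ofReal
      (√((8 * japaneseSum.toReal) ^ 2 * (anisoEnergy 1 1 (coeff u)).toReal *
        (anisoEnergy 0 0 (weighted (truncSq ε) (coeff u))).toReal *
        (anisoEnergy 1 0 (weighted (truncSq ε) (coeff u))).toReal) +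
      4 * japaneseSum.toReal * (anisoEnergy 1 1 (coeff u)).toReal *
        √(anisoEnergy 0 0 (weighted (truncSq ε) (coeff u))).toReal) := by
  set c := coeff u
  set A := anisoEnergy 1 1 c
  set Q := anisoEnergy 0 0 (weighted (truncSq ε) c)
  set P := anisoEnergy 1 0 (weighted (truncSq ε) c)
  have hQ : Q ≠ ∞ := ((anisoEnergy_mono zero_le le_rfl _).trans_lt (lt_top_iff_ne_top.2 hw)).ne
  have a1 : advection (weighted (truncSq ε) c) c (weighted (truncSq ε) c) ≤
      2 * japaneseSum * (A * Q * P) ^ (1 / 2 : ℝ) := by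
    refine (advection_le (weighted_div _ (coeff_div u))).trans (le_of_eq ?_)
    congr 2
    change P * A * Q = A * Q * P
    ring
  have a2 : advection (weighted (fun k => (k.2 : ℝ)) c)
      (weighted (fun l => (l.2 : ℝ) / (1 + ε * (l.2 : ℝ) ^ 2)) c) (weighted (truncSq ε) c) ≤
      2 * japaneseSum * (A * Q ^ (1 / 2 : ℝ) + (A * Q * P) ^ (1 / 2 : ℝ)) := by
    refine (advection_le (weighted_div _ (coeff_div u))).trans (mul_le_mul' le_rfl ?_)
    have b1 : anisoEnergy 1 0 (weighted (fun k => (k.2 : ℝ)) c) ≤ A := by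
      have := anisoEnergy_weighted_le_weighted (w := fun k => (k.2 : ℝ)) (w' := fun _ => 1)
        (c := c) (a := 1) (b := 0) (a' := 1) (b' := 1) zero_le_one (fun k => Or.inr (by
          have h2 : 0 ≤ 1 + (k.1 : ℝ) ^ 2 := by positivity
          nlinarith))
      rwa [weighted_one, ENNReal.ofReal_one, one_mul] at this
    -- One derivative in $x_2$ of the damped factor gives $y^4/(1+\varepsilon y^2)^2$, exactly the
    -- square of the truncated weight. What is left is at most $y^2$.
    have b2 : anisoEnergy 1 1 (weighted (fun l => (l.2 : ℝ) / (1 + ε * (l.2 : ℝ) ^ 2)) c) ≤ A + P := by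
      have e : A + P = ∑' k : ℤ × ℤ, (ENNReal.ofReal (1 + (k.1 : ℝ) ^ 2) *
          ENNReal.ofReal (1 + (k.2 : ℝ) ^ 2 + truncSq ε k ^ 2)) * ‖c k‖ₑ ^ 2 := by
        change anisoEnergy 1 1 c + anisoEnergy 1 0 (weighted (truncSq ε) c) = _
        unfold anisoEnergy
        rw [← ENNReal.tsum_add]
        congr 1; ext k
        rw [enorm_weighted_sq, pow_one, pow_one, pow_zero, mul_one,
          ENNReal.ofReal_add (p := 1 + (k.2 : ℝ) ^ 2) (by positivity) (by positivity), ENNReal.ofReal_mul (by positivity)]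
        ring
      rw [e]
      refine ENNReal.tsum_le_tsum fun k => ?_
      rw [enorm_weighted_sq, pow_one, pow_one, ENNReal.ofReal_mul (by positivity), mul_assoc, mul_assoc,
        ← mul_assoc (ENNReal.ofReal (1 + (k.2 : ℝ) ^ 2)), ← ENNReal.ofReal_mul (by positivity)]
      refine mul_le_mul' le_rfl (mul_le_mul' (ENNReal.ofReal_le_ofReal ?_) le_rfl)
      unfold truncSq
      generalize (k.2 : ℝ) = y
      have hy : 1 ≤ 1 + ε * y ^ 2 := by nlinarith [mul_nonneg hε.le (sq_nonneg y)]
      rw [div_pow, div_pow]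
      have h3 : (1 + y ^ 2) * (y ^ 2 / (1 + ε * y ^ 2) ^ 2) = y ^ 2 / (1 + ε * y ^ 2) ^ 2 +
          (y ^ 2) ^ 2 / (1 + ε * y ^ 2) ^ 2 := by ring
      rw [h3]
      have h4 : y ^ 2 / (1 + ε * y ^ 2) ^ 2 ≤ y ^ 2 := div_le_self (sq_nonneg _) (one_le_pow₀ hy)
      linarith
    have hA : A = (A * A) ^ (1 / 2 : ℝ) := by
      rw [ENNReal.mul_rpow_of_nonneg _ _ (by norm_num), ← ENNReal.rpow_add_of_nonneg _ _ (by norm_num)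
        (by norm_num)]
      norm_num
    calc _ ≤ (A * (A + P) * Q) ^ (1 / 2 : ℝ) :=
          ENNReal.rpow_le_rpow (mul_le_mul' (mul_le_mul' b1 b2) le_rfl) (by norm_num)
      _ = (A * A * Q + A * Q * P) ^ (1 / 2 : ℝ) := by congr 1; ring
      _ ≤ (A * A * Q) ^ (1 / 2 : ℝ) + (A * Q * P) ^ (1 / 2 : ℝ) :=
          ENNReal.rpow_add_le_add_rpow _ _ (by norm_num) (by norm_num)
      _ = _ := by rw [ENNReal.mul_rpow_of_nonneg (A * A) _ (by norm_num), ← hA]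
  have hfin : A * Q * P ≠ ∞ := ENNReal.mul_ne_top (ENNReal.mul_ne_top hu hQ) hw
  refine (commutator_truncSq_le hε c).trans ((add_le_add (mul_le_mul' le_rfl a1)
    (mul_le_mul' le_rfl a2)).trans (le_of_eq ?_))
  rw [mul_assoc _ A.toReal, mul_assoc _ (A.toReal * Q.toReal), ← ENNReal.toReal_mul,
    ← ENNReal.toReal_mul, Real.sqrt_mul (sq_nonneg _), Real.sqrt_sq (by positivity),
    ENNReal.ofReal_add (by positivity) (by positivity), ENNReal.ofReal_mul (by positivity),
    ENNReal.ofReal_mul (by positivity), ENNReal.ofReal_mul (by positivity), ENNReal.ofReal_mul (by norm_num),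
    ENNReal.ofReal_mul (by norm_num), ← rpow_half_eq hfin, ← rpow_half_eq hQ,
    ENNReal.ofReal_toReal hu, ENNReal.ofReal_toReal japaneseSum_ne_top,
    ENNReal.ofReal_ofNat, ENNReal.ofReal_ofNat]
  ring

/-- Propagation of the regularity in the second variable by the deterministic equation. -/
theorem deterministic_regularity {T : ℝ} {u₀ : H} {U : Icc (0 : ℝ) T → H}
    {F c : Icc (0 : ℝ) T → ℤ × ℤ → CPlane}
    (hF : ∀ s k, F s k = partialOneSq (U s) k - convection (U s) (U s) k)
    (hFint : ∀ k, Integrable (fun s => F s k) (timeMeasure T))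
    (hc : ∀ t k, c t k = coeff u₀ k + ∫ s in Iic t, F s k ∂timeMeasure T)
    (hU : ∀ᵐ s ∂timeMeasure T, coeff (U s) = c s)
    (hUm : AEStronglyMeasurable U (timeMeasure T))
    (hU11 : ∫⁻ s, anisoEnergy 1 1 (coeff (U s)) ∂timeMeasure T ≠ ∞)
    {M : ℝ} (hUb : ∀ᵐ s ∂timeMeasure T, ‖U s‖ ≤ M)
    (h0 : anisoEnergy 0 2 (coeff u₀) ≠ ∞) :
    ∫⁻ s, anisoEnergy 1 2 (coeff (U s)) ∂timeMeasure T ≠ ∞ := by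
  set μ := timeMeasure T
  have hUk : ∀ k, AEStronglyMeasurable (fun s => coeff (U s) k) μ := fun k =>
    (coeffL k).continuous.comp_aestronglyMeasurable hUm
  have fin11 := ae_lt_top' (aemeasurable_anisoEnergy hUk 1 1) hU11
  have hint : Integrable (fun s => (anisoEnergy 1 1 (coeff (U s))).toReal) μ :=
    integrable_toReal_of_lintegral_ne_top (aemeasurable_anisoEnergy hUk 1 1) hU11
  -- The bound $1/\varepsilon$ on the weight does not enter the conclusion of `energy_estimate`, so
  -- one constant serves for all $\varepsilon$.
  obtain ⟨K, hK⟩ : ∃ K : ℝ, ∀ ε : ℝ, 0 < ε →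
      ∫⁻ s, anisoEnergy 1 0 (weighted (truncSq ε) (coeff (U s))) ∂μ ≤ ENNReal.ofReal K := by
    refine ⟨_, fun ε hε => (energy_estimate (U := U) (Y := U) (F := F) (c := c) (x₀ := coeff u₀)
      (R := 0) (γ := fun s => (8 * japaneseSum.toReal) ^ 2 * (anisoEnergy 1 1 (coeff (U s))).toReal)
      (b := fun s => 4 * japaneseSum.toReal * (anisoEnergy 1 1 (coeff (U s))).toReal)
      (Q₀ := (anisoEnergy 0 2 (coeff u₀)).toReal)
      (abs_truncSq_le hε) ENNReal.toReal_nonneg hFint hc hU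
      (Filter.Eventually.of_forall fun s k => Or.inr (by rw [hF]; simp [partialOneSq]))
      ((lintegral_mono fun s => anisoEnergy_mono le_rfl zero_le_one _).trans_lt
        (lt_top_iff_ne_top.2 hU11)).ne hUm hU11 hUb (fun k => aestronglyMeasurable_const)
      (by simp) ?_ (hint.const_mul _) (fun s => by positivity) (hint.const_mul _)
      (fun s => by positivity) ?_).2⟩
    · rw [ENNReal.ofReal_toReal h0]
      have := anisoEnergy_weighted_le_weighted (w := truncSq ε) (w' := fun _ => 1)
        (c := coeff u₀) (a := 0) (b := 0) (a' := 0) (b' := 2) zero_le_one (fun k => Or.inr (by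
          have h3 : truncSq ε k ≤ (k.2 : ℝ) ^ 2 := div_le_self (sq_nonneg _)
            (by nlinarith [mul_nonneg hε.le (sq_nonneg (k.2 : ℝ))])
          have h4 : 0 ≤ truncSq ε k := by unfold truncSq; positivity
          have := pow_le_pow_left₀ h4 (h3.trans (by linarith : (k.2 : ℝ) ^ 2 ≤ 1 + (k.2 : ℝ) ^ 2)) 2
          simpa using this))
      rwa [weighted_one, ENNReal.ofReal_one, one_mul] at this
    · filter_upwards [fin11] with s hs
      have hv : anisoEnergy 1 0 (weighted (truncSq ε) (coeff (U s))) ≠ ∞ :=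
        ((anisoEnergy_weighted_le (abs_truncSq_le hε) 1 0 _).trans_lt
          (ENNReal.mul_lt_top ENNReal.ofReal_lt_top
          ((anisoEnergy_mono le_rfl zero_le_one _).trans_lt hs))).ne
      simpa using deterministic_drift_le hε (U s) hs.ne hv
  set A : ℤ × ℤ → ℝ≥0∞ := fun k => ∫⁻ s, ‖coeff (U s) k‖ₑ ^ 2 ∂μ
  have hA : ∀ p : ℤ × ℤ → ℝ≥0∞, (∀ k, p k ≠ ∞) → ∫⁻ s, ∑' k, p k * ‖coeff (U s) k‖ₑ ^ 2 ∂μ =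
      ∑' k, p k * A k := fun p hp => by
    rw [lintegral_tsum fun k => ((hUk k).enorm.pow_const 2).const_mul _]
    congr 1; ext k
    rw [lintegral_const_mul' _ _ (hp k)]
  -- Limit $\varepsilon\to0$ through finite partial sums: on a finite set where $k_2^2\le N$, the
  -- choice $\varepsilon=1/(|N|+1)$ makes the truncated weight at least $k_2^2/2$, whence the factor
  -- $4$ after squaring.
  have hsum : ∑' k : ℤ × ℤ, ENNReal.ofReal ((1 + (k.1 : ℝ) ^ 2) * (k.2 : ℝ) ^ 4) * A k ≤
      4 * ENNReal.ofReal K := by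
    rw [ENNReal.tsum_eq_iSup_sum]
    refine iSup_le fun S => ?_
    obtain ⟨N, hN⟩ : ∃ N : ℝ, ∀ k ∈ S, (k.2 : ℝ) ^ 2 ≤ N :=
      ⟨∑ k ∈ S, (k.2 : ℝ) ^ 2, fun k hk => Finset.single_le_sum (f := fun k : ℤ × ℤ => (k.2 : ℝ) ^ 2)
        (fun _ _ => sq_nonneg _) hk⟩
    have hN1 : 0 < |N| + 1 := by positivity
    have h1 := hK (1 / (|N| + 1)) (by positivity)
    have e : ∀ s, anisoEnergy 1 0 (weighted (truncSq (1 / (|N| + 1))) (coeff (U s))) =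
        ∑' k : ℤ × ℤ, ENNReal.ofReal ((1 + (k.1 : ℝ) ^ 2) * truncSq (1 / (|N| + 1)) k ^ 2) *
          ‖coeff (U s) k‖ₑ ^ 2 := fun s => by
      unfold anisoEnergy
      congr 1; ext k
      rw [enorm_weighted_sq, pow_one, pow_zero, mul_one, ENNReal.ofReal_mul (by positivity), mul_assoc]
    simp only [e] at h1
    rw [hA _ fun k => ENNReal.ofReal_ne_top] at h1
    refine le_trans ?_ (mul_le_mul' le_rfl h1)
    refine le_trans ?_ (mul_le_mul' le_rfl (ENNReal.sum_le_tsum S))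
    rw [Finset.mul_sum]
    refine Finset.sum_le_sum fun k hk => ?_
    rw [← mul_assoc]
    refine mul_le_mul' ?_ le_rfl
    have h4 : (4 : ℝ≥0∞) = ENNReal.ofReal 4 := by simp
    rw [h4, ← ENNReal.ofReal_mul (by norm_num)]
    refine ENNReal.ofReal_le_ofReal ?_
    have h5 : (k.2 : ℝ) ^ 2 ≤ 2 * truncSq (1 / (|N| + 1)) k := by
      unfold truncSq
      rw [← mul_div_assoc, le_div_iff₀ (by positivity)]
      have : 1 / (|N| + 1) * (k.2 : ℝ) ^ 2 ≤ 1 := by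
        rw [one_div, inv_mul_le_iff₀ hN1]
        linarith [hN k hk, le_abs_self N]
      nlinarith [sq_nonneg (k.2 : ℝ)]
    have h6 := pow_le_pow_left₀ (sq_nonneg (k.2 : ℝ)) h5 2
    have h7 : 0 ≤ 1 + (k.1 : ℝ) ^ 2 := by positivity
    nlinarith [mul_le_mul_of_nonneg_left h6 h7]
  have hle : ∀ s, anisoEnergy 1 2 (coeff (U s)) ≤ 2 * anisoEnergy 1 1 (coeff (U s)) +
      2 * ∑' k : ℤ × ℤ, ENNReal.ofReal ((1 + (k.1 : ℝ) ^ 2) * (k.2 : ℝ) ^ 4) * ‖coeff (U s) k‖ₑ ^ 2 := by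
    intro s
    unfold anisoEnergy
    rw [← ENNReal.tsum_mul_left, ← ENNReal.tsum_mul_left, ← ENNReal.tsum_add]
    refine ENNReal.tsum_le_tsum fun k => ?_
    rw [← mul_assoc, ← mul_assoc, ← add_mul]
    refine mul_le_mul' ?_ le_rfl
    have h2 : (2 : ℝ≥0∞) = ENNReal.ofReal 2 := by simp
    rw [h2, ← ENNReal.ofReal_mul (by norm_num), ← ENNReal.ofReal_mul (by norm_num),
      ← ENNReal.ofReal_add (by positivity) (by positivity)]
    refine ENNReal.ofReal_le_ofReal ?_
    have h3 : (1 + (k.2 : ℝ) ^ 2) ^ 2 ≤ 2 * (1 + (k.2 : ℝ) ^ 2) + 2 * (k.2 : ℝ) ^ 4 := by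
      nlinarith [sq_nonneg ((k.2 : ℝ) ^ 2)]
    have h7 : 0 ≤ 1 + (k.1 : ℝ) ^ 2 := by positivity
    nlinarith [mul_le_mul_of_nonneg_left h3 h7]
  refine ((lintegral_mono hle).trans_lt ?_).ne
  rw [lintegral_add_left' ((aemeasurable_anisoEnergy hUk 1 1).const_mul _),
    lintegral_const_mul' _ _ (by norm_num), lintegral_const_mul' _ _ (by norm_num),
    hA _ fun k => ENNReal.ofReal_ne_top]
  exact ENNReal.add_lt_top.2 ⟨ENNReal.mul_lt_top (by norm_num) (lt_top_iff_ne_top.2 hU11),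
    ENNReal.mul_lt_top (by norm_num) (hsum.trans_lt (ENNReal.mul_lt_top (by norm_num)
      ENNReal.ofReal_lt_top))⟩

/-- Solvability of linear evolution equations with a bilinear coefficient. -/
theorem exists_eq_setIntegral_Iic_bilinear {α : Type*} [LinearOrder α] [TopologicalSpace α]
    [OrderTopology α] [SecondCountableTopology α] [MeasurableSpace α] [BorelSpace α] {μ : Measure α}
    [CompactSpace α] [IsFiniteMeasure μ] [NullSingletonClass μ] {E : Type*} [NormedAddCommGroup E]
    [NormedSpace ℝ E] [CompleteSpace E] (L : E →L[ℝ] E) (β : E →L[ℝ] E →L[ℝ] E) {U f : α → E}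
    (hUm : AEStronglyMeasurable U μ) {M : ℝ} (hUb : ∀ᵐ s ∂μ, ‖U s‖ ≤ M) (hf : Integrable f μ) :
    ∃ X : C(α, E), Integrable (fun s => L (X s) - β (X s) (U s) - β (U s) (X s) + f s) μ ∧
      ∀ t, X t = ∫ s in Iic t, (L (X s) - β (X s) (U s) - β (U s) (X s) + f s) ∂μ := by
  set A : α → E →L[ℝ] E := fun s => L - β.flip (U s) - β (U s) with hA
  have hAm : AEStronglyMeasurable A μ :=
    (aestronglyMeasurable_const.sub (β.flip.continuous.comp_aestronglyMeasurable hUm)).sub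
      (β.continuous.comp_aestronglyMeasurable hUm)
  have hAi : Integrable A μ := by
    refine Integrable.of_bound hAm (‖L‖ + ‖β.flip‖ * M + ‖β‖ * M) ?_
    filter_upwards [hUb] with s hs
    refine (norm_sub_le _ _).trans (add_le_add ((norm_sub_le _ _).trans (add_le_add le_rfl ?_)) ?_)
    · exact (β.flip.le_opNorm _).trans (mul_le_mul_of_nonneg_left hs (norm_nonneg _))
    · exact (β.le_opNorm _).trans (mul_le_mul_of_nonneg_left hs (norm_nonneg _))
  obtain ⟨X, hX⟩ := exists_eq_setIntegral_Iic hAi hf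
  refine ⟨X, ?_, hX⟩
  refine Integrable.add (f := fun s => A s (X s)) ?_ hf
  refine (hAi.norm.mul_const ‖X‖).mono' ?_ (Filter.Eventually.of_forall fun s =>
    ((A s).le_opNorm _).trans (mul_le_mul_of_nonneg_left (X.norm_coe_le_norm s) (norm_nonneg _)))
  exact (ContinuousLinearMap.apply ℝ E).flip.aestronglyMeasurable_comp₂ hAm
    X.continuous.aestronglyMeasurable

/-! ### Galerkin approximations of the linearised equation -/

theorem norm_le_of_anisoEnergy {u : H} {a b : ℕ} {B : ℝ} (hB : 0 ≤ B)
    (h : anisoEnergy a b (coeff u) ≤ ENNReal.ofReal (B ^ 2)) : ‖u‖ ≤ 2 * Real.pi * B := by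
  have h1 := (anisoEnergy_mono (zero_le (a := a)) (zero_le (a := b)) (coeff u)).trans h
  rw [anisoEnergy_coeff] at h1
  have h2 := (ENNReal.ofReal_le_ofReal_iff (sq_nonneg _)).1 h1
  rw [div_le_iff₀ (by positivity)] at h2
  refine abs_le_of_sq_le_sq' ?_ (by positivity) |>.2
  rw [mul_pow]; linarith

theorem anisoEnergy_le_of_le {c : ℤ × ℤ → CPlane} {a b a' b' : ℕ} {C : ℝ} (hC : 0 ≤ C)
    (h : ∀ k : ℤ × ℤ, c k = 0 ∨ (1 + (k.1 : ℝ) ^ 2) ^ a * (1 + (k.2 : ℝ) ^ 2) ^ b ≤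
      C * ((1 + (k.1 : ℝ) ^ 2) ^ a' * (1 + (k.2 : ℝ) ^ 2) ^ b')) :
    anisoEnergy a b c ≤ ENNReal.ofReal C * anisoEnergy a' b' c := by
  have := anisoEnergy_weighted_le_weighted (w := fun _ => 1) (w' := fun _ => 1) (c := c) hC
    fun k => (h k).imp_right fun h => by simpa using h
  rwa [weighted_one] at this

/-- Bernstein's inequality for trigonometric polynomials. -/
theorem anisoEnergy_le_of_box {c : ℤ × ℤ → CPlane} {n : ℕ} (hc : ∀ k, k ∉ box n → c k = 0) (a b : ℕ) :
    anisoEnergy a b c ≤ ENNReal.ofReal ((1 + (n : ℝ) ^ 2) ^ (a + b)) * anisoEnergy 0 0 c := by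
  refine anisoEnergy_le_of_le (by positivity) fun k => ?_
  by_cases hk : k ∈ box n
  · right
    rw [mem_box] at hk
    have h : ∀ m : ℤ, |m| ≤ n → 1 + (m : ℝ) ^ 2 ≤ 1 + (n : ℝ) ^ 2 := fun m hm => by
      have : |(m : ℝ)| ≤ n := by exact_mod_cast hm
      have := sq_le_sq' (by linarith [neg_abs_le (m : ℝ)]) ((le_abs_self _).trans this)
      linarith
    rw [pow_zero, pow_zero, mul_one, mul_one, pow_add]
    exact mul_le_mul (pow_le_pow_left₀ (by positivity) (h _ hk.1) _)
      (pow_le_pow_left₀ (by positivity) (h _ hk.2) _) (by positivity) (by positivity)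
  · exact Or.inl (hc k hk)

/-- The symbol of `∂₁²` truncated to a box. -/
def Symbol.truncLaplace (n : ℕ) : Symbol where
  fn k := if k ∈ box n then -(k.1 : ℝ) ^ 2 else 0
  bound := (n : ℝ) ^ 2
  le_bound k := by
    split_ifs with h
    · rw [abs_neg, abs_of_nonneg (sq_nonneg _), ← sq_abs]
      have : |(k.1 : ℝ)| ≤ n := by exact_mod_cast (mem_box.1 h).1
      exact pow_le_pow_left₀ (abs_nonneg _) this 2
    · simp
  even k := by simp [neg_mem_box]

/-- The weight of the Galerkin estimate. -/
def galerkinWeight (n : ℕ) (k : ℤ × ℤ) : ℝ := 1 + min |(k.2 : ℝ)| n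

theorem one_le_galerkinWeight (n : ℕ) (k : ℤ × ℤ) : 1 ≤ galerkinWeight n k := by
  unfold galerkinWeight
  have : 0 ≤ min |(k.2 : ℝ)| n := le_min (abs_nonneg _) (Nat.cast_nonneg _)
  linarith

theorem abs_galerkinWeight_le (n : ℕ) (k : ℤ × ℤ) : |galerkinWeight n k| ≤ 1 + n := by
  rw [abs_of_nonneg (zero_le_one.trans (one_le_galerkinWeight n k))]
  unfold galerkinWeight
  linarith [min_le_right |(k.2 : ℝ)| n]

theorem galerkinWeight_le (n : ℕ) (k : ℤ × ℤ) : galerkinWeight n k ≤ 1 + |(k.2 : ℝ)| := by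
  unfold galerkinWeight
  linarith [min_le_left |(k.2 : ℝ)| n]

theorem galerkinWeight_eq {n : ℕ} {k : ℤ × ℤ} (hk : k ∈ box n) :
    galerkinWeight n k = 1 + |(k.2 : ℝ)| := by
  unfold galerkinWeight
  have : |(k.2 : ℝ)| ≤ n := by exact_mod_cast (mem_box.1 hk).2
  rw [min_eq_left this]

/-- The function $\min(|\cdot|,n)$ is subadditive, and $1+a+b\le(1+a)(1+b)$. The form $1+|k_2|$ is
preferred to $(1+k_2^2)^{1/2}$ because it is submultiplicative with constant one, and the cap at $n$
keeps the weight bounded without changing it on the box. -/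
theorem galerkinWeight_add_le (n : ℕ) (k l : ℤ × ℤ) :
    galerkinWeight n (k + l) ≤ galerkinWeight n k * galerkinWeight n l := by
  have e : ((k + l).2 : ℝ) = k.2 + l.2 := by simp
  unfold galerkinWeight
  rw [e]
  have h1 : 0 ≤ min |(k.2 : ℝ)| n := le_min (abs_nonneg _) (Nat.cast_nonneg _)
  have h2 : 0 ≤ min |(l.2 : ℝ)| n := le_min (abs_nonneg _) (Nat.cast_nonneg _)
  have h3 : min |(k.2 + l.2 : ℝ)| n ≤ min |(k.2 : ℝ)| n + min |(l.2 : ℝ)| n := by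
    have h4 := abs_add_le (k.2 : ℝ) l.2
    rcases le_total |(k.2 : ℝ)| n with h5 | h5
    · rcases le_total |(l.2 : ℝ)| n with h6 | h6
      · rw [min_eq_left h5, min_eq_left h6]; exact (min_le_left _ _).trans h4
      · rw [min_eq_right h6]; exact (min_le_right _ _).trans (by linarith)
    · rw [min_eq_right h5]; exact (min_le_right _ _).trans (by linarith)
  nlinarith

theorem abs_galerkinWeight_sub_le (n : ℕ) (k l : ℤ × ℤ) :
    |galerkinWeight n (k + l) - galerkinWeight n l| ≤ |(k.2 : ℝ)| := by
  have e : ((k + l).2 : ℝ) = k.2 + l.2 := by simp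
  unfold galerkinWeight
  rw [e, add_sub_add_left_eq_sub]
  refine (abs_min_sub_min_le_max _ _ _ _).trans (max_le ((abs_abs_sub_abs_le _ _).trans ?_) (by simp))
  rw [add_sub_cancel_right]

theorem tsum_weighted_mul_le {w : ℤ × ℤ → ℝ} {f c : ℤ × ℤ → CPlane} {B : ℝ} (hB : 0 ≤ B)
    (hf : anisoEnergy 0 0 (weighted w f) ≤ ENNReal.ofReal (B ^ 2))
    (hc : anisoEnergy 0 0 (weighted w c) ≠ ∞) :
    ∑' k, ENNReal.ofReal (w k ^ 2) * (‖f k‖ₑ * ‖c k‖ₑ) ≤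
      ENNReal.ofReal (B * √(anisoEnergy 0 0 (weighted w c)).toReal) := by
  have e : ∀ k, ENNReal.ofReal (w k ^ 2) * (‖f k‖ₑ * ‖c k‖ₑ) = ‖weighted w f k‖ₑ * ‖weighted w c k‖ₑ :=
    fun k => by
      rw [enorm_weighted, enorm_weighted, ← sq_abs, ENNReal.ofReal_pow (abs_nonneg _)]; ring
  simp only [e]
  refine (tsum_mul_le_sqrt _ _).trans ?_
  rw [← anisoEnergy_zero_zero_eq, ← anisoEnergy_zero_zero_eq, rpow_half_eq hc, ENNReal.ofReal_mul hB]
  refine mul_le_mul' ?_ le_rfl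
  refine (ENNReal.rpow_le_rpow hf (by norm_num)).trans (le_of_eq ?_)
  rw [rpow_half_eq ENNReal.ofReal_ne_top, ENNReal.toReal_ofReal (sq_nonneg _), Real.sqrt_sq hB]

/-- The drift of the linearised equation at `u`, at frequency `k`. -/
def linearDrift (u : H) (k : ℤ × ℤ) (x : H) : CPlane :=
  partialOneSq x k - convection x u k - convection u x k

/-- The truncated drift is a bounded operator on all of $H$, so the linear equation is solved there
by Picard iteration. Its right-hand side vanishes outside the box, hence so does the solution, and
inside the box the equation is the full one. The weight equals $1+|k_2|$ on the support of the
solution, so the bounds do not depend on $n$. -/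
theorem exists_galerkin {T : ℝ} {U f : Icc (0 : ℝ) T → H}
    (hUm : AEStronglyMeasurable U (timeMeasure T)) {M : ℝ} (hUb : ∀ᵐ s ∂timeMeasure T, ‖U s‖ ≤ M)
    (hU : ∫⁻ s, anisoEnergy 1 2 (coeff (U s)) ∂timeMeasure T ≠ ∞)
    (hfm : AEStronglyMeasurable f (timeMeasure T))
    {b : Icc (0 : ℝ) T → ℝ} (hb : Integrable b (timeMeasure T)) (hb0 : ∀ s, 0 ≤ b s)
    (hf : ∀ᵐ s ∂timeMeasure T, anisoEnergy 0 1 (coeff (f s)) ≤ ENNReal.ofReal (b s ^ 2)) (n : ℕ) :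
    ∃ X : C(Icc (0 : ℝ) T, H),
      (∀ t k, k ∉ box n → coeff (X t) k = 0) ∧
      (∀ t, ∀ k ∈ box n, coeff (X t) k =
        ∫ s in Iic t, (linearDrift (U s) k (X s) + coeff (f s) k) ∂timeMeasure T) ∧
      (∀ t, anisoEnergy 0 1 (coeff (X t)) ≤ ENNReal.ofReal
        (estimateConst T (∫ s, growthRate (coeff (U s)) ∂timeMeasure T) *
          (∫ s, 2 * b s ∂timeMeasure T) ^ 2)) ∧
      ∫⁻ s, anisoEnergy 1 1 (coeff (X s)) ∂timeMeasure T ≤ ENNReal.ofReal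
        (estimateConst T (∫ s, growthRate (coeff (U s)) ∂timeMeasure T) *
          (∫ s, 2 * b s ∂timeMeasure T) ^ 2) := by
  set μ := timeMeasure T
  obtain ⟨β, hβ⟩ := exists_truncConvection n
  have hfi : Integrable f μ := by
    refine (hb.const_mul (2 * Real.pi)).mono' hfm ?_
    filter_upwards [hf] with s hs
    exact norm_le_of_anisoEnergy (hb0 s) hs
  obtain ⟨X, hXi, hX⟩ := exists_eq_setIntegral_Iic_bilinear (Symbol.truncLaplace n).op β hUm hUb
    ((Symbol.trunc n).op.integrable_comp hfi)
  set F : Icc (0 : ℝ) T → ℤ × ℤ → CPlane := fun s k =>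
    if k ∈ box n then linearDrift (U s) k (X s) + coeff (f s) k else 0 with hFdef
  have hFeq : ∀ s k, coeffL k ((Symbol.truncLaplace n).op (X s) - β (X s) (U s) - β (U s) (X s) +
      (Symbol.trunc n).op (f s)) = F s k := fun s k => by
    rw [coeffL_apply, coeff_add, Pi.add_apply, coeff_trunc, coeff_sub, Pi.sub_apply, coeff_sub,
      Pi.sub_apply, Symbol.coeff_op, hβ, hβ]
    simp only [Symbol.truncLaplace, hFdef]
    split_ifs
    · rfl
    · simp
  have hFint : ∀ k, Integrable (fun s => F s k) μ := fun k => by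
    simp only [← hFeq]
    exact (coeffL k).integrable_comp hXi
  have hc : ∀ t k, coeff (X t) k = ∫ s in Iic t, F s k ∂μ := fun t k => by
    simp only [← hFeq]
    rw [(coeffL k).integral_comp_comm hXi.integrableOn, ← hX]; rfl
  have hbox : ∀ t k, k ∉ box n → coeff (X t) k = 0 := fun t k hk => by
    rw [hc]; simp [hFdef, hk]
  have hest := linearised_estimate (w := galerkinWeight n) (abs_galerkinWeight_le n)
    (one_le_galerkinWeight n) (galerkinWeight_add_le n) (abs_galerkinWeight_sub_le n)
    (galerkinWeight_le n) (U := U) (Y := X) (F := F) (g := fun s => coeff (f s))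
    (c := fun t => coeff (X t)) hFint hc (Filter.Eventually.of_forall fun s => rfl)
    (Filter.Eventually.of_forall fun s k => by
      by_cases hk : k ∈ box n
      · right; simp only [hFdef, if_pos hk]; rfl
      · exact Or.inl (hbox s k hk)) hU hUm
    (by
      refine ((lintegral_mono fun s => ?_).trans_lt (lintegral_const_lt_top
        (c := ENNReal.ofReal ((1 + (n : ℝ) ^ 2) ^ (1 + 1)) * ENNReal.ofReal (‖X‖ ^ 2 / (2 * Real.pi) ^ 2))
        (ENNReal.mul_ne_top ENNReal.ofReal_ne_top ENNReal.ofReal_ne_top))).ne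
      refine (anisoEnergy_le_of_box (hbox s) 1 1).trans (mul_le_mul' le_rfl ?_)
      rw [anisoEnergy_coeff]
      refine ENNReal.ofReal_le_ofReal ?_
      gcongr
      exact X.norm_coe_le_norm s)
    (M := ‖X‖) (Filter.Eventually.of_forall fun s => X.norm_coe_le_norm s)
    (fun k => (coeffL k).continuous.comp_aestronglyMeasurable hfm)
    (Or.inr (Filter.Eventually.of_forall fun s k hk => by
      by_cases h : k ∈ box n
      · exact (galerkinWeight_eq h).ge
      · exact absurd (hbox s k h) hk))
    (b := fun s => 2 * b s) (hb.const_mul 2) (fun s => mul_nonneg zero_le_two (hb0 s))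
    (by
      filter_upwards [hf] with s hs
      refine tsum_weighted_mul_le (mul_nonneg zero_le_two (hb0 s)) ?_ ?_
      -- The square of $1+|k_2|$ is at most $4(1+k_2^2)$; this is the reason for $2b$ in place of
      -- $b$.
      · have := anisoEnergy_weighted_le_weighted (w := galerkinWeight n) (w' := fun _ => 1)
          (c := coeff (f s)) (a := 0) (b := 0) (a' := 0) (b' := 1) (C := 4) (by norm_num)
          (fun k => Or.inr (by
            have := pow_le_pow_left₀ (zero_le_one.trans (one_le_galerkinWeight n k))
              (galerkinWeight_le n k) 2
            nlinarith [sq_nonneg (|(k.2 : ℝ)| - 1), sq_abs (k.2 : ℝ)]))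
        rw [weighted_one] at this
        refine this.trans ((mul_le_mul' le_rfl hs).trans (le_of_eq ?_))
        rw [← ENNReal.ofReal_mul (by norm_num)]
        congr 1; ring
      · refine ((anisoEnergy_weighted_le (abs_galerkinWeight_le n) 0 0 _).trans_lt ?_).ne
        rw [anisoEnergy_coeff]
        exact ENNReal.mul_lt_top ENNReal.ofReal_lt_top ENNReal.ofReal_lt_top)
  have hle : ∀ (a : ℕ) t, anisoEnergy a 1 (coeff (X t)) ≤
      anisoEnergy a 0 (weighted (galerkinWeight n) (coeff (X t))) := fun a t => by
    have := anisoEnergy_weighted_le_weighted (w := fun _ => 1) (w' := galerkinWeight n)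
      (c := coeff (X t)) (a := a) (b := 1) (a' := a) (b' := 0) zero_le_one (fun k => by
        by_cases h : k ∈ box n
        · right
          rw [galerkinWeight_eq h]
          have h4 : 1 + (k.2 : ℝ) ^ 2 ≤ (1 + |(k.2 : ℝ)|) ^ 2 := by
            nlinarith [abs_nonneg (k.2 : ℝ), sq_abs (k.2 : ℝ)]
          have h2 : 0 ≤ (1 + (k.1 : ℝ) ^ 2) ^ a := by positivity
          nlinarith [mul_le_mul_of_nonneg_left h4 h2]
        · exact Or.inl (hbox t k h))
    rwa [weighted_one, ENNReal.ofReal_one, one_mul] at this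
  refine ⟨X, hbox, fun t k hk => ?_, fun t => (hle 0 t).trans (hest.1 t),
    (lintegral_mono fun s => hle 1 s).trans hest.2⟩
  rw [hc]
  simp only [hFdef, if_pos hk]

/-! ### Weak limits -/

/-- A decreasing sequence of nonempty bounded closed convex sets of a Hilbert space has a common
point. -/
theorem nonempty_iInter_of_convex {V : Type*} [NormedAddCommGroup V] [InnerProductSpace ℝ V]
    [CompleteSpace V] {C : ℕ → Set V} (hC : Antitone C) (hne : ∀ n, (C n).Nonempty)
    (hcl : ∀ n, IsClosed (C n)) (hconv : ∀ n, Convex ℝ (C n)) {M : ℝ} (hM : ∀ n, ∀ x ∈ C n, ‖x‖ ≤ M) :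
    (⋂ n, C n).Nonempty := by
  -- The points of least norm in the sets have increasing bounded norms; the parallelogram law makes
  -- them a Cauchy sequence, whose limit lies in every set.
  choose x hx hmin using fun n =>
    exists_norm_eq_iInf_of_complete_convex (hne n) (hcl n).isComplete (hconv n) 0
  have hle : ∀ n, ∀ y ∈ C n, ‖x n‖ ≤ ‖y‖ := fun n y hy => by
    have h1 := hmin n
    simp only [zero_sub, norm_neg] at h1
    rw [h1]
    exact ciInf_le ⟨0, Set.forall_mem_range.2 fun _ => norm_nonneg _⟩ (⟨y, hy⟩ : C n)
  have hmono : Monotone fun n => ‖x n‖ ^ 2 := fun m n h =>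
    pow_le_pow_left₀ (norm_nonneg _) (hle m _ (hC h (hx n))) 2
  have hbdd : BddAbove (Set.range fun n => ‖x n‖ ^ 2) :=
    ⟨M ^ 2, Set.forall_mem_range.2 fun n => pow_le_pow_left₀ (norm_nonneg _) (hM n _ (hx n)) 2⟩
  have hlim := tendsto_atTop_ciSup hmono hbdd
  set L := ⨆ n, ‖x n‖ ^ 2
  have hL : ∀ n, ‖x n‖ ^ 2 ≤ L := fun n => le_ciSup hbdd n
  have hdist : ∀ m n, m ≤ n → ‖x m - x n‖ ^ 2 ≤ 2 * (L - ‖x m‖ ^ 2) := fun m n h => by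
    have hmid : (1 / 2 : ℝ) • x m + (1 / 2 : ℝ) • x n ∈ C m :=
      hconv m (hx m) (hC h (hx n)) (by norm_num) (by norm_num) (by norm_num)
    have h1 := hle m _ hmid
    rw [← smul_add, norm_smul, Real.norm_of_nonneg (by norm_num)] at h1
    have h2 := parallelogram_law_with_norm ℝ (x m) (x n)
    have h3 := pow_le_pow_left₀ (norm_nonneg _) h1 2
    nlinarith [hL n, hmono h]
  have hcau : CauchySeq x := by
    rw [Metric.cauchySeq_iff']
    intro ε hε
    obtain ⟨N, hN⟩ := ((tendsto_order.1 hlim).1 (L - ε ^ 2 / 2) (by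
      have : 0 < ε ^ 2 := by positivity
      linarith)).exists
    refine ⟨N, fun n hn => ?_⟩
    rw [dist_comm, dist_eq_norm]
    have := hdist N n hn
    exact lt_of_pow_lt_pow_left₀ 2 hε.le (by linarith)
  obtain ⟨y, hy⟩ := cauchySeq_tendsto_of_complete hcau
  refine ⟨y, Set.mem_iInter.2 fun n => (hcl n).mem_of_tendsto hy ?_⟩
  filter_upwards [Filter.eventually_ge_atTop n] with m hm using hC hm (hx m)

/-- The Cauchy-Schwarz inequality in time. -/
theorem integrable_mul_norm {α E : Type*} [MeasurableSpace α] {μ : Measure α} [NormedAddCommGroup E]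
    {a : α → ℝ} (ha : MemLp a 2 μ) (ha0 : ∀ s, 0 ≤ a s) (φ : Lp E 2 μ) :
    Integrable (fun s => a s * ‖φ s‖) μ ∧
      ∫ s, a s * ‖φ s‖ ∂μ ≤ √(∫ s, a s ^ 2 ∂μ) * ‖φ‖ := by
  have hφ := (Lp.memLp φ).norm
  refine ⟨ha.integrable_mul hφ, ?_⟩
  have h := integral_mul_le_Lp_mul_Lq_of_nonneg (p := 2) (q := 2) (by constructor <;> norm_num)
    (Filter.Eventually.of_forall ha0) (Filter.Eventually.of_forall fun s => norm_nonneg (φ s))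
    (by simpa using ha) (by simpa using hφ)
  refine h.trans (le_of_eq ?_)
  simp only [Real.rpow_two, ← Real.sqrt_eq_rpow]
  congr 1
  rw [Lp.norm_def, MemLp.eLpNorm_eq_integral_rpow_norm (by norm_num) (by norm_num) (Lp.memLp φ),
    ENNReal.toReal_ofReal (by positivity), Real.sqrt_eq_rpow]
  simp

/-! ### Existence for the linearised equation -/

theorem ofReal_norm_sq_Lp {α E : Type*} [MeasurableSpace α] {μ : Measure α} [NormedAddCommGroup E]
    (W : Lp E 2 μ) : ENNReal.ofReal (‖W‖ ^ 2) = ∫⁻ s, ‖W s‖ₑ ^ 2 ∂μ := by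
  rw [Lp.norm_def, ← ENNReal.toReal_pow, ENNReal.ofReal_toReal
    (ENNReal.pow_ne_top (Lp.eLpNorm_ne_top W)),
    eLpNorm_eq_lintegral_rpow_enorm_toReal (by norm_num) (by norm_num), ← ENNReal.rpow_natCast,
    ← ENNReal.rpow_mul]
  simp

theorem exists_seq_tendsto_ae_of_tendsto_Lp {α E : Type*} [MeasurableSpace α] {μ : Measure α}
    [NormedAddCommGroup E] {W : ℕ → Lp E 2 μ} {V : Lp E 2 μ}
    (h : Filter.Tendsto W Filter.atTop (nhds V)) :
    ∃ ns : ℕ → ℕ, StrictMono ns ∧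
      ∀ᵐ t ∂μ, Filter.Tendsto (fun i => W (ns i) t) Filter.atTop (nhds (V t)) :=
  (tendstoInMeasure_of_tendsto_Lp h).exists_seq_tendsto_ae

section Closed

variable {α : Type*} [MeasurableSpace α] {μ : Measure α} {E F : Type*} [NormedAddCommGroup E]
  [NormedSpace ℝ E] [NormedAddCommGroup F] [NormedSpace ℝ F]

/-- An $L^2$ limit is an almost everywhere limit along a subsequence. Closedness and convexity
together stand in for weak closedness. -/
theorem isClosed_setOf_ae_norm_le (b : E →L[ℝ] F) (M : ℝ) :
    IsClosed {W : Lp E 2 μ | ∀ᵐ t ∂μ, ‖b (W t)‖ ≤ M} := by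
  refine isSeqClosed_iff_isClosed.1 fun W V hW hV => ?_
  obtain ⟨ns, -, hns⟩ := exists_seq_tendsto_ae_of_tendsto_Lp hV
  have h := ae_all_iff.2 fun i => hW (ns i)
  filter_upwards [h, hns] with t h1 h2
  exact le_of_tendsto ((b.continuous.tendsto _).comp h2).norm (Filter.Eventually.of_forall h1)

theorem convex_setOf_ae_norm_le (b : E →L[ℝ] F) (M : ℝ) :
    Convex ℝ {W : Lp E 2 μ | ∀ᵐ t ∂μ, ‖b (W t)‖ ≤ M} := by
  intro W hW V hV x y hx hy hxy
  filter_upwards [hW, hV, Lp.coeFn_add (x • W) (y • V), Lp.coeFn_smul x W, Lp.coeFn_smul y V]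
    with t h1 h2 h3 h4 h5
  rw [h3, Pi.add_apply, h4, h5, Pi.smul_apply, Pi.smul_apply, map_add, map_smul, map_smul]
  refine (norm_add_le _ _).trans ?_
  rw [norm_smul, norm_smul, Real.norm_of_nonneg hx, Real.norm_of_nonneg hy]
  refine (add_le_add (mul_le_mul_of_nonneg_left h1 hx) (mul_le_mul_of_nonneg_left h2 hy)).trans ?_
  rw [← add_mul, hxy, one_mul]

variable [IsFiniteMeasure μ]

theorem integrable_apply_Lp {D : α → E →L[ℝ] F} {C : ℝ} (hC : 0 ≤ C)
    (hD : ∀ᵐ s ∂μ, ∀ x, ‖D s x‖ ≤ C * ‖x‖)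
    (hm : ∀ W : Lp E 2 μ, AEStronglyMeasurable (fun s => D s (W s)) μ) (W : Lp E 2 μ) :
    Integrable (fun s => D s (W s)) μ ∧ ∫ s, ‖D s (W s)‖ ∂μ ≤ C * √(μ.real univ) * ‖W‖ := by
  obtain ⟨h1, h2⟩ := integrable_mul_norm (μ := μ) (memLp_const C) (fun _ => hC) W
  have h3 : Integrable (fun s => D s (W s)) μ := h1.mono' (hm W) (hD.mono fun s hs => hs (W s))
  refine ⟨h3, (integral_mono_ae h3.norm h1 (hD.mono fun s hs => hs (W s))).trans (h2.trans (le_of_eq ?_))⟩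
  rw [integral_const, smul_eq_mul, mul_comm (μ.real univ), Real.sqrt_mul (sq_nonneg _), Real.sqrt_sq hC]

variable [LinearOrder α]

/-- Along a subsequence the left side converges almost everywhere. The right side converges at every
time, the drift being bounded from $L^2$ to $L^1$ in time. -/
theorem isClosed_setOf_ae_eq_setIntegral (a : E →L[ℝ] F) {D : α → E →L[ℝ] F} {C : ℝ} (hC : 0 ≤ C)
    (hD : ∀ᵐ s ∂μ, ∀ x, ‖D s x‖ ≤ C * ‖x‖)
    (hm : ∀ W : Lp E 2 μ, AEStronglyMeasurable (fun s => D s (W s)) μ) {g : α → F} (hg : Integrable g μ) :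
    IsClosed {W : Lp E 2 μ | ∀ᵐ t ∂μ, a (W t) = ∫ s in Iic t, (D s (W s) + g s) ∂μ} := by
  refine isSeqClosed_iff_isClosed.1 fun W V hW hV => ?_
  obtain ⟨ns, hmono, hns⟩ := exists_seq_tendsto_ae_of_tendsto_Lp hV
  have h := ae_all_iff.2 fun i => hW (ns i)
  have hV' : Filter.Tendsto (fun i => C * √(μ.real univ) * ‖W (ns i) - V‖) Filter.atTop (nhds 0) := by
    have := (tendsto_iff_norm_sub_tendsto_zero.1 (hV.comp hmono.tendsto_atTop)).const_mul
      (C * √(μ.real univ))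
    simpa using this
  have hR : ∀ t, Filter.Tendsto (fun i => ∫ s in Iic t, (D s (W (ns i) s) + g s) ∂μ) Filter.atTop
      (nhds (∫ s in Iic t, (D s (V s) + g s) ∂μ)) := fun t => by
    rw [tendsto_iff_norm_sub_tendsto_zero]
    refine squeeze_zero (fun _ => norm_nonneg _) (fun i => ?_) hV'
    obtain ⟨h1, -⟩ := integrable_apply_Lp hC hD hm (W (ns i))
    obtain ⟨h2, -⟩ := integrable_apply_Lp hC hD hm V
    obtain ⟨h3, h4⟩ := integrable_apply_Lp hC hD hm (W (ns i) - V)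
    have i1 : Integrable (fun s => D s (W (ns i) s) + g s) μ := h1.add hg
    have i2 : Integrable (fun s => D s (V s) + g s) μ := h2.add hg
    rw [← integral_sub i1.integrableOn i2.integrableOn]
    have e : ∫ s in Iic t, (D s (W (ns i) s) + g s - (D s (V s) + g s)) ∂μ =
        ∫ s in Iic t, D s ((W (ns i) - V : Lp E 2 μ) s) ∂μ := by
      refine integral_congr_ae (ae_restrict_of_ae ?_)
      filter_upwards [Lp.coeFn_sub (W (ns i)) V] with s hs
      rw [hs, Pi.sub_apply, map_sub]; abel
    rw [e]
    refine (norm_integral_le_integral_norm _).trans (le_trans ?_ h4)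
    exact setIntegral_le_integral h3.norm (Filter.Eventually.of_forall fun _ => norm_nonneg _)
  filter_upwards [h, hns] with t h1 h2
  refine tendsto_nhds_unique ((a.continuous.tendsto _).comp h2) ((hR t).congr fun i => ?_)
  exact (h1 i).symm

theorem convex_setOf_ae_eq_setIntegral (a : E →L[ℝ] F) {D : α → E →L[ℝ] F} {C : ℝ} (hC : 0 ≤ C)
    (hD : ∀ᵐ s ∂μ, ∀ x, ‖D s x‖ ≤ C * ‖x‖)
    (hm : ∀ W : Lp E 2 μ, AEStronglyMeasurable (fun s => D s (W s)) μ) {g : α → F} (hg : Integrable g μ) :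
    Convex ℝ {W : Lp E 2 μ | ∀ᵐ t ∂μ, a (W t) = ∫ s in Iic t, (D s (W s) + g s) ∂μ} := by
  intro W hW V hV x y hx hy hxy
  have hsum : ∀ᵐ t ∂μ, (x • W + y • V : Lp E 2 μ) t = x • W t + y • V t := by
    filter_upwards [Lp.coeFn_add (x • W) (y • V), Lp.coeFn_smul x W, Lp.coeFn_smul y V] with t h3 h4 h5
    rw [h3, Pi.add_apply, h4, h5, Pi.smul_apply, Pi.smul_apply]
  filter_upwards [hW, hV, hsum] with t h1 h2 h3
  have i1 : Integrable (fun s => x • (D s (W s) + g s)) μ :=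
    ((integrable_apply_Lp hC hD hm W).1.add hg).smul x
  have i2 : Integrable (fun s => y • (D s (V s) + g s)) μ :=
    ((integrable_apply_Lp hC hD hm V).1.add hg).smul y
  rw [h3, map_add, map_smul, map_smul, h1, h2, ← integral_smul, ← integral_smul,
    ← integral_add i1.integrableOn i2.integrableOn]
  refine integral_congr_ae (ae_restrict_of_ae ?_)
  filter_upwards [hsum] with s hs
  rw [hs, map_add, map_smul, map_smul, smul_add, smul_add]
  have : g s = x • g s + y • g s := by rw [← add_smul, hxy, one_smul]
  nth_rewrite 3 [this]
  abel

/-- Weak compactness without extracting subsequences: the fields that obey the bounds and the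
equations indexed by `S n` form a decreasing sequence of nonempty bounded closed convex sets, and a
common point satisfies all the equations. -/
theorem exists_Lp_of_approximations {E : Type*} [NormedAddCommGroup E] [InnerProductSpace ℝ E]
    [CompleteSpace E] {ι : Type*} (S : ℕ → Finset ι) (hS : Monotone S) (b : E →L[ℝ] E)
    (a : ι → E →L[ℝ] F) {D : ι → α → E →L[ℝ] F} {C : ι → ℝ} (hC : ∀ k, 0 ≤ C k)
    (hD : ∀ k, ∀ᵐ s ∂μ, ∀ x, ‖D k s x‖ ≤ C k * ‖x‖)
    (hm : ∀ k, ∀ W : Lp E 2 μ, AEStronglyMeasurable (fun s => D k s (W s)) μ) {g : ι → α → F}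
    (hg : ∀ k, Integrable (g k) μ) {M : ℝ}
    (h : ∀ n, ∃ W : Lp E 2 μ, ‖W‖ ≤ M ∧ (∀ᵐ t ∂μ, ‖b (W t)‖ ≤ M) ∧
      ∀ k ∈ S n, ∀ᵐ t ∂μ, a k (W t) = ∫ s in Iic t, (D k s (W s) + g k s) ∂μ) :
    ∃ W : Lp E 2 μ, (∀ᵐ t ∂μ, ‖b (W t)‖ ≤ M) ∧
      ∀ n, ∀ k ∈ S n, ∀ᵐ t ∂μ, a k (W t) = ∫ s in Iic t, (D k s (W s) + g k s) ∂μ := by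
  set V : ℕ → Set (Lp E 2 μ) := fun n => Metric.closedBall 0 M ∩
    ({W : Lp E 2 μ | ∀ᵐ t ∂μ, ‖b (W t)‖ ≤ M} ∩
    ⋂ k ∈ S n, {W : Lp E 2 μ | ∀ᵐ t ∂μ, a k (W t) = ∫ s in Iic t, (D k s (W s) + g k s) ∂μ})
  have hne : ∀ n, (V n).Nonempty := fun n => by
    obtain ⟨W, h1, h2, h3⟩ := h n
    exact ⟨W, mem_closedBall_zero_iff.2 h1, h2, mem_iInter₂.2 h3⟩
  have hanti : Antitone V := fun m n h =>
    inter_subset_inter_right _ (inter_subset_inter_right _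
      (biInter_subset_biInter_left fun k hk => hS h hk))
  have hcl : ∀ n, IsClosed (V n) := fun n => Metric.isClosed_closedBall.inter
    ((isClosed_setOf_ae_norm_le _ _).inter (isClosed_biInter fun k _ =>
      isClosed_setOf_ae_eq_setIntegral _ (hC k) (hD k) (hm k) (hg k)))
  have hconv : ∀ n, Convex ℝ (V n) := fun n => (convex_closedBall _ _).inter
    ((convex_setOf_ae_norm_le _ _).inter (convex_iInter₂ fun k _ =>
      convex_setOf_ae_eq_setIntegral _ (hC k) (hD k) (hm k) (hg k)))
  obtain ⟨W, hW⟩ := nonempty_iInter_of_convex hanti hne hcl hconv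
    (M := M) fun n x hx => by simpa using hx.1
  refine ⟨W, (mem_iInter.1 hW 0).2.1, fun n k hk => ?_⟩
  have h1 := mem_iInter₂.1 (mem_iInter.1 hW n).2.2 k hk
  exact h1

end Closed

theorem norm_linearDrift_le {u : H} {M : ℝ} (hu : ‖u‖ ≤ M) (k : ℤ × ℤ) (x : H) :
    ‖linearDrift u k x‖ ≤ ((k.1 : ℝ) ^ 2 + 2 * ((|(k.1 : ℝ)| + |(k.2 : ℝ)|) * M)) * ‖x‖ := by
  have h1 : ‖partialOneSq x k‖ ≤ (k.1 : ℝ) ^ 2 * ‖x‖ := by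
    unfold partialOneSq
    rw [norm_smul, norm_neg, Real.norm_of_nonneg (sq_nonneg _)]
    exact mul_le_mul_of_nonneg_left (norm_coeff_le _ _) (sq_nonneg _)
  have h2 : (|(k.1 : ℝ)| + |(k.2 : ℝ)|) * (‖x‖ * ‖u‖) ≤ (|(k.1 : ℝ)| + |(k.2 : ℝ)|) * (‖x‖ * M) := by
    gcongr
  have h3 := norm_convection_le x u k
  have h4 := norm_convection_le u x k
  rw [mul_comm ‖u‖] at h4
  unfold linearDrift
  calc _ ≤ ‖partialOneSq x k‖ + ‖convection x u k‖ + ‖convection u x k‖ :=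
        (norm_sub_le _ _).trans (add_le_add (norm_sub_le _ _) le_rfl)
    _ ≤ _ := by linarith

/-- `linearDrift` as a continuous linear map. -/
def linearDriftL (u : H) (k : ℤ × ℤ) : H →L[ℝ] CPlane :=
  (-((k.1 : ℝ) ^ 2)) • coeffL k - (convectionL k).flip u - convectionL k u

theorem aestronglyMeasurable_convection {α : Type*} [MeasurableSpace α] {μ : Measure α} {U X : α → H}
    (hU : AEStronglyMeasurable U μ) (hX : AEStronglyMeasurable X μ) (k : ℤ × ℤ) :
    AEStronglyMeasurable (fun s => convection (U s) (X s) k) μ :=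
  (convectionL k).aestronglyMeasurable_comp₂ hU hX

theorem aestronglyMeasurable_partialOneSq {α : Type*} [MeasurableSpace α] {μ : Measure α} {X : α → H}
    (hX : AEStronglyMeasurable X μ) (k : ℤ × ℤ) :
    AEStronglyMeasurable (fun s => partialOneSq (X s) k) μ :=
  AEStronglyMeasurable.const_smul ((coeffL k).continuous.comp_aestronglyMeasurable hX)
    (-((k.1 : ℝ) ^ 2))

theorem aestronglyMeasurable_linearDrift {α : Type*} [MeasurableSpace α] {μ : Measure α} {U X : α → H}
    (hU : AEStronglyMeasurable U μ) (hX : AEStronglyMeasurable X μ) (k : ℤ × ℤ) :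
    AEStronglyMeasurable (fun s => linearDrift (U s) k (X s)) μ :=
  ((aestronglyMeasurable_partialOneSq hX k).sub (aestronglyMeasurable_convection hX hU k)).sub
    (aestronglyMeasurable_convection hU hX k)

/-- The multiplier `(1 + k₁²)^{-a/2} (1 + k₂²)^{-b/2}`. -/
def besselOp (a b : ℕ) : H →L[ℝ] H := (Symbol.bessel a b a.cast_nonneg b.cast_nonneg).op

theorem anisoEnergy_besselOp (a b : ℕ) (u : H) :
    anisoEnergy a b (coeff (besselOp a b u)) = ENNReal.ofReal (‖u‖ ^ 2 / (2 * Real.pi) ^ 2) := by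
  have h := ofReal_norm_sq_HT (s := a) (s' := b) rfl rfl (toHT a b a.cast_nonneg b.cast_nonneg u)
  rw [toH_toHT] at h
  refine h.trans ?_
  congr 1
  have : ‖toHT a b a.cast_nonneg b.cast_nonneg u‖ = ‖coeffFreq u‖ := norm_toHTLin _ _ u
  rw [this, norm_coeffFreq u, mul_pow, mul_div_cancel_left₀ _ (by positivity)]

theorem besselOp_comp (u : H) : besselOp 0 1 (besselOp 1 0 u) = besselOp 1 1 u ∧
    besselOp 1 0 (besselOp 0 1 u) = besselOp 1 1 u := by
  have h : ∀ k, anisoWeight ((0 : ℕ) : ℝ) ((1 : ℕ) : ℝ) k * anisoWeight ((1 : ℕ) : ℝ) ((0 : ℕ) : ℝ) k =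
      anisoWeight ((1 : ℕ) : ℝ) ((1 : ℕ) : ℝ) k := fun k => by
    simp [anisoWeight, mul_comm]
  constructor <;> refine coeff_injective (funext fun k => ?_) <;> unfold besselOp <;>
    rw [Symbol.coeff_op, Symbol.coeff_op, Symbol.coeff_op, smul_smul] <;> simp only [Symbol.bessel] <;>
    rw [← mul_inv]
  · rw [h]
  · rw [mul_comm, h]

theorem norm_besselOp_le (a b : ℕ) (u : H) : ‖besselOp a b u‖ ≤ ‖u‖ := by
  have := Symbol.norm_op_le (Symbol.bessel a b a.cast_nonneg b.cast_nonneg) u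
  rwa [show (Symbol.bessel a b a.cast_nonneg b.cast_nonneg).bound = 1 from rfl, one_mul] at this

/-- The inverse of `besselOp 1 1` on the trigonometric polynomials. -/
def Symbol.truncWeight (n : ℕ) : Symbol where
  fn k := if k ∈ box n then anisoWeight ((1 : ℕ) : ℝ) ((1 : ℕ) : ℝ) k else 0
  bound := ∑ k ∈ box n, anisoWeight ((1 : ℕ) : ℝ) ((1 : ℕ) : ℝ) k
  le_bound k := by
    split_ifs with h
    · rw [abs_of_pos (anisoWeight_pos _ _ _)]
      exact Finset.single_le_sum (f := fun k => anisoWeight ((1 : ℕ) : ℝ) ((1 : ℕ) : ℝ) k)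
        (fun k _ => (anisoWeight_pos _ _ k).le) h
    · rw [abs_zero]
      exact Finset.sum_nonneg fun k _ => (anisoWeight_pos _ _ k).le
  even k := by simp [neg_mem_box, anisoWeight]

theorem besselOp_truncWeight {n : ℕ} {u : H} (hu : ∀ k, k ∉ box n → coeff u k = 0) :
    besselOp 1 1 ((Symbol.truncWeight n).op u) = u := by
  refine coeff_injective (funext fun k => ?_)
  unfold besselOp
  rw [Symbol.coeff_op, Symbol.coeff_op, smul_smul]
  simp only [Symbol.bessel, Symbol.truncWeight]
  by_cases hk : k ∈ box n
  · rw [if_pos hk, inv_mul_cancel₀ (anisoWeight_pos _ _ _).ne', one_smul]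
  · rw [hu k hk, smul_zero]

/-- The unknown is changed to $W$ with $X$ equal to `besselOp 1 1` applied to $W$, so that the
single Hilbert space $L^2([0,T],H)$ carries both bounds. Up to $2\pi$, the norm of $W$ is that of
$X$ in $L^2(\tilde H^{1,1})$, and the norm of `besselOp 1 0` applied to $W(t)$ is that of $X(t)$ in
$\tilde H^{0,1}$. -/
theorem exists_galerkin_Lp {T : ℝ} {U f : Icc (0 : ℝ) T → H} {n : ℕ} {K : ℝ} (hK : 0 ≤ K)
    (X : C(Icc (0 : ℝ) T, H)) (hX1 : ∀ t k, k ∉ box n → coeff (X t) k = 0)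
    (hX2 : ∀ t, ∀ k ∈ box n, coeff (X t) k =
        ∫ s in Iic t, (linearDrift (U s) k (X s) + coeff (f s) k) ∂timeMeasure T)
    (hX3 : ∀ t, anisoEnergy 0 1 (coeff (X t)) ≤ ENNReal.ofReal K)
    (hX4 : ∫⁻ s, anisoEnergy 1 1 (coeff (X s)) ∂timeMeasure T ≤ ENNReal.ofReal K) :
    ∃ W : Lp H 2 (timeMeasure T), ‖W‖ ≤ 2 * Real.pi * √K ∧
      (∀ᵐ t ∂timeMeasure T, ‖besselOp 1 0 (W t)‖ ≤ 2 * Real.pi * √K) ∧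
      ∀ k ∈ box n, ∀ᵐ t ∂timeMeasure T, coeff (besselOp 1 1 (W t)) k =
        ∫ s in Iic t, (linearDrift (U s) k (besselOp 1 1 (W s)) + coeff (f s) k) ∂timeMeasure T := by
  set μ := timeMeasure T
  set Wf : Icc (0 : ℝ) T → H := fun t => (Symbol.truncWeight n).op (X t)
  have hWc : Continuous Wf := (Symbol.truncWeight n).op.continuous.comp X.continuous
  have hWm : MemLp Wf 2 μ := by
    refine MemLp.of_bound hWc.aestronglyMeasurable ((Symbol.truncWeight n).bound * ‖X‖)
      (Filter.Eventually.of_forall fun t => ?_)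
    exact (Symbol.norm_op_le _ _).trans
      (mul_le_mul_of_nonneg_left (X.norm_coe_le_norm t) (Symbol.bound_nonneg _))
  have hW : ∀ᵐ t ∂μ, hWm.toLp Wf t = Wf t := hWm.coeFn_toLp
  have hιW : ∀ t, besselOp 1 1 (Wf t) = X t := fun t => besselOp_truncWeight (hX1 t)
  have hle : ∀ x : ℝ, ENNReal.ofReal (x ^ 2 / (2 * Real.pi) ^ 2) ≤ ENNReal.ofReal K →
      x ≤ 2 * Real.pi * √K := fun x h => by
    have h1 := (ENNReal.ofReal_le_ofReal_iff hK).1 h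
    rw [div_le_iff₀ (by positivity)] at h1
    refine (abs_le_of_sq_le_sq' ?_ (by positivity)).2
    rw [mul_pow, Real.sq_sqrt hK]; linarith
  refine ⟨hWm.toLp Wf, ?_, ?_, fun k hk => ?_⟩
  · refine hle _ ?_
    have e : ∀ x : ℝ, ENNReal.ofReal (x ^ 2 / (2 * Real.pi) ^ 2) =
        ENNReal.ofReal (x ^ 2) * ENNReal.ofReal ((2 * Real.pi) ^ 2)⁻¹ := fun x => by
      rw [div_eq_mul_inv, ENNReal.ofReal_mul (sq_nonneg _)]
    refine le_trans (le_of_eq ?_) hX4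
    rw [e, ofReal_norm_sq_Lp, ← lintegral_mul_const' _ _ ENNReal.ofReal_ne_top]
    refine lintegral_congr_ae ?_
    filter_upwards [hW] with t ht
    rw [ht, ← hιW, anisoEnergy_besselOp, e, ENNReal.ofReal_pow (norm_nonneg _), ofReal_norm]
  · filter_upwards [hW] with t ht
    refine hle _ ?_
    rw [ht, ← anisoEnergy_besselOp 0 1, (besselOp_comp _).1, hιW]
    exact hX3 t
  · filter_upwards [hW] with t ht
    rw [ht, hιW, hX2 t k hk]
    refine integral_congr_ae (ae_restrict_of_ae ?_)
    filter_upwards [hW] with s hs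
    rw [hs, hιW]

theorem exists_weak_solution {T : ℝ} {U f : Icc (0 : ℝ) T → H}
    (hUm : AEStronglyMeasurable U (timeMeasure T)) {M : ℝ} (hM : 0 ≤ M)
    (hUb : ∀ᵐ s ∂timeMeasure T, ‖U s‖ ≤ M)
    (hU : ∫⁻ s, anisoEnergy 1 2 (coeff (U s)) ∂timeMeasure T ≠ ∞)
    (hfm : AEStronglyMeasurable f (timeMeasure T))
    {b : Icc (0 : ℝ) T → ℝ} (hb : Integrable b (timeMeasure T)) (hb0 : ∀ s, 0 ≤ b s)
    (hf : ∀ᵐ s ∂timeMeasure T, anisoEnergy 0 1 (coeff (f s)) ≤ ENNReal.ofReal (b s ^ 2)) :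
    ∃ W : Lp H 2 (timeMeasure T), (∃ K : ℝ, ∀ᵐ t ∂timeMeasure T, ‖besselOp 1 0 (W t)‖ ≤ K) ∧
      ∀ k, Integrable (fun s => linearDrift (U s) k (besselOp 1 1 (W s)) + coeff (f s) k)
          (timeMeasure T) ∧
        ∀ᵐ t ∂timeMeasure T, coeff (besselOp 1 1 (W t)) k =
          ∫ s in Iic t, (linearDrift (U s) k (besselOp 1 1 (W s)) + coeff (f s) k) ∂timeMeasure T := by
  set μ := timeMeasure T
  set K := max (estimateConst T (∫ s, growthRate (coeff (U s)) ∂μ) * (∫ s, 2 * b s ∂μ) ^ 2) 0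
  set D : ℤ × ℤ → Icc (0 : ℝ) T → H →L[ℝ] CPlane := fun k s =>
    (linearDriftL (U s) k).comp (besselOp 1 1)
  have hC : ∀ k : ℤ × ℤ, 0 ≤ (k.1 : ℝ) ^ 2 + 2 * ((|(k.1 : ℝ)| + |(k.2 : ℝ)|) * M) := fun k => by
    positivity
  have hD : ∀ k, ∀ᵐ s ∂μ, ∀ x, ‖D k s x‖ ≤
      ((k.1 : ℝ) ^ 2 + 2 * ((|(k.1 : ℝ)| + |(k.2 : ℝ)|) * M)) * ‖x‖ := fun k => by
    filter_upwards [hUb] with s hs x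
    exact (norm_linearDrift_le hs k _).trans
      (mul_le_mul_of_nonneg_left (norm_besselOp_le 1 1 x) (hC k))
  have hm : ∀ k, ∀ W : Lp H 2 μ, AEStronglyMeasurable (fun s => D k s (W s)) μ := fun k W =>
    aestronglyMeasurable_linearDrift hUm ((besselOp 1 1).continuous.comp_aestronglyMeasurable
      (Lp.aestronglyMeasurable W)) k
  have hfi : ∀ k, Integrable (fun s => coeff (f s) k) μ := fun k => by
    refine (coeffL k).integrable_comp ((hb.const_mul (2 * Real.pi)).mono' hfm ?_)
    filter_upwards [hf] with s hs
    exact norm_le_of_anisoEnergy (hb0 s) hs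
  obtain ⟨W, hW1, hW2⟩ := exists_Lp_of_approximations box (fun m n h => box_mono h) (besselOp 1 0)
    (fun k => coeffL k ∘L besselOp 1 1) hC hD hm hfi (M := 2 * Real.pi * √K) fun n => by
      obtain ⟨X, hX1, hX2, hX3, hX4⟩ := exists_galerkin hUm hUb hU hfm hb hb0 hf n
      exact exists_galerkin_Lp (le_max_right _ _) X hX1 hX2
        (fun t => (hX3 t).trans (ENNReal.ofReal_le_ofReal (le_max_left _ 0)))
        (hX4.trans (ENNReal.ofReal_le_ofReal (le_max_left _ 0)))
  refine ⟨W, ⟨_, hW1⟩, fun k => ⟨(integrable_apply_Lp (hC k) (hD k) (hm k) W).1.add (hfi k), ?_⟩⟩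
  obtain ⟨n, hn⟩ := (tendsto_box.eventually (Filter.eventually_ge_atTop {k})).exists
  exact hW2 n k (hn (Finset.mem_singleton_self k))

/-! ### Elements of the path space -/

/-- Inside the box the weight of $H^{-1}$ is at most one, outside it is at most $1/(1+n^2)$. This
quantifies the compactness of the embedding of $H$ in $H^{-1}$. -/
theorem norm_toHMinusOne_sq_le (n : ℕ) (v : H) :
    ‖toHMinusOne v‖ ^ 2 ≤ ∑ k ∈ box n, ‖coeff v k‖ ^ 2 + ‖v‖ ^ 2 / (1 + (n : ℝ) ^ 2) := by
  have hs := summable_norm_coeff_sq v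
  have hs' := summable_HMinusOne (toHMinusOne v)
  rw [HMinusOne.norm_sq]
  rw [fourier_toHMinusOne] at *
  have hle : ∀ k : ℤ × ℤ, (1 + ((k.1 : ℝ) ^ 2 + (k.2 : ℝ) ^ 2))⁻¹ * ‖coeff v k‖ ^ 2 ≤
      (if k ∈ box n then ‖coeff v k‖ ^ 2 else 0) + (1 + (n : ℝ) ^ 2)⁻¹ * ‖coeff v k‖ ^ 2 := fun k => by
    split_ifs with hk
    · have h1 : (1 + ((k.1 : ℝ) ^ 2 + (k.2 : ℝ) ^ 2))⁻¹ ≤ 1 :=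
        inv_le_one_of_one_le₀ (by nlinarith [sq_nonneg (k.1 : ℝ), sq_nonneg (k.2 : ℝ)])
      have h2 := mul_le_mul_of_nonneg_right h1 (sq_nonneg ‖coeff v k‖)
      have h3 : 0 ≤ (1 + (n : ℝ) ^ 2)⁻¹ * ‖coeff v k‖ ^ 2 := by positivity
      linarith
    · rw [zero_add]
      refine mul_le_mul_of_nonneg_right ?_ (sq_nonneg _)
      refine inv_anti₀ (by positivity) (add_le_add le_rfl ?_)
      have hlt : ∀ m : ℤ, (n : ℤ) < |m| → (n : ℝ) ^ 2 ≤ (m : ℝ) ^ 2 := fun m hm => by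
        rw [← sq_abs (m : ℝ)]
        have : (n : ℝ) < |(m : ℝ)| := by exact_mod_cast hm
        exact pow_le_pow_left₀ (Nat.cast_nonneg _) this.le 2
      rw [mem_box, not_and_or, not_le, not_le] at hk
      rcases hk with hk | hk
      · linarith [hlt _ hk, sq_nonneg (k.2 : ℝ)]
      · linarith [hlt _ hk, sq_nonneg (k.1 : ℝ)]
  have hs1 : Summable fun k => if k ∈ box n then ‖coeff v k‖ ^ 2 else 0 :=
    summable_of_hasFiniteSupport ((box n).finite_toSet.subset fun k hk => by
      by_contra h
      exact hk (if_neg h))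
  have hs2 := hs.mul_left (1 + (n : ℝ) ^ 2)⁻¹
  refine (hs'.tsum_le_tsum hle (hs1.add hs2)).trans ?_
  rw [hs1.tsum_add hs2, tsum_mul_left]
  refine add_le_add (le_of_eq ?_) ?_
  · rw [tsum_eq_sum (s := box n) fun k hk => if_neg hk]
    exact Finset.sum_congr rfl fun k hk => if_pos hk
  · rw [div_eq_inv_mul]
    refine mul_le_mul_of_nonneg_left ?_ (by positivity)
    rw [norm_sq_eq_tsum_coeff]
    exact le_mul_of_one_le_left (tsum_nonneg fun _ => by positivity) (one_le_pow₀ one_le_two_pi)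

/-- The high frequencies are uniformly small by the bound in $H$, and the finitely many low ones are
continuous. -/
theorem continuous_toHMinusOne {α : Type*} [TopologicalSpace α] {x : α → H} {M : ℝ}
    (hM : ∀ t, ‖x t‖ ≤ M) (hx : ∀ k, Continuous fun t => coeff (x t) k) :
    Continuous fun t => toHMinusOne (x t) := by
  rw [continuous_iff_continuousAt]
  intro t
  rw [ContinuousAt, tendsto_iff_norm_sub_tendsto_zero]
  have hlim : Filter.Tendsto (fun s => ‖toHMinusOne (x s) - toHMinusOne (x t)‖ ^ 2) (nhds t) (nhds 0) := by
    rw [tendsto_order]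
    refine ⟨fun a ha => Filter.Eventually.of_forall fun s => ha.trans_le (sq_nonneg _), fun ε hε => ?_⟩
    obtain ⟨n, hn⟩ : ∃ n : ℕ, (2 * M) ^ 2 / (1 + (n : ℝ) ^ 2) < ε / 2 := by
      obtain ⟨n, hn⟩ := exists_nat_gt ((2 * M) ^ 2 / (ε / 2))
      refine ⟨n, ?_⟩
      rw [div_lt_iff₀ (by positivity)] at hn ⊢
      have : (n : ℝ) ≤ 1 + (n : ℝ) ^ 2 := by nlinarith [sq_nonneg ((n : ℝ) - 1)]
      nlinarith
    have hc : Filter.Tendsto (fun s => ∑ k ∈ box n, ‖coeff (x s) k - coeff (x t) k‖ ^ 2) (nhds t)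
        (nhds (∑ k ∈ box n, ‖coeff (x t) k - coeff (x t) k‖ ^ 2)) :=
      (continuous_finsetSum _ fun k _ => (((hx k).sub continuous_const).norm.pow 2)).tendsto t
    simp only [sub_self, norm_zero, ne_eq, OfNat.ofNat_ne_zero, not_false_eq_true, zero_pow,
      Finset.sum_const_zero] at hc
    filter_upwards [(tendsto_order.1 hc).2 (ε / 2) (by positivity)] with s hs
    rw [← map_sub]
    refine (norm_toHMinusOne_sq_le n _).trans_lt ?_
    have h1 : ‖x s - x t‖ ≤ 2 * M := (norm_sub_le _ _).trans (by linarith [hM s, hM t])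
    have h2 : ‖x s - x t‖ ^ 2 / (1 + (n : ℝ) ^ 2) ≤ (2 * M) ^ 2 / (1 + (n : ℝ) ^ 2) := by gcongr
    simp only [coeff_sub, Pi.sub_apply]
    linarith
  have := (Real.continuous_sqrt.tendsto _).comp hlim
  simpa [Function.comp_def, Real.sqrt_sq] using this

/-- A set of full measure is dense when open sets have positive measure, and a dense closed set is
everything. -/
theorem forall_of_ae_of_isClosed {T : ℝ} (hT : 0 < T) {p : Icc (0 : ℝ) T → Prop}
    (hp : IsClosed {t | p t}) (h : ∀ᵐ t ∂timeMeasure T, p t) (t : Icc (0 : ℝ) T) : p t := by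
  have := isOpenPosMeasure_timeMeasure hT
  have hd : Dense {t | p t} := Measure.dense_of_ae h
  have := hp.closure_eq ▸ hd.closure_eq
  exact (this ▸ mem_univ t : t ∈ {t | p t})

/-- A family of coefficients that depends continuously on time and that is for almost every time the
one of a field in a fixed ball of `H` is a field in `H` at every time. -/
theorem exists_field {T : ℝ} (hT : 0 < T) {X : Icc (0 : ℝ) T → H} {M : ℝ} (hM0 : 0 ≤ M)
    (hM : ∀ᵐ t ∂timeMeasure T, ‖X t‖ ≤ M) {c : Icc (0 : ℝ) T → ℤ × ℤ → CPlane}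
    (hc : ∀ k, Continuous fun t => c t k) (h : ∀ᵐ t ∂timeMeasure T, coeff (X t) = c t) :
    ∃ x : Icc (0 : ℝ) T → H, (∀ t, coeff (x t) = c t) ∧ ∀ t, ‖x t‖ ≤ M := by
  have hcj : ∀ k j, Continuous fun t => c t k j := fun k j =>
    (EuclideanSpace.proj (𝕜 := ℂ) j : CPlane →L[ℂ] ℂ).continuous.comp (hc k)
  have h1 : ∀ t k j, c t (-k) j = (starRingEnd ℂ) (c t k j) := fun t k j =>
    forall_of_ae_of_isClosed hT (p := fun t => c t (-k) j = (starRingEnd ℂ) (c t k j))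
      (isClosed_eq (hcj (-k) j) (Complex.continuous_conj.comp (hcj k j)))
      (h.mono fun t ht => by rw [← ht, coeff_neg_apply]) t
  have h2 : ∀ t k, ∑ j, (freq k j : ℂ) * c t k j = 0 := fun t k =>
    forall_of_ae_of_isClosed hT (p := fun t => ∑ j, (freq k j : ℂ) * c t k j = 0)
      (isClosed_eq (continuous_finsetSum _ fun j _ =>
      continuous_const.mul (hcj k j)) continuous_const)
      (h.mono fun t ht => by rw [← ht]; exact coeff_div _ _) t
  -- The full norm is not known to be continuous in time, but finite partial sums are; their bound
  -- extends to every time and then to the whole series.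
  have h3 : ∀ t (S : Finset (ℤ × ℤ)), ∑ k ∈ S, ‖c t k‖ ^ 2 ≤ M ^ 2 / (2 * Real.pi) ^ 2 := fun t S =>
    forall_of_ae_of_isClosed hT (p := fun t => ∑ k ∈ S, ‖c t k‖ ^ 2 ≤ M ^ 2 / (2 * Real.pi) ^ 2)
      (isClosed_le (continuous_finsetSum _ fun k _ => (hc k).norm.pow 2)
      continuous_const) (by
        filter_upwards [h, hM] with t ht h4
        rw [← ht, le_div_iff₀ (by positivity), mul_comm]
        refine le_trans ?_ (pow_le_pow_left₀ (norm_nonneg _) h4 2)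
        rw [norm_sq_eq_tsum_coeff]
        exact mul_le_mul_of_nonneg_left ((summable_norm_coeff_sq _).sum_le_tsum S
          fun _ _ => sq_nonneg _) (by positivity)) t
  have h4 : ∀ t, Summable fun k => ‖c t k‖ ^ 2 := fun t =>
    summable_of_sum_le (fun _ => sq_nonneg _) (h3 t)
  choose x hx using fun t => exists_coeff_eq (h1 t) (h2 t) (h4 t)
  refine ⟨x, hx, fun t => ?_⟩
  refine (abs_le_of_sq_le_sq' ?_ hM0).2
  rw [norm_sq_eq_tsum_coeff, hx, mul_comm, ← le_div_iff₀ (by positivity)]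
  exact (h4 t).tsum_le_of_sum_le (h3 t)

theorem toH_toHT_natCast {s s' : ℝ} {a b : ℕ} (ha : s = a) (hb : s' = b) (hs : 0 ≤ s) (hs' : 0 ≤ s')
    (v : H) : HT.toH (toHT s s' hs hs' v) = besselOp a b v := by
  subst ha hb; rfl

/-- Partial applications of the multipliers to the same $W$ supply the members of the different
spaces: `besselOp 1 0` for $L^\infty(\tilde H^{0,1})$, `besselOp 0 1` for $L^2(\tilde H^{1,0})$, and
$W$ itself for $L^2(\tilde H^{1,1})$. -/
theorem exists_pathSpace {T : ℝ} (hT : 0 < T) {W : Icc (0 : ℝ) T → H} (hW : MemLp W 2 (timeMeasure T))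
    {M : ℝ} (hM0 : 0 ≤ M) (hM : ∀ᵐ t ∂timeMeasure T, ‖besselOp 1 0 (W t)‖ ≤ M)
    {c : Icc (0 : ℝ) T → ℤ × ℤ → CPlane}
    (hc : ∀ k, Continuous fun t => c t k)
    (h : ∀ᵐ t ∂timeMeasure T, coeff (besselOp 1 1 (W t)) = c t) :
    ∃ P : PathSpace T, (∀ᵐ t ∂timeMeasure T, P.inH t = besselOp 1 1 (W t)) ∧
      (∀ t, HMinusOne.fourier (P.inHMinusOne t) = c t) ∧ P.MemLpHT ∞ 0 1 ∧ P.MemLpHT 2 1 1 := by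
  set μ := timeMeasure T
  have hM' : ∀ᵐ t ∂μ, ‖besselOp 1 1 (W t)‖ ≤ M := hM.mono fun t ht => by
    rw [← (besselOp_comp _).1]; exact (norm_besselOp_le _ _ _).trans ht
  obtain ⟨x, hx, hxM⟩ := exists_field hT hM0 hM' hc h
  have hcont : Continuous fun t => toHMinusOne (x t) :=
    continuous_toHMinusOne hxM fun k => by simp only [hx]; exact hc k
  have hX : MemLp (fun t => besselOp 1 1 (W t)) ∞ μ :=
    memLp_top_of_bound ((besselOp 1 1).continuous.comp_aestronglyMeasurable hW.1) M hM'
  have h10 : MemLp (fun t => besselOp 1 0 (W t)) ∞ μ :=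
    memLp_top_of_bound ((besselOp 1 0).continuous.comp_aestronglyMeasurable hW.1) M hM
  have h01 : MemLp (fun t => besselOp 0 1 (W t)) 2 μ := (besselOp 0 1).comp_memLp' hW
  have e10 : MemLp (fun t => toHT 1 0 zero_le_one le_rfl (besselOp 0 1 (W t))) 2 μ :=
    (toHT 1 0 zero_le_one le_rfl).comp_memLp' h01
  have e01 : MemLp (fun t => toHT 0 1 le_rfl zero_le_one (besselOp 1 0 (W t))) ∞ μ :=
    (toHT 0 1 le_rfl zero_le_one).comp_memLp' h10
  have e11 : MemLp (fun t => toHT 1 1 zero_le_one zero_le_one (W t)) 2 μ :=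
    (toHT 1 1 zero_le_one zero_le_one).comp_memLp' hW
  have hP : (hX.toLp _, e10.toLp _, (⟨_, hcont⟩ : C(Icc (0 : ℝ) T, HMinusOne))) ∈ pathSet T := by
    filter_upwards [hX.coeFn_toLp, e10.coeFn_toLp, h] with t h1 h2 h3
    rw [h1, h2, toH_toHT_natCast (a := 1) (b := 0) (by simp) (by simp), (besselOp_comp _).2]
    refine ⟨rfl, ?_⟩
    rw [h3, ← hx]; rfl
  refine ⟨⟨_, hP⟩, hX.coeFn_toLp, fun t => hx t, ⟨_, e01, ?_⟩, ⟨_, e11, ?_⟩⟩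
  · filter_upwards [hX.coeFn_toLp] with t h1
    rw [toH_toHT_natCast (a := 0) (b := 1) (by simp) (by simp), (besselOp_comp _).1]
    exact h1.symm
  · filter_upwards [hX.coeFn_toLp] with t h1
    rw [toH_toHT_natCast (a := 1) (b := 1) (by simp) (by simp)]
    exact h1.symm

theorem exists_linearised_solution {T : ℝ} (hT : 0 < T) {U f : Icc (0 : ℝ) T → H}
    (hUm : AEStronglyMeasurable U (timeMeasure T)) {M : ℝ} (hM : 0 ≤ M)
    (hUb : ∀ᵐ s ∂timeMeasure T, ‖U s‖ ≤ M)
    (hU : ∫⁻ s, anisoEnergy 1 2 (coeff (U s)) ∂timeMeasure T ≠ ∞)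
    (hfm : AEStronglyMeasurable f (timeMeasure T))
    {b : Icc (0 : ℝ) T → ℝ} (hb : Integrable b (timeMeasure T)) (hb0 : ∀ s, 0 ≤ b s)
    (hf : ∀ᵐ s ∂timeMeasure T, anisoEnergy 0 1 (coeff (f s)) ≤ ENNReal.ofReal (b s ^ 2)) :
    ∃ P : PathSpace T, IsSolution 0 (fun s k => linearDrift (U s) k (P.inH s) + coeff (f s) k) P := by
  obtain ⟨W, ⟨K, hK⟩, hW⟩ := exists_weak_solution hUm hM hUb hU hfm hb hb0 hf
  obtain ⟨P, h1, h2, h3, h4⟩ := exists_pathSpace hT (Lp.memLp W) (le_max_right K 0)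
    (hK.mono fun t ht => ht.trans (le_max_left _ _))
    (c := fun t k => ∫ s in Iic t, (linearDrift (U s) k (besselOp 1 1 (W s)) + coeff (f s) k)
      ∂timeMeasure T) (fun k => continuous_setIntegral_Iic (hW k).1)
    ((ae_all_iff.2 fun k => (hW k).2).mono fun t ht => funext ht)
  refine ⟨P, h3, h4, fun t k => ?_⟩
  rw [h2, Pi.zero_apply, zero_add]
  refine integral_congr_ae (ae_restrict_of_ae ?_)
  filter_upwards [h1] with s hs
  rw [hs]

/-! ### Continuous dependence on the forcing -/

theorem anisoEnergy_add_le (a b : ℕ) (c d : ℤ × ℤ → CPlane) :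
    anisoEnergy a b (c + d) ≤ 2 * anisoEnergy a b c + 2 * anisoEnergy a b d := by
  unfold anisoEnergy
  rw [← ENNReal.tsum_mul_left, ← ENNReal.tsum_mul_left, ← ENNReal.tsum_add]
  refine ENNReal.tsum_le_tsum fun k => ?_
  rw [mul_left_comm, mul_left_comm 2, ← mul_add]
  refine mul_le_mul' le_rfl ?_
  rw [Pi.add_apply, ← ofReal_norm_sq_cplane, ← ofReal_norm_sq_cplane, ← ofReal_norm_sq_cplane]
  refine le_trans (b := ENNReal.ofReal 2 * ENNReal.ofReal (‖c k‖ ^ 2) +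
    ENNReal.ofReal 2 * ENNReal.ofReal (‖d k‖ ^ 2)) ?_ (by rw [ENNReal.ofReal_ofNat])
  rw [← ENNReal.ofReal_mul (by norm_num), ← ENNReal.ofReal_mul (by norm_num),
    ← ENNReal.ofReal_add (by positivity) (by positivity)]
  refine ENNReal.ofReal_le_ofReal ?_
  have h := pow_le_pow_left₀ (norm_nonneg _) (norm_add_le (c k) (d k)) 2
  nlinarith [sq_nonneg (‖c k‖ - ‖d k‖)]

theorem estimateConst_nonneg (T : ℝ) {Γ : ℝ} (hΓ : 0 ≤ Γ) : 0 ≤ estimateConst T Γ := by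
  have : 0 ≤ (timeMeasure T).real univ := measureReal_nonneg
  unfold estimateConst energyConst
  positivity

/-- The bound for the linear drift tested against `Y` on trigonometric polynomials. -/
def driftBound (n : ℕ) (u : H) : ℝ :=
  (1 + (n : ℝ) ^ 2) * (1 + 4 * japaneseSum.toReal * (1 + (anisoEnergy 1 1 (coeff u)).toReal))

theorem driftBound_nonneg (n : ℕ) (u : H) : 0 ≤ driftBound n u := by
  unfold driftBound; positivity

/-- On trigonometric polynomials all derivatives of $G$ are paid for by powers of $1+n^2$, so
smallness of $G$ in $H$ makes its whole drift small, at the price of a constant depending on $n$. -/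
theorem tsum_linearDrift_le {n : ℕ} {u G : H} (hG : ∀ k, k ∉ box n → coeff G k = 0) {ρ : ℝ} (hρ : 0 ≤ ρ)
    (hGρ : ‖G‖ ≤ ρ) (hu : anisoEnergy 1 1 (coeff u) ≠ ∞) (y : H) :
    ∑' k, ‖linearDrift u k G‖ₑ * ‖coeff y k‖ₑ ≤
      ENNReal.ofReal (driftBound n u * ρ * √(anisoEnergy 0 0 (coeff y)).toReal) := by
  set Q := anisoEnergy 0 0 (coeff y)
  set A := anisoEnergy 1 1 (coeff u)
  set N : ℝ := 1 + (n : ℝ) ^ 2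
  have hN : 1 ≤ N := by simp only [N]; nlinarith [sq_nonneg (n : ℝ)]
  have hNρ : 0 ≤ N * ρ := mul_nonneg (zero_le_one.trans hN) hρ
  have hQ : Q ≠ ∞ := by
    simp only [Q]; rw [anisoEnergy_coeff]; exact ENNReal.ofReal_ne_top
  have hG0 : anisoEnergy 0 0 (coeff G) ≤ ENNReal.ofReal (ρ ^ 2) := by
    rw [anisoEnergy_coeff]
    refine ENNReal.ofReal_le_ofReal ?_
    exact (div_le_self (sq_nonneg _) (one_le_pow₀ one_le_two_pi)).trans
      (pow_le_pow_left₀ (norm_nonneg _) hGρ 2)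
  have hGab : ∀ a b : ℕ, a + b ≤ 2 → anisoEnergy a b (coeff G) ≤ ENNReal.ofReal ((N * ρ) ^ 2) :=
    fun a b hab => by
      refine (anisoEnergy_le_of_box hG a b).trans ((mul_le_mul' le_rfl hG0).trans ?_)
      rw [← ENNReal.ofReal_mul (by positivity), mul_pow]
      exact ENNReal.ofReal_le_ofReal (mul_le_mul_of_nonneg_right (pow_le_pow_right₀ hN hab) (sq_nonneg _))
  have e1 : ∑' k, ‖partialOneSq G k‖ₑ * ‖coeff y k‖ₑ ≤ ENNReal.ofReal (N * ρ * √Q.toReal) := by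
    have h1 : anisoEnergy 0 0 (weighted (fun _ => 1) (partialOneSq G)) ≤ ENNReal.ofReal ((N * ρ) ^ 2) := by
      rw [weighted_one]
      refine le_trans ?_ (hGab 2 0 le_rfl)
      have := anisoEnergy_weighted_le_weighted (w := fun k => -((k.1 : ℝ) ^ 2)) (w' := fun _ => 1)
        (c := coeff G) (a := 0) (b := 0) (a' := 2) (b' := 0) zero_le_one (fun k => Or.inr (by
          nlinarith [sq_nonneg (k.1 : ℝ)]))
      rwa [weighted_one, ENNReal.ofReal_one, one_mul] at this
    have := tsum_weighted_mul_le (c := coeff y) (mul_nonneg (by positivity) hρ) h1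
      (by rw [weighted_one]; exact hQ)
    simpa [weighted_one] using this
  have e2 : ∀ z v : H, anisoEnergy 1 0 (coeff z) * anisoEnergy 1 1 (coeff v) ≤
      ENNReal.ofReal ((N * ρ) ^ 2) * A →
      ∑' k, ‖convection z v k‖ₑ * ‖coeff y k‖ₑ ≤ ENNReal.ofReal
        (2 * japaneseSum.toReal * (N * ρ * (1 + A.toReal)) * √Q.toReal) := fun z v h => by
    refine (tsum_convection_le z v _).trans ((advection_le (coeff_div z)).trans ?_)
    calc _ ≤ 2 * japaneseSum * (ENNReal.ofReal ((N * ρ) ^ 2) * A * Q) ^ (1 / 2 : ℝ) :=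
          mul_le_mul' le_rfl (ENNReal.rpow_le_rpow (mul_le_mul' h le_rfl) (by norm_num))
      _ = ENNReal.ofReal (2 * japaneseSum.toReal * (N * ρ * √A.toReal * √Q.toReal)) := by
          rw [rpow_half_eq (ENNReal.mul_ne_top (ENNReal.mul_ne_top ENNReal.ofReal_ne_top hu) hQ),
            ENNReal.toReal_mul, ENNReal.toReal_mul, ENNReal.toReal_ofReal (sq_nonneg _),
            Real.sqrt_mul (by positivity), Real.sqrt_mul (by positivity),
            Real.sqrt_sq hNρ, ENNReal.ofReal_mul (p := 2 * japaneseSum.toReal) (by positivity),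
            ENNReal.ofReal_mul (p := 2) (by norm_num), ENNReal.ofReal_toReal japaneseSum_ne_top,
            ENNReal.ofReal_ofNat]
      _ ≤ _ := by
          refine ENNReal.ofReal_le_ofReal ?_
          rw [mul_assoc (2 * japaneseSum.toReal)]
          gcongr
          -- The linear bound makes `driftBound` integrable in time when the $\tilde H^{1,1}$ energy
          -- is.
          have h3 : √A.toReal ≤ 1 + A.toReal := by
            rw [Real.sqrt_le_left (by positivity)]
            nlinarith [ENNReal.toReal_nonneg (a := A)]
          exact h3
  have e3 := e2 G u (mul_le_mul' (hGab 1 0 (by norm_num)) le_rfl)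
  have e4 := e2 u G (by
    rw [mul_comm]
    exact mul_le_mul' (hGab 1 1 le_rfl) (anisoEnergy_mono le_rfl zero_le_one _))
  have hle : ∀ k, ‖linearDrift u k G‖ₑ * ‖coeff y k‖ₑ ≤ ‖partialOneSq G k‖ₑ * ‖coeff y k‖ₑ +
      ‖convection G u k‖ₑ * ‖coeff y k‖ₑ + ‖convection u G k‖ₑ * ‖coeff y k‖ₑ := fun k => by
    rw [← add_mul, ← add_mul]
    exact mul_le_mul' (enorm_sub_le.trans (add_le_add enorm_sub_le le_rfl)) le_rfl
  refine (ENNReal.tsum_le_tsum hle).trans ?_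
  rw [ENNReal.tsum_add, ENNReal.tsum_add]
  refine (add_le_add (add_le_add e1 e3) e4).trans (le_of_eq ?_)
  rw [← ENNReal.ofReal_add (by positivity) (by positivity), ← ENNReal.ofReal_add (by positivity)
    (by positivity)]
  congr 1
  unfold driftBound
  simp only [N, A]
  ring

/-- The truncated part of the forcing is measured only through its time primitive $G$, since weak
convergence makes $G$ small but not the forcing itself. The difference $D-G$ solves the linearised
equation with forcing the drift of $G$ plus the untruncated remainder of $h$, both small in
$L^1([0,T],H)$; then $G$ is added back. -/
theorem linearised_estimate_of_forcing {T : ℝ} {U D h : Icc (0 : ℝ) T → H}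
    (hUm : AEStronglyMeasurable U (timeMeasure T)) {M : ℝ} (hUb : ∀ᵐ s ∂timeMeasure T, ‖U s‖ ≤ M)
    (hU : ∫⁻ s, anisoEnergy 1 2 (coeff (U s)) ∂timeMeasure T ≠ ∞)
    (hDm : AEStronglyMeasurable D (timeMeasure T)) {M' : ℝ} (hDb : ∀ᵐ s ∂timeMeasure T, ‖D s‖ ≤ M')
    (hD : ∫⁻ s, anisoEnergy 1 1 (coeff (D s)) ∂timeMeasure T ≠ ∞)
    (hh : Integrable h (timeMeasure T)) {c : Icc (0 : ℝ) T → ℤ × ℤ → CPlane}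
    (hc : ∀ t k, c t k = ∫ s in Iic t, (linearDrift (U s) k (D s) + coeff (h s) k) ∂timeMeasure T)
    (hDc : ∀ᵐ s ∂timeMeasure T, coeff (D s) = c s) (n : ℕ) {ρ : ℝ} (hρ0 : 0 ≤ ρ)
    (hρ : ∀ t, ‖∫ s in Iic t, (Symbol.trunc n).op (h s) ∂timeMeasure T‖ ≤ ρ)
    {r : Icc (0 : ℝ) T → ℝ} (hr : Integrable r (timeMeasure T)) (hr0 : ∀ s, 0 ≤ r s)
    (hhr : ∀ᵐ s ∂timeMeasure T,
      anisoEnergy 0 0 (coeff (h s - (Symbol.trunc n).op (h s))) ≤ ENNReal.ofReal (r s ^ 2)) {Δ : ℝ}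
    (hΔ : 2 * (estimateConst T (∫ s, growthRate (coeff (U s)) ∂timeMeasure T) *
        ((∫ s, driftBound n (U s) ∂timeMeasure T) * ρ + ∫ s, r s ∂timeMeasure T) ^ 2) +
      2 * ((1 + (timeMeasure T).real univ) * (1 + (n : ℝ) ^ 2) * ρ ^ 2) ≤ Δ) :
    (∀ t, anisoEnergy 0 0 (c t) ≤ ENNReal.ofReal Δ) ∧
      ∫⁻ s, anisoEnergy 1 0 (coeff (D s)) ∂timeMeasure T ≤ ENNReal.ofReal Δ := by
  set μ := timeMeasure T
  have hPh : Integrable (fun s => (Symbol.trunc n).op (h s)) μ := (Symbol.trunc n).op.integrable_comp hh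
  set G : Icc (0 : ℝ) T → H := fun t => ∫ s in Iic t, (Symbol.trunc n).op (h s) ∂μ
  have hGc : Continuous G := continuous_setIntegral_Iic hPh
  have hGk : ∀ t k, coeff (G t) k = ∫ s in Iic t, coeff ((Symbol.trunc n).op (h s)) k ∂μ := fun t k =>
    ((coeffL k).integral_comp_comm hPh.integrableOn).symm
  have hGbox : ∀ t k, k ∉ box n → coeff (G t) k = 0 := fun t k hk => by
    rw [hGk]; simp [coeff_trunc, hk]
  have hYm : AEStronglyMeasurable (fun s => D s - G s) μ := hDm.sub hGc.aestronglyMeasurable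
  have hdrift : ∀ s k, linearDrift (U s) k (D s - G s) = linearDrift (U s) k (D s) -
      linearDrift (U s) k (G s) := fun s k => (linearDriftL (U s) k).map_sub _ _
  have hDint : ∀ k, Integrable (fun s => linearDrift (U s) k (D s)) μ := fun k => by
    refine Integrable.of_bound (aestronglyMeasurable_linearDrift hUm hDm k)
      (((k.1 : ℝ) ^ 2 + 2 * ((|(k.1 : ℝ)| + |(k.2 : ℝ)|) * M)) * M') ?_
    filter_upwards [hUb, hDb] with s h1 h2
    have hM : 0 ≤ M := (norm_nonneg _).trans h1
    exact (norm_linearDrift_le h1 k (D s)).trans (mul_le_mul_of_nonneg_left h2 (by positivity))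
  have hhk : ∀ k, Integrable (fun s => coeff (h s) k) μ := fun k => (coeffL k).integrable_comp hh
  have hPhk : ∀ k, Integrable (fun s => coeff ((Symbol.trunc n).op (h s)) k) μ := fun k =>
    (coeffL k).integrable_comp hPh
  have hGE : ∀ t, ∀ a b : ℕ, anisoEnergy a b (coeff (G t)) ≤
      ENNReal.ofReal ((1 + (n : ℝ) ^ 2) ^ (a + b)) * ENNReal.ofReal (ρ ^ 2) := fun t a b => by
    refine (anisoEnergy_le_of_box (hGbox t) a b).trans (mul_le_mul' le_rfl ?_)
    rw [anisoEnergy_coeff]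
    exact ENNReal.ofReal_le_ofReal ((div_le_self (sq_nonneg _) (one_le_pow₀ one_le_two_pi)).trans
      (pow_le_pow_left₀ (norm_nonneg _) (hρ t) 2))
  have hUk : ∀ k, AEStronglyMeasurable (fun s => coeff (U s) k) μ := fun k =>
    (coeffL k).continuous.comp_aestronglyMeasurable hUm
  have hDk : ∀ k, AEStronglyMeasurable (fun s => coeff (D s) k) μ := fun k =>
    (coeffL k).continuous.comp_aestronglyMeasurable hDm
  have hU11 : ∫⁻ s, anisoEnergy 1 1 (coeff (U s)) ∂μ ≠ ∞ :=
    ((lintegral_mono fun s => anisoEnergy_mono le_rfl one_le_two _).trans_lt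
      (lt_top_iff_ne_top.2 hU)).ne
  have hdb : Integrable (fun s => driftBound n (U s)) μ :=
    ((integrable_const 1).add (((integrable_const 1).add (integrable_toReal_of_lintegral_ne_top
      (aemeasurable_anisoEnergy hUk 1 1) hU11)).const_mul _)).const_mul _
  -- With constant weight there is no commutator, so no regularity of $D-G$ in the second variable
  -- enters the bound.
  have key := linearised_estimate (T := T) (w := fun _ => 1) (W := 1) (by simp) (fun _ => le_rfl)
    (by simp) (by simp) (by simp) (U := U) (Y := fun s => D s - G s)
    (F := fun s k => linearDrift (U s) k (D s) + coeff (h s - (Symbol.trunc n).op (h s)) k)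
    (g := fun s k => linearDrift (U s) k (G s) + coeff (h s - (Symbol.trunc n).op (h s)) k)
    (c := fun t k => c t k - coeff (G t) k)
    (fun k => (hDint k).add ((coeffL k).integrable_comp (hh.sub hPh)))
    (fun t k => by
      have i1 : Integrable (fun s => linearDrift (U s) k (D s) + coeff (h s) k) μ := (hDint k).add (hhk k)
      rw [hc, hGk, ← integral_sub i1.integrableOn (hPhk k).integrableOn]
      refine integral_congr_ae (Filter.Eventually.of_forall fun s => ?_)
      simp only [coeff_sub, Pi.sub_apply]
      abel)
    (hDc.mono fun s hs => by rw [coeff_sub, hs]; rfl)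
    (Filter.Eventually.of_forall fun s k => Or.inr (by
      change _ = linearDrift (U s) k (D s - G s) + _
      rw [hdrift]; abel))
    hU hUm
    (by
      refine ((lintegral_mono fun s => (?_ : _ ≤ 2 * anisoEnergy 1 1 (coeff (D s)) + 2 *
        (ENNReal.ofReal ((1 + (n : ℝ) ^ 2) ^ (1 + 1)) * ENNReal.ofReal (ρ ^ 2)))).trans_lt ?_).ne
      · rw [sub_eq_add_neg, coeff_add]
        refine (anisoEnergy_add_le _ _ _ _).trans (add_le_add le_rfl (mul_le_mul' le_rfl
          (le_trans (le_of_eq ?_) (hGE s 1 1))))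
        unfold anisoEnergy
        congr 1; ext k
        have : coeff (-G s) k = -coeff (G s) k := (coeffL k).map_neg _
        rw [this, enorm_neg]
      · rw [lintegral_add_right _ measurable_const, lintegral_const_mul' _ _ (by norm_num),
          lintegral_const]
        exact ENNReal.add_lt_top.2 ⟨ENNReal.mul_lt_top (by norm_num) (lt_top_iff_ne_top.2 hD),
          ENNReal.mul_lt_top (ENNReal.mul_lt_top (by norm_num) (ENNReal.mul_lt_top ENNReal.ofReal_lt_top
            ENNReal.ofReal_lt_top)) (measure_lt_top _ _)⟩)
    (M := M' + ρ) (hDb.mono fun s hs => (norm_sub_le _ _).trans (add_le_add hs (hρ s)))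
    (fun k => (aestronglyMeasurable_linearDrift hUm hGc.aestronglyMeasurable k).add
      ((coeffL k).continuous.comp_aestronglyMeasurable (hh.sub hPh).1))
    (Or.inl fun _ => rfl)
    (b := fun s => driftBound n (U s) * ρ + r s) ((hdb.mul_const ρ).add hr)
    (fun s => add_nonneg (mul_nonneg (driftBound_nonneg _ _) hρ0) (hr0 s))
    (by
      filter_upwards [hhr, ae_lt_top' (aemeasurable_anisoEnergy hUk 1 1) hU11] with s h1 h2
      have e1 := tsum_linearDrift_le (hGbox s) hρ0 (hρ s) h2.ne (D s - G s)
      have e2 := tsum_weighted_mul_le (w := fun _ => 1)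
        (f := coeff (h s - (Symbol.trunc n).op (h s))) (c := coeff (D s - G s)) (hr0 s)
        (by rw [weighted_one]; exact h1)
        (by rw [weighted_one, anisoEnergy_coeff]; exact ENNReal.ofReal_ne_top)
      rw [weighted_one] at e2 ⊢
      simp only [one_pow, ENNReal.ofReal_one, one_mul] at e2 ⊢
      rw [add_mul, ENNReal.ofReal_add (mul_nonneg (mul_nonneg (driftBound_nonneg _ _) hρ0)
        (Real.sqrt_nonneg _)) (mul_nonneg (hr0 s) (Real.sqrt_nonneg _))]
      refine le_trans ?_ (add_le_add e1 e2)
      rw [← ENNReal.tsum_add]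
      refine ENNReal.tsum_le_tsum fun k => ?_
      rw [← add_mul]
      exact mul_le_mul' (enorm_add_le _ _) le_rfl)
  have hint : ∫ s, (driftBound n (U s) * ρ + r s) ∂μ = (∫ s, driftBound n (U s) ∂μ) * ρ + ∫ s, r s ∂μ := by
    rw [integral_add (hdb.mul_const ρ) hr, integral_mul_const]
  rw [hint] at key
  simp only [weighted_one] at key
  set B := estimateConst T (∫ s, growthRate (coeff (U s)) ∂μ) *
        ((∫ s, driftBound n (U s) ∂μ) * ρ + ∫ s, r s ∂μ) ^ 2
  have hB : 0 ≤ B := mul_nonneg (estimateConst_nonneg T (integral_nonneg fun s => growthRate_nonneg _))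
    (sq_nonneg _)
  have hm : 0 ≤ μ.real univ := measureReal_nonneg
  have hsum : ∀ {x y : ℝ}, 0 ≤ x → 0 ≤ y → 2 * ENNReal.ofReal x + 2 * ENNReal.ofReal y =
      ENNReal.ofReal (2 * x + 2 * y) := fun {x y} hx hy => by
    rw [ENNReal.ofReal_add (by positivity) (by positivity), ENNReal.ofReal_mul (by norm_num),
      ENNReal.ofReal_mul (by norm_num), ENNReal.ofReal_ofNat]
  have hNρ : ρ ^ 2 ≤ (1 + (n : ℝ) ^ 2) * ρ ^ 2 :=
    le_mul_of_one_le_left (sq_nonneg _) (by nlinarith [sq_nonneg (n : ℝ)])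
  have hNρ' : 0 ≤ μ.real univ * ((1 + (n : ℝ) ^ 2) * ρ ^ 2) := by positivity
  refine ⟨fun t => ?_, ?_⟩
  · have e : c t = (fun k => c t k - coeff (G t) k) + coeff (G t) := by
      funext k; simp
    rw [e]
    have hg : anisoEnergy 0 0 (coeff (G t)) ≤ ENNReal.ofReal (ρ ^ 2) := by simpa using hGE t 0 0
    refine (anisoEnergy_add_le _ _ _ _).trans ((add_le_add (mul_le_mul' le_rfl (key.1 t))
      (mul_le_mul' le_rfl hg)).trans ?_)
    rw [hsum hB (sq_nonneg _)]
    refine ENNReal.ofReal_le_ofReal (le_trans ?_ hΔ)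
    nlinarith
  · have e : ∀ s, anisoEnergy 1 0 (coeff (D s)) ≤ 2 * anisoEnergy 1 0 (coeff (D s - G s)) +
        2 * ENNReal.ofReal ((1 + (n : ℝ) ^ 2) * ρ ^ 2) := fun s => by
      have h1 := hGE s 1 0
      rw [add_zero, pow_one, ← ENNReal.ofReal_mul (by positivity)] at h1
      calc anisoEnergy 1 0 (coeff (D s)) = anisoEnergy 1 0 (coeff (D s - G s) + coeff (G s)) := by
            rw [← coeff_add, sub_add_cancel]
        _ ≤ _ := (anisoEnergy_add_le _ _ _ _).trans (add_le_add le_rfl (mul_le_mul' le_rfl h1))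
    refine (lintegral_mono e).trans ?_
    rw [lintegral_add_right _ measurable_const, lintegral_const_mul' _ _ (by norm_num), lintegral_const,
      mul_assoc, ← ENNReal.ofReal_toReal (measure_ne_top μ univ), ← ENNReal.ofReal_mul (by positivity)]
    refine (add_le_add (mul_le_mul' le_rfl key.2) le_rfl).trans ?_
    rw [hsum hB (by positivity)]
    refine ENNReal.ofReal_le_ofReal (le_trans ?_ hΔ)
    change _ + 2 * (_ * μ.real univ) ≤ _
    nlinarith

/-! ### The metric of the path space -/

theorem ae_norm_le_Lp_top {α E : Type*} [MeasurableSpace α] {μ : Measure α} [NormedAddCommGroup E]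
    (f : Lp E ∞ μ) : ∀ᵐ s ∂μ, ‖f s‖ ≤ ‖f‖ := by
  have h := enorm_ae_le_eLpNormEssSup f μ
  filter_upwards [h] with s hs
  rw [Lp.norm_def, eLpNorm_exponent_top]
  have h2 := ENNReal.toReal_mono (by rw [← eLpNorm_exponent_top]; exact Lp.eLpNorm_ne_top f) hs
  simpa using h2

theorem norm_le_of_anisoEnergy_Lp_top {T : ℝ} (X : Lp H ∞ (timeMeasure T)) {δ : ℝ} (hδ : 0 ≤ δ)
    (h : ∀ᵐ s ∂timeMeasure T, anisoEnergy 0 0 (coeff (X s)) ≤ ENNReal.ofReal (δ ^ 2)) :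
    ‖X‖ ≤ 2 * Real.pi * δ := by
  have h : ∀ᵐ s ∂timeMeasure T, ‖X s‖ ≤ 2 * Real.pi * δ := h.mono fun s hs =>
    norm_le_of_anisoEnergy (a := 0) (b := 0) hδ hs
  have := Lp.norm_le_of_ae_bound (by positivity) h
  simpa using this

theorem norm_le_of_lintegral_anisoEnergy {T : ℝ} (X : Lp (HT 1 0) 2 (timeMeasure T)) {δ : ℝ} (hδ : 0 ≤ δ)
    (h : ∫⁻ s, anisoEnergy 1 0 (coeff (HT.toH (X s))) ∂timeMeasure T ≤ ENNReal.ofReal (δ ^ 2)) :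
    ‖X‖ ≤ δ := by
  refine (abs_le_of_sq_le_sq' ?_ hδ).2
  refine (ENNReal.ofReal_le_ofReal_iff (sq_nonneg _)).1 ?_
  rw [ofReal_norm_sq_Lp]
  refine le_trans (le_of_eq (lintegral_congr fun s => ?_)) h
  have := ofReal_norm_sq_HT (s := 1) (s' := 0) (a := 1) (b := 0) (by simp) (by simp) (X s)
  rw [this, ENNReal.ofReal_pow (norm_nonneg _), ofReal_norm]

theorem HMinusOne.norm_le_of_anisoEnergy (x : HMinusOne) {δ : ℝ} (hδ : 0 ≤ δ)
    (h : anisoEnergy 0 0 (HMinusOne.fourier x) ≤ ENNReal.ofReal (δ ^ 2)) : ‖x‖ ≤ δ := by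
  refine (abs_le_of_sq_le_sq' ?_ hδ).2
  have h4 := hasSum_anisoEnergy (h.trans_lt ENNReal.ofReal_lt_top).ne
  have h5 := ENNReal.toReal_mono ENNReal.ofReal_ne_top h
  rw [ENNReal.toReal_ofReal (sq_nonneg _), ← h4.tsum_eq] at h5
  refine le_trans ?_ h5
  rw [HMinusOne.norm_sq]
  refine (summable_HMinusOne _).tsum_le_tsum (fun k => ?_) h4.summable
  have : (1 + ((k.1 : ℝ) ^ 2 + (k.2 : ℝ) ^ 2))⁻¹ ≤ 1 := inv_le_one_of_one_le₀ (by
      nlinarith [sq_nonneg (k.1 : ℝ), sq_nonneg (k.2 : ℝ)])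
  simpa using mul_le_mul_of_nonneg_right this (sq_nonneg ‖HMinusOne.fourier x k‖)

/-- A bound on the coefficients at every time controls both the $L^\infty(H)$ and the $C(H^{-1})$
distances. The factor $2\pi$ is the ratio between the norm of $H$ and the $\ell^2$ norm of the
coefficients. -/
theorem dist_le_of_energy_triple {T : ℝ} (X₁ Y₁ : Lp H ∞ (timeMeasure T))
    (X₂ Y₂ : Lp (HT 1 0) 2 (timeMeasure T)) (X₃ Y₃ : C(Icc (0 : ℝ) T, HMinusOne))
    (hP : ∀ᵐ t ∂timeMeasure T, HT.toH (X₂ t) = X₁ t ∧ HMinusOne.fourier (X₃ t) = coeff (X₁ t))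
    (hQ : ∀ᵐ t ∂timeMeasure T, HT.toH (Y₂ t) = Y₁ t ∧ HMinusOne.fourier (Y₃ t) = coeff (Y₁ t))
    {δ : ℝ} (hδ : 0 ≤ δ)
    (h1 : ∀ t, anisoEnergy 0 0 (fun k => HMinusOne.fourier (X₃ t) k -
      HMinusOne.fourier (Y₃ t) k) ≤ ENNReal.ofReal (δ ^ 2))
    (h2 : ∫⁻ s, anisoEnergy 1 0 (coeff (X₁ s - Y₁ s)) ∂timeMeasure T ≤ ENNReal.ofReal (δ ^ 2)) :
    dist (X₁, X₂, X₃) (Y₁, Y₂, Y₃) ≤ 2 * Real.pi * δ := by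
  have hδ' : δ ≤ 2 * Real.pi * δ := le_mul_of_one_le_left hδ one_le_two_pi
  rw [Prod.dist_eq, Prod.dist_eq]
  refine max_le ?_ (max_le (le_trans ?_ hδ') (le_trans ?_ hδ'))
  · refine (dist_eq_norm X₁ Y₁).trans_le (norm_le_of_anisoEnergy_Lp_top _ hδ ?_)
    filter_upwards [hP, hQ, Lp.coeFn_sub X₁ Y₁] with s hp hq hs
    have h3 := h1 s
    rw [hp.2, hq.2] at h3
    rw [hs, Pi.sub_apply, coeff_sub]
    exact h3
  · refine (dist_eq_norm X₂ Y₂).trans_le (norm_le_of_lintegral_anisoEnergy _ hδ ?_)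
    refine le_trans (le_of_eq (lintegral_congr_ae ?_)) h2
    filter_upwards [hP, hQ, Lp.coeFn_sub X₂ Y₂] with s hp hq hs
    rw [hs, Pi.sub_apply, map_sub, hp.1, hq.1]
  · refine (ContinuousMap.dist_le hδ).2 fun t => ?_
    refine (dist_eq_norm _ _).trans_le (HMinusOne.norm_le_of_anisoEnergy _ hδ ?_)
    rw [map_sub]
    exact h1 t

theorem PathSpace.dist_le_of_energy {T : ℝ} (P Q : PathSpace T) {δ : ℝ} (hδ : 0 ≤ δ)
    (h1 : ∀ t, anisoEnergy 0 0 (fun k => HMinusOne.fourier (P.inHMinusOne t) k -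
      HMinusOne.fourier (Q.inHMinusOne t) k) ≤ ENNReal.ofReal (δ ^ 2))
    (h2 : ∫⁻ s, anisoEnergy 1 0 (coeff (P.inH s - Q.inH s)) ∂timeMeasure T ≤ ENNReal.ofReal (δ ^ 2)) :
    dist P Q ≤ 2 * Real.pi * δ :=
  dist_le_of_energy_triple P.1.1 Q.1.1 P.1.2.1 Q.1.2.1 P.1.2.2 Q.1.2.2 P.2 Q.2 hδ h1 h2

/-! ### Solutions in the path space -/

namespace PathSpace

variable {T : ℝ}

theorem stronglyMeasurable_inH (X : PathSpace T) : StronglyMeasurable X.inH := Lp.stronglyMeasurable X.1.1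

theorem exists_ae_norm_inH_le (X : PathSpace T) : ∃ M, 0 ≤ M ∧ ∀ᵐ s ∂timeMeasure T, ‖X.inH s‖ ≤ M :=
  have h := ae_norm_le_Lp_top X.1.1
  ⟨max ‖X.1.1‖ 0, le_max_right _ _, h.mono fun _ hs => hs.trans (le_max_left _ _)⟩

theorem ae_coeff_inH (X : PathSpace T) :
    ∀ᵐ s ∂timeMeasure T, coeff (X.inH s) = HMinusOne.fourier (X.inHMinusOne s) := by
  have h : ∀ᵐ t ∂timeMeasure T, HT.toH (X.1.2.1 t) = X.inH t ∧
    HMinusOne.fourier (X.inHMinusOne t) = coeff (X.inH t) := X.2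
  exact h.mono fun s hs => hs.2.symm

theorem MemLpHT.lintegral_ne_top {X : PathSpace T} (h : X.MemLpHT 2 1 1) :
    ∫⁻ s, anisoEnergy 1 1 (coeff (X.inH s)) ∂timeMeasure T ≠ ∞ := by
  obtain ⟨Y, hY, hX⟩ := h
  have h2 := (eLpNorm_lt_top_iff_lintegral_rpow_enorm_lt_top (by norm_num) (by norm_num)).1 hY.2
  refine ne_of_lt (lt_of_le_of_lt (le_of_eq (lintegral_congr_ae ?_)) h2)
  filter_upwards [hX] with s hs
  rw [← hs, ofReal_norm_sq_HT (a := 1) (b := 1) (by simp) (by simp),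
    ENNReal.ofReal_pow (norm_nonneg _), ofReal_norm]
  simp

theorem MemLpHT.ae_exists {X : PathSpace T} {p : ℝ≥0∞} {s s' : ℝ} (h : X.MemLpHT p s s') :
    ∀ᵐ t ∂timeMeasure T, ∃ v : HT s s', HT.toH v = X.inH t := by
  obtain ⟨Y, -, hX⟩ := h
  exact hX.mono fun t ht => ⟨_, ht⟩

end PathSpace

/-! ### Hilbert-Schmidt operators with values in the anisotropic spaces -/

theorem hasSum_apply_single {E : Type*} [NormedAddCommGroup E] [NormedSpace ℝ E] (S : SeqL2 →L[ℝ] E)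
    (ψ : SeqL2) : HasSum (fun i => ψ i • S (lp.single 2 i (1 : ℝ))) (S ψ) := by
  have h := S.hasSum (lp.hasSum_single (by norm_num) ψ)
  refine h.congr_fun fun i => ?_
  rw [← map_smul, ← lp.single_smul]
  simp

theorem enorm_seqL2_sq (ψ : SeqL2) : ‖ψ‖ₑ ^ 2 = ∑' i, ‖ψ i‖ₑ ^ 2 := by
  have h := lp.norm_rpow_eq_tsum (p := 2) (by norm_num) ψ
  have hs := (lp.memℓp ψ).summable (by norm_num)
  simp only [ENNReal.toReal_ofNat, Real.rpow_ofNat] at h hs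
  rw [← ofReal_norm, ← ENNReal.ofReal_pow (norm_nonneg _), h,
    ENNReal.ofReal_tsum_of_nonneg (fun _ => by positivity) hs]
  congr 1; ext i
  rw [ENNReal.ofReal_pow (norm_nonneg _), ofReal_norm]

/-- The operator norm is at most the Hilbert-Schmidt norm, proved by Cauchy-Schwarz at each
frequency so that it holds for every weight at once. -/
theorem anisoEnergy_apply_le (S : SeqL2 →L[ℝ] H) (a b : ℕ) (ψ : SeqL2) :
    anisoEnergy a b (coeff (S ψ)) ≤
      (∑' i, anisoEnergy a b (coeff (S (lp.single 2 i (1 : ℝ))))) * ‖ψ‖ₑ ^ 2 := by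
  have h : ∀ k, ‖coeff (S ψ) k‖ₑ ^ 2 ≤
      (∑' i, ‖coeff (S (lp.single 2 i (1 : ℝ))) k‖ₑ ^ 2) * ‖ψ‖ₑ ^ 2 := fun k => by
    have e := (hasSum_apply_single ((coeffL k).comp S) ψ).tsum_eq
    have h1 : ‖coeff (S ψ) k‖ₑ ≤ ∑' i, ‖ψ i‖ₑ * ‖coeff (S (lp.single 2 i (1 : ℝ))) k‖ₑ := by
      have e : coeff (S ψ) k = ∑' i, ψ i • coeff (S (lp.single 2 i (1 : ℝ))) k := e.symm
      rw [e]
      refine enorm_tsum_le_tsum_enorm.trans (ENNReal.tsum_le_tsum fun i => ?_)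
      rw [enorm_smul]
    refine (pow_le_pow_left' (h1.trans (tsum_mul_le_sqrt _ _)) 2).trans (le_of_eq ?_)
    rw [mul_pow, ← ENNReal.rpow_ofNat, ← ENNReal.rpow_ofNat, ← ENNReal.rpow_mul, ← ENNReal.rpow_mul,
      enorm_seqL2_sq, mul_comm]
    norm_num
  unfold anisoEnergy
  rw [ENNReal.tsum_comm, ← ENNReal.tsum_mul_right]
  refine ENNReal.tsum_le_tsum fun k => ?_
  rw [ENNReal.tsum_mul_left, mul_assoc]
  exact mul_le_mul' le_rfl (h k)

/-- The inclusion of `H̃^{0,1}` in `H` as a continuous map. -/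
def HT.toHL : HT 0 1 →L[ℝ] H :=
  (HT.toH : HT 0 1 →ₗ[ℝ] H).mkContinuous (2 * Real.pi) fun u =>
    norm_le_of_anisoEnergy (a := 0) (b := 1) (norm_nonneg u)
      (ofReal_norm_sq_HT (by simp) (by simp) u).le

theorem tsum_anisoEnergy_toHL_comp (S : SeqL2 →L[ℝ] HT 0 1) :
    ∑' i, anisoEnergy 0 1 (coeff ((HT.toHL.comp S) (lp.single 2 i (1 : ℝ)))) = hsNormSq S := by
  unfold hsNormSq
  congr 1; ext i
  have := ofReal_norm_sq_HT (a := 0) (b := 1) (by simp) (by simp) (S (lp.single 2 i (1 : ℝ)))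
  rw [ENNReal.ofReal_pow (norm_nonneg _), ofReal_norm] at this
  exact this

theorem exists_hasPartial {z : H} {j : Fin 2} {A : ℝ≥0∞} (hA : A ≠ ∞)
    (h : anisoEnergy 0 0 (fun k => (Complex.I * (freq k j : ℂ)) • coeff z k) ≤ A) :
    ∃ w, HasPartial j z w ∧ ‖w‖ ^ 2 ≤ (2 * Real.pi) ^ 2 * A.toReal := by
  have hs := hasSum_anisoEnergy (h.trans_lt (lt_top_iff_ne_top.2 hA)).ne
  have hneg : ∀ k : ℤ × ℤ, freq (-k) j = -freq k j := fun k => by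
    fin_cases j <;> simp [freq]
  obtain ⟨w, hw⟩ := exists_coeff_eq (c := fun k => (Complex.I * (freq k j : ℂ)) • coeff z k)
    (fun k i => by
      simp only [PiLp.smul_apply, smul_eq_mul, coeff_neg_apply, hneg, map_mul, Complex.conj_I,
        Complex.conj_ofReal, Complex.ofReal_neg]
      ring)
    (fun k => by
      simp only [PiLp.smul_apply, smul_eq_mul, mul_left_comm _ (Complex.I * (freq k j : ℂ)),
        ← Finset.mul_sum, coeff_div, mul_zero])
    hs.summable
  refine ⟨w, fun k => congrFun hw k, ?_⟩
  rw [norm_sq_eq_tsum_coeff, hw, hs.tsum_eq]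
  exact mul_le_mul_of_nonneg_left (ENNReal.toReal_mono hA h) (by positivity)

theorem enorm_I_freq_sq (k : ℤ × ℤ) (j : Fin 2) (x : CPlane) :
    ‖(Complex.I * (freq k j : ℂ)) • x‖ₑ ^ 2 = ENNReal.ofReal (freq k j ^ 2) * ‖x‖ₑ ^ 2 := by
  rw [← ofReal_norm_sq_cplane, ← ofReal_norm_sq_cplane, norm_smul, mul_pow, norm_mul, Complex.norm_I,
    one_mul, Complex.norm_real, Real.norm_eq_abs, sq_abs, ENNReal.ofReal_mul (sq_nonneg _)]

theorem exists_partials {z : H} (h : anisoEnergy 1 1 (coeff z) ≠ ∞) : ∃ v w, HasPartial 0 z v ∧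
    HasPartial 1 v w ∧ ‖v‖ ^ 2 ≤ (2 * Real.pi) ^ 2 * (anisoEnergy 1 1 (coeff z)).toReal ∧
      ‖w‖ ^ 2 ≤ (2 * Real.pi) ^ 2 * (anisoEnergy 1 1 (coeff z)).toReal := by
  obtain ⟨v, h1, h2⟩ := exists_hasPartial (z := z) (j := 0) h (by
    unfold anisoEnergy
    refine ENNReal.tsum_le_tsum fun k => ?_
    rw [enorm_I_freq_sq, ← mul_assoc, ← ENNReal.ofReal_mul (by positivity)]
    refine mul_le_mul' (ENNReal.ofReal_le_ofReal ?_) le_rfl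
    simp only [freq, Matrix.cons_val_zero, pow_zero, pow_one, one_mul]
    nlinarith [sq_nonneg (k.1 : ℝ), sq_nonneg (k.2 : ℝ), mul_nonneg (sq_nonneg (k.1 : ℝ)) (sq_nonneg (k.2 : ℝ))])
  obtain ⟨w, h3, h4⟩ := exists_hasPartial (z := v) (j := 1) h (by
    unfold anisoEnergy
    refine ENNReal.tsum_le_tsum fun k => ?_
    beta_reduce
    rw [h1 k, enorm_I_freq_sq, enorm_I_freq_sq, ← mul_assoc, ← mul_assoc,
      ← ENNReal.ofReal_mul (by positivity), ← ENNReal.ofReal_mul (by positivity)]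
    refine mul_le_mul' (ENNReal.ofReal_le_ofReal ?_) le_rfl
    simp only [freq, Matrix.cons_val_zero, Matrix.cons_val_one, pow_zero, pow_one, one_mul]
    nlinarith [sq_nonneg (k.1 : ℝ), sq_nonneg (k.2 : ℝ), mul_nonneg (sq_nonneg (k.1 : ℝ)) (sq_nonneg (k.2 : ℝ))])
  exact ⟨v, w, h1, h3, h2, h4⟩

/-! ### The forcing along a path -/

/-- Measurability of $\sigma$ is assumed only for fixed vectors of $l^2$, so $\varphi(s)$ is
expanded in the canonical basis. -/
theorem aestronglyMeasurable_diffusion {T : ℝ} {σ : Icc (0 : ℝ) T → H → SeqL2 →L[ℝ] HMinusOne}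
    (hσ : DiffusionMeasurable σ) (u : PathSpace T) {φ : Icc (0 : ℝ) T → SeqL2}
    (hφ : AEStronglyMeasurable φ (timeMeasure T)) :
    AEStronglyMeasurable (fun s => σ s (u.inH s) (φ s)) (timeMeasure T) := by
  have h1 : ∀ ψ, StronglyMeasurable fun s => σ s (u.inH s) ψ := fun ψ =>
    (hσ ψ).comp_measurable (measurable_id.prodMk u.stronglyMeasurable_inH.measurable)
  refine aestronglyMeasurable_of_tendsto_ae Filter.atTop
    (f := fun (n : ℕ) s => ∑ i ∈ Finset.range n, φ s i • σ s (u.inH s) (lp.single 2 i (1 : ℝ)))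
    (fun n => Finset.aestronglyMeasurable_fun_sum _ fun i _ => ?_)
    (Filter.Eventually.of_forall fun s => (hasSum_apply_single _ _).tendsto_sum_nat)
  exact ((lp.evalCLM ℝ (fun _ : ℕ => ℝ) 2 i).continuous.comp_aestronglyMeasurable hφ).smul
    (h1 _).aestronglyMeasurable

/-- (A2) along the path: at almost every time the state lies in $\tilde H^{1,1}$, and the squared
Hilbert-Schmidt norm into $\tilde H^{0,1}$ is dominated by an integrable function. The operators are
chosen time by time, with no measurability. This is recovered afterwards from the coefficients,
which are almost everywhere those of $\sigma$. -/
theorem exists_forcing {T : ℝ} {σ : Icc (0 : ℝ) T → H → SeqL2 →L[ℝ] HMinusOne}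
    (hσ : DiffusionMeasurable σ) (hA2 : A2 σ) {u : PathSpace T} (h01 : u.MemLpHT ∞ 0 1)
    (h11 : u.MemLpHT 2 1 1) :
    ∃ (S : Icc (0 : ℝ) T → SeqL2 →L[ℝ] H) (κ : Icc (0 : ℝ) T → ℝ), Integrable κ (timeMeasure T) ∧
      (∀ s, 0 ≤ κ s) ∧
      (∀ᵐ s ∂timeMeasure T, ∀ ψ, HMinusOne.fourier (σ s (u.inH s) ψ) = coeff (S s ψ)) ∧
      (∀ s, ∑' i, anisoEnergy 0 1 (coeff (S s (lp.single 2 i (1 : ℝ)))) ≤ ENNReal.ofReal (κ s)) ∧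
      ∀ φ : Icc (0 : ℝ) T → SeqL2, AEStronglyMeasurable φ (timeMeasure T) →
        AEStronglyMeasurable (fun s => S s (φ s)) (timeMeasure T) := by
  obtain ⟨K₀, K₁, K₂, hK₀, hK₁, hK₂, hK⟩ := hA2
  have hk : ∀ k, AEStronglyMeasurable (fun s => coeff (u.inH s) k) (timeMeasure T) := fun k =>
    (coeffL k).continuous.comp_aestronglyMeasurable u.stronglyMeasurable_inH.aestronglyMeasurable
  have hE := h11.lintegral_ne_top
  have hE01 : ∫⁻ s, anisoEnergy 0 1 (coeff (u.inH s)) ∂timeMeasure T ≠ ∞ :=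
    ((lintegral_mono fun s => anisoEnergy_mono zero_le_one le_rfl _).trans_lt
      (lt_top_iff_ne_top.2 hE)).ne
  -- Both $\partial_1u$ and $\partial_1\partial_2u$ have squared $H$ norm at most $(2\pi)^2$ times
  -- the $\tilde H^{1,1}$ energy; hence the factor $2$.
  set κ : Icc (0 : ℝ) T → ℝ := fun s => K₀ + K₁ * (anisoEnergy 0 1 (coeff (u.inH s))).toReal +
    2 * K₂ * (2 * Real.pi) ^ 2 * (anisoEnergy 1 1 (coeff (u.inH s))).toReal
  have hκ0 : ∀ s, 0 ≤ κ s := fun s => by positivity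
  have hκ : Integrable κ (timeMeasure T) :=
    ((integrable_const _).add ((integrable_toReal_of_lintegral_ne_top
      (aemeasurable_anisoEnergy hk 0 1) hE01).const_mul _)).add ((integrable_toReal_of_lintegral_ne_top
      (aemeasurable_anisoEnergy hk 1 1) hE).const_mul _)
  have key : ∀ s, ∃ S : SeqL2 →L[ℝ] H,
      ((∃ v : HT 0 1, HT.toH v = u.inH s) ∧ anisoEnergy 1 1 (coeff (u.inH s)) < ∞ →
        ∀ ψ, HMinusOne.fourier (σ s (u.inH s) ψ) = coeff (S ψ)) ∧
      ∑' i, anisoEnergy 0 1 (coeff (S (lp.single 2 i (1 : ℝ)))) ≤ ENNReal.ofReal (κ s) := fun s => by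
    by_cases hs : (∃ v : HT 0 1, HT.toH v = u.inH s) ∧ anisoEnergy 1 1 (coeff (u.inH s)) < ∞
    · obtain ⟨⟨v, hv⟩, hs2⟩ := hs
      obtain ⟨du, ddu, h1, h2, h3, h4⟩ := exists_partials hs2.ne
      obtain ⟨S, hS, hSb⟩ := hK s v du ddu (by rw [hv]; exact h1) h2
      refine ⟨HT.toHL.comp S, fun _ ψ => by rw [← hv]; exact hS ψ, ?_⟩
      rw [tsum_anisoEnergy_toHL_comp]
      refine hSb.trans (ENNReal.ofReal_le_ofReal ?_)
      have h5 : ‖v‖ ^ 2 = (anisoEnergy 0 1 (coeff (u.inH s))).toReal := by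
        rw [← hv, ofReal_norm_sq_HT (a := 0) (b := 1) (by simp) (by simp),
          ENNReal.toReal_ofReal (sq_nonneg _)]
      rw [h5]
      have := mul_le_mul_of_nonneg_left (add_le_add h3 h4) hK₂
      simp only [κ]
      linarith
    -- At the exceptional times the operator is set to zero, so that the bound by `κ` holds
    -- everywhere.
    · refine ⟨0, fun h => absurd h hs, ?_⟩
      simp [coeff_zero, anisoEnergy]
  choose S hS hSb using key
  have hae : ∀ᵐ s ∂timeMeasure T, ∀ ψ, HMinusOne.fourier (σ s (u.inH s) ψ) = coeff (S s ψ) := by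
    filter_upwards [h01.ae_exists, ae_lt_top' (aemeasurable_anisoEnergy hk 1 1) hE] with s h1 h2
    exact hS s ⟨h1, h2⟩
  refine ⟨S, κ, hκ, hκ0, hae, hSb, fun φ hφ => aestronglyMeasurable_of_coeff fun k => ?_⟩
  refine ((fourierL k).continuous.comp_aestronglyMeasurable
    (aestronglyMeasurable_diffusion hσ u hφ)).congr ?_
  filter_upwards [hae] with s hs
  exact congrFun (hs (φ s)) k

/-! ### Square-integrable families of Hilbert-Schmidt operators -/

/-- A family of Hilbert-Schmidt operators from `l²` to `H̃^{0,1}`, square-integrable in time. -/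
structure Forcing (T : ℝ) where
  op : Icc (0 : ℝ) T → SeqL2 →L[ℝ] H
  weight : Icc (0 : ℝ) T → ℝ
  integrable_weight : Integrable weight (timeMeasure T)
  weight_nonneg : ∀ s, 0 ≤ weight s
  tsum_le : ∀ s, ∑' i, anisoEnergy 0 1 (coeff (op s (lp.single 2 i (1 : ℝ)))) ≤ ENNReal.ofReal (weight s)
  measurable : ∀ φ : Icc (0 : ℝ) T → SeqL2, AEStronglyMeasurable φ (timeMeasure T) →
    AEStronglyMeasurable (fun s => op s (φ s)) (timeMeasure T)

theorem memLp_sqrt {α : Type*} [MeasurableSpace α] {μ : Measure α} {f : α → ℝ} (hf : Integrable f μ)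
    (h0 : ∀ s, 0 ≤ f s) : MemLp (fun s => √(f s)) 2 μ := by
  rw [memLp_two_iff_integrable_sq (Real.continuous_sqrt.comp_aestronglyMeasurable hf.1)]
  exact hf.congr (Filter.Eventually.of_forall fun s => (Real.sq_sqrt (h0 s)).symm)

namespace Forcing

variable {T : ℝ} (S : Forcing T)

theorem anisoEnergy_le (s : Icc (0 : ℝ) T) (ψ : SeqL2) :
    anisoEnergy 0 1 (coeff (S.op s ψ)) ≤ ENNReal.ofReal ((√(S.weight s) * ‖ψ‖) ^ 2) := by
  refine (anisoEnergy_apply_le _ 0 1 ψ).trans ((mul_le_mul' (S.tsum_le s) le_rfl).trans (le_of_eq ?_))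
  rw [mul_pow, Real.sq_sqrt (S.weight_nonneg s), ENNReal.ofReal_mul (S.weight_nonneg s),
    ENNReal.ofReal_pow (norm_nonneg _), ofReal_norm]

theorem norm_op_le (s : Icc (0 : ℝ) T) (ψ : SeqL2) :
    ‖S.op s ψ‖ ≤ 2 * Real.pi * (√(S.weight s) * ‖ψ‖) :=
  norm_le_of_anisoEnergy (by positivity) (S.anisoEnergy_le s ψ)

theorem integrable_sqrt_mul_norm (φ : Lp SeqL2 2 (timeMeasure T)) :
    Integrable (fun s => √(S.weight s) * ‖φ s‖) (timeMeasure T) :=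
  (integrable_mul_norm (memLp_sqrt S.integrable_weight S.weight_nonneg)
    (fun _ => Real.sqrt_nonneg _) φ).1

theorem integrable (φ : Lp SeqL2 2 (timeMeasure T)) :
    Integrable (fun s => S.op s (φ s)) (timeMeasure T) :=
  ((S.integrable_sqrt_mul_norm φ).const_mul (2 * Real.pi)).mono'
    (S.measurable φ (Lp.aestronglyMeasurable φ)) (Filter.Eventually.of_forall fun s => S.norm_op_le s _)

theorem norm_setIntegral_le {B : Set (Icc (0 : ℝ) T)} (hB : MeasurableSet B)
    (φ : Lp SeqL2 2 (timeMeasure T)) : ‖∫ s in B, S.op s (φ s) ∂timeMeasure T‖ ≤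
      2 * Real.pi * (√(∫ s in B, S.weight s ∂timeMeasure T) * ‖φ‖) := by
  have hm := memLp_sqrt (S.integrable_weight.indicator hB)
    (fun s => indicator_nonneg (fun s _ => S.weight_nonneg s) s)
  have h := integrable_mul_norm hm (fun _ => Real.sqrt_nonneg _) φ
  have e : ∀ s, √(B.indicator S.weight s) ^ 2 = B.indicator S.weight s := fun s =>
    Real.sq_sqrt (indicator_nonneg (fun s _ => S.weight_nonneg s) s)
  simp only [e, integral_indicator hB] at h
  rw [← integral_indicator hB]
  refine (norm_integral_le_of_norm_le (h.1.const_mul (2 * Real.pi))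
    (Filter.Eventually.of_forall fun s => ?_)).trans ?_
  · by_cases hs : s ∈ B
    · rw [indicator_of_mem hs, indicator_of_mem hs]
      exact S.norm_op_le s _
    · rw [indicator_of_notMem hs, norm_zero]
      positivity
  · rw [integral_const_mul]
    exact mul_le_mul_of_nonneg_left h.2 (by positivity)

/-- `φ ↦ ∫₀ᵗ S(s) φ(s) ds`. -/
def primitive (t : Icc (0 : ℝ) T) : Lp SeqL2 2 (timeMeasure T) →L[ℝ] H :=
  LinearMap.mkContinuous
    { toFun := fun φ => ∫ s in Iic t, S.op s (φ s) ∂timeMeasure T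
      map_add' := fun φ ψ => by
        rw [← integral_add (S.integrable φ).integrableOn (S.integrable ψ).integrableOn]
        refine integral_congr_ae (ae_restrict_of_ae ?_)
        filter_upwards [Lp.coeFn_add φ ψ] with s hs
        rw [hs, Pi.add_apply, map_add]
      map_smul' := fun a φ => by
        rw [RingHom.id_apply, ← integral_smul]
        refine integral_congr_ae (ae_restrict_of_ae ?_)
        filter_upwards [Lp.coeFn_smul a φ] with s hs
        rw [hs, Pi.smul_apply, map_smul] }
    (2 * Real.pi * √(∫ s in Iic t, S.weight s ∂timeMeasure T)) fun φ => by
      rw [mul_assoc]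
      exact S.norm_setIntegral_le measurableSet_Iic φ

theorem primitive_apply (t : Icc (0 : ℝ) T) (φ : Lp SeqL2 2 (timeMeasure T)) :
    S.primitive t φ = ∫ s in Iic t, S.op s (φ s) ∂timeMeasure T := rfl

/-- By Cauchy-Schwarz in time the primitives are equicontinuous, uniformly over bounded sets of
$\varphi$. -/
theorem norm_primitive_sub_le (t t' : Icc (0 : ℝ) T) (φ : Lp SeqL2 2 (timeMeasure T)) :
    ‖S.primitive t φ - S.primitive t' φ‖ ≤ 2 * Real.pi *
      (√|∫ s in Iic t, S.weight s ∂timeMeasure T - ∫ s in Iic t', S.weight s ∂timeMeasure T| * ‖φ‖) := by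
  wlog h : t' ≤ t generalizing t t'
  · rw [norm_sub_rev, abs_sub_comm]
    exact this t' t (le_of_not_ge h)
  rw [primitive_apply, primitive_apply, ← setIntegral_sdiff measurableSet_Iic
    (S.integrable φ).integrableOn (Iic_subset_Iic.2 h), ← setIntegral_sdiff measurableSet_Iic
    S.integrable_weight.integrableOn (Iic_subset_Iic.2 h),
    abs_of_nonneg (integral_nonneg S.weight_nonneg)]
  exact S.norm_setIntegral_le (measurableSet_Iic.diff measurableSet_Iic) φ

/-- The sum over the frequencies outside `box n` of the squares of the coefficients of `S(s)`. -/
def tail (n : ℕ) (s : Icc (0 : ℝ) T) : ℝ≥0∞ :=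
  ∑' i, anisoEnergy 0 0 (coeff (((ContinuousLinearMap.id ℝ H - (Symbol.trunc n).op).comp (S.op s))
    (lp.single 2 i (1 : ℝ))))

theorem tail_le_weight (n : ℕ) (s : Icc (0 : ℝ) T) : S.tail n s ≤ ENNReal.ofReal (S.weight s) := by
  refine le_trans (ENNReal.tsum_le_tsum fun i => ?_) (S.tsum_le s)
  unfold anisoEnergy
  refine ENNReal.tsum_le_tsum fun k => mul_le_mul' (ENNReal.ofReal_le_ofReal ?_) (pow_le_pow_left' ?_ 2)
  · nlinarith [sq_nonneg (k.2 : ℝ)]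
  · change ‖coeff (_ - (Symbol.trunc n).op _) k‖ₑ ≤ _
    rw [coeff_sub, Pi.sub_apply, coeff_trunc]
    split_ifs <;> simp

/-- Exchanging the sums over basis vectors and frequencies, the tail is the remainder of a
convergent series; its convergence is the Hilbert-Schmidt property. -/
theorem tendsto_tail (s : Icc (0 : ℝ) T) :
    Filter.Tendsto (fun n => S.tail n s) Filter.atTop (nhds 0) := by
  set f : ℤ × ℤ → ℝ≥0∞ := fun k => ∑' i, ‖coeff (S.op s (lp.single 2 i (1 : ℝ))) k‖ₑ ^ 2
  have hf : ∑' k, f k ≠ ∞ := by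
    refine ((le_trans (le_of_eq ?_) ((ENNReal.tsum_le_tsum fun i => anisoEnergy_mono le_rfl zero_le_one _).trans
      (S.tsum_le s))).trans_lt ENNReal.ofReal_lt_top).ne
    simp only [f]
    rw [ENNReal.tsum_comm]
    simp only [anisoEnergy_zero_zero_eq]
  have e : ∀ n, S.tail n s = ∑' k : {k // k ∉ box n}, f k := fun n => by
    have h1 : ∀ i, ∀ k, ‖coeff (((ContinuousLinearMap.id ℝ H - (Symbol.trunc n).op).comp (S.op s))
        (lp.single 2 i (1 : ℝ))) k‖ₑ ^ 2 = {k | k ∉ box n}.indicator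
          (fun k => ‖coeff (S.op s (lp.single 2 i (1 : ℝ))) k‖ₑ ^ 2) k := fun i k => by
      change ‖coeff (_ - (Symbol.trunc n).op _) k‖ₑ ^ 2 = _
      rw [coeff_sub, Pi.sub_apply, coeff_trunc]
      by_cases hk : k ∈ box n
      · rw [indicator_of_notMem (by simpa using hk), if_pos hk]; simp
      · rw [indicator_of_mem (by simpa using hk), if_neg hk, sub_zero]; rfl
    unfold tail
    simp only [anisoEnergy_zero_zero_eq, h1]
    rw [ENNReal.tsum_comm]
    refine Eq.trans ?_ (tsum_subtype {k | k ∉ box n} f).symm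
    congr 1; ext k
    by_cases hk : k ∈ {k | k ∉ box n} <;> simp [hk, f]
  simp only [e]
  exact (ENNReal.tendsto_tsum_compl_atTop_zero hf).comp tendsto_box

theorem aemeasurable_tail (n : ℕ) : AEMeasurable (S.tail n) (timeMeasure T) := by
  refine AEMeasurable.tsum fun i => aemeasurable_anisoEnergy (fun k => ?_) 0 0
  exact ((coeffL k).comp (ContinuousLinearMap.id ℝ H - (Symbol.trunc n).op)).continuous.comp_aestronglyMeasurable
    (S.measurable _ aestronglyMeasurable_const)

theorem tail_ne_top (n : ℕ) (s : Icc (0 : ℝ) T) : S.tail n s ≠ ∞ :=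
  ((S.tail_le_weight n s).trans_lt ENNReal.ofReal_lt_top).ne

theorem lintegral_ofReal_weight_ne_top : ∫⁻ s, ENNReal.ofReal (S.weight s) ∂timeMeasure T ≠ ∞ := by
  rw [← ofReal_integral_eq_lintegral_ofReal S.integrable_weight
    (Filter.Eventually.of_forall S.weight_nonneg)]
  exact ENNReal.ofReal_ne_top

theorem integrable_tail (n : ℕ) : Integrable (fun s => (S.tail n s).toReal) (timeMeasure T) :=
  integrable_toReal_of_lintegral_ne_top (S.aemeasurable_tail n)
    ((lintegral_mono (S.tail_le_weight n)).trans_lt (lt_top_iff_ne_top.2 S.lintegral_ofReal_weight_ne_top)).ne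

theorem tendsto_integral_tail :
    Filter.Tendsto (fun n => ∫ s, (S.tail n s).toReal ∂timeMeasure T) Filter.atTop (nhds 0) := by
  have h := tendsto_lintegral_of_dominated_convergence' (F := S.tail) (f := fun _ => 0)
    (fun s => ENNReal.ofReal (S.weight s)) S.aemeasurable_tail
    (fun n => Filter.Eventually.of_forall (S.tail_le_weight n)) S.lintegral_ofReal_weight_ne_top
    (Filter.Eventually.of_forall S.tendsto_tail)
  rw [lintegral_zero] at h
  have h2 := (ENNReal.tendsto_toReal ENNReal.zero_ne_top).comp h
  refine h2.congr fun n => ?_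
  rw [Function.comp_apply, integral_toReal (S.aemeasurable_tail n)
    (Filter.Eventually.of_forall fun s => lt_top_iff_ne_top.2 (S.tail_ne_top n s))]

theorem anisoEnergy_sub_trunc_le (n : ℕ) (s : Icc (0 : ℝ) T) (ψ : SeqL2) :
    anisoEnergy 0 0 (coeff (S.op s ψ - (Symbol.trunc n).op (S.op s ψ))) ≤
      ENNReal.ofReal ((√(S.tail n s).toReal * ‖ψ‖) ^ 2) := by
  refine (anisoEnergy_apply_le ((ContinuousLinearMap.id ℝ H - (Symbol.trunc n).op).comp (S.op s))
    0 0 ψ).trans (le_of_eq ?_)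
  rw [mul_pow, Real.sq_sqrt ENNReal.toReal_nonneg, ENNReal.ofReal_mul ENNReal.toReal_nonneg,
    ENNReal.ofReal_toReal (S.tail_ne_top n s), ENNReal.ofReal_pow (norm_nonneg _), ofReal_norm]
  rfl

end Forcing

/-! ### Differences of solutions of the linearised equation -/

/-- The initial data agree and the equation is linear, so the difference of two solutions is driven
by the difference of the forcings, and `linearised_estimate_of_forcing` applies to it. -/
theorem dist_le_of_forcing {T : ℝ} {U f g : Icc (0 : ℝ) T → H}
    (hUm : AEStronglyMeasurable U (timeMeasure T)) {M : ℝ} (hUb : ∀ᵐ s ∂timeMeasure T, ‖U s‖ ≤ M)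
    (hU : ∫⁻ s, anisoEnergy 1 2 (coeff (U s)) ∂timeMeasure T ≠ ∞)
    (hf : Integrable f (timeMeasure T)) (hg : Integrable g (timeMeasure T)) {P Q : PathSpace T}
    (hP : IsSolution 0 (fun s k => linearDrift (U s) k (P.inH s) + coeff (f s) k) P)
    (hQ : IsSolution 0 (fun s k => linearDrift (U s) k (Q.inH s) + coeff (g s) k) Q)
    (n : ℕ) {ρ : ℝ} (hρ0 : 0 ≤ ρ)
    (hρ : ∀ t, ‖∫ s in Iic t, (Symbol.trunc n).op (f s - g s) ∂timeMeasure T‖ ≤ ρ)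
    {r : Icc (0 : ℝ) T → ℝ} (hr : Integrable r (timeMeasure T)) (hr0 : ∀ s, 0 ≤ r s)
    (hfg : ∀ᵐ s ∂timeMeasure T,
      anisoEnergy 0 0 (coeff ((f s - g s) - (Symbol.trunc n).op (f s - g s))) ≤ ENNReal.ofReal (r s ^ 2))
    {δ : ℝ} (hδ : 0 ≤ δ)
    (hle : 2 * (estimateConst T (∫ s, growthRate (coeff (U s)) ∂timeMeasure T) *
        ((∫ s, driftBound n (U s) ∂timeMeasure T) * ρ + ∫ s, r s ∂timeMeasure T) ^ 2) +
      2 * ((1 + (timeMeasure T).real univ) * (1 + (n : ℝ) ^ 2) * ρ ^ 2) ≤ δ ^ 2) :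
    dist P Q ≤ 2 * Real.pi * δ := by
  set μ := timeMeasure T
  have hPm := P.stronglyMeasurable_inH.aestronglyMeasurable (μ := μ)
  have hQm := Q.stronglyMeasurable_inH.aestronglyMeasurable (μ := μ)
  obtain ⟨MP, hMP0, hMP⟩ := P.exists_ae_norm_inH_le
  obtain ⟨MQ, hMQ0, hMQ⟩ := Q.exists_ae_norm_inH_le
  have hint : ∀ {X : Icc (0 : ℝ) T → H} {N : ℝ}, AEStronglyMeasurable X μ → (∀ᵐ s ∂μ, ‖X s‖ ≤ N) → ∀ k,
      Integrable (fun s => linearDrift (U s) k (X s)) μ := fun {X N} hX hXb k => by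
    refine Integrable.of_bound (aestronglyMeasurable_linearDrift hUm hX k)
      (((k.1 : ℝ) ^ 2 + 2 * ((|(k.1 : ℝ)| + |(k.2 : ℝ)|) * M)) * N) ?_
    filter_upwards [hUb, hXb] with s h1 h2
    have hM : 0 ≤ M := (norm_nonneg _).trans h1
    exact (norm_linearDrift_le h1 k (X s)).trans (mul_le_mul_of_nonneg_left h2 (by positivity))
  have hD : ∫⁻ s, anisoEnergy 1 1 (coeff (P.inH s - Q.inH s)) ∂μ ≠ ∞ := by
    have hm : AEMeasurable (fun s => 2 * anisoEnergy 1 1 (coeff (P.inH s))) μ :=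
      (aemeasurable_anisoEnergy (fun k => (coeffL k).continuous.comp_aestronglyMeasurable hPm) 1 1).const_mul _
    have hE : ∀ v : H, anisoEnergy 1 1 (coeff (-v)) = anisoEnergy 1 1 (coeff v) := fun v => by
      unfold anisoEnergy
      congr 1; ext k
      have : coeff (-v) k = -coeff v k := (coeffL k).map_neg _
      rw [this, enorm_neg]
    refine ((lintegral_mono fun s => (?_ : _ ≤ 2 * anisoEnergy 1 1 (coeff (P.inH s)) +
      2 * anisoEnergy 1 1 (coeff (Q.inH s)))).trans_lt ?_).ne
    · rw [sub_eq_add_neg, coeff_add, ← hE (Q.inH s)]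
      exact anisoEnergy_add_le _ _ _ _
    · rw [lintegral_add_left' hm, lintegral_const_mul' _ _ (by norm_num),
        lintegral_const_mul' _ _ (by norm_num)]
      exact ENNReal.add_lt_top.2
        ⟨ENNReal.mul_lt_top (by norm_num) (lt_top_iff_ne_top.2 hP.2.1.lintegral_ne_top),
          ENNReal.mul_lt_top (by norm_num) (lt_top_iff_ne_top.2 hQ.2.1.lintegral_ne_top)⟩
  have key := linearised_estimate_of_forcing hUm hUb hU (D := fun s => P.inH s - Q.inH s)
    (h := fun s => f s - g s) (hPm.sub hQm) (M' := MP + MQ)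
    (by filter_upwards [hMP, hMQ] with s h1 h2 using (norm_sub_le _ _).trans (add_le_add h1 h2))
    hD (hf.sub hg)
    (c := fun t k => HMinusOne.fourier (P.inHMinusOne t) k - HMinusOne.fourier (Q.inHMinusOne t) k)
    (fun t k => by
      have i1 : Integrable (fun s => linearDrift (U s) k (P.inH s) + coeff (f s) k) μ :=
        (hint hPm hMP k).add ((coeffL k).integrable_comp hf)
      have i2 : Integrable (fun s => linearDrift (U s) k (Q.inH s) + coeff (g s) k) μ :=
        (hint hQm hMQ k).add ((coeffL k).integrable_comp hg)
      rw [hP.2.2, hQ.2.2, Pi.zero_apply, zero_add, zero_add, ← integral_sub i1.integrableOn i2.integrableOn]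
      refine integral_congr_ae (Filter.Eventually.of_forall fun s => ?_)
      have : linearDrift (U s) k (P.inH s - Q.inH s) = linearDrift (U s) k (P.inH s) -
        linearDrift (U s) k (Q.inH s) := (linearDriftL (U s) k).map_sub _ _
      beta_reduce
      rw [this, coeff_sub, Pi.sub_apply]
      abel)
    (by
      filter_upwards [P.ae_coeff_inH, Q.ae_coeff_inH] with s h1 h2
      rw [coeff_sub, h1, h2]; rfl)
    n hρ0 hρ hr hr0 hfg hle
  exact PathSpace.dist_le_of_energy P Q hδ key.1 key.2

/-- With equal forcings all the tolerances can be taken equal to zero. -/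
theorem eq_of_isSolution {T : ℝ} {U f : Icc (0 : ℝ) T → H}
    (hUm : AEStronglyMeasurable U (timeMeasure T)) {M : ℝ} (hUb : ∀ᵐ s ∂timeMeasure T, ‖U s‖ ≤ M)
    (hU : ∫⁻ s, anisoEnergy 1 2 (coeff (U s)) ∂timeMeasure T ≠ ∞)
    (hf : Integrable f (timeMeasure T)) {P Q : PathSpace T}
    (hP : IsSolution 0 (fun s k => linearDrift (U s) k (P.inH s) + coeff (f s) k) P)
    (hQ : IsSolution 0 (fun s k => linearDrift (U s) k (Q.inH s) + coeff (f s) k) Q) : P = Q := by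
  have h := dist_le_of_forcing hUm hUb hU hf hf hP hQ 0 (ρ := 0) le_rfl (fun t => by simp)
    (r := fun _ => 0) (integrable_zero _ _ _) (fun _ => le_rfl)
    (Filter.Eventually.of_forall fun s => by simp [coeff_zero, anisoEnergy]) (δ := 0) le_rfl (by simp)
  rw [mul_zero] at h
  exact dist_le_zero.1 h

/-! ### Weak continuity of the solution map -/

/-- In a basis of the finite-dimensional target, each coordinate is the evaluation of the functional
at a fixed vector, the Riesz representative of that coordinate of `L`. -/
theorem continuous_comp_toDual_symm {G W : Type*} [NormedAddCommGroup G] [InnerProductSpace ℝ G]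
    [CompleteSpace G] [NormedAddCommGroup W] [NormedSpace ℝ W] [FiniteDimensional ℝ W] (L : G →L[ℝ] W) :
    Continuous fun ℓ : WeakDual ℝ G => L ((InnerProductSpace.toDual ℝ G).symm (WeakDual.toStrongDual ℓ)) := by
  set e := (Module.finBasis ℝ W).equivFunL
  have h : Continuous fun ℓ : WeakDual ℝ G =>
      e (L ((InnerProductSpace.toDual ℝ G).symm (WeakDual.toStrongDual ℓ))) := by
    refine continuous_pi fun i => ?_
    set m : StrongDual ℝ G := ((ContinuousLinearMap.proj (R := ℝ) (φ := fun _ : Fin (Module.finrank ℝ W) => ℝ) i).comp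
      (e : W →L[ℝ] (Fin (Module.finrank ℝ W) → ℝ))).comp L
    refine (WeakDual.eval_continuous ((InnerProductSpace.toDual ℝ G).symm m)).congr fun ℓ => ?_
    change WeakDual.toStrongDual ℓ _ = m _
    rw [← InnerProductSpace.toDual_symm_apply, real_inner_comm, InnerProductSpace.toDual_symm_apply]
  exact (e.symm.continuous.comp h).congr fun ℓ => e.symm_apply_apply _

theorem norm_trunc_le (n : ℕ) (v : H) :
    ‖(Symbol.trunc n).op v‖ ≤ 2 * Real.pi * √(∑ k ∈ box n, ‖coeff v k‖ ^ 2) := by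
  refine norm_le_of_anisoEnergy (a := 0) (b := 0) (Real.sqrt_nonneg _) (le_of_eq ?_)
  rw [Real.sq_sqrt (Finset.sum_nonneg fun _ _ => sq_nonneg _), anisoEnergy_zero_zero_eq,
    tsum_eq_sum (s := box n) fun k hk => by simp [coeff_trunc, hk],
    ENNReal.ofReal_sum_of_nonneg fun _ _ => sq_nonneg _]
  refine Finset.sum_congr rfl fun k hk => ?_
  rw [coeff_trunc, if_pos hk, ofReal_norm_sq_cplane]

/-- A map from the ball of radius `R` of `L²([0,T], l²)` whose differences are estimated as in
`dist_le_of_forcing` has compact image. -/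
theorem Forcing.isCompact_image {T : ℝ} (S : Forcing T) {E : Type*} [MetricSpace E]
    {X : Lp SeqL2 2 (timeMeasure T) → E} {C C' : ℝ} {K : ℕ → ℝ}
    (hX : ∀ φ ψ n ρ δ, 0 ≤ ρ → 0 ≤ δ → (∀ t, ‖(Symbol.trunc n).op (S.primitive t (φ - ψ))‖ ≤ ρ) →
      C * (K n * ρ + √(∫ s, (S.tail n s).toReal ∂timeMeasure T) * ‖φ - ψ‖) ^ 2 +
        C' * (1 + (n : ℝ) ^ 2) * ρ ^ 2 ≤ δ ^ 2 → dist (X φ) (X ψ) ≤ 2 * Real.pi * δ)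
    (hC : 0 ≤ C) (hK : ∀ n, 0 ≤ K n) (R : ℝ) : IsCompact (X '' Metric.closedBall 0 R) := by
  -- Through the Riesz isomorphism the ball becomes a ball of the dual with its weak-* topology,
  -- compact by the Banach-Alaoglu theorem.
  set B : Set (WeakDual ℝ (Lp SeqL2 2 (timeMeasure T))) := WeakDual.toStrongDual ⁻¹' Metric.closedBall (0 : StrongDual ℝ (Lp SeqL2 2 (timeMeasure T))) R
  have hB : IsCompact B := WeakDual.isCompact_closedBall 0 R
  set p : WeakDual ℝ (Lp SeqL2 2 (timeMeasure T)) → Lp SeqL2 2 (timeMeasure T) := fun ℓ => (InnerProductSpace.toDual ℝ (Lp SeqL2 2 (timeMeasure T))).symm (WeakDual.toStrongDual ℓ)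
  have hp : ∀ ℓ ∈ B, ‖p ℓ‖ ≤ R := fun ℓ hℓ => by
    have h : ‖WeakDual.toStrongDual ℓ‖ ≤ R := by simpa [B] using hℓ
    exact ((InnerProductSpace.toDual ℝ _).symm.norm_map _).trans_le h
  have himage : X '' Metric.closedBall 0 R = (fun ℓ : B => X (p ℓ)) '' univ := by
    ext x
    constructor
    · rintro ⟨φ, hφ, rfl⟩
      refine ⟨⟨WeakDual.toStrongDual.symm (InnerProductSpace.toDual ℝ (Lp SeqL2 2 (timeMeasure T)) φ), ?_⟩, mem_univ _, ?_⟩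
      · simpa [B] using hφ
      · simp [p]
    · rintro ⟨ℓ, -, rfl⟩
      exact ⟨p ℓ, by simpa using hp ℓ ℓ.2, rfl⟩
  have : CompactSpace B := isCompact_iff_compactSpace.1 hB
  rw [himage]
  refine isCompact_univ.image ?_
  rw [continuous_iff_continuousAt]
  intro ℓ₀
  rw [ContinuousAt, Metric.tendsto_nhds]
  intro ε hε
  have hπ := Real.pi_pos
  set δ := ε / (4 * Real.pi)
  have hδ : 0 < δ := by positivity
  have hδε : 2 * Real.pi * δ < ε := by
    have : 2 * Real.pi * δ = ε / 2 := by simp only [δ]; field_simp; norm_num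
    linarith
  have hR : 0 ≤ R := (norm_nonneg _).trans (hp ℓ₀ ℓ₀.2)
  have hd : ∀ ℓ : B, ‖p ℓ - p ℓ₀‖ ≤ 2 * R := fun ℓ =>
    (norm_sub_le _ _).trans (by linarith [hp ℓ ℓ.2, hp ℓ₀ ℓ₀.2])
  -- The order of choices matters: first $n$, so that the tails are small uniformly on the ball;
  -- then `ρ`, small compared with the constants depending on $n$; and last the weak neighbourhood.
  obtain ⟨n, hn⟩ : ∃ n, C * (√(∫ s, (S.tail n s).toReal ∂timeMeasure T) * (2 * R)) ^ 2 < δ ^ 2 := by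
    have h := (((S.tendsto_integral_tail.sqrt).mul_const (2 * R)).pow 2).const_mul C
    rw [Real.sqrt_zero, zero_mul, zero_pow two_ne_zero, mul_zero] at h
    exact ((tendsto_order.1 h).2 _ (by positivity)).exists
  obtain ⟨ρ, hρ0, hρ⟩ : ∃ ρ : ℝ, 0 < ρ ∧
      C * (K n * ρ + √(∫ s, (S.tail n s).toReal ∂timeMeasure T) * (2 * R)) ^ 2 +
        C' * (1 + (n : ℝ) ^ 2) * ρ ^ 2 < δ ^ 2 := by
    have h : Continuous fun ρ : ℝ => C * (K n * ρ + √(∫ s, (S.tail n s).toReal ∂timeMeasure T) *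
      (2 * R)) ^ 2 + C' * (1 + (n : ℝ) ^ 2) * ρ ^ 2 := by fun_prop
    have h := (h.tendsto 0).mono_left (nhdsWithin_le_nhds (s := Ioi 0))
    simp only [mul_zero, zero_add, ne_eq, OfNat.ofNat_ne_zero, not_false_eq_true, zero_pow,
      add_zero] at h
    obtain ⟨ρ, h1, h2⟩ := (((tendsto_order.1 h).2 _ hn).and self_mem_nhdsWithin).exists
    exact ⟨ρ, h2, h1⟩
  -- At a fixed time the truncated primitive is weakly continuous in the control. Equicontinuity in
  -- time and compactness of $[0,T]$ make the smallness uniform.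
  have hev : ∀ᶠ ℓ in nhds ℓ₀, ∀ t ∈ (univ : Set (Icc (0 : ℝ) T)),
      ‖(Symbol.trunc n).op (S.primitive t (p (ℓ : B) - p ℓ₀))‖ ≤ ρ := by
    refine isCompact_univ.eventually_forall_of_forall_eventually fun t₀ _ => ?_
    have h1 : Continuous fun z : B × Icc (0 : ℝ) T =>
        2 * Real.pi * √(∑ k ∈ box n, ‖coeff (S.primitive t₀ (p z.1 - p ℓ₀)) k‖ ^ 2) := by
      refine continuous_const.mul (Continuous.sqrt (continuous_finsetSum _ fun k _ => ?_))
      refine Continuous.pow (Continuous.norm ?_) 2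
      have h2 := (continuous_comp_toDual_symm ((coeffL k).comp (S.primitive t₀))).comp
        (continuous_subtype_val.comp (continuous_fst (X := B) (Y := Icc (0 : ℝ) T)))
      refine (h2.sub (continuous_const (y := coeffL k (S.primitive t₀ (p ℓ₀))))).congr fun z => ?_
      change coeffL k (S.primitive t₀ (p z.1)) - _ = coeffL k _
      rw [map_sub, map_sub]
    have h2 : Continuous fun z : B × Icc (0 : ℝ) T => 2 * Real.pi *
        (√|∫ s in Iic z.2, S.weight s ∂timeMeasure T - ∫ s in Iic t₀, S.weight s ∂timeMeasure T| *
          (2 * R)) := by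
      have h := (continuous_setIntegral_Iic S.integrable_weight).comp
        (continuous_snd (X := B) (Y := Icc (0 : ℝ) T))
      exact continuous_const.mul (((h.sub continuous_const).abs.sqrt).mul continuous_const)
    have h3 := (h1.add h2).tendsto (ℓ₀, t₀)
    have e : 2 * Real.pi * √(∑ k ∈ box n, ‖coeff (S.primitive t₀ (p ℓ₀ - p ℓ₀)) k‖ ^ 2) + 2 * Real.pi *
        (√|∫ s in Iic t₀, S.weight s ∂timeMeasure T - ∫ s in Iic t₀, S.weight s ∂timeMeasure T| *
          (2 * R)) = 0 := by
      simp [coeff_zero]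
    rw [Pi.add_apply, e] at h3
    filter_upwards [(tendsto_order.1 h3).2 ρ hρ0] with z hz
    refine le_trans ?_ hz.le
    have e2 : S.primitive z.2 (p z.1 - p ℓ₀) = S.primitive t₀ (p z.1 - p ℓ₀) +
      (S.primitive z.2 (p z.1 - p ℓ₀) - S.primitive t₀ (p z.1 - p ℓ₀)) := by abel
    rw [e2, map_add]
    refine (norm_add_le _ _).trans (add_le_add (norm_trunc_le n _) ?_)
    refine ((Symbol.trunc n).norm_op_le _).trans ?_
    rw [show (Symbol.trunc n).bound = 1 from rfl, one_mul]
    refine (S.norm_primitive_sub_le _ _ _).trans ?_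
    exact mul_le_mul_of_nonneg_left (mul_le_mul_of_nonneg_left (hd z.1) (Real.sqrt_nonneg _)) (by positivity)
  filter_upwards [hev] with ℓ hℓ
  refine (hX (p ℓ) (p ℓ₀) n ρ δ hρ0.le hδ.le (fun t => hℓ t (mem_univ t)) (le_trans ?_ hρ.le)).trans_lt hδε
  have := hd ℓ
  have := hK n
  gcongr

/-! ### Rate functions -/

/-- The infimum of `½ ‖φ‖²` over the fibres of a relation is a good rate function as soon as the images
of the balls are compact. -/
theorem isGoodRateFunction_iInf {G E : Type*} [TopologicalSpace E] [T2Space E] {N : G → ℝ}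
    (r : G → E → Prop) (hr : ∃ φ g, r φ g) (hc : ∀ M : ℝ, IsCompact {g | ∃ φ, N φ ≤ M ∧ r φ g}) :
    IsGoodRateFunction fun g => ⨅ (φ : G) (_ : r φ g), ENNReal.ofReal (1 / 2 * N φ) := by
  set I : E → ℝ≥0∞ := fun g => ⨅ (φ : G) (_ : r φ g), ENNReal.ofReal (1 / 2 * N φ)
  -- The infimum is not known to be attained, so a level set is written as the intersection of
  -- images of slightly larger balls.
  have hI : ∀ a : ℝ, 0 ≤ a → {g | I g ≤ ENNReal.ofReal a} =
      ⋂ n : ℕ, {g | ∃ φ, N φ ≤ 2 * (a + 1 / ((n : ℝ) + 1)) ∧ r φ g} := fun a ha => by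
    ext g
    simp only [mem_iInter, mem_ofPred_eq]
    constructor
    · intro h n
      have hn : (0 : ℝ) < 1 / ((n : ℝ) + 1) := by positivity
      have h := h.trans_lt ((ENNReal.ofReal_lt_ofReal_iff (by positivity)).2 (lt_add_of_pos_right a hn))
      simp only [I, iInf_lt_iff] at h
      obtain ⟨φ, hφ, h⟩ := h
      have := (ENNReal.ofReal_lt_ofReal_iff (by positivity)).1 h
      exact ⟨φ, by linarith, hφ⟩
    · intro h
      have hlim : Filter.Tendsto (fun n : ℕ => ENNReal.ofReal (a + 1 / ((n : ℝ) + 1))) Filter.atTop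
          (nhds (ENNReal.ofReal a)) := by
        have := tendsto_one_div_add_atTop_nhds_zero_nat.const_add a
        rw [add_zero] at this
        exact ENNReal.tendsto_ofReal this
      refine ge_of_tendsto' hlim fun n => ?_
      obtain ⟨φ, h1, h2⟩ := h n
      refine (iInf₂_le φ h2).trans (ENNReal.ofReal_le_ofReal ?_)
      linarith
  have hclosed : ∀ a : ℝ, 0 ≤ a → IsClosed {g | I g ≤ ENNReal.ofReal a} := fun a ha => by
    rw [hI a ha]
    exact isClosed_iInter fun n => (hc _).isClosed
  refine ⟨lowerSemicontinuous_iff_isClosed_preimage.2 fun y => ?_, ?_, fun a ha => ?_⟩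
  · by_cases hy : y = ∞
    · subst hy
      simp
    · have := hclosed y.toReal ENNReal.toReal_nonneg
      rw [ENNReal.ofReal_toReal hy] at this
      exact this
  · obtain ⟨φ, g, h⟩ := hr
    exact ⟨g, ((iInf₂_le φ h).trans_lt ENNReal.ofReal_lt_top).ne⟩
  · refine (hc (2 * (a + 1 / (((0 : ℕ) : ℝ) + 1)))).of_isClosed_subset (hclosed a ha.le) ?_
    rw [hI a ha.le]
    exact iInter_subset _ 0

/-! ### The deterministic solution and the skeleton equation -/

theorem IsDeterministicSolution.lintegral_ne_top {T : ℝ} {u₀ : HT 0 2} {u : PathSpace T}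
    (hu : IsDeterministicSolution (HT.toH u₀) u) :
    ∫⁻ s, anisoEnergy 1 2 (coeff (u.inH s)) ∂timeMeasure T ≠ ∞ := by
  obtain ⟨M, hM0, hM⟩ := u.exists_ae_norm_inH_le
  have hm := u.stronglyMeasurable_inH.aestronglyMeasurable (μ := timeMeasure T)
  refine deterministic_regularity (fun _ _ => rfl) (fun k => ?_) hu.2.2 u.ae_coeff_inH hm
    hu.2.1.lintegral_ne_top hM ?_
  · refine Integrable.of_bound ((aestronglyMeasurable_partialOneSq hm k).sub
      (aestronglyMeasurable_convection hm hm k))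
      ((k.1 : ℝ) ^ 2 * M + (|(k.1 : ℝ)| + |(k.2 : ℝ)|) * (M * M)) ?_
    filter_upwards [hM] with s hs
    refine (norm_sub_le _ _).trans (add_le_add ?_ ((norm_convection_le _ _ _).trans ?_))
    · unfold partialOneSq
      rw [norm_smul, norm_neg, Real.norm_of_nonneg (sq_nonneg _)]
      exact mul_le_mul_of_nonneg_left ((norm_coeff_le _ _).trans hs) (sq_nonneg _)
    · gcongr
  · rw [ofReal_norm_sq_HT (a := 0) (b := 2) (by simp) (by simp)]
    exact ENNReal.ofReal_ne_top

theorem exists_forcing_isSkeletonSolution {T : ℝ} {σ : Icc (0 : ℝ) T → H → SeqL2 →L[ℝ] HMinusOne}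
    (hσ : DiffusionMeasurable σ) (hA2 : A2 σ) {u : PathSpace T} (h01 : u.MemLpHT ∞ 0 1)
    (h11 : u.MemLpHT 2 1 1) : ∃ S : Forcing T, ∀ φ X, IsSkeletonSolution σ u φ X ↔
      IsSolution 0 (fun s k => linearDrift (u.inH s) k (X.inH s) + coeff (S.op s (φ s)) k) X := by
  obtain ⟨S, κ, h1, h2, h3, h4, h5⟩ := exists_forcing hσ hA2 h01 h11
  refine ⟨⟨S, κ, h1, h2, h4, h5⟩, fun φ X => ?_⟩
  unfold IsSkeletonSolution IsSolution
  refine and_congr_right fun _ => and_congr_right fun _ => forall_congr' fun t => forall_congr' fun k => ?_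
  refine Eq.congr_right (congrArg _ (integral_congr_ae (ae_restrict_of_ae ?_)))
  filter_upwards [h3] with s hs
  rw [hs]
  rfl

theorem norm_sq_eq_integral_Lp {α E : Type*} [MeasurableSpace α] {μ : Measure α} [NormedAddCommGroup E]
    (φ : Lp E 2 μ) : ∫ s, ‖φ s‖ ^ 2 ∂μ = ‖φ‖ ^ 2 := by
  rw [Lp.norm_def, MemLp.eLpNorm_eq_integral_rpow_norm (by norm_num) (by norm_num) (Lp.memLp φ),
    ENNReal.toReal_ofReal (by positivity)]
  simp only [ENNReal.toReal_ofNat, Real.rpow_two]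
  rw [← Real.rpow_natCast, ← Real.rpow_mul (integral_nonneg fun _ => sq_nonneg _)]
  norm_num

theorem skeleton_equation {T : ℝ} (hT : 0 < T) {σ : Icc (0 : ℝ) T → H → SeqL2 →L[ℝ] HMinusOne}
    (hσ : DiffusionMeasurable σ) (hA2 : A2 σ) {u₀ : HT 0 2} {u : PathSpace T}
    (hu : IsDeterministicSolution (HT.toH u₀) u) :
    (∀ φ, ∃! X : PathSpace T, IsSkeletonSolution σ u φ X) ∧ ∀ N, IsCompact (skeletonSet σ u N) := by
  obtain ⟨S, hS⟩ := exists_forcing_isSkeletonSolution hσ hA2 hu.1 hu.2.1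
  obtain ⟨M, hM0, hM⟩ := u.exists_ae_norm_inH_le
  have hm := u.stronglyMeasurable_inH.aestronglyMeasurable (μ := timeMeasure T)
  have hE := hu.lintegral_ne_top
  have hex : ∀ φ, ∃ X : PathSpace T, IsSkeletonSolution σ u φ X := fun φ => by
    obtain ⟨X, hX⟩ := exists_linearised_solution hT hm hM0 hM hE
      (S.measurable φ (Lp.aestronglyMeasurable φ)) (S.integrable_sqrt_mul_norm φ)
      (fun _ => by positivity) (Filter.Eventually.of_forall fun s => S.anisoEnergy_le s _)
    exact ⟨X, (hS φ X).2 hX⟩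
  have huniq : ∀ φ X Y, IsSkeletonSolution σ u φ X → IsSkeletonSolution σ u φ Y → X = Y :=
    fun φ X Y hX hY => eq_of_isSolution hm hM hE (S.integrable φ) ((hS φ X).1 hX) ((hS φ Y).1 hY)
  refine ⟨fun φ => ?_, fun N => ?_⟩
  · obtain ⟨X, hX⟩ := hex φ
    exact ⟨X, hX, fun Y hY => huniq φ Y X hY hX⟩
  choose X hX using hex
  -- For negative `N` the set is empty; it must be treated apart, since $\sqrt N$ is then $0$ and
  -- the ball of that radius contains the zero control.
  by_cases hN : N < 0
  · convert isCompact_empty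
    rw [eq_empty_iff_forall_notMem]
    rintro g ⟨φ, h, -⟩
    rw [norm_sq_eq_integral_Lp] at h
    linarith [sq_nonneg ‖φ‖]
  have himage : skeletonSet σ u N = X '' Metric.closedBall 0 √N := by
    ext g
    constructor
    · rintro ⟨φ, h, hg⟩
      rw [norm_sq_eq_integral_Lp] at h
      refine ⟨φ, ?_, huniq φ _ _ (hX φ) hg⟩
      rw [mem_closedBall_zero_iff]
      exact Real.le_sqrt_of_sq_le h
    · rintro ⟨φ, h, rfl⟩
      refine ⟨φ, ?_, hX φ⟩
      rw [mem_closedBall_zero_iff] at h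
      rw [norm_sq_eq_integral_Lp]
      exact (Real.le_sqrt (norm_nonneg _) (not_lt.1 hN)).1 h
  rw [himage]
  refine S.isCompact_image (C := 2 * estimateConst T (∫ s, growthRate (coeff (u.inH s)) ∂timeMeasure T))
    (C' := 2 * (1 + (timeMeasure T).real univ))
    (K := fun n => ∫ s, driftBound n (u.inH s) ∂timeMeasure T) (fun φ ψ n ρ δ hρ0 hδ hρ hle => ?_)
    (mul_nonneg zero_le_two (estimateConst_nonneg T (integral_nonneg fun s => growthRate_nonneg _)))
    (fun n => integral_nonneg fun s => driftBound_nonneg _ _) _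
  have hsub : ∀ᵐ s ∂timeMeasure T, S.op s (φ s) - S.op s (ψ s) = S.op s ((φ - ψ : Lp SeqL2 2 _) s) := by
    filter_upwards [Lp.coeFn_sub φ ψ] with s hs
    rw [hs, Pi.sub_apply, map_sub]
  have hr := integrable_mul_norm (memLp_sqrt (S.integrable_tail n) fun _ => ENNReal.toReal_nonneg)
    (fun _ => Real.sqrt_nonneg _) (φ - ψ)
  simp only [Real.sq_sqrt ENNReal.toReal_nonneg] at hr
  have hr0 : ∀ s, 0 ≤ √(S.tail n s).toReal * ‖(φ - ψ : Lp SeqL2 2 (timeMeasure T)) s‖ := fun s => by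
    positivity
  refine dist_le_of_forcing hm hM hE (S.integrable φ) (S.integrable ψ) ((hS φ _).1 (hX φ))
    ((hS ψ _).1 (hX ψ)) n hρ0 (fun t => ?_) hr.1 hr0 ?_ hδ (le_trans ?_ hle)
  · refine le_trans (le_of_eq (congrArg _ ?_)) (hρ t)
    rw [Forcing.primitive_apply, ← ContinuousLinearMap.integral_comp_comm _
      (S.integrable (φ - ψ)).integrableOn]
    refine integral_congr_ae (ae_restrict_of_ae ?_)
    filter_upwards [hsub] with s hs
    rw [hs]
  · filter_upwards [hsub] with s hs
    rw [hs]
    exact S.anisoEnergy_sub_trunc_le n s _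
  · have h1 : 0 ≤ ∫ s, driftBound n (u.inH s) ∂timeMeasure T :=
      integral_nonneg fun s => driftBound_nonneg _ _
    have h2 : 0 ≤ estimateConst T (∫ s, growthRate (coeff (u.inH s)) ∂timeMeasure T) :=
      estimateConst_nonneg T (integral_nonneg fun s => growthRate_nonneg _)
    have h3 : 0 ≤ ∫ s, √(S.tail n s).toReal * ‖(φ - ψ : Lp SeqL2 2 (timeMeasure T)) s‖ ∂timeMeasure T :=
      integral_nonneg hr0
    rw [← mul_assoc 2, ← mul_assoc 2, ← mul_assoc 2]
    gcongr
    exact hr.2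

end
end AnisoNS

/-! ### The theorem -/

theorem mainTheorem7 (T : ℝ) (hT : 0 < T)
    (σ : Set.Icc (0 : ℝ) T → AnisoNS.H → AnisoNS.SeqL2 →L[ℝ] AnisoNS.HMinusOne)
    (hσ : AnisoNS.DiffusionMeasurable σ)
    (hA0 : AnisoNS.A0 σ) (hA1 : AnisoNS.A1 σ) (hA2 : AnisoNS.A2 σ)
    (u₀ : AnisoNS.HT 0 2) (u : AnisoNS.PathSpace T)
    (hu : AnisoNS.IsDeterministicSolution (AnisoNS.HT.toH u₀) u) :
    (∀ φ : MeasureTheory.Lp AnisoNS.SeqL2 2 (AnisoNS.timeMeasure T),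
      ∃! X : AnisoNS.PathSpace T, AnisoNS.IsSkeletonSolution σ u φ X) ∧
    (∀ N : ℝ, IsCompact (AnisoNS.skeletonSet σ u N)) ∧
    AnisoNS.IsGoodRateFunction (AnisoNS.rateFunction σ u) := by
  have h := AnisoNS.skeleton_equation hT hσ hA2 hu
  refine ⟨h.1, h.2, AnisoNS.isGoodRateFunction_iInf (AnisoNS.IsSkeletonSolution σ u) ?_ h.2⟩
  -- The zero control has a solution, so the rate function is finite somewhere.
  obtain ⟨X, hX, -⟩ := h.1 0
  exact ⟨0, X, hX⟩
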